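/- Let $\alpha$ be a strongly continuous action of a locally compact (Hausdorff) group $G$ on a $C^*$-algebra $A$, let $K$ be a closed subgroup of $G$, and let $N$ be a closed normal subgroup of $G$ with $N\subset K$. Fix left Haar measures on $G$ and $K/N$, and write $\Delta_G$, $\Delta_{K/N}$ for the modular functions, normalised by $\Delta_G(r)\int_G f(tr)\,dt=\int_G f(t)\,dt$. For a closed subgroup $M$ identify $A\otimes C_0(G/M)$ with $C_0(G/M,A)$ and let $(\alpha\otimes\mathrm{lt})_t(f)(sM)=\alpha_t(f(t^{-1}sM))$. Let $\beta$ be the action of $G/N$ on the full crossed product $(A\otimes C_0(G/N))\rtimes_{\alpha\otimes\mathrm{lt}}G$ induced by the commuting action $(\mathrm{id}\otimes\mathrm{rt})_{tN}(f)(sN)=f(stN)$. Set (with full crossed products) $$L:=\big((A\otimes C_0(G/N))\rtimes_{\alpha\otimes\mathrm{lt}}G\big)\rtimes_\beta K/N,\qquad R:=(A\otimes C_0(G/K))\rtimes_{\alpha\otimes\mathrm{lt}}G .$$ Then $C_c(G\times G/N,A)$ completes to an $L$--$R$ imprimitivity bimodule $Z_{G/K}^{G/N}$: there are an $L$--$R$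 imprimitivity bimodule $Z_{G/K}^{G/N}$ and an injective linear map with dense range from $C_c(G\times G/N,A)$ into it such that, for $c\in C_c(K/N\times G\times G/N,A)\subset L$, $b\in C_c(G\times G/K,A)\subset R$ and $x,y\in C_c(G\times G/N,A)$, the actions and inner products are given by the following formulas, whose right-hand sides are again functions in $C_c(G\times G/N,A)$, $C_c(G\times G/N,A)$, $C_c(K/N\times G\times G/N,A)$ and $C_c(G\times G/K,A)$ respectively: \begin{align*} c\cdot x(r,sN)&=\int_{K/N}\int_G c(kN,t,sN)\,\alpha_t\big(x(t^{-1}r,t^{-1}skN)\big)\Delta_{K/N}(kN)^{1/2}\,dt\,d(kN),\\ x\cdot b(r,sN)&=\int_G x(t,sN)\,\alpha_t\big(b(t^{-1}r,t^{-1}sK)\big)\,dt,\\ {}_L\langle x,y\rangle(kN,r,sN)&=\Delta_{K/N}(kN)^{-1/2}\int_G x(t,sN)\,\alpha_r\big(y(r^{-1}t,r^{-1}skN)^*\big)\Delta_G(r^{-1}t)\,dt,\\ \langle x,y\rangle_R(r,sK)&=\int_{K/N}\int_G\alpha_t\big(x(t^{-1},t^{-1}skN)^*\,y(t^{-1}r,t^{-1}skN)\big)\Delta_G(t)^{-1}\,dt\,d(kN).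 \end{align*} -/

import Mathlib

open MeasureTheory Topology Filter
open scoped CompactlySupported ZeroAtInfty ENNReal

universe u v w u₁ u₂

noncomputable section

/-- A (strongly continuous) action of a topological group `G` by automorphisms on a C*-algebra `A`.
Each `act s` is an automorphism, with inverse `act s⁻¹`. -/
structure CStarAction (G : Type v) (A : Type u) [Group G] [TopologicalSpace G]
    [NonUnitalCStarAlgebra A] where
  act : G → A →⋆ₙₐ[ℂ] A
  act_one : ∀ a, act 1 a = a
  act_mul : ∀ s t a, act (s * t) a = act s (act t a)
  continuous_act : ∀ a, Continuous fun s => act s a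

namespace CStarAction

variable {G : Type v} {A : Type u} [Group G] [TopologicalSpace G] [NonUnitalCStarAlgebra A]

lemma act_inv_act (α : CStarAction G A) (s : G) (a : A) : α.act s⁻¹ (α.act s a) = a := by
  rw [← α.act_mul, inv_mul_cancel, α.act_one]

lemma act_act_inv (α : CStarAction G A) (s : G) (a : A) : α.act s (α.act s⁻¹ a) = a := by
  rw [← α.act_mul, mul_inv_cancel, α.act_one]

lemma continuous_act_prod (α : CStarAction G A) :
    Continuous fun p : G × A => α.act p.1 p.2 := by
  rw [continuous_iff_continuousAt]
  rintro ⟨s, a⟩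
  rw [ContinuousAt, tendsto_iff_norm_sub_tendsto_zero]
  have h1 : Tendsto (fun p : G × A => ‖p.2 - a‖ + ‖α.act p.1 a - α.act s a‖) (𝓝 (s, a)) (𝓝 0) := by
    have h2 : Continuous fun p : G × A => ‖p.2 - a‖ + ‖α.act p.1 a - α.act s a‖ :=
      ((continuous_snd.sub continuous_const).norm).add
        ((((α.continuous_act a).comp continuous_fst).sub continuous_const).norm)
    simpa using h2.tendsto (s, a)
  refine squeeze_zero (fun _ => norm_nonneg _) (fun p => ?_) h1
  calc ‖α.act p.1 p.2 - α.act s a‖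
      = ‖α.act p.1 (p.2 - a) + (α.act p.1 a - α.act s a)‖ := by rw [map_sub]; congr 1; abel
    _ ≤ ‖α.act p.1 (p.2 - a)‖ + ‖α.act p.1 a - α.act s a‖ := norm_add_le _ _
    _ ≤ _ := by gcongr; exact NonUnitalStarAlgHom.norm_apply_le _ _

/-- The trivial action. -/
def trivial (G : Type v) (A : Type u) [Group G] [TopologicalSpace G] [NonUnitalCStarAlgebra A] :
    CStarAction G A where
  act _ := NonUnitalStarAlgHom.id ℂ A
  act_one _ := rfl
  act_mul _ _ _ := rfl
  continuous_act _ := continuous_const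

/-- Restriction of an action along a continuous homomorphism. -/
def restrict {H : Type*} [Group H] [TopologicalSpace H] (α : CStarAction G A) (φ : H →* G)
    (hφ : Continuous φ) : CStarAction H A where
  act h := α.act (φ h)
  act_one a := by rw [map_one, α.act_one]
  act_mul s t a := by rw [map_mul, α.act_mul]
  continuous_act a := (α.continuous_act a).comp hφ

/-- The action `α ⊗ θ` of `G` on `A ⊗ C₀(X) = C₀(X, A)` coming from an action `α` on `A` and
a jointly continuous left action `θ` of `G` on `X`:
`((α ⊗ θ)_t f)(x) = α_t (f (θ_{t⁻¹} x))`. -/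
def onC0 {X : Type w} [TopologicalSpace X] (α : CStarAction G A) (θ : G → X → X)
    (h_one : ∀ x, θ 1 x = x) (h_mul : ∀ s t x, θ (s * t) x = θ s (θ t x))
    (h_cont : Continuous fun p : G × X => θ p.1 p.2) [IsTopologicalGroup G] :
    CStarAction G C₀(X, A) where
  act t :=
    { toFun := fun f =>
        { toFun := fun x => α.act t (f (θ t⁻¹ x))
          continuous_toFun := by
            have h1 : Continuous fun x => θ t⁻¹ x :=
              h_cont.comp (continuous_const.prodMk continuous_id)
            exact α.continuous_act_prod.comp
              (continuous_const.prodMk (f.continuous.comp h1))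
          zero_at_infty' := by
            let e : X ≃ₜ X :=
              { toFun := θ t⁻¹
                invFun := θ t
                left_inv := fun x => by rw [← h_mul, mul_inv_cancel, h_one]
                right_inv := fun x => by rw [← h_mul, inv_mul_cancel, h_one]
                continuous_toFun := h_cont.comp (continuous_const.prodMk continuous_id)
                continuous_invFun := h_cont.comp (continuous_const.prodMk continuous_id) }
            have h2 : Tendsto (fun x => f (e x)) (cocompact X) (𝓝 0) :=
              f.zero_at_infty'.comp e.isClosedEmbedding.tendsto_cocompact
            have h3 : Continuous (α.act t) :=
              α.continuous_act_prod.comp (continuous_const.prodMk continuous_id)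
            have h4 := (h3.tendsto 0).comp h2
            rw [map_zero] at h4
            exact h4 }
      map_smul' := fun c f => by ext x; simp
      map_zero' := by ext x; simp
      map_add' := fun f g => by ext x; simp
      map_mul' := fun f g => by ext x; simp
      map_star' := fun f => by ext x; simp [map_star] }
  act_one f := by ext x; simp [h_one, α.act_one]
  act_mul s t f := by
    ext x
    simp [h_mul, α.act_mul]
  continuous_act f := by
    have hF : Continuous fun p : G × X => α.act p.1 (f (θ p.1⁻¹ p.2)) :=
      α.continuous_act_prod.comp (continuous_fst.prodMk
        (f.continuous.comp (h_cont.comp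
          ((continuous_inv.comp continuous_fst).prodMk continuous_snd))))
    rw [continuous_iff_continuousAt]
    intro t₀
    rw [ContinuousAt, Metric.tendsto_nhds]
    intro ε hε
    obtain ⟨S, hS, hSf⟩ : ∃ S : Set X, IsCompact S ∧ ∀ x ∉ S, ‖f x‖ < ε / 4 := by
      have h1 := f.zero_at_infty'.eventually (Metric.ball_mem_nhds (0 : A) (by positivity : 0 < ε / 4))
      obtain ⟨S, hS, h2⟩ := mem_cocompact.1 h1
      exact ⟨S, hS, fun x hx => by simpa using h2 hx⟩
    have hS' : IsCompact (θ t₀ '' S) := hS.image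
      (h_cont.comp (continuous_const.prodMk continuous_id))
    have hD : Continuous fun p : G × X =>
        ‖α.act p.1 (f (θ p.1⁻¹ p.2)) - α.act t₀ (f (θ t₀⁻¹ p.2))‖ :=
      (hF.sub (hF.comp (continuous_const.prodMk continuous_snd))).norm
    have e1 : ∀ᶠ t in 𝓝 t₀, ∀ x ∈ θ t₀ '' S,
        ‖α.act t (f (θ t⁻¹ x)) - α.act t₀ (f (θ t₀⁻¹ x))‖ < ε / 2 := by
      refine hS'.eventually_forall_of_forall_eventually fun x _ => ?_
      refine (hD.tendsto (t₀, x)).eventually (gt_mem_nhds ?_)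
      simpa using hε
    have hD2 : Continuous fun p : G × X =>
        ‖α.act p.1 (f (θ p.1⁻¹ (θ p.1 p.2))) - α.act t₀ (f (θ t₀⁻¹ (θ p.1 p.2)))‖ :=
      hD.comp (continuous_fst.prodMk h_cont)
    have e2 : ∀ᶠ t in 𝓝 t₀, ∀ y ∈ S,
        ‖α.act t (f (θ t⁻¹ (θ t y))) - α.act t₀ (f (θ t₀⁻¹ (θ t y)))‖ < ε / 2 := by
      refine hS.eventually_forall_of_forall_eventually fun x _ => ?_
      refine (hD2.tendsto (t₀, x)).eventually (gt_mem_nhds ?_)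
      simpa using hε
    filter_upwards [e1, e2] with t h1 h2
    refine lt_of_le_of_lt ?_ (half_lt_self hε)
    rw [← ZeroAtInftyContinuousMap.dist_toBCF_eq_dist]
    refine (BoundedContinuousFunction.dist_le (by positivity)).2 fun x => ?_
    rw [dist_eq_norm]
    change ‖α.act t (f (θ t⁻¹ x)) - α.act t₀ (f (θ t₀⁻¹ x))‖ ≤ ε / 2
    by_cases hx1 : θ t₀⁻¹ x ∈ S
    · exact (h1 x ⟨_, hx1, by rw [← h_mul, mul_inv_cancel, h_one]⟩).le
    by_cases hx2 : θ t⁻¹ x ∈ S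
    · have := h2 _ hx2
      rw [← h_mul t t⁻¹, mul_inv_cancel, h_one] at this
      exact this.le
    · calc _ ≤ ‖α.act t (f (θ t⁻¹ x))‖ + ‖α.act t₀ (f (θ t₀⁻¹ x))‖ := norm_sub_le _ _
        _ ≤ ‖f (θ t⁻¹ x)‖ + ‖f (θ t₀⁻¹ x)‖ :=
          add_le_add (NonUnitalStarAlgHom.norm_apply_le _ _)
            (NonUnitalStarAlgHom.norm_apply_le _ _)
        _ ≤ ε / 4 + ε / 4 := add_le_add (hSf _ hx2).le (hSf _ hx1).le
        _ = ε / 2 := by ring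

end CStarAction

section CrossedProduct

variable {H : Type v} {B : Type u} [Group H] [TopologicalSpace H] [NonUnitalCStarAlgebra B]

/-- A covariant representation `(π, U)` of `(B, H, γ)` on a Hilbert space `E`: a non-degenerate
representation `π` of `B` and a strongly continuous unitary representation `U` of `H` with
`π (γ_s b) = U_s π(b) U_s^*`. -/
structure CovRep (γ : CStarAction H B) : Type (max u v + 1) where
  E : Type (max u v)
  [instNormed : NormedAddCommGroup E]
  [instInner : InnerProductSpace ℂ E]
  [instComplete : CompleteSpace E]
  π : B →⋆ₙₐ[ℂ] (E →L[ℂ] E)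
  U : H →* unitary (E →L[ℂ] E)
  nondegenerate : Dense (Submodule.span ℂ {x : E | ∃ b h, x = π b h} : Set E)
  continuous_U : ∀ h : E, Continuous fun s => (U s : E →L[ℂ] E) h
  covariant : ∀ s b, π (γ.act s b) = (U s : E →L[ℂ] E) * π b * star (U s : E →L[ℂ] E)

attribute [instance] CovRep.instNormed CovRep.instInner CovRep.instComplete

namespace CovRep

variable {γ : CStarAction H B}

lemma norm_U_apply (R : CovRep γ) (s : H) (h : R.E) : ‖(R.U s : R.E →L[ℂ] R.E) h‖ = ‖h‖ := by
  have h1 : star (R.U s : R.E →L[ℂ] R.E) * (R.U s : R.E →L[ℂ] R.E) = 1 :=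
    Unitary.coe_star_mul_self (R.U s)
  exact (ContinuousLinearMap.norm_map_iff_adjoint_comp_self _).2 h1 h

lemma norm_integrand_le (R : CovRep γ) (b : B) (s : H) (h : R.E) :
    ‖R.π b ((R.U s : R.E →L[ℂ] R.E) h)‖ ≤ ‖b‖ * ‖h‖ := by
  calc _ ≤ ‖R.π b‖ * ‖(R.U s : R.E →L[ℂ] R.E) h‖ := ContinuousLinearMap.le_opNorm _ _
    _ ≤ ‖b‖ * ‖h‖ := by
      rw [norm_U_apply]
      gcongr
      exact NonUnitalStarAlgHom.norm_apply_le _ _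

lemma continuous_integrand (R : CovRep γ) (f : C_c(H, B)) (h : R.E) :
    Continuous fun s => R.π (f s) ((R.U s : R.E →L[ℂ] R.E) h) := by
  have h1 : Continuous R.π :=
    AddMonoidHomClass.continuous_of_bound R.π 1 fun b => by
      simpa using NonUnitalStarAlgHom.norm_apply_le R.π b
  exact (h1.comp f.continuous).clm_apply (R.continuous_U h)

lemma integrable_integrand [MeasurableSpace H] [OpensMeasurableSpace H] (μ : Measure H)
    [IsFiniteMeasureOnCompacts μ] (R : CovRep γ) (f : C_c(H, B)) (h : R.E) :
    Integrable (fun s => R.π (f s) ((R.U s : R.E →L[ℂ] R.E) h)) μ := by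
  refine (R.continuous_integrand f h).integrable_of_hasCompactSupport ?_
  refine f.hasCompactSupport.mono fun s hs => ?_
  rw [Function.mem_support] at hs ⊢
  contrapose! hs
  simp [hs]

lemma integrable_norm {H : Type v} [TopologicalSpace H] [MeasurableSpace H]
    [OpensMeasurableSpace H] (μ : Measure H) [IsFiniteMeasureOnCompacts μ] (f : C_c(H, B)) : Integrable (fun s => ‖f s‖) μ :=
  (f.continuous.integrable_of_hasCompactSupport f.hasCompactSupport).norm

lemma norm_integral_le [MeasurableSpace H] [OpensMeasurableSpace H] (μ : Measure H)
    [IsFiniteMeasureOnCompacts μ] (R : CovRep γ) (f : C_c(H, B)) (h : R.E) :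
    ‖∫ s, R.π (f s) ((R.U s : R.E →L[ℂ] R.E) h) ∂μ‖ ≤ (∫ s, ‖f s‖ ∂μ) * ‖h‖ := by
  rw [← integral_mul_const]
  exact norm_integral_le_of_norm_le ((integrable_norm μ f).mul_const _)
    (Eventually.of_forall fun s => R.norm_integrand_le _ _ _)

/-- The integrated form `(π ⋊ U)(f) = ∫ π(f(s)) U_s dμ(s)` (a strong integral). -/
def integratedForm [MeasurableSpace H] [OpensMeasurableSpace H] (μ : Measure H)
    [IsFiniteMeasureOnCompacts μ] (R : CovRep γ) (f : C_c(H, B)) : R.E →L[ℂ] R.E :=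
  LinearMap.mkContinuous
    { toFun := fun h => ∫ s, R.π (f s) ((R.U s : R.E →L[ℂ] R.E) h) ∂μ
      map_add' := fun h k => by
        simp only [map_add]
        exact integral_add (R.integrable_integrand μ f h) (R.integrable_integrand μ f k)
      map_smul' := fun c h => by
        simp only [map_smul, RingHom.id_apply]
        exact integral_smul c _ }
    (∫ s, ‖f s‖ ∂μ) (R.norm_integral_le μ f)

lemma norm_integratedForm_le [MeasurableSpace H] [OpensMeasurableSpace H] (μ : Measure H)
    [IsFiniteMeasureOnCompacts μ] (R : CovRep γ) (f : C_c(H, B)) :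
    ‖R.integratedForm μ f‖ ≤ ∫ s, ‖f s‖ ∂μ :=
  LinearMap.mkContinuous_norm_le _ (integral_nonneg fun _ => norm_nonneg _) _

/-- Composition of a covariant representation with an automorphism `δ` of `B` (with inverse `δ'`)
that commutes with the action. -/
def comp (R : CovRep γ) (δ δ' : B →⋆ₙₐ[ℂ] B) (h_inv : ∀ b, δ (δ' b) = b)
    (h_comm : ∀ s b, δ (γ.act s b) = γ.act s (δ b)) : CovRep γ where
  E := R.E
  π := R.π.comp δ
  U := R.U
  nondegenerate := by
    convert R.nondegenerate using 4
    ext x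
    constructor
    · rintro ⟨b, h, rfl⟩; exact ⟨δ b, h, rfl⟩
    · rintro ⟨b, h, rfl⟩; exact ⟨δ' b, h, by simp [h_inv]⟩
  continuous_U := R.continuous_U
  covariant s b := by
    change R.π (δ (γ.act s b)) = _
    rw [h_comm, R.covariant]
    rfl

end CovRep

variable [MeasurableSpace H] [BorelSpace H] (μ : Measure H) [IsFiniteMeasureOnCompacts μ]

variable (γ : CStarAction H B)

/-- The C*-algebra of all bounded families of operators, indexed by the covariant representations
of `(B, H, γ)`. -/
def OperatorFamilies (γ : CStarAction H B) : Type (max u v + 1) :=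
  lp (fun R : CovRep γ => R.E →L[ℂ] R.E) ∞

instance : NonUnitalCStarAlgebra (OperatorFamilies γ) :=
  inferInstanceAs (NonUnitalCStarAlgebra (lp (fun R : CovRep γ => R.E →L[ℂ] R.E) ∞))

/-- The universal representation of `C_c(H, B)`: the family of all its integrated forms. -/
def universalRep : C_c(H, B) →ₗ[ℂ] OperatorFamilies γ where
  toFun f := ⟨fun R => R.integratedForm μ f, memℓp_infty
    ⟨∫ s, ‖f s‖ ∂μ, by rintro _ ⟨R, rfl⟩; exact R.norm_integratedForm_le μ f⟩⟩
  map_add' f g := by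
    refine Subtype.ext (funext fun R => ContinuousLinearMap.ext fun h => ?_)
    change ∫ s, R.π (f s + g s) ((R.U s : R.E →L[ℂ] R.E) h) ∂μ = _
    simp only [map_add]
    exact integral_add (R.integrable_integrand μ f h) (R.integrable_integrand μ g h)
  map_smul' c f := by
    refine Subtype.ext (funext fun R => ContinuousLinearMap.ext fun h => ?_)
    change ∫ s, R.π (c • f s) ((R.U s : R.E →L[ℂ] R.E) h) ∂μ = _
    simp only [map_smul]
    exact integral_smul c _

lemma norm_universalRep_le (f : C_c(H, B)) : ‖universalRep μ γ f‖ ≤ ∫ s, ‖f s‖ ∂μ :=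
  lp.norm_le_of_forall_le (integral_nonneg fun _ => norm_nonneg _)
    fun R => R.norm_integratedForm_le μ f

/-- The C*-algebra generated by the image of `C_c(H, B)` in its universal representation. The image
is itself a *-subalgebra, isomorphic to `C_c(H, B)` with convolution
`(f * g)(s) = ∫ f(t) γ_t(g(t⁻¹ s)) dt` and involution `f^*(s) = Δ(s)⁻¹ γ_s(f(s⁻¹)^*)`. -/
def crossedProductSubalgebra : NonUnitalStarSubalgebra ℂ (OperatorFamilies γ) :=
  (NonUnitalStarAlgebra.adjoin ℂ (Set.range (universalRep μ γ))).topologicalClosure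

/-- The full crossed product `B ⋊_γ H`: the completion of `C_c(H, B)` in the universal norm
`‖f‖ = sup ‖(π ⋊ U)(f)‖`, the supremum being over all covariant representations `(π, U)`. -/
def CrossedProduct : Type (max u v + 1) := crossedProductSubalgebra μ γ

namespace CrossedProduct

instance : NonUnitalCStarAlgebra (CrossedProduct μ γ) :=
  haveI : IsClosed (crossedProductSubalgebra μ γ : Set (OperatorFamilies γ)) :=
    NonUnitalStarSubalgebra.isClosed_topologicalClosure _
  inferInstanceAs (NonUnitalCStarAlgebra (crossedProductSubalgebra μ γ))

/-- The inclusion `C_c(H, B) ⊆ B ⋊_γ H`. -/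
def ofCc : C_c(H, B) →ₗ[ℂ] CrossedProduct μ γ where
  toFun f := ⟨universalRep μ γ f, NonUnitalStarSubalgebra.le_topologicalClosure _
    (NonUnitalStarAlgebra.subset_adjoin ℂ _ ⟨f, rfl⟩)⟩
  map_add' f g := Subtype.ext (map_add _ f g)
  map_smul' c f := Subtype.ext (map_smul _ c f)

lemma norm_ofCc_le (f : C_c(H, B)) : ‖ofCc μ γ f‖ ≤ ∫ s, ‖f s‖ ∂μ :=
  norm_universalRep_le μ γ f

/-- Continuity in a parameter of functions supported in a fixed compact set. -/
lemma continuous_ofCc {T : Type*} [TopologicalSpace T] (F : T → C_c(H, B)) (S : Set H)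
    (hS : IsCompact S) (hFS : ∀ t, ∀ s ∉ S, F t s = 0)
    (hF : Continuous fun p : T × H => F p.1 p.2) : Continuous fun t => ofCc μ γ (F t) := by
  rw [continuous_iff_continuousAt]
  intro t₀
  rw [ContinuousAt, Metric.tendsto_nhds]
  intro ε hε
  have hm : 0 ≤ μ.real S := measureReal_nonneg
  set η : ℝ := ε / (2 * (μ.real S + 1)) with hη
  have hη0 : 0 < η := by positivity
  have hD : Continuous fun p : T × H => ‖F p.1 p.2 - F t₀ p.2‖ :=
    (hF.sub (hF.comp (continuous_const.prodMk continuous_snd))).norm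
  have e1 : ∀ᶠ t in 𝓝 t₀, ∀ s ∈ S, ‖F t s - F t₀ s‖ < η := by
    refine hS.eventually_forall_of_forall_eventually fun x _ => ?_
    refine (hD.tendsto (t₀, x)).eventually (gt_mem_nhds ?_)
    simpa using hη0
  filter_upwards [e1] with t ht
  rw [dist_eq_norm, ← map_sub]
  refine (norm_ofCc_le μ γ _).trans_lt ?_
  have h1 : ∀ s, s ∉ S → ‖(F t - F t₀) s‖ = 0 := fun s hs => by
    simp [hFS t s hs, hFS t₀ s hs]
  rw [← setIntegral_eq_integral_of_forall_compl_eq_zero h1]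
  have h2 : ‖∫ s in S, ‖(F t - F t₀) s‖ ∂μ‖ ≤ η * μ.real S :=
    norm_setIntegral_le_of_norm_le_const hS.measure_lt_top
      (fun s hs => by simpa using (ht s hs).le)
  refine ((le_abs_self _).trans h2).trans_lt ?_
  rw [hη, div_mul_eq_mul_div, div_lt_iff₀ (by positivity)]
  nlinarith

/-- A bounded family of operators, transported along an automorphism `δ` of `B` (with inverse `δ'`)
that commutes with the action. -/
def transport (δ δ' : B →⋆ₙₐ[ℂ] B) (h_inv : ∀ b, δ (δ' b) = b)
    (h_comm : ∀ s b, δ (γ.act s b) = γ.act s (δ b)) :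
    OperatorFamilies γ →⋆ₙₐ[ℂ] OperatorFamilies γ where
  toFun T := ⟨fun R => T.1 (R.comp δ δ' h_inv h_comm), memℓp_infty
    ⟨‖T‖, by rintro _ ⟨R, rfl⟩; exact lp.norm_apply_le_norm (by simp) T _⟩⟩
  map_smul' _ _ := rfl
  map_zero' := rfl
  map_add' _ _ := rfl
  map_mul' _ _ := rfl
  map_star' _ := rfl

/-- Applying an automorphism of `B` pointwise to a function in `C_c(H, B)`. -/
def mapCc (δ : B →⋆ₙₐ[ℂ] B) (f : C_c(H, B)) : C_c(H, B) where
  toFun s := δ (f s)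
  continuous_toFun := (AddMonoidHomClass.continuous_of_bound δ 1 fun b => by
      simpa using NonUnitalStarAlgHom.norm_apply_le δ b).comp f.continuous
  hasCompactSupport' := f.hasCompactSupport.comp_left (map_zero δ)

lemma transport_universalRep (δ δ' : B →⋆ₙₐ[ℂ] B) (h_inv : ∀ b, δ (δ' b) = b)
    (h_comm : ∀ s b, δ (γ.act s b) = γ.act s (δ b)) (f : C_c(H, B)) :
    transport γ δ δ' h_inv h_comm (universalRep μ γ f) = universalRep μ γ (mapCc δ f) := rfl

lemma transport_mem (δ δ' : B →⋆ₙₐ[ℂ] B) (h_inv : ∀ b, δ (δ' b) = b)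
    (h_comm : ∀ s b, δ (γ.act s b) = γ.act s (δ b)) (T : OperatorFamilies γ)
    (hT : T ∈ crossedProductSubalgebra μ γ) :
    transport γ δ δ' h_inv h_comm T ∈ crossedProductSubalgebra μ γ := by
  have hc : Continuous (transport γ δ δ' h_inv h_comm) :=
    AddMonoidHomClass.continuous_of_bound _ 1 fun b => by
      simpa using NonUnitalStarAlgHom.norm_apply_le (transport γ δ δ' h_inv h_comm) b
  have h1 : crossedProductSubalgebra μ γ ≤
      (crossedProductSubalgebra μ γ).comap (transport γ δ δ' h_inv h_comm) := by
    refine NonUnitalStarSubalgebra.topologicalClosure_minimal _ ?_ ?_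
    · refine NonUnitalStarAlgebra.adjoin_le ?_
      rintro _ ⟨f, rfl⟩
      exact NonUnitalStarSubalgebra.le_topologicalClosure _
        (NonUnitalStarAlgebra.subset_adjoin ℂ _ ⟨mapCc δ f, rfl⟩)
    · exact (NonUnitalStarSubalgebra.isClosed_topologicalClosure _).preimage hc
  exact h1 hT

variable {D : Type w} [Group D] [TopologicalSpace D] (δ : CStarAction D B)

lemma continuous_transport (h_comm : ∀ d s b, δ.act d (γ.act s b) = γ.act s (δ.act d b))
    (T : OperatorFamilies γ) (hT : T ∈ crossedProductSubalgebra μ γ) :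
    Continuous fun d => transport γ (δ.act d) (δ.act d⁻¹) (δ.act_act_inv d) (h_comm d) T := by
  let Φ : D → OperatorFamilies γ →⋆ₙₐ[ℂ] OperatorFamilies γ := fun d =>
    transport γ (δ.act d) (δ.act d⁻¹) (δ.act_act_inv d) (h_comm d)
  let S : NonUnitalStarSubalgebra ℂ (OperatorFamilies γ) :=
    { carrier := {T | Continuous fun d => Φ d T}
      add_mem' := fun {a b} ha hb => by
        simp only [Set.mem_ofPred_eq, map_add] at *
        exact ha.add hb
      zero_mem' := by
        simp only [Set.mem_ofPred_eq, map_zero]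
        exact continuous_const
      mul_mem' := fun {a b} ha hb => by
        simp only [Set.mem_ofPred_eq, map_mul] at *
        exact ha.mul hb
      smul_mem' := fun c a ha => by
        simp only [Set.mem_ofPred_eq, map_smul] at *
        exact ha.const_smul c
      star_mem' := fun {a} ha => by
        simp only [Set.mem_ofPred_eq, map_star] at *
        exact ha.star }
  have hcl : IsClosed (S : Set (OperatorFamilies γ)) := by
    rw [← isSeqClosed_iff_isClosed]
    intro x a hx ha
    have h1 : TendstoUniformly (fun n d => Φ d (x n)) (fun d => Φ d a) atTop := by
      rw [Metric.tendstoUniformly_iff]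
      intro ε hε
      filter_upwards [Metric.tendsto_nhds.1 ha ε hε] with n hn d
      refine lt_of_le_of_lt ?_ hn
      rw [dist_comm, dist_eq_norm, dist_eq_norm, ← map_sub]
      exact NonUnitalStarAlgHom.norm_apply_le _ _
    exact h1.continuous (Frequently.of_forall hx)
  have hle : crossedProductSubalgebra μ γ ≤ S := by
    refine NonUnitalStarSubalgebra.topologicalClosure_minimal _ ?_ hcl
    refine NonUnitalStarAlgebra.adjoin_le ?_
    rintro _ ⟨f, rfl⟩
    exact continuous_subtype_val.comp
      (continuous_ofCc μ γ (fun d => mapCc (δ.act d) f) (tsupport f) f.hasCompactSupport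
        (fun d s hs => by
          change δ.act d (f s) = 0
          rw [image_eq_zero_of_notMem_tsupport hs, map_zero])
        (δ.continuous_act_prod.comp
          (continuous_fst.prodMk (f.continuous.comp continuous_snd))))
  exact hle hT

/-- An action `δ` of `D` on `B` that commutes with `γ` induces an action of `D` on `B ⋊_γ H`,
given on `f ∈ C_c(H, B)` by `(d · f)(s) = δ_d (f(s))`. -/
def inducedAction (h_comm : ∀ d s b, δ.act d (γ.act s b) = γ.act s (δ.act d b)) :
    CStarAction D (CrossedProduct μ γ) where
  act d :=
    { toFun := fun T => ⟨transport γ (δ.act d) (δ.act d⁻¹) (δ.act_act_inv d) (h_comm d) T.1,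
        transport_mem μ γ _ _ _ _ T.1 T.2⟩
      map_smul' := fun c T => Subtype.ext (map_smul _ c T.1)
      map_zero' := Subtype.ext (map_zero _)
      map_add' := fun S T => Subtype.ext (map_add _ S.1 T.1)
      map_mul' := fun S T => Subtype.ext (map_mul _ S.1 T.1)
      map_star' := fun T => Subtype.ext (map_star _ T.1) }
  act_one T := by
    refine Subtype.ext (Subtype.ext (funext fun R => ?_))
    have h : ∀ (e e' : B →⋆ₙₐ[ℂ] B) (h1) (h2), e = NonUnitalStarAlgHom.id ℂ B →
        T.1.1 (R.comp e e' h1 h2) = T.1.1 R := by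
      rintro e e' h1 h2 rfl
      rfl
    exact h _ _ _ _ (NonUnitalStarAlgHom.ext fun b => δ.act_one b)
  act_mul d d' T := by
    refine Subtype.ext (Subtype.ext (funext fun R => ?_))
    have h : ∀ (e e' e₁ e₁' e₂ e₂' : B →⋆ₙₐ[ℂ] B) (h1) (h2) (h3) (h4) (h5) (h6), e = e₁.comp e₂ →
        T.1.1 (R.comp e e' h1 h2) = T.1.1 ((R.comp e₁ e₁' h3 h4).comp e₂ e₂' h5 h6) := by
      rintro e e' e₁ e₁' e₂ e₂' h1 h2 h3 h4 h5 h6 rfl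
      rfl
    exact h _ _ _ _ _ _ _ _ _ _ _ _ (NonUnitalStarAlgHom.ext fun b => δ.act_mul d d' b)
  continuous_act T := (continuous_transport μ γ δ h_comm T.1 T.2).subtype_mk _

lemma inducedAction_ofCc (h_comm : ∀ d s b, δ.act d (γ.act s b) = γ.act s (δ.act d b))
    (d : D) (f : C_c(H, B)) :
    (inducedAction μ γ δ h_comm).act d (ofCc μ γ f) = ofCc μ γ (mapCc (δ.act d) f) := rfl

end CrossedProduct

end CrossedProduct

section FunctionSpaces

variable {A : Type u} [NonUnitalCStarAlgebra A]

/-- A function in `C_c(Y × X, A)` viewed as an element of `C_c(Y, C₀(X, A))`. -/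
def curryCc {Y X : Type*} [TopologicalSpace Y] [R1Space Y] [TopologicalSpace X]
    (f : C_c(Y × X, A)) : C_c(Y, C₀(X, A)) where
  toFun y :=
    { toFun := fun x => f (y, x)
      continuous_toFun := f.continuous.comp (continuous_const.prodMk continuous_id)
      zero_at_infty' := by
        refine tendsto_const_nhds.congr' ?_
        have hK : IsCompact (Prod.snd '' tsupport f) := f.hasCompactSupport.image continuous_snd
        filter_upwards [hK.compl_mem_cocompact] with x hx
        refine (image_eq_zero_of_notMem_tsupport fun h => hx ⟨(y, x), h, rfl⟩).symm }
  continuous_toFun := by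
    rw [continuous_iff_continuousAt]
    intro y₀
    rw [ContinuousAt, Metric.tendsto_nhds]
    intro ε hε
    have hK : IsCompact (Prod.snd '' tsupport f) := f.hasCompactSupport.image continuous_snd
    have hD : Continuous fun p : Y × X => ‖f p - f (y₀, p.2)‖ :=
      (f.continuous.sub (f.continuous.comp (continuous_const.prodMk continuous_snd))).norm
    have e1 : ∀ᶠ y in 𝓝 y₀, ∀ x ∈ Prod.snd '' tsupport f, ‖f (y, x) - f (y₀, x)‖ < ε / 2 := by
      refine hK.eventually_forall_of_forall_eventually fun x _ => ?_
      refine (hD.tendsto (y₀, x)).eventually (gt_mem_nhds ?_)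
      simpa using hε
    filter_upwards [e1] with y h1
    refine lt_of_le_of_lt ?_ (half_lt_self hε)
    rw [← ZeroAtInftyContinuousMap.dist_toBCF_eq_dist]
    refine (BoundedContinuousFunction.dist_le (by positivity)).2 fun x => ?_
    rw [dist_eq_norm]
    change ‖f (y, x) - f (y₀, x)‖ ≤ ε / 2
    by_cases hx : x ∈ Prod.snd '' tsupport f
    · exact (h1 x hx).le
    · have h0 : ∀ z, f (z, x) = 0 := fun z =>
        image_eq_zero_of_notMem_tsupport fun h => hx ⟨(z, x), h, rfl⟩
      simpa [h0] using (half_pos hε).le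
  hasCompactSupport' := by
    have hK : IsCompact (Prod.fst '' tsupport f) := f.hasCompactSupport.image continuous_fst
    refine HasCompactSupport.of_support_subset_isCompact hK fun y hy => ?_
    rw [Function.mem_support] at hy
    by_contra hn
    refine hy (ZeroAtInftyContinuousMap.ext fun x => ?_)
    exact image_eq_zero_of_notMem_tsupport (f := f) fun h => hn ⟨(y, x), h, rfl⟩

lemma curryCc_apply {Y X : Type*} [TopologicalSpace Y] [R1Space Y] [TopologicalSpace X]
    (f : C_c(Y × X, A)) (y : Y) (x : X) : curryCc f y x = f (y, x) := rfl

/-- The function `z ↦ f(d, z)` for `f ∈ C_c(D × Z, A)`. -/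
def sliceCc {D Z : Type*} [TopologicalSpace D] [TopologicalSpace Z] (f : C_c(D × Z, A)) (d : D) :
    C_c(Z, A) where
  toFun z := f (d, z)
  continuous_toFun := f.continuous.comp (continuous_const.prodMk continuous_id)
  hasCompactSupport' := by
    have hK : IsCompact (Prod.snd '' tsupport f) := f.hasCompactSupport.image continuous_snd
    have hc : IsClosed {z : Z | (d, z) ∈ tsupport f} :=
      (isClosed_tsupport _).preimage (continuous_const.prodMk continuous_id)
    refine (hK.of_isClosed_subset hc fun z hz => ⟨(d, z), hz, rfl⟩).of_isClosed_subset
      (isClosed_tsupport _) (closure_minimal (fun z hz => ?_) hc)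
    exact subset_tsupport f hz

end FunctionSpaces

section Inclusions

variable {A : Type u} [NonUnitalCStarAlgebra A] {H : Type v} [Group H] [TopologicalSpace H]
  [IsTopologicalGroup H] [MeasurableSpace H] [BorelSpace H] (μ : Measure H)
  [IsFiniteMeasureOnCompacts μ] {X : Type w} [TopologicalSpace X] (γ : CStarAction H C₀(X, A))

/-- The inclusion `C_c(H × X, A) ⊆ C₀(X, A) ⋊_γ H`. -/
def inclCrossed (f : C_c(H × X, A)) : CrossedProduct μ γ :=
  CrossedProduct.ofCc μ γ (curryCc f)

/-- A function in `C_c(D × H × X, A)` viewed as an element of `C_c(D, C₀(X, A) ⋊_γ H)`. -/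
def curryCrossed {D : Type*} [TopologicalSpace D] [R1Space D] (f : C_c(D × H × X, A)) :
    C_c(D, CrossedProduct μ γ) where
  toFun d := inclCrossed μ γ (sliceCc f d)
  continuous_toFun := by
    have hK : IsCompact ((fun p : D × H × X => p.2.1) '' tsupport f) :=
      f.hasCompactSupport.image (by fun_prop)
    refine CrossedProduct.continuous_ofCc μ γ _ _ hK (fun d s hs => ?_) ?_
    · refine ZeroAtInftyContinuousMap.ext fun x => ?_
      exact image_eq_zero_of_notMem_tsupport (f := f) fun h => hs ⟨(d, s, x), h, rfl⟩
    · let g : C_c((D × H) × X, A) :=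
        { toFun := fun p => f (p.1.1, p.1.2, p.2)
          continuous_toFun := f.continuous.comp (by fun_prop)
          hasCompactSupport' :=
            f.hasCompactSupport.comp_homeomorph (Homeomorph.prodAssoc D H X) }
      exact (curryCc g).continuous
  hasCompactSupport' := by
    have hK : IsCompact (Prod.fst '' tsupport f) := f.hasCompactSupport.image continuous_fst
    refine HasCompactSupport.of_support_subset_isCompact hK fun d hd => ?_
    rw [Function.mem_support] at hd
    by_contra hn
    refine hd ?_
    have h0 : curryCc (sliceCc f d) = 0 := by
      ext s x
      exact image_eq_zero_of_notMem_tsupport (f := f) fun h => hn ⟨(d, s, x), h, rfl⟩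
    rw [inclCrossed, h0, map_zero]

/-- The inclusion `C_c(D × H × X, A) ⊆ (C₀(X, A) ⋊_γ H) ⋊_β D`. -/
def inclIterated {D : Type*} [Group D] [TopologicalSpace D] [IsTopologicalGroup D]
    [MeasurableSpace D] [BorelSpace D] (ν : Measure D) [IsFiniteMeasureOnCompacts ν]
    (β : CStarAction D (CrossedProduct μ γ)) (f : C_c(D × H × X, A)) : CrossedProduct ν β :=
  CrossedProduct.ofCc ν β (curryCrossed μ γ f)

end Inclusions

section Modular

/-- The modular function `Δ` of a group `G` with left Haar measure `μ`, normalised by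
`Δ(r) ∫ f(s r) ds = ∫ f(s) ds`; it does not depend on the choice of `μ`. (For locally compact `G`,
Mathlib's `modularCharacterFun` is its inverse.) -/
def modularFn {G : Type*} [Group G] [TopologicalSpace G] [IsTopologicalGroup G]
    [MeasurableSpace G] [BorelSpace G] (μ : Measure G) [μ.IsHaarMeasure] (s : G) : ℝ :=
  ((Measure.haarScalarFactor (Measure.map (· * s) μ) μ : ℝ))⁻¹

lemma modularFn_eq {G : Type*} [Group G] [TopologicalSpace G] [IsTopologicalGroup G]
    [LocallyCompactSpace G] [MeasurableSpace G] [BorelSpace G] (μ : Measure G) [μ.IsHaarMeasure]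
    (s : G) : modularFn μ s = ((Measure.modularCharacterFun s : ℝ))⁻¹ := by
  rw [modularFn, Measure.modularCharacterFun_eq_haarScalarFactor μ]

lemma modularFn_mul_integral {G : Type*} [Group G] [TopologicalSpace G] [IsTopologicalGroup G]
    [MeasurableSpace G] [BorelSpace G] (μ : Measure G) [μ.IsHaarMeasure]
    (f : C_c(G, ℝ)) (r : G) : modularFn μ r * ∫ s, f (s * r) ∂μ = ∫ s, f s ∂μ := by
  have h1 : ∫ s, f (s * r) ∂μ = ∫ s, f s ∂(Measure.map (· * r) μ) :=
    (integral_map (by fun_prop) f.continuous.aestronglyMeasurable).symm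
  have h2 : ∫ s, f s ∂(Measure.map (· * r) μ) = _ :=
    Measure.integral_isMulLeftInvariant_eq_smul_of_hasCompactSupport
      (Measure.map (· * r) μ) μ f.continuous f.hasCompactSupport
  have h3 := Measure.haarScalarFactor_pos_of_isHaarMeasure (Measure.map (· * r) μ) μ
  rw [h1, h2, integral_smul_nnreal_measure, NNReal.smul_def, smul_eq_mul, modularFn, ← mul_assoc,
    inv_mul_cancel₀ (by exact_mod_cast h3.ne'), one_mul]

end Modular

section Bimodules

/-- An `L`--`R` imprimitivity bimodule: a complex vector space `carrier` with a left action of `L`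
and a right action of `R` (here `lact l x = l · x` and `ract x r = x · r`), an `L`-valued inner
product `linner`, linear in the first variable, and an `R`-valued inner product `rinner`, linear in
the second variable, which make it a full left Hilbert `L`-module and a full right Hilbert
`R`-module, such that each algebra acts by adjointable operators for the other inner product
and `L⟨x, y⟩ · z = x · ⟨y, z⟩R`. -/
structure ImprimitivityBimodule (L : Type u₁) (R : Type u₂) [NonUnitalCStarAlgebra L]
    [NonUnitalCStarAlgebra R] where
  carrier : Type w
  [instNormed : NormedAddCommGroup carrier]
  [instSpace : NormedSpace ℂ carrier]
  [instComplete : CompleteSpace carrier]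
  lact : L →ₗ[ℂ] carrier →ₗ[ℂ] carrier
  ract : carrier →ₗ[ℂ] R →ₗ[ℂ] carrier
  linner : carrier → carrier → L
  rinner : carrier → carrier → R
  lact_mul : ∀ l l' x, lact (l * l') x = lact l (lact l' x)
  ract_mul : ∀ x r r', ract x (r * r') = ract (ract x r) r'
  lact_ract : ∀ l x r, ract (lact l x) r = lact l (ract x r)
  linner_add_left : ∀ x y z, linner (x + y) z = linner x z + linner y z
  linner_smul_left : ∀ (c : ℂ) x y, linner (c • x) y = c • linner x y
  linner_lact : ∀ l x y, linner (lact l x) y = l * linner x y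
  star_linner : ∀ x y, star (linner x y) = linner y x
  linner_self_nonneg : ∀ x, ∃ l, linner x x = star l * l
  norm_linner_self : ∀ x, ‖linner x x‖ = ‖x‖ ^ 2
  linner_full : Dense (Submodule.span ℂ {l | ∃ x y, l = linner x y} : Set L)
  rinner_add_right : ∀ x y z, rinner x (y + z) = rinner x y + rinner x z
  rinner_smul_right : ∀ (c : ℂ) x y, rinner x (c • y) = c • rinner x y
  rinner_ract : ∀ x y r, rinner x (ract y r) = rinner x y * r
  star_rinner : ∀ x y, star (rinner x y) = rinner y x
  rinner_self_nonneg : ∀ x, ∃ r, rinner x x = star r * r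
  norm_rinner_self : ∀ x, ‖rinner x x‖ = ‖x‖ ^ 2
  rinner_full : Dense (Submodule.span ℂ {r | ∃ x y, r = rinner x y} : Set R)
  rinner_lact : ∀ l x y, rinner (lact l x) y = rinner x (lact (star l) y)
  linner_ract : ∀ x r y, linner (ract x r) y = linner x (ract y (star r))
  linner_lact_eq : ∀ x y z, lact (linner x y) z = ract x (rinner y z)

attribute [instance] ImprimitivityBimodule.instNormed ImprimitivityBimodule.instSpace
  ImprimitivityBimodule.instComplete

end Bimodules

/-- The inclusion `K/N → G/N`. -/
def quotientIncl {G : Type v} [Group G] (N K : Subgroup G) [N.Normal] : K ⧸ N.subgroupOf K →* G ⧸ N :=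
  QuotientGroup.map (N.subgroupOf K) N K.subtype le_rfl

lemma quotientIncl_mk {G : Type v} [Group G] (N K : Subgroup G) [N.Normal] (k : K) :
    quotientIncl N K (k : K ⧸ N.subgroupOf K) = ((k : G) : G ⧸ N) := rfl

lemma continuous_quotientIncl {G : Type v} [Group G] [TopologicalSpace G]
    (N K : Subgroup G) [N.Normal] :
    Continuous (quotientIncl N K) :=
  (QuotientGroup.isQuotientMap_mk _).continuous_iff.2
    (QuotientGroup.continuous_mk.comp continuous_subtype_val)

section Algebras

variable {A : Type u} [NonUnitalCStarAlgebra A] {G : Type v} [Group G] [TopologicalSpace G]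
  [IsTopologicalGroup G]

/-- The action `α ⊗ lt` of `G` on `A ⊗ C₀(G/K) = C₀(G/K, A)`:
`(t · f)(sK) = α_t (f(t⁻¹sK))`. -/
def ltAction (α : CStarAction G A) (K : Subgroup G) : CStarAction G C₀(G ⧸ K, A) :=
  α.onC0 (fun t x => t • x) (one_smul G) mul_smul continuous_smul

/-- The action `id ⊗ rt` of `G/N` on `A ⊗ C₀(G/N) = C₀(G/N, A)`: `(tN · f)(sN) = f(stN)`. -/
def rtAction (N : Subgroup G) [N.Normal] : CStarAction (G ⧸ N) C₀(G ⧸ N, A) :=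
  (CStarAction.trivial (G ⧸ N) A).onC0 (fun t x => x * t⁻¹) (fun x => by simp)
    (fun s t x => by simp [mul_assoc]) (by fun_prop)

lemma ltAction_apply (α : CStarAction G A) (K : Subgroup G) (t : G) (f : C₀(G ⧸ K, A))
    (x : G ⧸ K) : (ltAction α K).act t f x = α.act t (f (t⁻¹ • x)) := rfl

lemma rtAction_apply (N : Subgroup G) [N.Normal] (t : G ⧸ N) (f : C₀(G ⧸ N, A))
    (x : G ⧸ N) : (rtAction N).act t f x = f (x * t) := by
  change f (x * t⁻¹⁻¹) = f (x * t)
  rw [inv_inv]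

lemma rtAction_ltAction_comm (α : CStarAction G A) (N : Subgroup G) [N.Normal] (d : G ⧸ N)
    (s : G) (f : C₀(G ⧸ N, A)) :
    (rtAction N).act d ((ltAction α N).act s f) = (ltAction α N).act s ((rtAction N).act d f) := by
  ext x
  rw [rtAction_apply, ltAction_apply, ltAction_apply, rtAction_apply]
  congr 2
  induction x using QuotientGroup.induction_on with
  | H x =>
    induction d using QuotientGroup.induction_on with
    | H d =>
      change ((s⁻¹ * (x * d) : G) : G ⧸ N) = ((s⁻¹ * x * d : G) : G ⧸ N)
      rw [mul_assoc]

variable [MeasurableSpace G] [BorelSpace G] (μ : Measure G) [IsFiniteMeasureOnCompacts μ]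

/-- The crossed product `(A ⊗ C₀(G/K)) ⋊_{α ⊗ lt} G`. -/
abbrev TransformationCrossedProduct (α : CStarAction G A) (K : Subgroup G) :=
  CrossedProduct μ (ltAction α K)

/-- The action `β` of `G/N` on `(A ⊗ C₀(G/N)) ⋊_{α ⊗ lt} G` induced by `id ⊗ rt`. -/
def dualAction (α : CStarAction G A) (N : Subgroup G) [N.Normal] :
    CStarAction (G ⧸ N) (TransformationCrossedProduct μ α N) :=
  CrossedProduct.inducedAction μ (ltAction α N) (rtAction N) (rtAction_ltAction_comm α N)

/-- The restriction of `β` to `K/N`. -/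
def dualActionRestrict (α : CStarAction G A) (N K : Subgroup G) [N.Normal] :
    CStarAction (K ⧸ N.subgroupOf K) (TransformationCrossedProduct μ α N) :=
  (dualAction μ α N).restrict (quotientIncl N K) (continuous_quotientIncl N K)

end Algebras

end

/-! Write X = G/N, D = K/N and Y = G/K, with inclusion i : D → X and projection q : X → Y. On C_c(G
× X, A) there are a twisted convolution x * y and an involution x^* that make it a dense
*-subalgebra of C₀(X, A) ⋊ G, and right translations β_k by elements of D that respect both. In
these terms the four formulas become short: x·b = x * q^*b with q^*b the pull-back of b; c·x = ∫
Δ(k)^{1/2} c(k) * β_k(x) dk; L⟨x,y⟩(k) = Δ(k)^{-1/2} x * β_k(y^*); and q^*⟨x,y⟩R = ∫ β_k(x^* * y)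
dk. Here Δ belongs to D. The algebra R thus plays the part of a generalised fixed-point algebra for
the proper action of D. The algebraic axioms, for instance L⟨x,y⟩·z = x·⟨y,z⟩R (`lactCc_linnerCc`),
are associativity, Fubini and bookkeeping with Δ.

Positivity and fullness rest on two approximations. First, every function z is a limit of z * κ^* *
κ with κ(r, s) = φ(r)a (`InductivelyContinuous.mem_of_convSquare_mem`), and over a compact set κ^* *
κ coincides with some ⟨u,u⟩R (`exists_rinnerCc_eq_squareFun`). So L⟨x,x⟩ is a limit of L⟨x·⟨u,u⟩R,
x⟩ = L⟨x,u⟩L⟨x,u⟩^*, and b is a limit of b * ⟨u,u⟩R = ⟨u·b^*, u⟩R. Secondly, for the tents T_p(r, s)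
= w(s⁻¹p)φ(r)a, and T'_p formed with w', the average of T'_p^* * β_k(T_p) over p ∈ X is κ^* * κ
times a correlation function of k (`integral_tconv_tentCc`). Correlations approximate all of C_c(D),
which gives fullness on the left; autocorrelations concentrated at the identity exhibit ⟨x,x⟩R as a
limit of averages of elements ⟨x,v⟩R⟨v,x⟩R (`InductivelyContinuous.mem_of_tentCc_mem`).

Boundedness of the actions comes from GNS representations. If φ is a positive functional on R, left
multiplication by C₀(X, A), translation by G and the operators Δ(k)^{1/2}β_k form covariant
representations on the space of φ(⟨x,y⟩R), and the integrated form is the left action of L. If φ is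
a positive functional on L, the form φ(L⟨x^*,y^*⟩) carries a representation of R, because (x·b)^* =
q^*b^* * x^*. Definiteness follows from the injectivity of C_c(G × Y, A) in R (`inclₗ_injective`),
which is proved with the forms φ((x^* * y)(1, s)) for positive functionals φ on A.

Finally, any data of this kind complete to an imprimitivity bimodule
(`PreImprimitivity.exists_imprimitivityBimodule`): the bounds force the two inner products to define
one and the same norm, and everything extends by continuity. -/

noncomputable section

set_option linter.unusedSectionVars false

/-! ### Integrals of continuous functions with compact supports -/

section CompactIntegrals

variable {Z T E : Type*} [TopologicalSpace Z] [TopologicalSpace T] [MeasurableSpace T]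
  [OpensMeasurableSpace T] [NormedAddCommGroup E] [NormedSpace ℝ E]

/-- Continuity is local, so the compact set that carries the integrand may depend on the base point.
Orbit integrals and the modular function need this form, since no single compact set serves all
parameters. -/
lemma continuous_integral_of_locally_compact_support (κ : Measure T)
    [IsFiniteMeasureOnCompacts κ] {F : Z → T → E} (hF : Continuous fun p : Z × T => F p.1 p.2)
    (hs : ∀ z₀, ∃ U ∈ 𝓝 z₀, ∃ S : Set T, IsCompact S ∧ ∀ z ∈ U, ∀ t ∉ S, F z t = 0) :
    Continuous fun z => ∫ t, F z t ∂κ := by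
  rw [continuous_iff_continuousAt]
  intro z₀
  obtain ⟨U, hU, S, hS, h⟩ := hs z₀
  have h1 : ContinuousOn (fun z => ∫ t, F z t ∂κ) U :=
    continuousOn_integral_of_compact_support hS hF.continuousOn fun z t hz ht => h z hz t ht
  exact h1.continuousAt hU

lemma continuous_integral_of_compact_support' (κ : Measure T)
    [IsFiniteMeasureOnCompacts κ] {F : Z → T → E} (hF : Continuous fun p : Z × T => F p.1 p.2)
    {S : Set T} (hS : IsCompact S) (hs : ∀ z, ∀ t ∉ S, F z t = 0) :
    Continuous fun z => ∫ t, F z t ∂κ :=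
  continuous_integral_of_locally_compact_support κ hF fun _ =>
    ⟨Set.univ, univ_mem, S, hS, fun z _ => hs z⟩

lemma integrable_of_continuous_of_vanish [R1Space T] (κ : Measure T) [IsFiniteMeasureOnCompacts κ]
    {F : T → E} (hF : Continuous F) {S : Set T} (hS : IsCompact S) (hs : ∀ t ∉ S, F t = 0) :
    Integrable F κ :=
  hF.integrable_of_hasCompactSupport (HasCompactSupport.intro hS fun t ht => hs t ht)

lemma integral_swap_of_vanish {T' : Type*} [TopologicalSpace T'] [MeasurableSpace T']
    [OpensMeasurableSpace T'] [R1Space T] [R1Space T']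
    (κ : Measure T) (κ' : Measure T') [IsFiniteMeasureOnCompacts κ]
    [IsFiniteMeasureOnCompacts κ'] {F : T → T' → E}
    (hF : Continuous fun p : T × T' => F p.1 p.2) {S : Set T} {S' : Set T'} (hS : IsCompact S)
    (hS' : IsCompact S') (h : ∀ t t', t ∉ S → F t t' = 0) (h' : ∀ t t', t' ∉ S' → F t t' = 0) :
    ∫ t, ∫ t', F t t' ∂κ' ∂κ = ∫ t', ∫ t, F t t' ∂κ ∂κ' := by
  refine integral_integral_swap_of_hasCompactSupport hF
    (HasCompactSupport.intro (hS.prod hS') fun p hp => ?_)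
  rw [Set.mem_prod, not_and_or] at hp
  exact hp.elim (h _ _) (h' _ _)

lemma norm_integral_le_of_vanish (κ : Measure T) [IsFiniteMeasureOnCompacts κ]
    {F : T → E} {S : Set T} (hS : IsCompact S)
    (hs : ∀ t ∉ S, F t = 0) {m : ℝ} (hm : ∀ t, ‖F t‖ ≤ m) :
    ‖∫ t, F t ∂κ‖ ≤ m * κ.real S := by
  rw [← setIntegral_eq_integral_of_forall_compl_eq_zero hs]
  exact norm_setIntegral_le_of_norm_le_const hS.measure_lt_top fun t _ => hm t

end CompactIntegrals

section CompactlySupportedConstruction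

variable {P : Type*} [TopologicalSpace P] {A : Type*} [TopologicalSpace A] [Zero A]

/-- A continuous function vanishing off a compact set, as a compactly supported function. -/
def mkCc [R1Space P] (f : P → A) (hf : Continuous f) (h : ∃ S, IsCompact S ∧ ∀ p ∉ S, f p = 0) :
    C_c(P, A) where
  toFun := f
  continuous_toFun := hf
  hasCompactSupport' := by
    obtain ⟨S, hS, h⟩ := h
    exact HasCompactSupport.intro hS fun p hp => h p hp

@[simp] lemma mkCc_apply [R1Space P] (f : P → A) (hf : Continuous f)
    (h : ∃ S, IsCompact S ∧ ∀ p ∉ S, f p = 0) (p : P) : mkCc f hf h p = f p := rfl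

end CompactlySupportedConstruction

/-! ### The inductive limit topology on C_c -/

section InductiveLimit

variable {P Q : Type*} [TopologicalSpace P] [TopologicalSpace Q]

/-- `f` vanishes off `S` and is bounded by `m`. -/
def BoundedOn {A : Type*} [NormedAddCommGroup A] (S : Set P) (m : ℝ) (f : C_c(P, A)) : Prop :=
  (∀ p ∉ S, f p = 0) ∧ ∀ p, ‖f p‖ ≤ m

lemma exists_boundedOn {A : Type*} [NormedAddCommGroup A] (f : C_c(P, A)) :
    ∃ S m, IsCompact S ∧ 0 ≤ m ∧ BoundedOn S m f := by
  obtain ⟨C, hC⟩ := f.continuous.bounded_above_of_compact_support f.hasCompactSupport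
  exact ⟨tsupport f, max C 0, f.hasCompactSupport, le_max_right _ _,
    fun p hp => image_eq_zero_of_notMem_tsupport hp, fun p => (hC p).trans (le_max_left _ _)⟩

/-- Linear maps out of `C_c(P, A)` that are continuous for the inductive limit topology. -/
def InductivelyContinuous {A : Type*} [NormedAddCommGroup A] [Module ℂ A] [ContinuousConstSMul ℂ A]
    {E : Type*} [SeminormedAddCommGroup E]
    [Module ℂ E] (J : C_c(P, A) →ₗ[ℂ] E) : Prop :=
  ∀ S : Set P, IsCompact S → ∃ C : ℝ, 0 ≤ C ∧ ∀ m f, BoundedOn S m f → ‖J f‖ ≤ C * m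

variable {A : Type*} [NonUnitalCStarAlgebra A] {E : Type*} [NormedAddCommGroup E] [NormedSpace ℂ E]

/-- The functions in `C₀(P, A)` that vanish off `S`. -/
def vanishingOff (A : Type*) [NonUnitalCStarAlgebra A] (S : Set P) : Submodule ℂ C₀(P, A) where
  carrier := {f | ∀ p ∉ S, f p = 0}
  add_mem' := fun ha hb p hp => by simp [ha p hp, hb p hp]
  zero_mem' := fun p _ => rfl
  smul_mem' := fun c f hf p hp => by simp [hf p hp]

lemma norm_apply_le_norm_C0 (f : C₀(P, A)) (p : P) : ‖f p‖ ≤ ‖f‖ := by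
  rw [← ZeroAtInftyContinuousMap.norm_toBCF_eq_norm]
  exact f.toBCF.norm_coe_le_norm p

/-- Evaluation at a point of `C₀(P, A)`. -/
def evalC0 (A : Type*) [NonUnitalCStarAlgebra A] (p : P) : C₀(P, A) →L[ℂ] A :=
  LinearMap.mkContinuous
    { toFun := fun f => f p
      map_add' := fun _ _ => rfl
      map_smul' := fun _ _ => rfl } 1 fun f => by
        simpa using norm_apply_le_norm_C0 f p

@[simp] lemma evalC0_apply (p : P) (f : C₀(P, A)) : evalC0 A p f = f p := rfl

lemma isClosed_vanishingOff (S : Set P) : IsClosed (vanishingOff A S : Set C₀(P, A)) := by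
  have : (vanishingOff A S : Set C₀(P, A)) = ⋂ p : {p // p ∉ S}, (evalC0 A p.1) ⁻¹' {0} := by
    ext f
    simp only [Set.mem_iInter, Set.mem_preimage, evalC0_apply, Set.mem_singleton_iff,
      Subtype.forall]
    exact Iff.rfl
  rw [this]
  exact isClosed_iInter fun p => isClosed_singleton.preimage (evalC0 A p.1).continuous

variable [CompleteSpace E] {T : Type*} [TopologicalSpace T] [R1Space T] [T2Space P]

/-- A compactly supported function as an element of `C₀`. -/
def ofVanishingOff {S : Set P} (hS : IsCompact S) : vanishingOff A S →ₗ[ℂ] C_c(P, A) where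
  toFun f := mkCc f.1 f.1.continuous ⟨S, hS, f.2⟩
  map_add' _ _ := rfl
  map_smul' _ _ := rfl

/-- On functions vanishing off a fixed compact set the defining estimate is boundedness for the sup
norm, so `J` becomes an operator on a closed subspace of `C₀(P, A)`. Bochner integrals of families
of functions exist in that Banach space and can be pushed through `J`. -/
lemma InductivelyContinuous.exists_clm {J : C_c(P, A) →ₗ[ℂ] E} (hJ : InductivelyContinuous J)
    {S : Set P} (hS : IsCompact S) :
    ∃ L : vanishingOff A S →L[ℂ] E, ∀ f, L f = J (ofVanishingOff hS f) := by
  obtain ⟨C, hC, h⟩ := hJ S hS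
  exact ⟨(J ∘ₗ ofVanishingOff hS).mkContinuous C fun f => h _ _
    ⟨f.2, fun p => norm_apply_le_norm_C0 f.1 p⟩, fun f => rfl⟩

/-- A continuous family of functions supported in a fixed compact set. -/
lemma exists_family {f : T → C_c(P, A)} (hf : Continuous fun p : T × P => f p.1 p.2)
    {S₀ : Set T} (hS₀ : IsCompact S₀) (h₀ : ∀ t ∉ S₀, f t = 0) {S : Set P} (hS : IsCompact S)
    (h : ∀ t, ∀ p ∉ S, f t p = 0) :
    ∃ F : T → vanishingOff A S, Continuous F ∧ (∀ t ∉ S₀, F t = 0) ∧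
      ∀ t, ofVanishingOff hS (F t) = f t := by
  let g : C_c(T × P, A) := mkCc (fun p => f p.1 p.2) hf ⟨S₀ ×ˢ S, hS₀.prod hS, fun p hp => by
    rw [Set.mem_prod, not_and_or] at hp
    rcases hp with hp | hp
    · rw [h₀ _ hp]; rfl
    · exact h _ _ hp⟩
  refine ⟨fun t => ⟨curryCc g t, fun p hp => h t p hp⟩, (curryCc g).continuous.subtype_mk _,
    fun t ht => ?_, fun t => rfl⟩
  refine Subtype.ext (ZeroAtInftyContinuousMap.ext fun p => ?_)
  change f t p = 0
  rw [h₀ t ht]; rfl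

lemma InductivelyContinuous.continuous_family {J : C_c(P, A) →ₗ[ℂ] E}
    (hJ : InductivelyContinuous J) {f : T → C_c(P, A)}
    (hf : Continuous fun p : T × P => f p.1 p.2)
    {S₀ : Set T} (hS₀ : IsCompact S₀) (h₀ : ∀ t ∉ S₀, f t = 0) {S : Set P} (hS : IsCompact S)
    (h : ∀ t, ∀ p ∉ S, f t p = 0) : Continuous fun t => J (f t) := by
  obtain ⟨F, hF, -, hF2⟩ := exists_family hf hS₀ h₀ hS h
  obtain ⟨L, hL⟩ := hJ.exists_clm hS
  have : (fun t => J (f t)) = fun t => L (F t) := by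
    ext t; rw [hL, hF2]
  rw [this]
  exact L.continuous.comp hF

/-- Inductively continuous maps commute with integrals of continuous families of functions. -/
lemma InductivelyContinuous.map_integral [MeasurableSpace T] [OpensMeasurableSpace T]
    {J : C_c(P, A) →ₗ[ℂ] E} (hJ : InductivelyContinuous J) (κ : Measure T)
    [IsFiniteMeasureOnCompacts κ] {f : T → C_c(P, A)}
    (hf : Continuous fun p : T × P => f p.1 p.2)
    {S₀ : Set T} (hS₀ : IsCompact S₀) (h₀ : ∀ t ∉ S₀, f t = 0) {S : Set P} (hS : IsCompact S)
    (h : ∀ t, ∀ p ∉ S, f t p = 0) (I : C_c(P, A)) (hI : ∀ p, I p = ∫ t, f t p ∂κ) :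
    J I = ∫ t, J (f t) ∂κ := by
  obtain ⟨F, hF, hF1, hF2⟩ := exists_family hf hS₀ h₀ hS h
  obtain ⟨L, hL⟩ := hJ.exists_clm hS
  have : CompleteSpace (vanishingOff A S) := (isClosed_vanishingOff S).completeSpace_coe
  have hFi : Integrable F κ := integrable_of_continuous_of_vanish κ hF hS₀ hF1
  have h1 : I = ofVanishingOff hS (∫ t, F t ∂κ) := by
    ext p
    -- The Bochner integral in the function space is identified with the pointwise integral by
    -- evaluating at each point.
    have := ((evalC0 A p).comp (vanishingOff A S).subtypeL).integral_comp_comm hFi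
    change _ = (evalC0 A p).comp (vanishingOff A S).subtypeL (∫ t, F t ∂κ)
    rw [hI, ← this]
    congr 1
    ext t
    exact (DFunLike.congr_fun (hF2 t) p).symm
  rw [h1, ← hL, ← L.integral_comp_comm hFi]
  congr 1
  ext t
  rw [hL, hF2]

end InductiveLimit

/-! ### The modular function and inversion of Haar measure -/

section ModularFunction

open scoped Pointwise

variable {H : Type*} [Group H] [TopologicalSpace H] [IsTopologicalGroup H]
  [MeasurableSpace H] [BorelSpace H] (μ : Measure H) [μ.IsHaarMeasure]

lemma modularFn_pos (s : H) : 0 < modularFn μ s :=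
  inv_pos.2 (by exact_mod_cast Measure.haarScalarFactor_pos_of_isHaarMeasure _ μ)

variable [LocallyCompactSpace H]

lemma modularFn_mul (s t : H) : modularFn μ (s * t) = modularFn μ s * modularFn μ t := by
  simp only [modularFn_eq, Measure.modularCharacterFun_map_mul, NNReal.coe_mul, mul_inv]

lemma modularFn_one : modularFn μ (1 : H) = 1 := by
  simp [modularFn_eq, Measure.modularCharacterFun_map_one]

lemma modularFn_inv (s : H) : modularFn μ s⁻¹ = (modularFn μ s)⁻¹ := by
  refine eq_inv_of_mul_eq_one_left ?_
  rw [← modularFn_mul, inv_mul_cancel, modularFn_one]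

variable {E : Type*} [NormedAddCommGroup E] [NormedSpace ℝ E]

/-- Regularity makes the right translate of `μ` equal, as a measure, to a multiple of `μ`; therefore
no integrability, continuity or support condition on `f` is needed. -/
lemma modularFn_smul_integral [μ.Regular] (f : H → E) (r : H) :
    modularFn μ r • ∫ s, f (s * r) ∂μ = ∫ s, f s ∂μ := by
  have h0 : (Measure.map (· * r) μ).Regular := Measure.Regular.map (Homeomorph.mulRight r)
  have h1 : ∫ s, f (s * r) ∂μ = ∫ s, f s ∂(Measure.map (· * r) μ) :=
    ((Homeomorph.mulRight r).measurableEmbedding.integral_map f).symm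
  have h3 := Measure.haarScalarFactor_pos_of_isHaarMeasure (Measure.map (· * r) μ) μ
  have h4 := Measure.isMulLeftInvariant_eq_smul_of_regular (Measure.map (· * r) μ) μ
  have h5 : ∫ s, f s ∂(Measure.map (· * r) μ) =
      ∫ s, f s ∂(Measure.haarScalarFactor (Measure.map (· * r) μ) μ • μ) :=
    congrArg (fun m => ∫ s, f s ∂m) h4
  rw [h1, h5, modularFn, integral_smul_nnreal_measure, NNReal.smul_def, smul_smul,
    inv_mul_cancel₀ (by exact_mod_cast h3.ne'), one_smul]

lemma integral_mul_right_modularFn [μ.Regular] (f : H → E) (r : H) :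
    ∫ s, f (s * r) ∂μ = (modularFn μ r)⁻¹ • ∫ s, f s ∂μ := by
  rw [← modularFn_smul_integral μ f r, smul_smul, inv_mul_cancel₀ (modularFn_pos μ r).ne', one_smul]

/-- A compactly supported nonnegative function with integral one, supported in a given
neighbourhood of a point. -/
lemma exists_bump [T2Space H] {U : Set H} (hU : U ∈ 𝓝 (1 : H)) :
    ∃ (φ : H → ℝ) (S : Set H), Continuous φ ∧ IsCompact S ∧ S ⊆ U ∧ (∀ s, 0 ≤ φ s) ∧
      (∀ s ∉ S, φ s = 0) ∧ ∫ s, φ s ∂μ = 1 := by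
  obtain ⟨S, hS, hSU, hSc⟩ := local_compact_nhds hU
  obtain ⟨f, hf1, hf2, hf3⟩ :=
    exists_continuous_one_zero_of_isCompact (isCompact_singleton (x := (1 : H)))
      (isOpen_interior (s := S)).isClosed_compl (by
        simpa using mem_interior_iff_mem_nhds.2 hS)
  have h0 : ∀ s ∉ S, f s = 0 := fun s hs => hf2 fun h => hs (interior_subset h)
  have hc : HasCompactSupport f := HasCompactSupport.intro hSc h0
  have hpos : 0 < ∫ s, f s ∂μ := by
    refine f.continuous.integral_pos_of_hasCompactSupport_nonneg_nonzero hc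
      (fun s => (hf3.2 s).1) (x := 1) ?_
    rw [hf1 rfl]; simp
  refine ⟨fun s => (∫ s, f s ∂μ)⁻¹ * f s, S, by fun_prop, hSc, hSU, fun s => ?_, fun s hs => ?_, ?_⟩
  · exact mul_nonneg (inv_nonneg.2 hpos.le) (hf3.2 s).1
  · simp only [h0 s hs, mul_zero]
  · rw [integral_const_mul, inv_mul_cancel₀ hpos.ne']

/-- A bump φ of integral one satisfies ∫ φ(sr) ds = Δ(r)⁻¹, and the left side is continuous because
the supports stay in one compact set for r near a given point. -/
lemma continuous_modularFn [T2Space H] [μ.Regular] : Continuous (modularFn μ : H → ℝ) := by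
  obtain ⟨φ, S, hφ, hS, -, hφ0, hφS, hφ1⟩ := exists_bump μ (univ_mem : Set.univ ∈ 𝓝 (1 : H))
  have h1 : ∀ r, ∫ s, φ (s * r) ∂μ = (modularFn μ r)⁻¹ := fun r => by
    rw [integral_mul_right_modularFn, hφ1, smul_eq_mul, mul_one]
  have h2 : Continuous fun r : H => ∫ s, φ (s * r) ∂μ := by
    refine continuous_integral_of_locally_compact_support μ
      (hφ.comp (continuous_snd.mul continuous_fst)) fun r₀ => ?_
    obtain ⟨U, hU, hUc⟩ := exists_compact_mem_nhds r₀
    refine ⟨U, hUc, S * U⁻¹, hS.mul hU.inv, fun r hr s hs => hφS _ fun h => hs ?_⟩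
    exact ⟨s * r, h, r⁻¹, Set.inv_mem_inv.2 hr, by simp⟩
  simp only [h1] at h2
  have h3 := h2.inv₀ fun r => (inv_pos.2 (modularFn_pos μ r)).ne'
  have h4 : (fun r => (modularFn μ r)⁻¹)⁻¹ = (modularFn μ : H → ℝ) := by
    ext r; simp
  rwa [h4] at h3

/-- Insert 1 = ∫ φ(st) dt for a bump φ and exchange integrals. The substitution s ↦ st⁻¹ frees the
bump from t; the inner integral is then a right translate of ∫ f, and its factor Δ(s) cancels
Δ(s)⁻¹. -/
lemma integral_inv_modularFn [CompleteSpace E] [T2Space H] [μ.Regular] {f : H → E}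
    (hf : Continuous f) {S : Set H}
    (hS : IsCompact S) (hfS : ∀ s ∉ S, f s = 0) :
    ∫ s, (modularFn μ s)⁻¹ • f s⁻¹ ∂μ = ∫ s, f s ∂μ := by
  obtain ⟨φ, V, hφ, hV, -, hφ0, hφV, hφ1⟩ := exists_bump μ (univ_mem : Set.univ ∈ 𝓝 (1 : H))
  have hΔ := continuous_modularFn μ
  have hΔi : Continuous fun s => (modularFn μ s)⁻¹ := hΔ.inv₀ fun r => (modularFn_pos μ r).ne'
  have e1 : ∀ s, (modularFn μ s)⁻¹ • f s⁻¹
      = ∫ t, φ (s * t) • (modularFn μ s)⁻¹ • f s⁻¹ ∂μ := fun s => by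
    rw [integral_smul_const, integral_mul_left_eq_self (fun t => φ t) s, hφ1, one_smul]
  have e2 : ∀ t, ∫ s, φ (s * t) • (modularFn μ s)⁻¹ • f s⁻¹ ∂μ
      = ∫ s, φ s • (modularFn μ s)⁻¹ • f (t * s⁻¹) ∂μ := fun t => by
    rw [← modularFn_smul_integral μ (fun s => φ s • (modularFn μ s)⁻¹ • f (t * s⁻¹)) t,
      ← integral_smul]
    congr 1; ext s
    have := (modularFn_pos μ t).ne'
    have := (modularFn_pos μ s).ne'
    rw [mul_inv_rev, mul_inv_cancel_left, modularFn_mul]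
    simp only [smul_smul]
    congr 1
    field_simp
  have e3 : ∀ s, ∫ t, φ s • (modularFn μ s)⁻¹ • f (t * s⁻¹) ∂μ = φ s • ∫ t, f t ∂μ := fun s => by
    rw [integral_smul, integral_smul, integral_mul_right_modularFn, modularFn_inv, inv_inv,
      smul_smul (modularFn μ s)⁻¹, inv_mul_cancel₀ (modularFn_pos μ s).ne', one_smul]
  rw [integral_congr_ae (Eventually.of_forall e1)]
  rw [integral_swap_of_vanish μ μ (S := S⁻¹) (S' := S * V) ?_ hS.inv (hS.mul hV)]
  · simp_rw [e2]
    rw [integral_swap_of_vanish μ μ (S := S * V) (S' := V) ?_ (hS.mul hV) hV]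
    · simp_rw [e3]
      rw [integral_smul_const, hφ1, one_smul]
    · intro t s ht
      by_cases hs : s ∈ V
      · rw [hfS, smul_zero, smul_zero]
        exact fun h => ht ⟨_, h, s, hs, by simp⟩
      · rw [hφV s hs, zero_smul]
    · intro t s hs
      rw [hφV s hs, zero_smul]
    · exact (hφ.comp continuous_snd).smul ((hΔi.comp continuous_snd).smul
        (hf.comp (continuous_fst.mul continuous_snd.inv)))
  · intro s t hs
    rw [hfS s⁻¹ (fun h => hs (by simpa using h)), smul_zero, smul_zero]
  · intro s t ht
    by_cases hs : s⁻¹ ∈ S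
    · rw [hφV, zero_smul]
      exact fun h => ht ⟨_, hs, _, h, by simp⟩
    · rw [hfS s⁻¹ hs, smul_zero, smul_zero]
  · exact (hφ.comp (continuous_fst.mul continuous_snd)).smul ((hΔi.comp continuous_fst).smul
        (hf.comp continuous_fst.inv))

end ModularFunction

/-! ### Convolution and involution inside a crossed product -/

section CrossedProductAlgebra

open scoped Pointwise

lemma CStarAction.continuous_act_comp {G A Z : Type*} [Group G] [TopologicalSpace G]
    [NonUnitalCStarAlgebra A] [TopologicalSpace Z] (α : CStarAction G A) {f : Z → G} {g : Z → A}
    (hf : Continuous f) (hg : Continuous g) : Continuous fun z => α.act (f z) (g z) :=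
  α.continuous_act_prod.comp (hf.prodMk hg)

lemma CStarAction.norm_act {G A : Type*} [Group G] [TopologicalSpace G]
    [NonUnitalCStarAlgebra A] (α : CStarAction G A) (s : G) (a : A) : ‖α.act s a‖ = ‖a‖ := by
  refine le_antisymm (NonUnitalStarAlgHom.norm_apply_le _ _) ?_
  conv_lhs => rw [← α.act_inv_act s a]
  exact NonUnitalStarAlgHom.norm_apply_le _ _

lemma continuous_nonUnitalStarAlgHom {A B : Type*} [NonUnitalCStarAlgebra A]
    [NonUnitalCStarAlgebra B] (π : A →⋆ₙₐ[ℂ] B) : Continuous π :=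
  AddMonoidHomClass.continuous_of_bound π 1 fun b => by
    simpa using NonUnitalStarAlgHom.norm_apply_le π b

/-- A star homomorphism of C*-algebras as a continuous linear map. -/
def starHomCLM {A B : Type*} [NonUnitalCStarAlgebra A]
    [NonUnitalCStarAlgebra B] (π : A →⋆ₙₐ[ℂ] B) : A →L[ℂ] B :=
  { toFun := π
    map_add' := map_add π
    map_smul' := map_smul π
    cont := continuous_nonUnitalStarAlgHom π }

@[simp] lemma starHomCLM_apply {A B : Type*} [NonUnitalCStarAlgebra A]
    [NonUnitalCStarAlgebra B] (π : A →⋆ₙₐ[ℂ] B) (a : A) : starHomCLM π a = π a := rfl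

lemma starHom_real_smul {A B : Type*} [NonUnitalCStarAlgebra A]
    [NonUnitalCStarAlgebra B] (π : A →⋆ₙₐ[ℂ] B) (r : ℝ) (a : A) : π (r • a) = r • π a := by
  rw [← Complex.coe_smul, map_smul, Complex.coe_smul]

variable {H : Type v} {B : Type u} [Group H] [TopologicalSpace H] [NonUnitalCStarAlgebra B]
  {γ : CStarAction H B}

lemma CovRep.U_mul_apply (R : CovRep γ) (s t : H) (h : R.E) :
    (R.U (s * t) : R.E →L[ℂ] R.E) h = (R.U s : R.E →L[ℂ] R.E) ((R.U t : R.E →L[ℂ] R.E) h) := by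
  rw [map_mul]; rfl

lemma CovRep.star_U (R : CovRep γ) (s : H) :
    star (R.U s : R.E →L[ℂ] R.E) = (R.U s⁻¹ : R.E →L[ℂ] R.E) := by
  rw [map_inv]; rfl

lemma CovRep.U_one_apply (R : CovRep γ) (h : R.E) : (R.U 1 : R.E →L[ℂ] R.E) h = h := by
  rw [map_one]; rfl

lemma CovRep.covariant_apply (R : CovRep γ) (s : H) (b : B) (h : R.E) :
    R.π (γ.act s b) ((R.U s : R.E →L[ℂ] R.E) h) = (R.U s : R.E →L[ℂ] R.E) (R.π b h) := by
  rw [R.covariant, R.star_U]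
  change (R.U s : R.E →L[ℂ] R.E) (R.π b ((R.U s⁻¹ : R.E →L[ℂ] R.E) ((R.U s : R.E →L[ℂ] R.E) h))) = _
  rw [← R.U_mul_apply, inv_mul_cancel, R.U_one_apply]

variable [MeasurableSpace H] [BorelSpace H] (μ : Measure H) [IsFiniteMeasureOnCompacts μ]

lemma CovRep.integratedForm_apply (R : CovRep γ) (f : C_c(H, B)) (h : R.E) :
    R.integratedForm μ f h = ∫ s, R.π (f s) ((R.U s : R.E →L[ℂ] R.E) h) ∂μ := rfl

namespace CrossedProduct

/-- The representation of the crossed product given by a covariant representation. -/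
def eval (R : CovRep γ) : CrossedProduct μ γ →⋆ₙₐ[ℂ] (R.E →L[ℂ] R.E) where
  toFun T := T.1.1 R
  map_smul' _ _ := rfl
  map_zero' := rfl
  map_add' _ _ := rfl
  map_mul' _ _ := rfl
  map_star' _ := rfl

lemma eval_ofCc (R : CovRep γ) (f : C_c(H, B)) : eval μ R (ofCc μ γ f) = R.integratedForm μ f := rfl

lemma ext_eval {S T : CrossedProduct μ γ} (h : ∀ R : CovRep γ, eval μ R S = eval μ R T) : S = T :=
  Subtype.ext (Subtype.ext (funext h))

variable (γ) in
lemma inductivelyContinuous_ofCc : InductivelyContinuous (ofCc μ γ) := by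
  intro S hS
  refine ⟨μ.real S, measureReal_nonneg, fun m f hf => (norm_ofCc_le μ γ f).trans ?_⟩
  have h1 := norm_integral_le_of_vanish μ (F := fun s => ‖f s‖) hS
    (fun s hs => by simp only [hf.1 s hs, norm_zero]) (m := m) (fun s => by simpa using hf.2 s)
  rw [mul_comm]
  exact (le_abs_self _).trans h1

variable [IsTopologicalGroup H] [LocallyCompactSpace H] [T2Space H]

/-- Elements of the crossed product are families indexed by covariant representations, so the
identity is tested in each of them. There it is Fubini, a left translation of the variable, and
covariance in the form π(γ_t b)U_t = U_t π(b). -/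
lemma ofCc_mul_of {μ : Measure H} [μ.IsHaarMeasure] {f g h : C_c(H, B)}
    (hh : ∀ s, h s = ∫ t, f t * γ.act t (g (t⁻¹ * s)) ∂μ) :
    ofCc μ γ f * ofCc μ γ g = ofCc μ γ h := by
  refine ext_eval _ fun R => ?_
  rw [map_mul]
  ext x
  change R.integratedForm μ f (R.integratedForm μ g x) = R.integratedForm μ h x
  rw [R.integratedForm_apply μ h, R.integratedForm_apply μ f]
  obtain ⟨S, m, hS, hm, hf⟩ := exists_boundedOn f
  obtain ⟨S', m', hS', hm', hg⟩ := exists_boundedOn g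
  have hπ := continuous_nonUnitalStarAlgHom R.π
  have hc : Continuous fun p : H × H => f p.2 * γ.act p.2 (g (p.2⁻¹ * p.1)) :=
    (f.continuous.comp continuous_snd).mul (γ.continuous_act_comp continuous_snd
      (g.continuous.comp (continuous_snd.inv.mul continuous_fst)))
  have e1 : ∀ s, R.π (h s) ((R.U s : R.E →L[ℂ] R.E) x) =
      ∫ t, R.π (f t * γ.act t (g (t⁻¹ * s))) ((R.U s : R.E →L[ℂ] R.E) x) ∂μ := fun s => by
    rw [hh]
    have hi : Integrable (fun t => f t * γ.act t (g (t⁻¹ * s))) μ :=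
      integrable_of_continuous_of_vanish μ (hc.comp (continuous_const.prodMk continuous_id)) hS
        fun t ht => by simp [hf.1 t ht]
    exact (((ContinuousLinearMap.apply ℂ R.E ((R.U s : R.E →L[ℂ] R.E) x)).comp
      (starHomCLM R.π)).integral_comp_comm hi).symm
  rw [integral_congr_ae (Eventually.of_forall e1)]
  rw [integral_swap_of_vanish μ μ (S := S * S') (S' := S) ?_ (hS.mul hS') hS]
  · congr 1; ext t
    rw [R.integratedForm_apply μ]
    have e2 : ∀ y, (R.π (f t)) ((R.U t : R.E →L[ℂ] R.E) y) =
      ((R.π (f t)).comp (R.U t : R.E →L[ℂ] R.E)) y := fun y => rfl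
    rw [e2, ← ContinuousLinearMap.integral_comp_comm _ (R.integrable_integrand μ g x),
      ← integral_mul_left_eq_self _ t⁻¹]
    congr 1; ext s
    rw [map_mul R.π]
    change _ = R.π (f t) (R.π (γ.act t (g (t⁻¹ * s))) ((R.U s : R.E →L[ℂ] R.E) x))
    have e3 : (R.U s : R.E →L[ℂ] R.E) x =
        (R.U t : R.E →L[ℂ] R.E) ((R.U (t⁻¹ * s) : R.E →L[ℂ] R.E) x) := by
      rw [← R.U_mul_apply, mul_inv_cancel_left]
    rw [e3, R.covariant_apply]
    rfl
  · intro s t hs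
    by_cases ht : t ∈ S
    · rw [hg.1, map_zero, mul_zero, map_zero]; rfl
      exact fun h => hs ⟨t, ht, _, h, by simp⟩
    · rw [hf.1 t ht, zero_mul, map_zero]; rfl
  · intro s t ht
    rw [hf.1 t ht, zero_mul, map_zero]; rfl
  · exact (hπ.comp hc).clm_apply ((R.continuous_U x).comp continuous_fst)

/-- The adjoint is computed weakly in each representation. Inversion of Haar measure replaces s by
s⁻¹ in ∫ ⟨x, π(f(s))U_s y⟩ ds, which is where Δ(s)⁻¹ comes from. -/
lemma ofCc_star_of {μ : Measure H} [μ.IsHaarMeasure] [μ.Regular] {f h : C_c(H, B)}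
    (hh : ∀ s, h s = (modularFn μ s)⁻¹ • γ.act s (star (f s⁻¹))) :
    star (ofCc μ γ f) = ofCc μ γ h := by
  refine ext_eval _ fun R => ?_
  rw [map_star]
  change star (R.integratedForm μ f) = R.integratedForm μ h
  symm
  refine (ContinuousLinearMap.eq_adjoint_iff _ _).2 fun x y => ?_
  rw [R.integratedForm_apply μ, R.integratedForm_apply μ]
  have h1 : inner ℂ (∫ s, R.π (h s) ((R.U s : R.E →L[ℂ] R.E) x) ∂μ) y =
      ∫ s, inner ℂ (R.π (h s) ((R.U s : R.E →L[ℂ] R.E) x)) y ∂μ := by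
    rw [← inner_conj_symm, ← integral_inner (R.integrable_integrand μ h x), ← integral_conj]
    simp only [inner_conj_symm]
  rw [h1, ← integral_inner (R.integrable_integrand μ f y)]
  obtain ⟨S, m, hS, hm, hf⟩ := exists_boundedOn f
  rw [← integral_inv_modularFn μ (f := fun s => inner ℂ x (R.π (f s) ((R.U s : R.E →L[ℂ] R.E) y)))
    (continuous_const.inner (R.continuous_integrand f y)) hS fun s hs => by simp [hf.1 s hs]]
  congr 1; ext s
  rw [hh]
  have e1 : R.π ((modularFn μ s)⁻¹ • γ.act s (star (f s⁻¹))) =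
    (((modularFn μ s)⁻¹ : ℝ) : ℂ) • R.π (γ.act s (star (f s⁻¹))) := by
    rw [starHom_real_smul, Complex.coe_smul]
  rw [e1]
  change inner ℂ ((((modularFn μ s)⁻¹ : ℝ) : ℂ) •
    (R.π (γ.act s (star (f s⁻¹))) ((R.U s : R.E →L[ℂ] R.E) x))) y = _
  rw [R.covariant_apply, inner_smul_left, Complex.conj_ofReal, map_star,
    ← R.star_U s, Complex.real_smul]
  congr 1
  rw [ContinuousLinearMap.star_eq_adjoint, ContinuousLinearMap.star_eq_adjoint,
    ← ContinuousLinearMap.adjoint_inner_right, ContinuousLinearMap.adjoint_inner_left]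

/-- The closure of a range of `ofCc` is everything. -/
lemma denseRange_ofCc {μ : Measure H} [μ.IsHaarMeasure] [μ.Regular] :
    DenseRange (ofCc μ γ) := by
  -- The image of C_c is already closed under products and adjoints, so generating a *-subalgebra
  -- adds nothing to it.
  let S : NonUnitalStarSubalgebra ℂ (OperatorFamilies γ) :=
    { carrier := Set.range (universalRep μ γ)
      add_mem' := by
        rintro _ _ ⟨f, rfl⟩ ⟨g, rfl⟩; exact ⟨f + g, map_add _ _ _⟩
      zero_mem' := ⟨0, map_zero _⟩
      mul_mem' := by
        rintro _ _ ⟨f, rfl⟩ ⟨g, rfl⟩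
        obtain ⟨S, m, hS, hm, hf⟩ := exists_boundedOn f
        obtain ⟨S', m', hS', hm', hg⟩ := exists_boundedOn g
        let h : C_c(H, B) := mkCc (fun s => ∫ t, f t * γ.act t (g (t⁻¹ * s)) ∂μ) (by
          refine continuous_integral_of_compact_support' μ ?_ hS fun s t ht => by simp [hf.1 t ht]
          exact (f.continuous.comp continuous_snd).mul (γ.continuous_act_comp continuous_snd
            (g.continuous.comp (continuous_snd.inv.mul continuous_fst))))
          ⟨S * S', hS.mul hS', fun s hs => by
            rw [integral_eq_zero_of_ae (Eventually.of_forall fun t => ?_)]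
            by_cases ht : t ∈ S
            · simp only [Pi.zero_apply]
              rw [hg.1, map_zero, mul_zero]
              exact fun h => hs ⟨t, ht, _, h, by simp⟩
            · simp [hf.1 t ht]⟩
        exact ⟨h, (congrArg Subtype.val (ofCc_mul_of (γ := γ) (f := f) (g := g) (h := h)
          fun s => rfl)).symm⟩
      smul_mem' := by
        rintro c _ ⟨f, rfl⟩; exact ⟨c • f, map_smul _ _ _⟩
      star_mem' := by
        rintro _ ⟨f, rfl⟩
        obtain ⟨S, m, hS, hm, hf⟩ := exists_boundedOn f
        let h : C_c(H, B) := mkCc (fun s => (modularFn μ s)⁻¹ • γ.act s (star (f s⁻¹)))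
          (((continuous_modularFn μ).inv₀ fun r => (modularFn_pos μ r).ne').smul
            (γ.continuous_act_comp continuous_id (f.continuous.comp continuous_inv).star))
          ⟨S⁻¹, hS.inv, fun s hs => by
            rw [hf.1 s⁻¹ fun h => hs (by simpa using h), star_zero, map_zero, smul_zero]⟩
        exact ⟨h, (congrArg Subtype.val (ofCc_star_of (γ := γ) (f := f) (h := h)
          fun s => rfl)).symm⟩ }
  have hle : NonUnitalStarAlgebra.adjoin ℂ (Set.range (universalRep μ γ)) ≤ S :=
    NonUnitalStarAlgebra.adjoin_le fun _ h => h
  intro T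
  rw [mem_closure_iff_seq_limit]
  have hT : T.1 ∈ closure (Set.range (universalRep μ γ)) := closure_mono hle T.2
  obtain ⟨x, hx, hlim⟩ := mem_closure_iff_seq_limit.1 hT
  choose f hf using hx
  refine ⟨fun n => ofCc μ γ (f n), fun n => ⟨f n, rfl⟩, ?_⟩
  refine tendsto_subtype_rng.2 ?_
  convert hlim using 2 with n
  exact hf n

end CrossedProduct

end CrossedProductAlgebra

/-! ### Representations on pre-Hilbert spaces -/

section PreHilbertRepresentations

/-- The element is g = 1 - √(1 - a^*a), available without a unit because t ↦ 1 - √(1 - t) vanishes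
at 0. It replaces the square root of 1 - a^*a in the usual proof that representations are
contractive. -/
lemma exists_one_sub_sq_eq {C : Type*} [NonUnitalCStarAlgebra C] {a : C} (ha : ‖a‖ ≤ 1) :
    ∃ g : C, star g = g ∧ g + g - g * g = star a * a := by
  let _ : PartialOrder C := CStarAlgebra.spectralOrder C
  have _ : StarOrderedRing C := CStarAlgebra.spectralOrderedRing C
  set p := star a * a with hp
  have hp0 : 0 ≤ p := star_mul_self_nonneg a
  have hpsa : IsSelfAdjoint p := IsSelfAdjoint.of_nonneg hp0
  have hp1 : ‖p‖ ≤ 1 := by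
    rw [hp, CStarRing.norm_star_mul_self]
    exact mul_le_one₀ ha (norm_nonneg _) ha
  let f : ℝ → ℝ := fun t => 1 - √(1 - t)
  have hf : Continuous f := by fun_prop
  have hf0 : f 0 = 0 := by simp [f]
  refine ⟨cfcₙ f p, (cfcₙ_predicate f p).star_eq, ?_⟩
  rw [← cfcₙ_mul f f p, ← cfcₙ_add (a := p) f f, ← cfcₙ_sub _ _ p]
  conv_rhs => rw [← cfcₙ_id' ℝ p]
  refine cfcₙ_congr fun t ht => ?_
  have h1 : t ≤ 1 := (le_abs_self t).trans
    ((NonUnitalIsometricContinuousFunctionalCalculus.norm_quasispectrum_le p ht).trans hp1)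
  have h2 := Real.sq_sqrt (sub_nonneg.2 h1)
  simp only [f]
  nlinarith

variable {V : Type*} [SeminormedAddCommGroup V] [InnerProductSpace ℂ V]

/-- A *-representation of a C*-algebra on a pre-Hilbert space is contractive. -/
lemma norm_rep_apply_le {C : Type*} [NonUnitalCStarAlgebra C] (π : C →ₗ[ℂ] V →ₗ[ℂ] V)
    (hmul : ∀ a b x, π (a * b) x = π a (π b x))
    (hadj : ∀ a x y, inner ℂ (π a x) y = inner ℂ x (π (star a) y)) (a : C) (x : V) :
    ‖π a x‖ ≤ ‖a‖ * ‖x‖ := by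
  have key : ∀ a : C, ‖a‖ ≤ 1 → ‖π a x‖ ≤ ‖x‖ := fun a ha => by
    obtain ⟨g, hg, hga⟩ := exists_one_sub_sq_eq ha
    -- Formally (1 - g)² = 1 - a^*a, so the loss of norm ‖x‖² - ‖π(a)x‖² is the square ‖x - π(g)x‖².
    have h1 : RCLike.re (inner ℂ (x - π g x) (x - π g x)) =
        RCLike.re (inner ℂ x x) - RCLike.re (inner ℂ (π a x) (π a x)) := by
      rw [hadj a, ← hmul, ← hga, map_sub, map_add, LinearMap.sub_apply, LinearMap.add_apply,
        hmul g g, inner_sub_right, inner_sub_left, inner_sub_left, inner_sub_right, inner_add_right,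
        hadj g x x, hadj g x (π g x), hg]
      simp only [map_sub, map_add]
      ring
    rw [inner_self_eq_norm_sq, inner_self_eq_norm_sq, inner_self_eq_norm_sq] at h1
    nlinarith [sq_nonneg ‖x - π g x‖, norm_nonneg x, norm_nonneg (π a x)]
  rcases eq_or_ne a 0 with rfl | ha
  · simp
  · have h0 : ‖a‖ ≠ 0 := norm_ne_zero_iff.2 ha
    have h1 := key (((‖a‖⁻¹ : ℝ) : ℂ) • a) (by
      rw [norm_smul, Complex.norm_real, norm_inv, norm_norm, inv_mul_cancel₀ h0])
    rw [map_smul, LinearMap.smul_apply, norm_smul, Complex.norm_real, norm_inv, norm_norm] at h1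
    rwa [inv_mul_le_iff₀ (by positivity)] at h1

variable {H : Type*} [Group H] [TopologicalSpace H] {E : Type*} [NormedAddCommGroup E]
  [InnerProductSpace ℂ E] [CompleteSpace E]

/-- A strongly continuous isometric representation on a dense subspace of a Hilbert space extends
to a unitary representation. -/
lemma exists_unitary_extension {V : Type*} [AddCommGroup V] [Module ℂ V] (j : V →ₗ[ℂ] E)
    (hj : DenseRange j) (U : H → V →ₗ[ℂ] V)
    (h_one : ∀ x, U 1 x = x) (h_mul : ∀ s t x, U (s * t) x = U s (U t x))
    (h_norm : ∀ s x, ‖j (U s x)‖ = ‖j x‖) (h_cont : ∀ x, Continuous fun s => j (U s x)) :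
    ∃ W : H →* unitary (E →L[ℂ] E), (∀ s x, (W s : E →L[ℂ] E) (j x) = j (U s x)) ∧
      ∀ h, Continuous fun s => (W s : E →L[ℂ] E) h := by
  let W : H → E →L[ℂ] E := fun s => (j ∘ₗ U s).extendOfNorm j
  have hn : ∀ s x, ‖(j ∘ₗ U s) x‖ ≤ 1 * ‖j x‖ := fun s x => by
    simp [h_norm]
  have hW : ∀ s x, W s (j x) = j (U s x) := fun s x =>
    LinearMap.extendOfNorm_eq hj ⟨1, hn s⟩ x
  have hW1 : ∀ s h, ‖W s h‖ ≤ 1 * ‖h‖ := fun s h =>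
    LinearMap.norm_extendOfNorm_apply_le hj 1 (hn s) h
  have W_one : W 1 = 1 := by
    ext h
    refine hj.induction_on h (isClosed_eq (by fun_prop) (by fun_prop)) fun x => ?_
    rw [hW, h_one]; rfl
  have W_mul : ∀ s t, W (s * t) = W s * W t := fun s t => by
    ext h
    refine hj.induction_on h (isClosed_eq (by fun_prop) (by fun_prop)) fun x => ?_
    change _ = W s (W t (j x))
    rw [hW, hW, hW, h_mul]
  have W_norm : ∀ s h, ‖W s h‖ = ‖h‖ := fun s h => by
    refine le_antisymm (by simpa using hW1 s h) ?_
    have h1 : W s⁻¹ (W s h) = h := by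
      change (W s⁻¹ * W s) h = h
      rw [← W_mul, inv_mul_cancel, W_one]; rfl
    conv_lhs => rw [← h1]
    simpa using hW1 s⁻¹ (W s h)
  -- `W s` is an isometry with two-sided inverse `W s⁻¹`; its left inverse `star (W s)` must agree
  -- with that inverse.
  have W_star : ∀ s, star (W s) = W s⁻¹ := fun s => by
    have h1 : star (W s) * W s = 1 := (ContinuousLinearMap.norm_map_iff_adjoint_comp_self _).1
      (W_norm s)
    calc star (W s) = star (W s) * (W s * W s⁻¹) := by
          rw [← W_mul, mul_inv_cancel, W_one, mul_one]
      _ = W s⁻¹ := by rw [← mul_assoc, h1, one_mul]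
  refine ⟨⟨⟨fun s => ⟨W s, ?_⟩, Subtype.ext W_one⟩, fun s t => Subtype.ext (W_mul s t)⟩, hW, ?_⟩
  · rw [Unitary.mem_iff, W_star, ← W_mul, ← W_mul, inv_mul_cancel, mul_inv_cancel]
    exact ⟨W_one, W_one⟩
  · intro h
    change Continuous fun s => W s h
    obtain ⟨x, hx, hlim⟩ := mem_closure_iff_seq_limit.1 (hj h)
    choose y hy using hx
    have h1 : TendstoUniformly (fun n s => W s (x n)) (fun s => W s h) atTop := by
      rw [Metric.tendstoUniformly_iff]
      intro ε hε
      filter_upwards [Metric.tendsto_nhds.1 hlim ε hε] with n hn s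
      rw [dist_eq_norm, ← map_sub, W_norm, ← dist_eq_norm, dist_comm]
      exact hn
    refine h1.continuous (Frequently.of_forall fun n => ?_)
    simp only [← hy n, hW]
    exact h_cont (y n)

/-- A *-representation on a dense subspace of a Hilbert space extends. -/
lemma exists_rep_extension {C : Type*} [NonUnitalCStarAlgebra C] (j : V →ₗᵢ[ℂ] E)
    (hj : DenseRange j) (π : C →ₗ[ℂ] V →ₗ[ℂ] V) (hmul : ∀ a b x, π (a * b) x = π a (π b x))
    (hadj : ∀ a x y, inner ℂ (π a x) y = inner ℂ x (π (star a) y)) :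
    ∃ ρ : C →⋆ₙₐ[ℂ] (E →L[ℂ] E), ∀ a x, ρ a (j x) = j (π a x) := by
  let W : C → E →L[ℂ] E := fun s => (j.toLinearMap ∘ₗ π s).extendOfNorm j.toLinearMap
  have hn : ∀ s x, ‖(j.toLinearMap ∘ₗ π s) x‖ ≤ ‖s‖ * ‖j.toLinearMap x‖ := fun s x => by
    simpa using norm_rep_apply_le π hmul hadj s x
  have hW : ∀ s x, W s (j x) = j (π s x) := fun s x =>
    LinearMap.extendOfNorm_eq hj ⟨_, hn s⟩ x
  have hext : ∀ S T : E →L[ℂ] E, (∀ x, S (j x) = T (j x)) → S = T := fun S T h => by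
    ext y
    exact hj.induction_on y (isClosed_eq (by fun_prop) (by fun_prop)) h
  refine ⟨{ toFun := W, map_smul' := fun c a => ?_, map_zero' := ?_, map_add' := fun a b => ?_,
            map_mul' := fun a b => ?_, map_star' := fun a => ?_ }, hW⟩
  · refine hext _ _ fun x => ?_
    change _ = c • W a (j x)
    rw [hW, hW, map_smul, LinearMap.smul_apply, map_smul]
  · refine hext _ _ fun x => ?_
    rw [hW, map_zero]; simp
  · refine hext _ _ fun x => ?_
    change _ = W a (j x) + W b (j x)
    rw [hW, hW, hW, map_add, LinearMap.add_apply, map_add]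
  · refine hext _ _ fun x => ?_
    change _ = W a (W b (j x))
    rw [hW, hW, hW, hmul]
  · refine (ContinuousLinearMap.eq_adjoint_iff _ _).2 fun x y => ?_
    refine hj.induction_on₂ (p := fun x y => inner ℂ (W (star a) x) y = inner ℂ x (W a y))
      (isClosed_eq (by fun_prop) (by fun_prop)) (fun x y => ?_) x y
    rw [hW, hW, j.inner_map_map, j.inner_map_map, hadj, star_star]

end PreHilbertRepresentations

/-! ### Covariant representations on completions and across universes -/

section CovariantRepresentations

variable {H : Type v} {B : Type u} [Group H] [TopologicalSpace H] [NonUnitalCStarAlgebra B]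
  {γ : CStarAction H B}

/-- A covariant representation on a pre-Hilbert space extends to its completion. -/
theorem exists_covRep {V : Type (max u v)} [SeminormedAddCommGroup V] [InnerProductSpace ℂ V]
    (π : B →ₗ[ℂ] V →ₗ[ℂ] V) (hmul : ∀ a b x, π (a * b) x = π a (π b x))
    (hadj : ∀ a x y, inner ℂ (π a x) y = inner ℂ x (π (star a) y))
    (hnd : ∀ x : V, x ∈ closure (Submodule.span ℂ {x : V | ∃ b y, x = π b y} : Set V))
    (U : H → V →ₗ[ℂ] V) (hU_one : ∀ x, U 1 x = x) (hU_mul : ∀ s t x, U (s * t) x = U s (U t x))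
    (hU_norm : ∀ s x, ‖U s x‖ = ‖x‖) (hU_cont : ∀ x, Continuous fun s => U s x)
    (hcov : ∀ s b x, π (γ.act s b) (U s x) = U s (π b x)) :
    ∃ (R : CovRep γ) (j : V →ₗᵢ[ℂ] R.E), DenseRange j ∧ (∀ b x, R.π b (j x) = j (π b x)) ∧
      ∀ s x, (R.U s : R.E →L[ℂ] R.E) (j x) = j (U s x) := by
  let j : V →ₗᵢ[ℂ] UniformSpace.Completion V := UniformSpace.Completion.toComplₗᵢ
  have hj : DenseRange j := UniformSpace.Completion.denseRange_coe
  obtain ⟨ρ, hρ⟩ := exists_rep_extension j hj π hmul hadj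
  obtain ⟨W, hW, hWc⟩ := exists_unitary_extension j.toLinearMap hj U hU_one hU_mul
    (fun s x => by simp [hU_norm]) fun x => j.continuous.comp (hU_cont x)
  change ∀ s x, (W s : UniformSpace.Completion V →L[ℂ] UniformSpace.Completion V) (j x) =
    j (U s x) at hW
  have hWU : ∀ s h, (W s : UniformSpace.Completion V →L[ℂ] UniformSpace.Completion V)
      ((W s⁻¹ : UniformSpace.Completion V →L[ℂ] UniformSpace.Completion V) h) = h := fun s h => by
    have := congrArg (fun T : unitary (UniformSpace.Completion V →L[ℂ] UniformSpace.Completion V) =>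
      (T : UniformSpace.Completion V →L[ℂ] UniformSpace.Completion V) h)
      (show W s * W s⁻¹ = 1 by rw [← map_mul, mul_inv_cancel, map_one])
    exact this
  refine ⟨{ E := UniformSpace.Completion V, π := ρ, U := W, nondegenerate := ?_,
            continuous_U := hWc, covariant := fun s b => ?_ }, j, hj, hρ, hW⟩
  · rw [dense_iff_closure_eq, Set.eq_univ_iff_forall]
    have h1 : ∀ x : V, j x ∈ closure (Submodule.span ℂ
        {x | ∃ b h, x = ρ b h} : Set (UniformSpace.Completion V)) := fun x => by
      refine closure_mono ?_ (map_mem_closure j.continuous (hnd x)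
        (t := j '' (Submodule.span ℂ {x : V | ∃ b y, x = π b y} : Set V)) fun y hy => ⟨y, hy, rfl⟩)
      rintro _ ⟨y, hy, rfl⟩
      refine Submodule.span_induction (p := fun y _ => j y ∈ Submodule.span ℂ
        {x | ∃ b h, x = ρ b h}) ?_ ?_ ?_ ?_ hy
      · rintro _ ⟨b, y, rfl⟩
        exact Submodule.subset_span ⟨b, j y, (hρ b y).symm⟩
      · rw [map_zero]; exact zero_mem _
      · intro x y _ _ hx hy
        rw [map_add]; exact add_mem hx hy
      · intro c x _ hx
        rw [map_smul]; exact Submodule.smul_mem _ _ hx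
    intro h
    exact hj.induction_on h isClosed_closure h1
  · have hs : star (W s : UniformSpace.Completion V →L[ℂ] UniformSpace.Completion V) =
        (W s⁻¹ : UniformSpace.Completion V →L[ℂ] UniformSpace.Completion V) := by
      rw [map_inv]; rfl
    rw [hs]
    ext h
    refine hj.induction_on h (isClosed_eq (by fun_prop) (by fun_prop)) fun x => ?_
    change ρ (γ.act s b) (j x) = (W s : UniformSpace.Completion V →L[ℂ] UniformSpace.Completion V)
      (ρ b ((W s⁻¹ : UniformSpace.Completion V →L[ℂ] UniformSpace.Completion V) (j x)))
    rw [hρ, hW, hρ, hW, ← hcov, ← hU_mul, mul_inv_cancel, hU_one]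

variable [MeasurableSpace H] [BorelSpace H] (μ : Measure H) [IsFiniteMeasureOnCompacts μ]

/-- This moves a Hilbert space into the universe over which the covariant representations of a given
system range. -/
instance ULift.instInnerProductSpaceComplex {E : Type*} [NormedAddCommGroup E]
    [InnerProductSpace ℂ E] : InnerProductSpace ℂ (ULift.{w} E) where
  inner x y := inner ℂ x.down y.down
  norm_sq_eq_re_inner x := norm_sq_eq_re_inner (𝕜 := ℂ) x.down
  conj_inner_symm x y := inner_conj_symm x.down y.down
  add_left x y z := inner_add_left x.down y.down z.down
  smul_left x y c := inner_smul_left x.down y.down c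

/-- The integrated form of a covariant representation on a Hilbert space in a smaller universe is
bounded by the norm of the crossed product. -/
theorem norm_integral_le_norm_ofCc {E : Type w} [NormedAddCommGroup E] [InnerProductSpace ℂ E]
    [CompleteSpace E] {B : Type (max w u)} [NonUnitalCStarAlgebra B] {γ : CStarAction H B}
    (π : B →⋆ₙₐ[ℂ] (E →L[ℂ] E))
    (hnd : ∀ x : E, x ∈ closure (Submodule.span ℂ {x : E | ∃ b y, x = π b y} : Set E))
    (U : H →* unitary (E →L[ℂ] E)) (hU : ∀ h, Continuous fun s => (U s : E →L[ℂ] E) h)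
    (hcov : ∀ s b x, π (γ.act s b) ((U s : E →L[ℂ] E) x) = (U s : E →L[ℂ] E) (π b x))
    (f : C_c(H, B)) (x : E) :
    ‖∫ s, π (f s) ((U s : E →L[ℂ] E) x) ∂μ‖ ≤ ‖CrossedProduct.ofCc μ γ f‖ * ‖x‖ := by
  let e : E ≃ₗᵢ[ℂ] ULift.{max w u v} E :=
    { (ULift.moduleEquiv (R := ℂ) (M := E)).symm with norm_map' := fun _ => rfl }
  have hUn : ∀ s x, ‖(U s : E →L[ℂ] E) x‖ = ‖x‖ := fun s x =>
    (ContinuousLinearMap.norm_map_iff_adjoint_comp_self _).2 (Unitary.coe_star_mul_self (U s)) x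
  let π' : B →ₗ[ℂ] ULift.{max w u v} E →ₗ[ℂ] ULift.{max w u v} E := LinearMap.mk₂ ℂ
    (fun b x => e (π b (e.symm x))) (by simp) (by simp) (by simp) (by simp)
  obtain ⟨R, j, hj, hjπ, hjU⟩ := exists_covRep (γ := γ) π' (by simp [π']) (fun a x y => by
      change inner ℂ (π a (e.symm x)) (e.symm y) = inner ℂ (e.symm x) (π (star a) (e.symm y))
      rw [map_star, ContinuousLinearMap.star_eq_adjoint, ContinuousLinearMap.adjoint_inner_right])
    (fun x => by
      have h1 := map_mem_closure e.continuous (hnd (e.symm x))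
        (t := (Submodule.span ℂ {x | ∃ b y, x = π' b y} : Set (ULift.{max w u v} E))) fun y hy => by
        refine Submodule.span_induction (p := fun y _ => e y ∈ Submodule.span ℂ
          {x | ∃ b y, x = π' b y}) ?_ ?_ ?_ ?_ hy
        · rintro _ ⟨b, y, rfl⟩
          exact Submodule.subset_span ⟨b, e y, rfl⟩
        · rw [map_zero]; exact zero_mem _
        · intro x y _ _ hx hy
          rw [map_add]; exact add_mem hx hy
        · intro c x _ hx
          rw [map_smul]; exact Submodule.smul_mem _ _ hx
      simpa using h1)
    (fun s => e.toLinearEquiv.toLinearMap ∘ₗ (U s : E →L[ℂ] E).toLinearMap ∘ₗ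
      e.symm.toLinearEquiv.toLinearMap)
    (fun x => by simp) (fun s t x => by simp) (fun s x => by simp [hUn])
    (fun x => e.continuous.comp (hU _)) (fun s b x => by
      change e (π (γ.act s b) (e.symm (e ((U s : E →L[ℂ] E) (e.symm x))))) =
        e ((U s : E →L[ℂ] E) (e.symm (e (π b (e.symm x)))))
      simp [hcov])
  have h1 : ∀ s, R.π (f s) ((R.U s : R.E →L[ℂ] R.E) (j (e x))) =
      (j.comp e.toLinearIsometry) (π (f s) ((U s : E →L[ℂ] E) x)) := fun s => by
    rw [hjU, hjπ]; simp [π']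
  have hi : Integrable (fun s => π (f s) ((U s : E →L[ℂ] E) x)) μ := by
    have hc : Continuous fun s => π (f s) ((U s : E →L[ℂ] E) x) :=
      ((continuous_nonUnitalStarAlgHom π).comp f.continuous).clm_apply (hU x)
    refine hc.integrable_of_hasCompactSupport (f.hasCompactSupport.mono fun s hs => ?_)
    rw [Function.mem_support] at hs ⊢
    contrapose! hs
    simp [hs]
  have h2 : R.integratedForm μ f (j (e x)) =
      (j.comp e.toLinearIsometry) (∫ s, π (f s) ((U s : E →L[ℂ] E) x) ∂μ) := by
    rw [R.integratedForm_apply μ, integral_congr_ae (Eventually.of_forall h1)]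
    exact (j.comp e.toLinearIsometry).toContinuousLinearMap.integral_comp_comm hi
  rw [← (j.comp e.toLinearIsometry).norm_map, ← h2]
  refine (ContinuousLinearMap.le_opNorm _ _).trans ?_
  have h3 : ‖j (e x)‖ = ‖x‖ := (j.comp e.toLinearIsometry).norm_map x
  rw [h3]
  gcongr
  rw [← CrossedProduct.eval_ofCc]
  exact NonUnitalStarAlgHom.norm_apply_le _ _

end CovariantRepresentations

/-! ### Positive functionals and states -/

section States

open ComplexOrder in
/-- A contractive unital functional on a C*-algebra is positive. -/
lemma nonneg_of_contractive_unital {C : Type*} [CStarAlgebra C] (φ : C →L[ℂ] ℂ)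
    (h1 : φ 1 = 1) (hφ : ∀ a, ‖φ a‖ ≤ ‖a‖) (a : C) : 0 ≤ φ (star a * a) := by
  let _ : PartialOrder C := CStarAlgebra.spectralOrder C
  have _ : StarOrderedRing C := CStarAlgebra.spectralOrderedRing C
  rcases subsingleton_or_nontrivial C with hC | hC
  · rw [Subsingleton.elim (star a * a) 0, map_zero]
  set x := star a * a with hx
  have hx0 : 0 ≤ x := star_mul_self_nonneg a
  have hsa : IsSelfAdjoint x := IsSelfAdjoint.of_nonneg hx0
  set m : ℝ := ‖x‖ / 2 with hm
  have hm0 : 0 ≤ m := by positivity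
  -- The spectrum of x lies in [0, 2m], so centring at m gives ‖y‖ ≤ m. Contractivity on y - it then
  -- puts φ(x) in every disc that has centre m + it and passes through 0, and the intersection of
  -- these discs is real and nonnegative.
  set y : C := cfc (fun t : ℝ => t - m) x with hy
  have hysa : star y = y := (cfc_predicate (fun t : ℝ => t - m) x : IsSelfAdjoint y).star_eq
  have hyx : y = x - (m : ℂ) • (1 : C) := by
    rw [hy, cfc_sub (fun t : ℝ => t) (fun _ => m) x, cfc_id' ℝ x, cfc_const m x,
      Algebra.algebraMap_eq_smul_one, Complex.coe_smul]
  have hyn : ‖y‖ ≤ m := norm_cfc_le hm0 fun t ht => by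
    have h2 : 0 ≤ t := spectrum_nonneg_of_nonneg hx0 ht
    have h3 : t ≤ ‖x‖ := (le_abs_self t).trans (spectrum.norm_le_norm_of_mem ht)
    rw [Real.norm_eq_abs, abs_le]
    constructor <;> linarith
  have key : ∀ t : ℝ, ((φ x).re - m) ^ 2 + ((φ x).im - t) ^ 2 ≤ m ^ 2 + t ^ 2 := fun t => by
    have e1 : φ (y - ((t : ℂ) * Complex.I) • (1 : C)) = φ x - m - t * Complex.I := by
      rw [hyx, map_sub, map_sub, map_smul, map_smul, h1]; simp
    have e2 : ‖y - ((t : ℂ) * Complex.I) • (1 : C)‖ ^ 2 ≤ m ^ 2 + t ^ 2 := by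
      rw [sq, ← CStarRing.norm_star_mul_self]
      have e3 : star (y - ((t : ℂ) * Complex.I) • (1 : C)) * (y - ((t : ℂ) * Complex.I) • (1 : C))
          = y * y + ((t ^ 2 : ℝ) : ℂ) • (1 : C) := by
        have hI : ((t : ℂ) * Complex.I) * ((t : ℂ) * Complex.I) = -((t ^ 2 : ℝ) : ℂ) := by
          push_cast
          linear_combination (t : ℂ) ^ 2 * Complex.I_mul_I
        have hs : star (y - ((t : ℂ) * Complex.I) • (1 : C)) =
            y + ((t : ℂ) * Complex.I) • (1 : C) := by
          rw [star_sub, hysa, star_smul, star_one, RCLike.star_def, map_mul, Complex.conj_ofReal,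
            Complex.conj_I, mul_neg, neg_smul, sub_neg_eq_add]
        rw [hs]
        simp only [add_mul, mul_sub, smul_mul_assoc, one_mul, mul_smul_comm, mul_one]
        rw [smul_add, smul_smul, hI, neg_smul]
        abel
      rw [e3]
      refine (norm_add_le _ _).trans (add_le_add ?_ ?_)
      · rw [sq]
        exact (norm_mul_le _ _).trans (mul_le_mul hyn hyn (norm_nonneg _) hm0)
      · rw [norm_smul, CStarRing.norm_one, Complex.norm_real, mul_one, Real.norm_eq_abs,
          abs_of_nonneg (sq_nonneg t)]
    refine le_trans (le_of_eq ?_) (((sq_le_sq₀ (norm_nonneg _) (norm_nonneg _)).2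
      (hφ (y - ((t : ℂ) * Complex.I) • (1 : C)))).trans e2)
    rw [e1, Complex.sq_norm, Complex.normSq_apply]
    simp
    ring
  have him : (φ x).im = 0 := by
    by_contra h
    -- This t makes the cross term 2t·Im φ(x) equal to m² + 1 in absolute value, more than the disc
    -- of radius √(m² + t²) allows.
    have h2 := key (-((m ^ 2 + 1) / (2 * (φ x).im)))
    have h3 := key ((m ^ 2 + 1) / (2 * (φ x).im))
    have h4 : (φ x).im * ((m ^ 2 + 1) / (2 * (φ x).im)) = (m ^ 2 + 1) / 2 := by
      field_simp
    nlinarith [sq_nonneg ((φ x).re - m), sq_nonneg (φ x).im]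
  have hre : 0 ≤ (φ x).re := by
    have h2 := key 0
    rw [him] at h2
    nlinarith
  rw [Complex.nonneg_iff]
  exact ⟨hre, him.symm⟩

open ComplexOrder in
/-- Contractive positive functionals. -/
structure IsPositiveFunctional {C : Type*} [NonUnitalCStarAlgebra C] (φ : C →L[ℂ] ℂ) : Prop where
  nonneg : ∀ b, 0 ≤ φ (star b * b)
  map_star : ∀ b, φ (star b) = starRingEnd ℂ (φ b)
  norm_le : ∀ b, ‖φ b‖ ≤ ‖b‖

/-- Hermitian symmetry comes from polarisation: φ((1 + zb)^*(1 + zb)) is real, hence so is zφ(b) +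
z̄φ(b^*), and z = 1 and z = i decide both parts of φ(b^*). -/
lemma isPositiveFunctional_of_contractive_unital {C : Type*} [CStarAlgebra C] (φ : C →L[ℂ] ℂ)
    (h1 : φ 1 = 1) (hφ : ∀ a, ‖φ a‖ ≤ ‖a‖) : IsPositiveFunctional φ := by
  have hnn := nonneg_of_contractive_unital φ h1 hφ
  refine ⟨hnn, fun b => ?_, hφ⟩
  have hr : ∀ a, (φ (star a * a)).im = 0 := fun a => (Complex.nonneg_iff.1 (hnn a)).2.symm
  have e : ∀ z : ℂ, (z * φ b + starRingEnd ℂ z * φ (star b)).im = 0 := fun z => by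
    have h2 : star ((1 : C) + z • b) * (1 + z • b) =
        1 + z • b + starRingEnd ℂ z • star b + (starRingEnd ℂ z * z) • (star b * b) := by
      simp only [star_add, star_one, star_smul, RCLike.star_def, add_mul, mul_add, one_mul, mul_one,
        smul_mul_assoc, mul_smul_comm]
      rw [smul_add, smul_smul, mul_comm z]
      abel
    have h3 := hr (1 + z • b)
    have h4 : (starRingEnd ℂ z * z).im = 0 := by
      rw [mul_comm, Complex.mul_conj]; exact Complex.ofReal_im _
    rw [h2, map_add, map_add, map_add, map_smul, map_smul, map_smul, h1] at h3
    simp only [Complex.add_im, smul_eq_mul, Complex.one_im, Complex.mul_im (starRingEnd ℂ z * z),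
      hr b, h4, mul_zero, zero_mul, add_zero, zero_add] at h3
    exact h3
  have e1 := e 1
  have e2 := e Complex.I
  simp at e1 e2
  apply Complex.ext
  · simp; linarith
  · simp; linarith

/-- Evaluation at the spectral value ‖a^*a‖ is a character of the C*-algebra generated by 1 and
a^*a. A norm-preserving Hahn–Banach extension of it remains unital and contractive, and is therefore
positive. -/
lemma exists_state_unital {C : Type*} [CStarAlgebra C] (a : C) :
    ∃ φ : C →L[ℂ] ℂ, IsPositiveFunctional φ ∧ φ (star a * a) = (‖a‖ ^ 2 : ℝ) := by
  let _ : PartialOrder C := CStarAlgebra.spectralOrder C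
  have _ : StarOrderedRing C := CStarAlgebra.spectralOrderedRing C
  rcases subsingleton_or_nontrivial C with hC | hC
  · refine ⟨0, ⟨fun b => by simp, fun b => by simp, fun b => by simp⟩, ?_⟩
    rw [Subsingleton.elim a 0]; simp
  set x := star a * a with hx
  have hx0 : 0 ≤ x := star_mul_self_nonneg a
  have hsa : IsSelfAdjoint x := IsSelfAdjoint.of_nonneg hx0
  have hn : IsStarNormal x := hsa.isStarNormal
  have hmem : (‖x‖ : ℂ) ∈ spectrum ℂ x := by
    simpa using spectrum.algebraMap_mem ℂ (CStarAlgebra.norm_mem_spectrum_of_nonneg hx0)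
  let e := continuousFunctionalCalculus x
  let χ : StarAlgebra.elemental ℂ x →ₗ[ℂ] ℂ :=
    { toFun := fun z => e.symm z ⟨_, hmem⟩
      map_add' := fun z w => by rw [map_add]; rfl
      map_smul' := fun c z => by rw [map_smul]; rfl }
  have hχ : ∀ z, ‖χ z‖ ≤ 1 * ‖z‖ := fun z => by
    rw [one_mul]
    refine ((e.symm z).norm_coe_le_norm _).trans ?_
    exact NonUnitalStarAlgHom.norm_apply_le e.symm z
  let χ' : StrongDual ℂ (Subalgebra.toSubmodule (StarAlgebra.elemental ℂ x).toSubalgebra) :=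
    LinearMap.mkContinuous χ 1 hχ
  obtain ⟨φ, hφ, hφn⟩ := exists_extension_norm_eq
    (Subalgebra.toSubmodule (StarAlgebra.elemental ℂ x).toSubalgebra) χ'
  have hφ1 : ∀ b, ‖φ b‖ ≤ ‖b‖ := fun b => by
    refine (φ.le_opNorm b).trans ?_
    rw [hφn]
    exact mul_le_of_le_one_left (norm_nonneg _)
      (LinearMap.mkContinuous_norm_le _ zero_le_one hχ)
  refine ⟨φ, isPositiveFunctional_of_contractive_unital φ ?_ hφ1, ?_⟩
  · rw [show (1 : C) = ((1 : StarAlgebra.elemental ℂ x) : C) from rfl]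
    refine (hφ ⟨_, (1 : StarAlgebra.elemental ℂ x).2⟩).trans ?_
    change e.symm 1 ⟨_, hmem⟩ = 1
    rw [map_one]; rfl
  · refine (hφ ⟨x, StarAlgebra.elemental.self_mem ℂ x⟩).trans ?_
    change e.symm ⟨x, StarAlgebra.elemental.self_mem ℂ x⟩ ⟨_, hmem⟩ = _
    have : e.symm ⟨x, StarAlgebra.elemental.self_mem ℂ x⟩ =
      (ContinuousMap.id ℂ).restrict (spectrum ℂ x) := by
      rw [StarAlgEquiv.symm_apply_eq]
      exact (continuousFunctionalCalculus_map_id x).symm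
    rw [this]
    change ((‖x‖ : ℝ) : ℂ) = _
    rw [hx, CStarRing.norm_star_mul_self, sq]

/-- Norms of positive elements are attained by contractive positive functionals. -/
theorem exists_positive_functional {C : Type*} [NonUnitalCStarAlgebra C] (a : C) :
    ∃ φ : C →L[ℂ] ℂ, IsPositiveFunctional φ ∧ φ (star a * a) = (‖a‖ ^ 2 : ℝ) := by
  obtain ⟨φ, ⟨h1, h2, h3⟩, h4⟩ := exists_state_unital (a : Unitization ℂ C)
  refine ⟨φ.comp (LinearMap.mkContinuous (Unitization.inrNonUnitalStarAlgHom ℂ C : C →ₗ[ℂ] _) 1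
    fun x => ?_), ⟨fun b => ?_, fun b => ?_, fun b => ?_⟩, ?_⟩
  · simp [Unitization.norm_inr]
  · have := h1 (b : Unitization ℂ C)
    simpa using this
  · simpa using h2 (b : Unitization ℂ C)
  · simpa [Unitization.norm_inr] using h3 (b : Unitization ℂ C)
  · simpa [Unitization.norm_inr] using h4

end States

/-! ### Scalar forms from algebra-valued inner products -/

section Forms

variable {C X : Type*} [NonUnitalCStarAlgebra C] [AddCommGroup X] [Module ℂ X]
  {φ : C →L[ℂ] ℂ} {h : X → X → C}

/-- The pre-inner product given by a positive functional and a `C`-valued pre-inner product. -/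
@[reducible] def IsPositiveFunctional.core (hφ : IsPositiveFunctional φ)
    (h_add : ∀ x y z, h x (y + z) = h x y + h x z) (h_smul : ∀ (c : ℂ) x y, h x (c • y) = c • h x y)
    (h_star : ∀ x y, star (h x y) = h y x) (h_self : ∀ x, ∃ a, h x x = star a * a) :
    PreInnerProductSpace.Core ℂ X where
  inner x y := φ (h x y)
  conj_inner_symm x y := by rw [← hφ.map_star, h_star]
  re_inner_nonneg x := by
    obtain ⟨r, hr⟩ := h_self x
    rw [hr]
    exact (Complex.nonneg_iff.1 (hφ.nonneg r)).1
  add_left x y z := by rw [← h_star, h_add, star_add, h_star, h_star, map_add]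
  smul_left x y c := by
    rw [← h_star, h_smul, star_smul, h_star, map_smul]; rfl

lemma IsPositiveFunctional.sqrt_re_le (hφ : IsPositiveFunctional φ) (c : C) :
    √(φ c).re ≤ √‖c‖ :=
  Real.sqrt_le_sqrt ((Complex.re_le_norm _).trans (hφ.norm_le _))

/-- Composition with a positive functional gives a scalar pre-inner product with its own triangle
inequality. Used with a functional that attains a norm, it yields the triangle inequality for the
norm √‖h x x‖. -/
lemma IsPositiveFunctional.sqrt_form_add_le (hφ : IsPositiveFunctional φ)
    (h_add : ∀ x y z, h x (y + z) = h x y + h x z) (h_smul : ∀ (c : ℂ) x y, h x (c • y) = c • h x y)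
    (h_star : ∀ x y, star (h x y) = h y x) (h_self : ∀ x, ∃ a, h x x = star a * a) (x y : X) :
    √(φ (h (x + y) (x + y))).re ≤ √‖h x x‖ + √‖h y y‖ := by
  let _ : SeminormedAddCommGroup X := InnerProductSpace.Core.toSeminormedAddCommGroup
    (c := hφ.core h_add h_smul h_star h_self)
  exact (norm_add_le x y).trans (add_le_add (hφ.sqrt_re_le _) (hφ.sqrt_re_le _))

lemma IsPositiveFunctional.norm_form_le (hφ : IsPositiveFunctional φ)
    (h_add : ∀ x y z, h x (y + z) = h x y + h x z) (h_smul : ∀ (c : ℂ) x y, h x (c • y) = c • h x y)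
    (h_star : ∀ x y, star (h x y) = h y x) (h_self : ∀ x, ∃ a, h x x = star a * a) (x y : X) :
    ‖φ (h x y)‖ ≤ √‖h x x‖ * √‖h y y‖ := by
  let _ : SeminormedAddCommGroup X := InnerProductSpace.Core.toSeminormedAddCommGroup
    (c := hφ.core h_add h_smul h_star h_self)
  let _ : InnerProductSpace ℂ X := InnerProductSpace.ofCore
    (hφ.core h_add h_smul h_star h_self)
  exact (norm_inner_le_norm (𝕜 := ℂ) x y).trans (mul_le_mul (hφ.sqrt_re_le _) (hφ.sqrt_re_le _)
    (Real.sqrt_nonneg _) (Real.sqrt_nonneg _))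

end Forms

/-- Semilinearity in the first variable lets one statement cover both the module actions and the
sesquilinear inner products. -/
lemma exists_extension₂ {σ : ℂ →+* ℂ} [RingHomIsometric σ] {X Y E F G : Type*} [AddCommGroup X]
    [Module ℂ X] [AddCommGroup Y] [Module ℂ Y] [NormedAddCommGroup E] [NormedSpace ℂ E]
    [NormedAddCommGroup F] [NormedSpace ℂ F] [NormedAddCommGroup G] [NormedSpace ℂ G]
    [CompleteSpace G] (i : X →ₗ[ℂ] E) (j : Y →ₗ[ℂ] F) (hi : DenseRange i) (hj : DenseRange j)
    (f : X →ₛₗ[σ] Y →ₗ[ℂ] G) (C : ℝ) (hf : ∀ x y, ‖f x y‖ ≤ C * (‖i x‖ * ‖j y‖)) :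
    ∃ T : E →SL[σ] F →L[ℂ] G, ∀ x y, T (i x) (j y) = f x y := by
  have hb : ∀ x y, ‖f x y‖ ≤ |C| * ‖i x‖ * ‖j y‖ := fun x y => by
    rw [mul_assoc]
    exact (hf x y).trans (mul_le_mul_of_nonneg_right (le_abs_self C) (by positivity))
  have e : ∀ x y, (f x).extendOfNorm j (j y) = f x y := fun x y =>
    LinearMap.extendOfNorm_eq hj ⟨_, hb x⟩ y
  let g : X →ₛₗ[σ] F →L[ℂ] G :=
    { toFun := fun x => (f x).extendOfNorm j
      map_add' := fun x x' => ContinuousLinearMap.coeFn_injective <|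
        hj.equalizer (by fun_prop) (by fun_prop) (funext fun y => by
          change (f (x + x')).extendOfNorm j (j y) =
            (f x).extendOfNorm j (j y) + (f x').extendOfNorm j (j y)
          rw [e, e, e, map_add]; rfl)
      map_smul' := fun c x => ContinuousLinearMap.coeFn_injective <|
        hj.equalizer (by fun_prop) (by fun_prop) (funext fun y => by
          change (f (c • x)).extendOfNorm j (j y) = σ c • (f x).extendOfNorm j (j y)
          rw [e, e, map_smulₛₗ]; rfl) }
  refine ⟨g.extendOfNorm i, fun x y => ?_⟩
  rw [LinearMap.extendOfNorm_eq hi ⟨|C|, fun x => ?_⟩]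
  · exact e x y
  · exact LinearMap.opNorm_extendOfNorm_le hj (by positivity) (hb x)

lemma dense_span_induction {E : Type*} [NormedAddCommGroup E] [NormedSpace ℂ E] {s : Set E}
    (hs : Dense (Submodule.span ℂ s : Set E)) {p : E → Prop} (hp : IsClosed {x | p x})
    (mem : ∀ x ∈ s, p x) (zero : p 0) (add : ∀ x y, p x → p y → p (x + y))
    (smul : ∀ (c : ℂ) x, p x → p (c • x)) (x : E) : p x :=
  hp.closure_subset_iff.2 (fun _ hx => Submodule.span_induction (p := fun x _ => p x) mem zero
    (fun x y _ _ => add x y) (fun c _ _ => smul c _) hx) (hs x)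

/-- For the spectral order these are exactly the nonnegative elements, a closed set; all positivity
statements below are proved by approximation and pass to the limit through this. -/
lemma isClosed_star_mul_self {C : Type*} [NonUnitalCStarAlgebra C] :
    IsClosed {a : C | ∃ b, a = star b * b} := by
  let _ : PartialOrder C := CStarAlgebra.spectralOrder C
  have _ : StarOrderedRing C := CStarAlgebra.spectralOrderedRing C
  have h : {a : C | ∃ b, a = star b * b} = {a | 0 ≤ a} := by
    ext a
    exact CStarAlgebra.nonneg_iff_eq_star_mul_self.symm
  rw [h]
  exact CStarAlgebra.isClosed_nonneg

/-! ### Completion of a pre-imprimitivity bimodule -/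

section CompletionOfPreImprimitivity

/-- The data from which an imprimitivity bimodule is obtained by completion. -/
structure PreImprimitivity (L R X L₀ R₀ : Type*) [NonUnitalCStarAlgebra L]
    [NonUnitalCStarAlgebra R] [AddCommGroup X] [Module ℂ X] [AddCommGroup L₀] [Module ℂ L₀]
    [AddCommGroup R₀] [Module ℂ R₀] where
  jL : L₀ →ₗ[ℂ] L
  jR : R₀ →ₗ[ℂ] R
  denseL : DenseRange jL
  denseR : DenseRange jR
  lact : L₀ → X → X
  ract : X → R₀ → X
  linner₀ : X → X → L₀
  rinner₀ : X → X → R₀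
  linner_add_left : ∀ x y z, jL (linner₀ (x + y) z) = jL (linner₀ x z) + jL (linner₀ y z)
  linner_smul_left : ∀ (c : ℂ) x y, jL (linner₀ (c • x) y) = c • jL (linner₀ x y)
  star_linner : ∀ x y, star (jL (linner₀ x y)) = jL (linner₀ y x)
  linner_lact : ∀ l x y, jL (linner₀ (lact l x) y) = jL l * jL (linner₀ x y)
  linner_self : ∀ x, ∃ l, jL (linner₀ x x) = star l * l
  linner_full : Dense (Submodule.span ℂ {l | ∃ x y, l = jL (linner₀ x y)} : Set L)
  rinner_add_right : ∀ x y z, jR (rinner₀ x (y + z)) = jR (rinner₀ x y) + jR (rinner₀ x z)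
  rinner_smul_right : ∀ (c : ℂ) x y, jR (rinner₀ x (c • y)) = c • jR (rinner₀ x y)
  star_rinner : ∀ x y, star (jR (rinner₀ x y)) = jR (rinner₀ y x)
  rinner_ract : ∀ x y r, jR (rinner₀ x (ract y r)) = jR (rinner₀ x y) * jR r
  rinner_self : ∀ x, ∃ r, jR (rinner₀ x x) = star r * r
  rinner_full : Dense (Submodule.span ℂ {r | ∃ x y, r = jR (rinner₀ x y)} : Set R)
  definite : ∀ x, jR (rinner₀ x x) = 0 → x = 0
  lact_linner : ∀ x y z, lact (linner₀ x y) z = ract x (rinner₀ y z)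
  lact_bound : ∀ l x, ‖jR (rinner₀ (lact l x) (lact l x))‖ ≤ ‖jL l‖ ^ 2 * ‖jR (rinner₀ x x)‖
  ract_bound : ∀ x r, ‖jL (linner₀ (ract x r) (ract x r))‖ ≤ ‖jR r‖ ^ 2 * ‖jL (linner₀ x x)‖

namespace PreImprimitivity

variable {L R X L₀ R₀ : Type*} [NonUnitalCStarAlgebra L]
  [NonUnitalCStarAlgebra R] [AddCommGroup X] [Module ℂ X] [AddCommGroup L₀] [Module ℂ L₀]
  [AddCommGroup R₀] [Module ℂ R₀] (P : PreImprimitivity L R X L₀ R₀)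

lemma linner_add_right (x y z : X) :
    P.jL (P.linner₀ x (y + z)) = P.jL (P.linner₀ x y) + P.jL (P.linner₀ x z) := by
  rw [← P.star_linner, P.linner_add_left, star_add, P.star_linner, P.star_linner]

lemma linner_smul_right (c : ℂ) (x y : X) :
    P.jL (P.linner₀ x (c • y)) = starRingEnd ℂ c • P.jL (P.linner₀ x y) := by
  rw [← P.star_linner, P.linner_smul_left, star_smul, P.star_linner]; rfl

lemma rinner_add_left (x y z : X) :
    P.jR (P.rinner₀ (x + y) z) = P.jR (P.rinner₀ x z) + P.jR (P.rinner₀ y z) := by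
  rw [← P.star_rinner, P.rinner_add_right, star_add, P.star_rinner, P.star_rinner]

lemma rinner_smul_left (c : ℂ) (x y : X) :
    P.jR (P.rinner₀ (c • x) y) = starRingEnd ℂ c • P.jR (P.rinner₀ x y) := by
  rw [← P.star_rinner, P.rinner_smul_right, star_smul, P.star_rinner]; rfl

lemma linner_lact_right (l : L₀) (x y : X) :
    P.jL (P.linner₀ x (P.lact l y)) = P.jL (P.linner₀ x y) * star (P.jL l) := by
  rw [← P.star_linner, P.linner_lact, star_mul, P.star_linner]

lemma rinner_ract_left (x y : X) (r : R₀) :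
    P.jR (P.rinner₀ (P.ract x r) y) = star (P.jR r) * P.jR (P.rinner₀ x y) := by
  rw [← P.star_rinner, P.rinner_ract, star_mul, P.star_rinner]

lemma sqrt_re_add_le {φ : R →L[ℂ] ℂ} (hφ : IsPositiveFunctional φ) (x y : X) :
    √(φ (P.jR (P.rinner₀ (x + y) (x + y)))).re ≤
      √‖P.jR (P.rinner₀ x x)‖ + √‖P.jR (P.rinner₀ y y)‖ :=
  (hφ.sqrt_form_add_le P.rinner_add_right P.rinner_smul_right P.star_rinner P.rinner_self x y)

lemma norm_functional_rinner_le {φ : R →L[ℂ] ℂ} (hφ : IsPositiveFunctional φ) (x y : X) :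
    ‖φ (P.jR (P.rinner₀ x y))‖ ≤ √‖P.jR (P.rinner₀ x x)‖ * √‖P.jR (P.rinner₀ y y)‖ :=
  hφ.norm_form_le P.rinner_add_right P.rinner_smul_right P.star_rinner P.rinner_self x y

lemma norm_functional_linner_le {φ : L →L[ℂ] ℂ} (hφ : IsPositiveFunctional φ) (x y : X) :
    ‖φ (P.jL (P.linner₀ x y))‖ ≤ √‖P.jL (P.linner₀ y y)‖ * √‖P.jL (P.linner₀ x x)‖ :=
  hφ.norm_form_le (h := fun x y => P.jL (P.linner₀ y x)) (fun x y z => P.linner_add_left y z x)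
    (fun c x y => P.linner_smul_left c y x) (fun x y => P.star_linner y x) P.linner_self y x

/-- The C*-identity for self-adjoint l gives ‖l‖⁴ = ‖l⁴‖ ≤ ‖l³‖‖l‖, so the hypothesis bounds ‖l‖² by
m². -/
lemma isSelfAdjoint_pow_three_norm {C : Type*} [NonUnitalCStarAlgebra C] {l : C}
    (h : star l = l) {m : ℝ} (hl : ‖l * l * l‖ ≤ m ^ 2 * ‖l‖) (hm : 0 ≤ m) : ‖l‖ ≤ m := by
  rcases eq_or_ne ‖l‖ 0 with h0 | h0
  · rwa [h0]
  have h1 : ‖l * l‖ = ‖l‖ * ‖l‖ := by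
    have := CStarRing.norm_star_mul_self (x := l)
    rwa [h] at this
  have h2 : ‖(l * l) * (l * l)‖ = ‖l * l‖ * ‖l * l‖ := by
    have h0 : star (l * l) = l * l := by rw [star_mul, h]
    have := CStarRing.norm_star_mul_self (x := l * l)
    rwa [h0] at this
  have h3 : ‖(l * l) * (l * l)‖ ≤ ‖l * l * l‖ * ‖l‖ := by
    rw [← mul_assoc]; exact norm_mul_le _ _
  have h4 : 0 < ‖l‖ := lt_of_le_of_ne (norm_nonneg _) (Ne.symm h0)
  rw [h2, h1] at h3
  have h5 : (‖l‖ * ‖l‖) * (‖l‖ * ‖l‖) ≤ (m ^ 2) * (‖l‖ * ‖l‖) := by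
    nlinarith [mul_le_mul_of_nonneg_right hl h4.le]
  have h6 := le_of_mul_le_mul_right h5 (by positivity)
  nlinarith

/-- The cube of L⟨x,x⟩ is L⟨x·⟨x,x⟩R, x·⟨x,x⟩R⟩, whose norm is at most ‖⟨x,x⟩R‖²‖L⟨x,x⟩‖ by
boundedness of the right action. The reverse inequality is the mirror image. -/
lemma norm_linner_self_eq (x : X) :
    ‖P.jL (P.linner₀ x x)‖ = ‖P.jR (P.rinner₀ x x)‖ := by
  refine le_antisymm (isSelfAdjoint_pow_three_norm (P.star_linner x x) ?_ (norm_nonneg _))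
    (isSelfAdjoint_pow_three_norm (P.star_rinner x x) ?_ (norm_nonneg _))
  · refine le_trans (le_of_eq ?_) (P.ract_bound x (P.rinner₀ x x))
    rw [← P.lact_linner, P.linner_lact, P.linner_lact_right, P.star_linner, mul_assoc]
  · refine le_trans (le_of_eq ?_) (P.lact_bound (P.linner₀ x x) x)
    rw [P.lact_linner, P.rinner_ract, P.rinner_ract_left, P.star_rinner, mul_assoc]

/-- For a = ⟨x,y⟩R one has a^*a = ⟨y, L⟨x,x⟩·y⟩R. Scalar Cauchy–Schwarz for a functional attaining
‖a^*a‖, followed by the bound on the left action, gives ‖a‖² ≤ ‖⟨x,x⟩R‖‖⟨y,y⟩R‖. -/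
lemma norm_rinner_le (x y : X) :
    ‖P.jR (P.rinner₀ x y)‖ ≤ √‖P.jR (P.rinner₀ x x)‖ * √‖P.jR (P.rinner₀ y y)‖ := by
  set a := P.jR (P.rinner₀ x y) with ha
  obtain ⟨φ, hφ, hφa⟩ := exists_positive_functional a
  have h1 : star a * a = P.jR (P.rinner₀ y (P.lact (P.linner₀ x x) y)) := by
    rw [P.lact_linner, P.rinner_ract, ha, P.star_rinner]
  have h2 := P.norm_functional_rinner_le hφ y (P.lact (P.linner₀ x x) y)
  rw [← h1, hφa, Complex.norm_real, Real.norm_eq_abs, abs_of_nonneg (sq_nonneg _)] at h2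
  have h4 := Real.sqrt_le_sqrt (P.lact_bound (P.linner₀ x x) y)
  rw [P.norm_linner_self_eq, Real.sqrt_mul (sq_nonneg _), Real.sqrt_sq (norm_nonneg _)] at h4
  have h5 := h2.trans (mul_le_mul_of_nonneg_left h4 (Real.sqrt_nonneg _))
  refine le_of_sq_le_sq ?_ (by positivity)
  rw [mul_pow, Real.sq_sqrt (norm_nonneg _), Real.sq_sqrt (norm_nonneg _)]
  refine h5.trans (le_of_eq ?_)
  rw [mul_left_comm, Real.mul_self_sqrt (norm_nonneg _)]

lemma norm_linner_le (x y : X) :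
    ‖P.jL (P.linner₀ x y)‖ ≤ √‖P.jR (P.rinner₀ x x)‖ * √‖P.jR (P.rinner₀ y y)‖ := by
  set a := P.jL (P.linner₀ y x) with ha
  obtain ⟨φ, hφ, hφa⟩ := exists_positive_functional a
  have h1 : star a * a = P.jL (P.linner₀ (P.ract x (P.rinner₀ y y)) x) := by
    rw [← P.lact_linner, P.linner_lact, ha, P.star_linner]
  have h2 := P.norm_functional_linner_le hφ (P.ract x (P.rinner₀ y y)) x
  rw [← h1, hφa, Complex.norm_real, Real.norm_eq_abs, abs_of_nonneg (sq_nonneg _)] at h2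
  have h4 := Real.sqrt_le_sqrt (P.ract_bound x (P.rinner₀ y y))
  rw [Real.sqrt_mul (sq_nonneg _), Real.sqrt_sq (norm_nonneg _)] at h4
  have h5 := h2.trans (mul_le_mul_of_nonneg_left h4 (Real.sqrt_nonneg _))
  rw [P.norm_linner_self_eq] at h5
  rw [← P.star_linner, norm_star]
  refine le_of_sq_le_sq ?_ (by positivity)
  rw [mul_pow, Real.sq_sqrt (norm_nonneg _), Real.sq_sqrt (norm_nonneg _)]
  refine h5.trans (le_of_eq ?_)
  rw [mul_left_comm, Real.mul_self_sqrt (norm_nonneg _), mul_comm]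

/-- The norm of a pre-imprimitivity bimodule. -/
@[reducible] def toNorm : Norm X := ⟨fun x => √‖P.jR (P.rinner₀ x x)‖⟩

lemma normedSpaceCore : let _ := P.toNorm; NormedSpace.Core ℂ X :=
  let _ := P.toNorm
  { norm_nonneg := fun x => Real.sqrt_nonneg _
    norm_smul := fun c x => by
      change √‖P.jR (P.rinner₀ (c • x) (c • x))‖ = ‖c‖ * √‖P.jR (P.rinner₀ x x)‖
      rw [P.rinner_smul_right, P.rinner_smul_left, norm_smul, norm_smul, RCLike.norm_conj, ← mul_assoc,
        Real.sqrt_mul (by positivity), Real.sqrt_mul_self (norm_nonneg _)]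
    norm_triangle := fun x y => by
      change √‖P.jR (P.rinner₀ (x + y) (x + y))‖ ≤ _
      obtain ⟨r, hr⟩ := P.rinner_self (x + y)
      obtain ⟨φ, hφ, hφr⟩ := exists_positive_functional r
      refine le_trans (le_of_eq ?_) (P.sqrt_re_add_le hφ x y)
      rw [hr, hφr, CStarRing.norm_star_mul_self, Complex.ofReal_re, sq]
    norm_eq_zero_iff := fun x => by
      change √‖P.jR (P.rinner₀ x x)‖ = 0 ↔ x = 0
      rw [Real.sqrt_eq_zero (norm_nonneg _), norm_eq_zero]
      refine ⟨P.definite x, ?_⟩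
      rintro rfl
      have := P.rinner_smul_right 0 (0 : X) 0
      rwa [zero_smul, zero_smul] at this }

/-- By definiteness the inner products separate points. Linearity of the two actions, which is not
part of the data, is recovered from this. -/
lemma ext_linner {x y : X} (h : ∀ z, P.jL (P.linner₀ x z) = P.jL (P.linner₀ y z)) : x = y := by
  rw [← sub_eq_zero, sub_eq_add_neg, ← neg_one_smul ℂ y]
  have h0 : ∀ z, P.jL (P.linner₀ (x + (-1 : ℂ) • y) z) = 0 := fun z => by
    rw [P.linner_add_left, P.linner_smul_left, h, neg_one_smul, add_neg_cancel]
  refine P.definite _ (norm_eq_zero.1 ?_)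
  rw [← P.norm_linner_self_eq, h0, norm_zero]

lemma ext_rinner {x y : X} (h : ∀ z, P.jR (P.rinner₀ z x) = P.jR (P.rinner₀ z y)) : x = y := by
  rw [← sub_eq_zero, sub_eq_add_neg, ← neg_one_smul ℂ y]
  have h0 : ∀ z, P.jR (P.rinner₀ z (x + (-1 : ℂ) • y)) = 0 := fun z => by
    rw [P.rinner_add_right, P.rinner_smul_right, h, neg_one_smul, add_neg_cancel]
  exact P.definite _ (h0 _)

/-- The left action as a bilinear map. -/
def lactₗ : L₀ →ₗ[ℂ] X →ₗ[ℂ] X :=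
  LinearMap.mk₂ ℂ P.lact
    (fun l l' x => P.ext_linner fun z => by
      rw [P.linner_lact, P.linner_add_left, P.linner_lact, P.linner_lact, map_add, add_mul])
    (fun c l x => P.ext_linner fun z => by
      rw [P.linner_lact, P.linner_smul_left, P.linner_lact, map_smul, smul_mul_assoc])
    (fun l x y => P.ext_linner fun z => by
      rw [P.linner_lact, P.linner_add_left, P.linner_add_left, P.linner_lact, P.linner_lact,
        mul_add])
    (fun c l x => P.ext_linner fun z => by
      rw [P.linner_lact, P.linner_smul_left, P.linner_smul_left, P.linner_lact, mul_smul_comm])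

/-- The right action as a bilinear map. -/
def ractₗ : R₀ →ₗ[ℂ] X →ₗ[ℂ] X :=
  LinearMap.mk₂ ℂ (fun r x => P.ract x r)
    (fun l l' x => P.ext_rinner fun z => by
      rw [P.rinner_ract, P.rinner_add_right, P.rinner_ract, P.rinner_ract, map_add, mul_add])
    (fun c l x => P.ext_rinner fun z => by
      rw [P.rinner_ract, P.rinner_smul_right, P.rinner_ract, map_smul, mul_smul_comm])
    (fun l x y => P.ext_rinner fun z => by
      rw [P.rinner_ract, P.rinner_add_right, P.rinner_add_right, P.rinner_ract, P.rinner_ract,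
        add_mul])
    (fun c l x => P.ext_rinner fun z => by
      rw [P.rinner_ract, P.rinner_smul_right, P.rinner_smul_right, P.rinner_ract, smul_mul_assoc])

/-- The right inner product as a sesquilinear map. -/
def rinnerₗ : X →ₗ⋆[ℂ] X →ₗ[ℂ] R :=
  LinearMap.mk₂'ₛₗ (starRingEnd ℂ) (RingHom.id ℂ) (fun (x y : X) => P.jR (P.rinner₀ x y))
    P.rinner_add_left P.rinner_smul_left P.rinner_add_right P.rinner_smul_right

/-- The left inner product, with arguments exchanged, as a sesquilinear map. -/
def linnerₗ : X →ₗ⋆[ℂ] X →ₗ[ℂ] L :=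
  LinearMap.mk₂'ₛₗ (starRingEnd ℂ) (RingHom.id ℂ) (fun (x y : X) => P.jL (P.linner₀ y x))
    (fun x y z => P.linner_add_right z x y) (fun c x y => P.linner_smul_right c y x)
    (fun x y z => P.linner_add_left y z x) (fun c x y => P.linner_smul_left c y x)

/-- The actions and inner products are bounded bilinear or sesquilinear maps, so they extend to the
completion, and the axioms are closed conditions verified on dense subspaces. Here the norm on `X`
is an instance; the next theorem supplies it. -/
lemma exists_imprimitivityBimodule_of_norm {L : Type u₁} {R : Type u₂} {X : Type w} {L₀ R₀ : Type*}
    [NonUnitalCStarAlgebra L] [NonUnitalCStarAlgebra R] [NormedAddCommGroup X]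
    [NormedSpace ℂ X] [AddCommGroup L₀] [Module ℂ L₀] [AddCommGroup R₀] [Module ℂ R₀]
    (P : PreImprimitivity L R X L₀ R₀) (hX : ∀ x, ‖P.jR (P.rinner₀ x x)‖ = ‖x‖ ^ 2) :
    ∃ (Z : ImprimitivityBimodule.{w} L R) (ι : X →ₗ[ℂ] Z.carrier),
      Function.Injective ι ∧ DenseRange ι ∧
      (∀ l x, Z.lact (P.jL l) (ι x) = ι (P.lact l x)) ∧
      (∀ x r, Z.ract (ι x) (P.jR r) = ι (P.ract x r)) ∧
      (∀ x y, Z.linner (ι x) (ι y) = P.jL (P.linner₀ x y)) ∧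
      (∀ x y, Z.rinner (ι x) (ι y) = P.jR (P.rinner₀ x y)) := by
  let E := UniformSpace.Completion X
  let i : X →ₗ[ℂ] E := (UniformSpace.Completion.toComplₗᵢ (𝕜 := ℂ) (E := X)).toLinearMap
  have hi : DenseRange i := UniformSpace.Completion.denseRange_coe
  have hin : ∀ x, ‖i x‖ = ‖x‖ := UniformSpace.Completion.norm_coe
  have hsqrt : ∀ x : X, √‖P.jR (P.rinner₀ x x)‖ = ‖x‖ := fun x => by
    rw [hX, Real.sqrt_sq (norm_nonneg _)]
  obtain ⟨La, hLa⟩ := exists_extension₂ P.jL i P.denseL hi (P.lactₗ.compr₂ i) 1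
    (fun l x => by
      rw [LinearMap.compr₂_apply, hin, hin, one_mul]
      refine le_of_sq_le_sq ?_ (by positivity)
      rw [mul_pow, ← hX x, ← hX]
      exact P.lact_bound l x)
  obtain ⟨Ra, hRa⟩ := exists_extension₂ P.jR i P.denseR hi (P.ractₗ.compr₂ i) 1
    (fun r x => by
      rw [LinearMap.compr₂_apply, hin, hin, one_mul]
      refine le_of_sq_le_sq ?_ (by positivity)
      rw [mul_pow, ← hX x, ← hX]
      refine le_trans (le_of_eq ?_) ((P.ract_bound x r).trans (le_of_eq ?_))
      · exact (P.norm_linner_self_eq _).symm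
      · rw [P.norm_linner_self_eq])
  obtain ⟨Ri, hRi⟩ := exists_extension₂ i i hi hi P.rinnerₗ 1
    (fun x y => by
      rw [hin, hin, one_mul, ← hsqrt x, ← hsqrt y]; exact P.norm_rinner_le x y)
  obtain ⟨Li, hLi⟩ := exists_extension₂ i i hi hi P.linnerₗ 1
    (fun x y => by
      rw [hin, hin, one_mul, mul_comm, ← hsqrt x, ← hsqrt y]; exact P.norm_linner_le y x)
  replace hLa : ∀ l (x : X), La (P.jL l) (i x) = i (P.lact l x : X) := hLa
  replace hRa : ∀ l (x : X), Ra (P.jR l) (i x) = i (P.ract x l : X) := hRa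
  replace hRi : ∀ x y : X, Ri (i x) (i y) = P.jR (P.rinner₀ x y) := hRi
  replace hLi : ∀ x y : X, Li (i x) (i y) = P.jL (P.linner₀ y x) := hLi
  have cRa : ∀ x, Continuous fun r => Ra r x := fun x => by fun_prop
  have cLa : ∀ x, Continuous fun r => La r x := fun x => by fun_prop
  have cRi : ∀ x, Continuous fun r => Ri r x := fun x => by fun_prop
  have cLi : ∀ x, Continuous fun r => Li r x := fun x => by fun_prop
  have star_R : ∀ x y, star (Ri x y) = Ri y x := fun x y => by
    refine hi.induction_on (p := fun x => star (Ri x y) = Ri y x) x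
      (isClosed_eq (by fun_prop) (by fun_prop)) fun x => ?_
    refine hi.induction_on (p := fun y => star (Ri (i x) y) = Ri y (i x)) y
      (isClosed_eq (by fun_prop) (by fun_prop)) fun y => ?_
    rw [hRi, hRi]; exact P.star_rinner x y
  have star_L : ∀ x y, star (Li x y) = Li y x := fun x y => by
    refine hi.induction_on (p := fun x => star (Li x y) = Li y x) x
      (isClosed_eq (by fun_prop) (by fun_prop)) fun x => ?_
    refine hi.induction_on (p := fun y => star (Li (i x) y) = Li y (i x)) y
      (isClosed_eq (by fun_prop) (by fun_prop)) fun y => ?_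
    rw [hLi, hLi]; exact P.star_linner y x
  have R_act : ∀ x y r, Ri x (Ra r y) = Ri x y * r := fun x y r => by
    refine hi.induction_on (p := fun x => Ri x (Ra r y) = Ri x y * r) x
      (isClosed_eq (by fun_prop) (by fun_prop)) fun x => ?_
    refine hi.induction_on (p := fun y => Ri (i x) (Ra r y) = Ri (i x) y * r) y
      (isClosed_eq (by fun_prop) (by fun_prop)) fun y => ?_
    refine P.denseR.induction_on (p := fun r => Ri (i x) (Ra r (i y)) = Ri (i x) (i y) * r) r
      (isClosed_eq (by fun_prop) (by fun_prop)) fun r => ?_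
    rw [hRa, hRi, hRi]; exact P.rinner_ract x y r
  have L_act : ∀ x y l, Li x (La l y) = l * Li x y := fun x y r => by
    refine hi.induction_on (p := fun x => Li x (La r y) = r * Li x y) x
      (isClosed_eq (by fun_prop) (by fun_prop)) fun x => ?_
    refine hi.induction_on (p := fun y => Li (i x) (La r y) = r * Li (i x) y) y
      (isClosed_eq (by fun_prop) (by fun_prop)) fun y => ?_
    refine P.denseL.induction_on (p := fun r => Li (i x) (La r (i y)) = r * Li (i x) (i y)) r
      (isClosed_eq (by fun_prop) (by fun_prop)) fun r => ?_
    rw [hLa, hLi, hLi]; exact P.linner_lact r y x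
  have assoc : ∀ x y z, La (Li y x) z = Ra (Ri y z) x := fun x y z => by
    refine hi.induction_on (p := fun x => La (Li y x) z = Ra (Ri y z) x) x
      (isClosed_eq (by fun_prop) (by fun_prop)) fun x => ?_
    refine hi.induction_on (p := fun y => La (Li y (i x)) z = Ra (Ri y z) (i x)) y
      (isClosed_eq (by fun_prop) (by fun_prop)) fun y => ?_
    refine hi.induction_on (p := fun z => La (Li (i y) (i x)) z = Ra (Ri (i y) z) (i x)) z
      (isClosed_eq (by fun_prop) (by fun_prop)) fun z => ?_
    rw [hLi, hRi, hLa, hRa]; exact congrArg i (P.lact_linner x y z)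
  have pos_R : ∀ x, ∃ r, Ri x x = star r * r := fun x => by
    refine hi.induction_on (p := fun x => ∃ r, Ri x x = star r * r) x
      ((isClosed_star_mul_self (C := R)).preimage (by fun_prop)) fun x => ?_
    rw [hRi]; exact P.rinner_self x
  have pos_L : ∀ x, ∃ r, Li x x = star r * r := fun x => by
    refine hi.induction_on (p := fun x => ∃ r, Li x x = star r * r) x
      ((isClosed_star_mul_self (C := L)).preimage (by fun_prop)) fun x => ?_
    rw [hLi]; exact P.linner_self x
  have norm_R : ∀ x, ‖Ri x x‖ = ‖x‖ ^ 2 := fun x => by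
    refine hi.induction_on (p := fun x => ‖Ri x x‖ = ‖x‖ ^ 2) x
      (isClosed_eq (by fun_prop) (by fun_prop)) fun x => ?_
    rw [hRi, hin]; exact hX x
  have norm_L : ∀ x, ‖Li x x‖ = ‖x‖ ^ 2 := fun x => by
    refine hi.induction_on (p := fun x => ‖Li x x‖ = ‖x‖ ^ 2) x
      (isClosed_eq (by fun_prop) (by fun_prop)) fun x => ?_
    rw [hLi, hin, P.norm_linner_self_eq]; exact hX x
  have full_L : Dense (Submodule.span ℂ {l | ∃ x y, l = Li y x} : Set L) := by
    refine P.linner_full.mono (Submodule.span_mono ?_)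
    rintro _ ⟨x, y, rfl⟩
    exact ⟨i x, i y, (hLi y x).symm⟩
  have full_R : Dense (Submodule.span ℂ {r | ∃ x y, r = Ri x y} : Set R) := by
    refine P.rinner_full.mono (Submodule.span_mono ?_)
    rintro _ ⟨x, y, rfl⟩
    exact ⟨i x, i y, (hRi x y).symm⟩
  have ext_L : ∀ x y, (∀ z, Li z x = Li z y) → x = y := fun x y h => by
    rw [← sub_eq_zero, ← norm_eq_zero, ← sq_eq_zero_iff, ← norm_L, map_sub, h, sub_self,
      norm_zero]
  have ext_R : ∀ x y, (∀ z, Ri z x = Ri z y) → x = y := fun x y h => by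
    rw [← sub_eq_zero, ← norm_eq_zero, ← sq_eq_zero_iff, ← norm_R, map_sub, h, sub_self,
      norm_zero]
  have L_mul : ∀ l l' x, La (l * l') x = La l (La l' x) := fun l l' x =>
    ext_L _ _ fun z => by rw [L_act, L_act, L_act, mul_assoc]
  have R_mul : ∀ x r r', Ra (r * r') x = Ra r' (Ra r x) := fun x r r' =>
    ext_R _ _ fun z => by rw [R_act, R_act, R_act, mul_assoc]
  have L_act' : ∀ x y l, Li (La l x) y = Li x y * star l := fun x y l => by
    rw [← star_L, L_act, star_mul, star_L]
  have R_act' : ∀ x y r, Ri (Ra r x) y = star r * Ri x y := fun x y l => by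
    rw [← star_R, R_act, star_mul, star_R]
  let Z : ImprimitivityBimodule.{w} L R :=
    { carrier := E
      lact := LinearMap.mk₂ ℂ (fun l x => La l x) (fun _ _ _ => by simp) (fun _ _ _ => by simp)
        (fun _ _ _ => by simp) (fun _ _ _ => by simp)
      ract := LinearMap.mk₂ ℂ (fun x r => Ra r x) (fun _ _ _ => by simp) (fun _ _ _ => by simp)
        (fun _ _ _ => by simp) (fun _ _ _ => by simp)
      linner := fun x y => Li y x
      rinner := fun x y => Ri x y
      lact_mul := L_mul
      ract_mul := R_mul
      -- By fullness it is enough to take r = ⟨y,z⟩R. Then x·⟨y,z⟩R = L⟨x,y⟩·z, and L-linearity of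
      -- the left inner product in x gives the claim; the two adjointability axioms below are
      -- obtained in the same way.
      lact_ract := fun l x r => by
        change Ra r (La l x) = La l (Ra r x)
        refine dense_span_induction full_R (p := fun r => Ra r (La l x) = La l (Ra r x))
          (isClosed_eq (by fun_prop) (by fun_prop)) ?_ (by simp) (fun r r' h h' => by simp [h, h'])
          (fun c r h => by simp [h]) r
        rintro _ ⟨y, z, rfl⟩
        rw [← assoc, L_act, L_mul, assoc]
      linner_add_left := fun x y z => by simp
      linner_smul_left := fun c x y => by simp
      linner_lact := fun l x y => L_act y x l
      star_linner := fun x y => star_L y x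
      linner_self_nonneg := pos_L
      norm_linner_self := norm_L
      linner_full := full_L
      rinner_add_right := fun x y z => by simp
      rinner_smul_right := fun c x y => by simp
      rinner_ract := R_act
      star_rinner := star_R
      rinner_self_nonneg := pos_R
      norm_rinner_self := norm_R
      rinner_full := full_R
      rinner_lact := fun l x y => by
        change Ri (La l x) y = Ri x (La (star l) y)
        refine dense_span_induction full_L (p := fun l => Ri (La l x) y = Ri x (La (star l) y))
          (isClosed_eq (by fun_prop) (by fun_prop)) ?_ (by simp) (fun r r' h h' => by simp [h, h'])
          (fun c r h => by simp [h]) l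
        rintro _ ⟨u, v, rfl⟩
        rw [assoc, star_L, assoc, R_act', R_act, star_R]
      linner_ract := fun x r y => by
        change Li y (Ra r x) = Li (Ra (star r) y) x
        refine dense_span_induction full_R (p := fun r => Li y (Ra r x) = Li (Ra (star r) y) x)
          (isClosed_eq (by fun_prop) (by fun_prop)) ?_ (by simp) (fun r r' h h' => by simp [h, h'])
          (fun c r h => by simp [h]) r
        rintro _ ⟨u, v, rfl⟩
        rw [star_R, ← assoc, ← assoc, L_act, L_act', star_L]
      linner_lact_eq := assoc }
  refine ⟨Z, i, ?_, hi, hLa, fun x r => hRa r x, fun x y => hLi y x, hRi⟩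
  exact (UniformSpace.Completion.toComplₗᵢ (𝕜 := ℂ) (E := X)).injective

/-- A pre-imprimitivity bimodule completes to an imprimitivity bimodule. -/
theorem exists_imprimitivityBimodule {L : Type u₁} {R : Type u₂} {X : Type w} {L₀ R₀ : Type*}
    [NonUnitalCStarAlgebra L] [NonUnitalCStarAlgebra R] [AddCommGroup X] [Module ℂ X]
    [AddCommGroup L₀] [Module ℂ L₀] [AddCommGroup R₀] [Module ℂ R₀]
    (P : PreImprimitivity L R X L₀ R₀) :
    ∃ (Z : ImprimitivityBimodule.{w} L R) (ι : X →ₗ[ℂ] Z.carrier),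
      Function.Injective ι ∧ DenseRange ι ∧
      (∀ l x, Z.lact (P.jL l) (ι x) = ι (P.lact l x)) ∧
      (∀ x r, Z.ract (ι x) (P.jR r) = ι (P.ract x r)) ∧
      (∀ x y, Z.linner (ι x) (ι y) = P.jL (P.linner₀ x y)) ∧
      (∀ x y, Z.rinner (ι x) (ι y) = P.jR (P.rinner₀ x y)) := by
  let _ := P.toNorm
  let _ : NormedAddCommGroup X := NormedAddCommGroup.ofCore P.normedSpaceCore
  let _ : NormedSpace ℂ X := NormedSpace.ofCore P.normedSpaceCore
  exact exists_imprimitivityBimodule_of_norm P fun x => (Real.sq_sqrt (norm_nonneg _)).symm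

end PreImprimitivity

end CompletionOfPreImprimitivity

/-! ### Twisted convolution and involution on functions on G × X -/

section TwistedConvolution

variable {G : Type v} [Group G] [TopologicalSpace G]
  {A : Type u} [NonUnitalCStarAlgebra A] {X : Type w} [TopologicalSpace X]

/-- Continuous functions on `G × X` whose support has compact closure of its projection to `G`. -/
structure IsFiberCompact (f : G × X → A) : Prop where
  continuous : Continuous f
  exists_compact : ∃ C : Set G, IsCompact C ∧ ∀ r s, r ∉ C → f (r, s) = 0

/-- Continuous functions vanishing off a compact set. -/
structure IsCompactlySupported {P : Type*} [TopologicalSpace P] (f : P → A) : Prop where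
  continuous : Continuous f
  exists_compact : ∃ S : Set P, IsCompact S ∧ ∀ p ∉ S, f p = 0

/-- The bundled version of a continuous function vanishing off a compact set. -/
def IsCompactlySupported.toCc {P : Type*} [TopologicalSpace P] [R1Space P] {f : P → A}
    (h : IsCompactlySupported f) : C_c(P, A) := mkCc f h.continuous h.exists_compact

lemma isCompactlySupported_coe {P : Type*} [TopologicalSpace P] (f : C_c(P, A)) :
    IsCompactlySupported f :=
  ⟨f.continuous, tsupport f, f.hasCompactSupport, fun _ h => image_eq_zero_of_notMem_tsupport h⟩

lemma IsCompactlySupported.isFiberCompact {f : G × X → A} (h : IsCompactlySupported f) :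
    IsFiberCompact f := by
  obtain ⟨S, hS, h0⟩ := h.exists_compact
  exact ⟨h.continuous, Prod.fst '' S, hS.image continuous_fst, fun r s hr =>
    h0 _ fun hp => hr ⟨_, hp, rfl⟩⟩

lemma integral_star_comm {T : Type*} [MeasurableSpace T] (κ : Measure T) (f : T → A) :
    ∫ t, star (f t) ∂κ = star (∫ t, f t ∂κ) :=
  (starL' ℝ : A ≃L[ℝ] A).integral_comp_comm f

lemma integrable_star {T : Type*} [MeasurableSpace T] {κ : Measure T} {f : T → A}
    (hf : Integrable f κ) : Integrable (fun t => star (f t)) κ :=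
  ((starL' ℝ : A ≃L[ℝ] A) : A →L[ℝ] A).integrable_comp hf

variable [MulAction G X] [MeasurableSpace G] (μ : Measure G) (α : CStarAction G A)

/-- The convolution of functions on `G × X` twisted by the action on `A` and the translation of
`X`. -/
def tconv (f g : G × X → A) (p : G × X) : A :=
  ∫ t, f (t, p.2) * α.act t (g (t⁻¹ * p.1, t⁻¹ • p.2)) ∂μ

lemma tconv_apply (f g : G × X → A) (r : G) (s : X) :
    tconv μ α f g (r, s) = ∫ t, f (t, s) * α.act t (g (t⁻¹ * r, t⁻¹ • s)) ∂μ := rfl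

/-- Translation of functions on `G × X`. -/
def ttrans (p : G) (f : G × X → A) (z : G × X) : A := α.act p (f (p⁻¹ * z.1, p⁻¹ • z.2))

/-- Multiplication by a function on `X`. -/
def tmul (f : X → A) (x : G × X → A) (z : G × X) : A := f z.2 * x z

variable {μ α}

lemma tconv_apply_eq_zero_of_left [BorelSpace G] [IsTopologicalGroup G] {f g : G × X → A}
    {S : Set (G × X)}
    (hf : ∀ p ∉ S, f p = 0) {C : Set G} (hg : ∀ r s, r ∉ C → g (r, s) = 0) {r : G} {s : X}
    (hp : (r, s) ∉ (fun q : (G × X) × G => (q.1.1 * q.2, q.1.2)) '' (S ×ˢ C)) :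
    tconv μ α f g (r, s) = 0 := by
  refine integral_eq_zero_of_ae (Eventually.of_forall fun t => ?_)
  by_cases h1 : (t, s) ∈ S
  · by_cases h2 : t⁻¹ * r ∈ C
    · exact absurd ⟨((t, s), t⁻¹ * r), ⟨h1, h2⟩, by simp⟩ hp
    · simp [hg _ _ h2]
  · simp [hf _ h1]

lemma tconv_apply_eq_zero_of_right {f g : G × X → A} {C : Set G}
    (hf : ∀ r s, r ∉ C → f (r, s) = 0) {S : Set (G × X)} (hg : ∀ p ∉ S, g p = 0) {r : G} {s : X}
    (hp : (r, s) ∉ (fun q : G × (G × X) => (q.1 * q.2.1, q.1 • q.2.2)) '' (C ×ˢ S)) :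
    tconv μ α f g (r, s) = 0 := by
  refine integral_eq_zero_of_ae (Eventually.of_forall fun t => ?_)
  by_cases h1 : t ∈ C
  · by_cases h2 : (t⁻¹ * r, t⁻¹ • s) ∈ S
    · exact absurd ⟨(t, (t⁻¹ * r, t⁻¹ • s)), ⟨h1, h2⟩, by simp⟩ hp
    · simp [hg _ h2]
  · simp [hf _ _ h1]

lemma tconv_apply_eq_zero {f g : G × X → A} {C C' : Set G}
    (hf : ∀ r s, r ∉ C → f (r, s) = 0) (hg : ∀ r s, r ∉ C' → g (r, s) = 0) {r : G} {s : X}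
    (hp : r ∉ (fun q : G × G => q.1 * q.2) '' (C ×ˢ C')) :
    tconv μ α f g (r, s) = 0 := by
  refine integral_eq_zero_of_ae (Eventually.of_forall fun t => ?_)
  by_cases h1 : t ∈ C
  · by_cases h2 : t⁻¹ * r ∈ C'
    · exact absurd ⟨(t, t⁻¹ * r), ⟨h1, h2⟩, by simp⟩ hp
    · simp [hg _ _ h2]
  · simp [hf _ _ h1]

lemma norm_tconv_le [OpensMeasurableSpace G] [IsFiniteMeasureOnCompacts μ] {f g : G × X → A}
    {C : Set G} (hC : IsCompact C)
    (hf : ∀ r s, r ∉ C → f (r, s) = 0) {m m' : ℝ} (hm : ∀ p, ‖f p‖ ≤ m) (hm' : ∀ p, ‖g p‖ ≤ m')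
    (p : G × X) : ‖tconv μ α f g p‖ ≤ m * m' * μ.real C := by
  refine norm_integral_le_of_vanish μ hC (fun t ht => by simp [hf t p.2 ht]) fun t => ?_
  refine (norm_mul_le _ _).trans ?_
  exact mul_le_mul (hm _) ((NonUnitalStarAlgHom.norm_apply_le _ _).trans (hm' _)) (norm_nonneg _)
    ((norm_nonneg _).trans (hm p))

variable [IsTopologicalGroup G] [ContinuousSMul G X] [BorelSpace G]

lemma continuous_tconv_integrand {f g : G × X → A} (hf : Continuous f) (hg : Continuous g) :
    Continuous fun z : (G × X) × G =>
      f (z.2, z.1.2) * α.act z.2 (g (z.2⁻¹ * z.1.1, z.2⁻¹ • z.1.2)) := by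
  refine (hf.comp (by fun_prop)).mul ?_
  exact α.continuous_act_prod.comp (continuous_snd.prodMk (hg.comp (by fun_prop)))

lemma continuous_tconv [IsFiniteMeasureOnCompacts μ] {f g : G × X → A} (hf : IsFiberCompact f)
    (hg : Continuous g) : Continuous (tconv μ α f g) := by
  obtain ⟨C, hC, h0⟩ := hf.exists_compact
  exact continuous_integral_of_compact_support' μ (continuous_tconv_integrand hf.continuous hg) hC
    fun z t ht => by simp [h0 t z.2 ht]

lemma integrable_tconv_integrand [T2Space G] [IsFiniteMeasureOnCompacts μ] {f g : G × X → A}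
    (hf : IsFiberCompact f) (hg : Continuous g) (r : G) (s : X) :
    Integrable (fun t => f (t, s) * α.act t (g (t⁻¹ * r, t⁻¹ • s))) μ := by
  obtain ⟨C, hC, h0⟩ := hf.exists_compact
  exact integrable_of_continuous_of_vanish μ ((continuous_tconv_integrand hf.continuous hg).comp
    (continuous_const.prodMk continuous_id : Continuous fun t => ((r, s), t))) hC
    fun t ht => by simp [h0 t s ht]

/-- Pull-backs from `Y` and functions constant in the `X`-variable are not compactly supported, but
their supports project into compact subsets of `G`. That is enough for every integral over `G`, and
compact support survives as soon as one factor has it. -/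
lemma IsFiberCompact.tconv [IsFiniteMeasureOnCompacts μ] {f g : G × X → A} (hf : IsFiberCompact f)
    (hg : IsFiberCompact g) : IsFiberCompact (tconv μ α f g) := by
  refine ⟨continuous_tconv hf hg.continuous, ?_⟩
  obtain ⟨C, hC, h0⟩ := hf.exists_compact
  obtain ⟨C', hC', h0'⟩ := hg.exists_compact
  exact ⟨_, (hC.prod hC').image (by fun_prop), fun r s hr => tconv_apply_eq_zero h0 h0' hr⟩

lemma IsCompactlySupported.tconv_left [IsFiniteMeasureOnCompacts μ] {f g : G × X → A}
    (hf : IsCompactlySupported f) (hg : IsFiberCompact g) :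
    IsCompactlySupported (tconv μ α f g) := by
  refine ⟨continuous_tconv hf.isFiberCompact hg.continuous, ?_⟩
  obtain ⟨S, hS, h0⟩ := hf.exists_compact
  obtain ⟨C', hC', h0'⟩ := hg.exists_compact
  exact ⟨_, (hS.prod hC').image (by fun_prop), fun p hp => tconv_apply_eq_zero_of_left h0 h0' hp⟩

lemma IsCompactlySupported.tconv_right [IsFiniteMeasureOnCompacts μ] {f g : G × X → A}
    (hf : IsFiberCompact f) (hg : IsCompactlySupported g) :
    IsCompactlySupported (tconv μ α f g) := by
  refine ⟨continuous_tconv hf hg.continuous, ?_⟩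
  obtain ⟨C, hC, h0⟩ := hf.exists_compact
  obtain ⟨S, hS, h0'⟩ := hg.exists_compact
  exact ⟨_, (hC.prod hS).image (by fun_prop), fun p hp => tconv_apply_eq_zero_of_right h0 h0' hp⟩

lemma tconv_add_left [T2Space G] [IsFiniteMeasureOnCompacts μ] {f f' g : G × X → A}
    (hf : IsFiberCompact f) (hf' : IsFiberCompact f') (hg : Continuous g) :
    tconv μ α (f + f') g = tconv μ α f g + tconv μ α f' g := by
  ext ⟨r, s⟩
  rw [Pi.add_apply, tconv_apply, tconv_apply, tconv_apply,
    ← integral_add (integrable_tconv_integrand hf hg r s) (integrable_tconv_integrand hf' hg r s)]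
  simp [add_mul]

lemma tconv_add_right [T2Space G] [IsFiniteMeasureOnCompacts μ] {f g g' : G × X → A}
    (hf : IsFiberCompact f) (hg : Continuous g) (hg' : Continuous g') :
    tconv μ α f (g + g') = tconv μ α f g + tconv μ α f g' := by
  ext ⟨r, s⟩
  rw [Pi.add_apply, tconv_apply, tconv_apply, tconv_apply,
    ← integral_add (integrable_tconv_integrand hf hg r s) (integrable_tconv_integrand hf hg' r s)]
  simp [mul_add]

lemma tconv_smul_left (c : ℂ) (f g : G × X → A) :
    tconv μ α (c • f) g = c • tconv μ α f g := by
  ext ⟨r, s⟩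
  rw [Pi.smul_apply, tconv_apply, tconv_apply, ← integral_smul]
  simp [smul_mul_assoc]

lemma tconv_smul_right (c : ℂ) (f g : G × X → A) :
    tconv μ α f (c • g) = c • tconv μ α f g := by
  ext ⟨r, s⟩
  rw [Pi.smul_apply, tconv_apply, tconv_apply, ← integral_smul]
  simp [mul_smul_comm]

/-- Fubini and the substitution t ↦ ut. Only the projections of the supports to `G` matter, so
factors pulled back from `Y` are allowed. -/
lemma tconv_assoc [T2Space G] [μ.IsHaarMeasure] {f g h : G × X → A} (hf : IsFiberCompact f)
    (hg : IsFiberCompact g) (hh : IsFiberCompact h) :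
    tconv μ α (tconv μ α f g) h = tconv μ α f (tconv μ α g h) := by
  obtain ⟨C, hC, h0⟩ := hf.exists_compact
  obtain ⟨C', hC', h0'⟩ := hg.exists_compact
  ext ⟨r, s⟩
  let F : G → G → A := fun t u =>
    f (u, s) * α.act u (g (u⁻¹ * t, u⁻¹ • s)) * α.act t (h (t⁻¹ * r, t⁻¹ • s))
  have hF : Continuous fun p : G × G => F p.1 p.2 := by
    refine (((continuous_tconv_integrand (α := α) hf.continuous hg.continuous).comp
      (show Continuous fun p : G × G => ((p.1, s), p.2) by fun_prop))).mul ?_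
    exact α.continuous_act_prod.comp (continuous_fst.prodMk (hh.continuous.comp (by fun_prop)))
  have e1 : tconv μ α (tconv μ α f g) h (r, s) = ∫ t, ∫ u, F t u ∂μ ∂μ := by
    rw [tconv_apply]
    refine integral_congr_ae (Eventually.of_forall fun t => ?_)
    exact (integral_mul_const_of_integrable (integrable_tconv_integrand hf hg.continuous t s)).symm
  have e2 : ∀ u, ∫ t, F t u ∂μ = f (u, s) * α.act u (tconv μ α g h (u⁻¹ * r, u⁻¹ • s)) := fun u => by
    rw [← integral_mul_left_eq_self (fun t => F t u) u, tconv_apply, ← starHomCLM_apply,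
      ← ContinuousLinearMap.integral_comp_comm _ (integrable_tconv_integrand hg hh.continuous _ _),
      ← integral_const_mul_of_integrable]
    · refine integral_congr_ae (Eventually.of_forall fun t => ?_)
      simp only [F, starHomCLM_apply, map_mul, inv_mul_cancel_left, mul_inv_rev, α.act_mul, mul_assoc,
        mul_smul]
    · exact ContinuousLinearMap.integrable_comp _ (integrable_tconv_integrand hg hh.continuous _ _)
  rw [e1, integral_swap_of_vanish μ μ hF ((hC.prod hC').image continuous_mul) hC, tconv_apply]
  · exact integral_congr_ae (Eventually.of_forall e2)
  · intro t u ht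
    by_cases hu : u ∈ C
    · have : u⁻¹ * t ∉ C' := fun h' => ht ⟨(u, u⁻¹ * t), ⟨hu, h'⟩, by simp⟩
      simp [F, h0' _ _ this]
    · simp [F, h0 _ _ hu]
  · intro t u hu
    simp [F, h0 _ _ hu]

variable (μ α) in
/-- The involution on functions on `G × X`. -/
def tstar [μ.IsHaarMeasure] (f : G × X → A) (p : G × X) : A :=
  (modularFn μ p.1)⁻¹ • α.act p.1 (star (f (p.1⁻¹, p.1⁻¹ • p.2)))

variable [μ.IsHaarMeasure]

lemma tstar_apply (f : G × X → A) (r : G) (s : X) :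
    tstar μ α f (r, s) = (modularFn μ r)⁻¹ • α.act r (star (f (r⁻¹, r⁻¹ • s))) := rfl

lemma tstar_add (f g : G × X → A) : tstar μ α (f + g) = tstar μ α f + tstar μ α g := by
  ext ⟨r, s⟩
  simp [tstar_apply]

lemma tstar_smul (c : ℂ) (f : G × X → A) :
    tstar μ α (c • f) = starRingEnd ℂ c • tstar μ α f := by
  ext ⟨r, s⟩
  simp [tstar_apply, smul_comm (modularFn μ r)⁻¹]

lemma tstar_eq_zero {f : G × X → A} {S : Set (G × X)} (hf : ∀ p ∉ S, f p = 0) {p : G × X}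
    (hp : p ∉ (fun q : G × X => (q.1⁻¹, q.1⁻¹ • q.2)) '' S) : tstar μ α f p = 0 := by
  have : (p.1⁻¹, p.1⁻¹ • p.2) ∉ S := fun h => hp ⟨_, h, by simp⟩
  rw [tstar, hf _ this]
  simp

variable [LocallyCompactSpace G] [T2Space G] [μ.Regular]

lemma tstar_tstar (f : G × X → A) : tstar μ α (tstar μ α f) = f := by
  ext ⟨r, s⟩
  rw [tstar_apply, tstar_apply, inv_inv, modularFn_inv, inv_inv, star_smul, map_star, star_star,
    starHom_real_smul, smul_smul, α.act_act_inv, smul_inv_smul, star_trivial,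
    inv_mul_cancel₀ (modularFn_pos μ r).ne', one_smul]

lemma continuous_tstar {f : G × X → A} (hf : Continuous f) : Continuous (tstar μ α f) := by
  refine Continuous.smul (f := fun p : G × X => (modularFn μ p.1)⁻¹) (((continuous_modularFn μ).comp continuous_fst).inv₀
    fun p => (modularFn_pos μ p.1).ne') ?_
  exact α.continuous_act_prod.comp (continuous_fst.prodMk ((hf.comp (by fun_prop)).star))

lemma IsCompactlySupported.tstar {f : G × X → A} (hf : IsCompactlySupported f) :
    IsCompactlySupported (tstar μ α f) := by
  refine ⟨continuous_tstar hf.continuous, ?_⟩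
  obtain ⟨S, hS, h0⟩ := hf.exists_compact
  exact ⟨_, hS.image (by fun_prop), fun p hp => tstar_eq_zero h0 hp⟩

lemma IsFiberCompact.tstar {f : G × X → A} (hf : IsFiberCompact f) :
    IsFiberCompact (tstar μ α f) := by
  refine ⟨continuous_tstar hf.continuous, ?_⟩
  obtain ⟨S, hS, h0⟩ := hf.exists_compact
  refine ⟨S⁻¹, hS.inv, fun r s hr => ?_⟩
  rw [tstar_apply, h0 _ _ (by simpa using hr)]
  simp

/-- After the substitution t ↦ rt, the factors Δ(rt)⁻¹ and Δ(t) from the two involutions combine to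
Δ(r)⁻¹. -/
lemma tstar_tconv {f g : G × X → A} (hf : IsFiberCompact f) (hg : IsFiberCompact g) :
    tstar μ α (tconv μ α f g) = tconv μ α (tstar μ α g) (tstar μ α f) := by
  ext ⟨r, s⟩
  rw [tstar_apply, tconv_apply, tconv_apply, ← integral_star_comm, ← starHomCLM_apply,
    ← ContinuousLinearMap.integral_comp_comm, ← integral_smul,
    ← integral_mul_left_eq_self (μ := μ) (fun t => tstar μ α g (t, s) * _) r]
  · refine integral_congr_ae (Eventually.of_forall fun t => ?_)
    have e1 : (r * t)⁻¹ * r = t⁻¹ := by group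
    have e2 : (r * t)⁻¹ • s = t⁻¹ • r⁻¹ • s := by rw [mul_inv_rev, mul_smul]
    have e3 : tstar μ α f (t⁻¹, t⁻¹ • r⁻¹ • s) =
        modularFn μ t • α.act t⁻¹ (star (f (t, r⁻¹ • s))) := by
      rw [tstar_apply, inv_inv, modularFn_inv, inv_inv, smul_inv_smul]
    simp only [starHomCLM_apply, e1, e2, e3]
    rw [tstar_apply, e2, mul_inv_rev, starHom_real_smul, ← α.act_mul,
      mul_inv_cancel_right, smul_mul_smul_comm, modularFn_mul, mul_inv, mul_assoc,
      inv_mul_cancel₀ (modularFn_pos μ t).ne', mul_one, star_mul, map_mul, α.act_mul, map_star (α.act t)]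
  · exact integrable_star (integrable_tconv_integrand hf hg.continuous _ _)

/-- The substitution t ↦ tp removes p, and its factor Δ(p) accounts for the one in the involution.
Hence translations preserve x^* * y; with the next lemma, any form that depends only on x^* * y is
compatible with translations and multiplications. -/
lemma tconv_tstar_ttrans (f g : G × X → A) (p : G) :
    tconv μ α (tstar μ α (ttrans α p f)) (ttrans α p g) = tconv μ α (tstar μ α f) g := by
  ext ⟨r, s⟩
  rw [tconv_apply, tconv_apply]
  refine Eq.trans ?_ (modularFn_smul_integral μ _ p)
  rw [← integral_smul]
  refine integral_congr_ae (Eventually.of_forall fun t => ?_)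
  have e1 : (t * p)⁻¹ = p⁻¹ * t⁻¹ := mul_inv_rev _ _
  simp only [tstar_apply, ttrans, e1, modularFn_mul, mul_inv, mul_smul, α.act_mul, map_star,
    smul_mul_assoc, mul_assoc]
  rw [smul_comm (modularFn μ t)⁻¹, smul_inv_smul₀ (modularFn_pos μ p).ne']

lemma tconv_tstar_tmul (f : X → A) (x y : G × X → A) :
    tconv μ α (tstar μ α (tmul f x)) y = tconv μ α (tstar μ α x) (tmul (star f) y) := by
  ext ⟨r, s⟩
  rw [tconv_apply, tconv_apply]
  refine integral_congr_ae (Eventually.of_forall fun t => ?_)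
  simp only [tstar_apply, tmul, star_mul, map_mul, smul_mul_assoc, mul_assoc, Pi.star_apply]

end TwistedConvolution

/-! ### Elementary tensors and density -/

section Tensors

variable {H : Type*} [TopologicalSpace H] {B : Type*} [NormedAddCommGroup B] [NormedSpace ℂ B]

/-- The function `(s, p) ↦ χ(s) f(p)`. -/
def tensorCc {P : Type*} [TopologicalSpace P] [R1Space H] [R1Space P] (χ : C_c(H, ℝ)) (f : C_c(P, B)) :
    C_c(H × P, B) :=
  mkCc (fun p => χ p.1 • f p.2) ((χ.continuous.comp continuous_fst).smul
    (f.continuous.comp continuous_snd)) ⟨tsupport χ ×ˢ tsupport f,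
      χ.hasCompactSupport.prod f.hasCompactSupport, fun p hp => by
        rw [Set.mem_prod, not_and_or] at hp
        rcases hp with h | h
        · rw [image_eq_zero_of_notMem_tsupport h, zero_smul]
        · rw [image_eq_zero_of_notMem_tsupport h, smul_zero]⟩

/-- The function `s ↦ χ(s) b`. -/
def tensorConst [R1Space H] (χ : C_c(H, ℝ)) (b : B) : C_c(H, B) :=
  mkCc (fun s => χ s • b) (χ.continuous.smul continuous_const) ⟨tsupport χ,
      χ.hasCompactSupport, fun p hp => by rw [image_eq_zero_of_notMem_tsupport hp, zero_smul]⟩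

/-- A partition of unity subordinate to sets on which h stays within η of a point of `B₀` replaces h
by a finite sum of tensors. The error is uniformly small and lives in a compact set fixed
beforehand, where `J` is bounded. -/
lemma mem_closure_of_tensorConst_mem [LocallyCompactSpace H] [T2Space H] {E : Type*}
    [NormedAddCommGroup E] [NormedSpace ℂ E] {J : C_c(H, B) →ₗ[ℂ] E}
    (hJ : InductivelyContinuous J) {B₀ : Set B} (hB₀ : Dense B₀) (V : Submodule ℂ E)
    (hV : ∀ χ : C_c(H, ℝ), ∀ b ∈ B₀, J (tensorConst χ b) ∈ V) (h : C_c(H, B)) :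
    J h ∈ closure (V : Set E) := by
  obtain ⟨S', hS', hSS'⟩ := exists_compact_superset h.hasCompactSupport
  obtain ⟨C, hC, hJC⟩ := hJ S' hS'
  rw [Metric.mem_closure_iff]
  intro ε hε
  set η : ℝ := ε / (C + 1) with hη
  have hη0 : 0 < η := by positivity
  have h1 : ∀ x : H, ∃ b ∈ B₀, ‖h x - b‖ < η := fun x => by
    obtain ⟨b, hb, hd⟩ := Metric.dense_iff.1 hB₀ (h x) η hη0
    exact ⟨b, hd, by rwa [mem_ball_iff_norm, norm_sub_rev] at hb⟩
  choose b hb hbd using h1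
  let W : H → Set H := fun x => interior S' ∩ {y | ‖h y - b x‖ < η}
  have hW : ∀ x, IsOpen (W x) := fun x => isOpen_interior.inter
    (isOpen_lt ((h.continuous.sub continuous_const).norm) continuous_const)
  obtain ⟨t, ht⟩ := h.hasCompactSupport.isCompact.elim_finite_subcover W hW fun x hx =>
    Set.mem_iUnion.2 ⟨x, hSS' hx, hbd x⟩
  obtain ⟨f, hf, hfc⟩ := PartitionOfUnity.exists_isSubordinate_of_locallyFinite_t2space
    h.hasCompactSupport.isCompact (fun i : t => W i) (fun i => hW i)
    (locallyFinite_of_finite _) (by simpa [Set.iUnion_subtype] using ht)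
  let χ : t → C_c(H, ℝ) := fun i => ⟨f i, hfc i⟩
  have hs1 : ∀ y, ∑ i, f i y ≤ 1 := fun y => by
    rw [← finsum_eq_sum_of_fintype]; exact f.sum_le_one y
  have hs2 : ∀ y ∈ tsupport h, ∑ i, f i y = 1 := fun y hy => by
    rw [← finsum_eq_sum_of_fintype]; exact f.sum_eq_one hy
  let g : C_c(H, B) := ∑ i, tensorConst (χ i) (b i)
  have hg : ∀ y, g y = ∑ i, f i y • b i := fun y => by
    simp only [g, CompactlySupportedContinuousMap.sum_apply]; rfl
  have hbd2 : BoundedOn S' η (h - g) := by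
    have e : ∀ y, (h - g) y = ∑ i, f i y • (h y - b i) := fun y => by
      simp only [smul_sub, Finset.sum_sub_distrib, ← Finset.sum_smul]
      rw [CompactlySupportedContinuousMap.sub_apply, hg]
      congr 1
      by_cases hy : y ∈ tsupport h
      · rw [hs2 y hy, one_smul]
      · rw [image_eq_zero_of_notMem_tsupport hy, smul_zero]
    have e2 : ∀ (i : t) y, y ∉ W i → f i y = 0 := fun i y hy =>
      image_eq_zero_of_notMem_tsupport fun h' => hy (hf i h')
    refine ⟨fun y hy => ?_, fun y => ?_⟩
    · rw [e]
      refine Finset.sum_eq_zero fun i _ => ?_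
      rw [e2 i y fun h' => hy (interior_subset h'.1), zero_smul]
    · rw [e]
      calc ‖∑ i, f i y • (h y - b i)‖ ≤ ∑ i, f i y * η := by
            refine norm_sum_le_of_le _ fun i _ => ?_
            rw [norm_smul, Real.norm_of_nonneg (f.nonneg i y)]
            by_cases hy : y ∈ W i
            · exact mul_le_mul_of_nonneg_left hy.2.le (f.nonneg i y)
            · rw [e2 i y hy, zero_mul, zero_mul]
        _ = (∑ i, f i y) * η := by rw [Finset.sum_mul]
        _ ≤ η := mul_le_of_le_one_left hη0.le (hs1 y)
  refine ⟨J g, ?_, ?_⟩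
  · rw [map_sum]
    exact Submodule.sum_mem _ fun i _ => hV _ _ (hb _)
  · rw [dist_eq_norm, ← map_sub]
    refine (hJC _ _ hbd2).trans_lt ?_
    rw [hη, mul_div_assoc', div_lt_iff₀ (by positivity)]
    nlinarith

/-- Compactly supported functions are dense in `C₀`. -/
lemma dense_compactlySupported_C0 {X : Type*} [TopologicalSpace X] [LocallyCompactSpace X] [T2Space X]
    {A : Type*} [NonUnitalCStarAlgebra A] :
    Dense {f : C₀(X, A) | ∃ g : C_c(X, A), ∀ x, f x = g x} := by
  intro f
  rw [Metric.mem_closure_iff]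
  intro ε hε
  obtain ⟨S, hS, h2⟩ := mem_cocompact.1 (f.zero_at_infty'.eventually
    (Metric.ball_mem_nhds (0 : A) (half_pos hε)))
  obtain ⟨χ, hχ1, -, hχc, hχ⟩ := exists_continuous_one_zero_of_isCompact hS isClosed_empty
    (Set.disjoint_empty _)
  let g : C_c(X, A) := mkCc (fun x => χ x • f x) (χ.continuous.smul f.continuous) ⟨tsupport χ, hχc,
    fun x hx => by rw [image_eq_zero_of_notMem_tsupport hx, zero_smul]⟩
  let g' : C₀(X, A) := ⟨g.toContinuousMap, g.hasCompactSupport.is_zero_at_infty⟩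
  refine ⟨g', ⟨g, fun x => rfl⟩, ?_⟩
  rw [← ZeroAtInftyContinuousMap.dist_toBCF_eq_dist]
  refine lt_of_le_of_lt ((BoundedContinuousFunction.dist_le (half_pos hε).le).2 fun x => ?_)
    (half_lt_self hε)
  rw [dist_eq_norm]
  change ‖f x - χ x • f x‖ ≤ ε / 2
  by_cases hx : x ∈ S
  · rw [hχ1 hx, Pi.one_apply, one_smul, sub_self, norm_zero]; positivity
  · have h3 : ‖f x‖ < ε / 2 := by simpa using h2 hx
    have h4 : f x - χ x • f x = (1 - χ x) • f x := by rw [sub_smul, one_smul]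
    rw [h4, norm_smul, Real.norm_of_nonneg (by linarith [(hχ x).2])]
    refine (mul_le_of_le_one_left (norm_nonneg _) ?_).trans h3.le
    linarith [(hχ x).1]

end Tensors

/-! ### The crossed product C₀(X, A) ⋊ G -/

section TransformationGroups

variable {G : Type v} [Group G] [TopologicalSpace G] [IsTopologicalGroup G] [LocallyCompactSpace G]
  [T2Space G] [MeasurableSpace G] [BorelSpace G] {μ : Measure G} [μ.IsHaarMeasure] [μ.Regular]
  {A : Type u} [NonUnitalCStarAlgebra A] {α : CStarAction G A}
  {X : Type w} [TopologicalSpace X] [MulAction G X] [ContinuousSMul G X]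

variable (α X) in
/-- The action of `G` on `C₀(X, A)`. -/
def translationAction : CStarAction G C₀(X, A) :=
  α.onC0 (fun t x => t • x) (one_smul G) mul_smul continuous_smul

lemma translationAction_apply (t : G) (f : C₀(X, A)) (x : X) :
    (translationAction α X).act t f x = α.act t (f (t⁻¹ • x)) := rfl

variable (μ α X) in
/-- The linear inclusion of `C_c(G × X, A)` into the crossed product. -/
def inclₗ : C_c(G × X, A) →ₗ[ℂ] CrossedProduct μ (translationAction α X) where
  toFun := inclCrossed μ (translationAction α X)
  map_add' f g := by
    rw [inclCrossed, inclCrossed, inclCrossed, ← map_add]; rfl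
  map_smul' c f := by
    rw [inclCrossed, inclCrossed, RingHom.id_apply, ← map_smul]; rfl

lemma inclₗ_apply (f : C_c(G × X, A)) :
    inclₗ μ α X f = CrossedProduct.ofCc μ (translationAction α X) (curryCc f) := rfl

lemma inductivelyContinuous_inclₗ : InductivelyContinuous (inclₗ μ α X) := by
  intro S hS
  -- For empty X the bound m in `BoundedOn` may be negative, so this case is treated separately,
  -- with constant 0.
  rcases isEmpty_or_nonempty X with hX | hX
  · refine ⟨0, le_rfl, fun m f _ => ?_⟩
    rw [show f = 0 by ext p; exact (hX.false p.2).elim, map_zero, norm_zero, zero_mul]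
  obtain ⟨C, hC, h⟩ := CrossedProduct.inductivelyContinuous_ofCc (translationAction α X) μ
    (Prod.fst '' S) (hS.image continuous_fst)
  refine ⟨C, hC, fun m f hf => h _ _ ⟨fun r hr => ZeroAtInftyContinuousMap.ext fun x =>
    hf.1 _ fun h => hr ⟨_, h, rfl⟩, fun r => ?_⟩⟩
  rw [← ZeroAtInftyContinuousMap.norm_toBCF_eq_norm]
  exact (BoundedContinuousFunction.norm_le ((norm_nonneg _).trans (hf.2 (1, hX.some)))).2
    fun x => hf.2 (r, x)

/-- The product in the crossed product is a Bochner integral with values in `C₀(X, A)`; evaluation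
at a point of `X` is continuous and turns it into the pointwise integral of the twisted convolution.
-/
lemma inclₗ_mul {f g h : C_c(G × X, A)} (hh : ∀ p, h p = tconv μ α f g p) :
    inclₗ μ α X f * inclₗ μ α X g = inclₗ μ α X h := by
  rw [inclₗ_apply, inclₗ_apply, inclₗ_apply]
  refine CrossedProduct.ofCc_mul_of fun r => ZeroAtInftyContinuousMap.ext fun s => ?_
  obtain ⟨S, m, hS, hm, hf⟩ := exists_boundedOn (curryCc f)
  have hc : Continuous fun t => curryCc f t * (translationAction α X).act t (curryCc g (t⁻¹ * r)) :=
    (curryCc f).continuous.mul ((translationAction α X).continuous_act_comp continuous_id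
      ((curryCc g).continuous.comp (continuous_inv.mul continuous_const)))
  have hi : Integrable (fun t =>
      curryCc f t * (translationAction α X).act t (curryCc g (t⁻¹ * r))) μ :=
    integrable_of_continuous_of_vanish μ hc hS fun t ht => by rw [hf.1 t ht, zero_mul]
  rw [← evalC0_apply s (∫ t, _ ∂μ), ← ContinuousLinearMap.integral_comp_comm _ hi]
  exact hh (r, s)

lemma inclₗ_star {f h : C_c(G × X, A)} (hh : ∀ p, h p = tstar μ α f p) :
    star (inclₗ μ α X f) = inclₗ μ α X h := by
  rw [inclₗ_apply, inclₗ_apply]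
  exact CrossedProduct.ofCc_star_of fun r => ZeroAtInftyContinuousMap.ext fun s => hh (r, s)

lemma denseRange_inclₗ [LocallyCompactSpace X] [T2Space X] : DenseRange (inclₗ μ α X) := by
  have h1 : ∀ f, CrossedProduct.ofCc μ (translationAction α X) f ∈
      closure (LinearMap.range (inclₗ μ α X) : Set _) :=
    mem_closure_of_tensorConst_mem (CrossedProduct.inductivelyContinuous_ofCc _ μ)
      dense_compactlySupported_C0 _ fun χ b ⟨g, hg⟩ => by
        refine ⟨tensorCc χ g, ?_⟩
        rw [inclₗ_apply]
        congr 1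
        ext r s
        change χ r • g s = χ r • b s
        rw [hg]
  intro T
  exact CrossedProduct.denseRange_ofCc.induction_on T isClosed_closure h1

end TransformationGroups

/-! ### Right translation and the iterated crossed product -/

section RightTranslation

variable {G : Type v} [Group G] [TopologicalSpace G] [IsTopologicalGroup G] [LocallyCompactSpace G]
  [T2Space G] [MeasurableSpace G] [BorelSpace G] {μ : Measure G} [μ.IsHaarMeasure] [μ.Regular]
  {A : Type u} [NonUnitalCStarAlgebra A] {α : CStarAction G A}
  {X : Type w} [Group X] [TopologicalSpace X] [IsTopologicalGroup X] [MulAction G X]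
  [ContinuousSMul G X]

/-- Right translation of functions on `G × X`. -/
def rtrans (d : X) (f : G × X → A) (p : G × X) : A := f (p.1, p.2 * d)

lemma IsFiberCompact.rtrans {f : G × X → A} (hf : IsFiberCompact f) (d : X) :
    IsFiberCompact (rtrans d f) := by
  obtain ⟨C, hC, h0⟩ := hf.exists_compact
  exact ⟨hf.continuous.comp (by fun_prop), C, hC, fun r s hr => h0 r _ hr⟩

lemma IsCompactlySupported.rtrans {f : G × X → A} (hf : IsCompactlySupported f) (d : X) :
    IsCompactlySupported (rtrans d f) := by
  obtain ⟨S, hS, h0⟩ := hf.exists_compact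
  refine ⟨hf.continuous.comp (by fun_prop), (fun p : G × X => (p.1, p.2 * d⁻¹)) '' S,
    hS.image (by fun_prop), fun p hp => h0 _ fun h' => hp ⟨_, h', by simp⟩⟩

lemma rtrans_mul (d e : X) (f : G × X → A) : rtrans (d * e) f = rtrans d (rtrans e f) := by
  ext p
  simp [rtrans, mul_assoc]

lemma rtrans_one (f : G × X → A) : rtrans (1 : X) f = f := by
  ext p
  simp [rtrans]

variable [IsScalarTower G X X]

lemma tconv_rtrans (d : X) (f g : G × X → A) :
    tconv μ α (rtrans d f) (rtrans d g) = rtrans d (tconv μ α f g) := by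
  ext ⟨r, s⟩
  simp only [tconv, rtrans, smul_mul_assoc]

lemma tstar_rtrans (d : X) (f : G × X → A) :
    tstar μ α (rtrans d f) = rtrans d (tstar μ α f) := by
  ext ⟨r, s⟩
  simp only [tstar, rtrans, smul_mul_assoc]

variable (X) in
/-- The action of `X` on `C₀(X, A)` by right translation. -/
def rightAction : CStarAction X C₀(X, A) :=
  (CStarAction.trivial X A).onC0 (fun t x => x * t⁻¹) (fun x => by simp)
    (fun s t x => by simp [mul_assoc]) (by fun_prop)

lemma rightAction_apply (t : X) (f : C₀(X, A)) (x : X) :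
    (rightAction X).act t f x = f (x * t) := by
  change f (x * t⁻¹⁻¹) = f (x * t)
  rw [inv_inv]

lemma rightAction_comm (d : X) (s : G) (f : C₀(X, A)) :
    (rightAction X).act d ((translationAction α X).act s f) =
      (translationAction α X).act s ((rightAction X).act d f) := by
  ext x
  rw [rightAction_apply, translationAction_apply, translationAction_apply, rightAction_apply,
    smul_mul_assoc]

variable {D : Type*} [Group D] [TopologicalSpace D] {i : D →* X} (hi : IsClosedEmbedding i)

variable (μ α) in
/-- The action of `D` on `C₀(X, A) ⋊ G` by right translation along `i`. -/
def rightDualAction : CStarAction D (CrossedProduct μ (translationAction α X)) :=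
  (CrossedProduct.inducedAction μ (translationAction α X) (rightAction X)
    rightAction_comm).restrict i hi.continuous

lemma rightDualAction_inclₗ {f h : C_c(G × X, A)} (k : D) (hh : ∀ p, h p = rtrans (i k) f p) :
    (rightDualAction μ α hi).act k (inclₗ μ α X f) = inclₗ μ α X h := by
  rw [inclₗ_apply, inclₗ_apply]
  change CrossedProduct.ofCc μ _ (CrossedProduct.mapCc ((rightAction X).act (i k)) (curryCc f)) = _
  refine congrArg _ ?_
  ext r s
  change (rightAction X).act (i k) (curryCc f r) s = h (r, s)
  rw [rightAction_apply, hh]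
  rfl

variable [IsTopologicalGroup D] [LocallyCompactSpace D]
  [T2Space D] [MeasurableSpace D] [BorelSpace D] {ν : Measure D} [ν.IsHaarMeasure] [ν.Regular]

variable (μ α ν) in
/-- The linear inclusion of `C_c(D × G × X, A)` into the iterated crossed product. -/
def inclItₗ : C_c(D × G × X, A) →ₗ[ℂ] CrossedProduct ν (rightDualAction μ α hi) where
  toFun := inclIterated μ (translationAction α X) ν (rightDualAction μ α hi)
  map_add' f g := by
    rw [inclIterated, inclIterated, inclIterated, ← map_add]
    refine congrArg _ ?_
    ext1 d
    exact (inclₗ μ α X).map_add (sliceCc f d) (sliceCc g d)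
  map_smul' c f := by
    rw [inclIterated, inclIterated, RingHom.id_apply, ← map_smul]
    refine congrArg _ ?_
    ext1 d
    exact (inclₗ μ α X).map_smul c (sliceCc f d)

lemma inclItₗ_apply (f : C_c(D × G × X, A)) :
    inclItₗ μ α hi ν f = CrossedProduct.ofCc ν (rightDualAction μ α hi)
      (curryCrossed μ (translationAction α X) f) := rfl

lemma curryCrossed_eq (f : C_c(D × G × X, A)) (k : D) :
    curryCrossed μ (translationAction α X) f k = inclₗ μ α X (sliceCc f k) := rfl

/-- The hypothesis is an identity in the inner crossed product, where convolution over `G` is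
already multiplication; only the integral over `D` remains to be handled. -/
lemma inclItₗ_mul {c d e : C_c(D × G × X, A)} (h : ∀ k, inclₗ μ α X (sliceCc e k) =
    ∫ m, inclₗ μ α X (sliceCc c m) *
      (rightDualAction μ α hi).act m (inclₗ μ α X (sliceCc d (m⁻¹ * k))) ∂ν) :
    inclItₗ μ α hi ν c * inclItₗ μ α hi ν d = inclItₗ μ α hi ν e :=
  CrossedProduct.ofCc_mul_of h

lemma inclItₗ_star {c d : C_c(D × G × X, A)} (h : ∀ k, inclₗ μ α X (sliceCc d k) =
    (modularFn ν k)⁻¹ • (rightDualAction μ α hi).act k (star (inclₗ μ α X (sliceCc c k⁻¹)))) :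
    star (inclItₗ μ α hi ν c) = inclItₗ μ α hi ν d :=
  CrossedProduct.ofCc_star_of h

lemma inductivelyContinuous_inclItₗ : InductivelyContinuous (inclItₗ μ α hi ν) := by
  intro S hS
  obtain ⟨C, hC, h⟩ := CrossedProduct.inductivelyContinuous_ofCc (rightDualAction μ α hi) ν
    (Prod.fst '' S) (hS.image continuous_fst)
  obtain ⟨C', hC', h'⟩ := inductivelyContinuous_inclₗ (μ := μ) (α := α) (X := X)
    (Prod.snd '' S) (hS.image continuous_snd)
  refine ⟨C * C', mul_nonneg hC hC', fun m f hf => ?_⟩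
  rw [mul_assoc]
  refine h _ _ ⟨fun k hk => ?_, fun k => h' _ _ ⟨fun p hp => hf.1 _ fun h => hp ⟨_, h, rfl⟩,
    fun p => hf.2 _⟩⟩
  rw [curryCrossed_eq, show sliceCc f k = 0 by
    ext p; exact hf.1 _ fun h => hk ⟨_, h, rfl⟩, map_zero]

lemma curryCrossed_tensorCc (χ : C_c(D, ℝ)) (f : C_c(G × X, A)) :
    curryCrossed μ (translationAction α X) (tensorCc χ f) = tensorConst χ (inclₗ μ α X f) := by
  ext1 k
  rw [curryCrossed_eq]
  change _ = χ k • inclₗ μ α X f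
  rw [← LinearMap.map_smul_of_tower]
  rfl

/-- Density in two stages: functions on `D` are approximated by sums of scalar functions times fixed
elements, and those elements may be taken in the dense image of C_c(G × X, A). -/
lemma dense_span_inclItₗ_tensorCc [LocallyCompactSpace X] [T2Space X] :
    Dense (Submodule.span ℂ {z | ∃ χ f, z = inclItₗ μ α hi ν (tensorCc χ f)} :
      Set (CrossedProduct ν (rightDualAction μ α hi))) := by
  intro T
  refine CrossedProduct.denseRange_ofCc.induction_on T isClosed_closure fun h => ?_
  refine mem_closure_of_tensorConst_mem (CrossedProduct.inductivelyContinuous_ofCc _ ν)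
    (denseRange_inclₗ (μ := μ) (α := α) (X := X)) _ ?_ h
  rintro χ _ ⟨f, rfl⟩
  rw [← curryCrossed_tensorCc, ← inclItₗ_apply]
  exact Submodule.subset_span ⟨χ, f, rfl⟩

lemma denseRange_inclItₗ [LocallyCompactSpace X] [T2Space X] :
    DenseRange (inclItₗ μ α hi ν) := by
  refine (dense_span_inclItₗ_tensorCc (μ := μ) (α := α) hi (ν := ν)).mono ?_
  refine fun z hz => (Submodule.span_le (p := LinearMap.range (inclItₗ μ α hi ν))).2 ?_ hz
  rintro _ ⟨χ, f, rfl⟩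
  exact ⟨_, rfl⟩

end RightTranslation

/-! ### The square root of the modular function -/

section SqrtModular

variable {D : Type*} [Group D] [TopologicalSpace D] [IsTopologicalGroup D] [LocallyCompactSpace D]
  [MeasurableSpace D] [BorelSpace D] (ν : Measure D) [ν.IsHaarMeasure]

/-- The square root of the modular function. -/
def sqrtModular (k : D) : ℝ := modularFn ν k ^ (1 / 2 : ℝ)

lemma sqrtModular_pos (k : D) : 0 < sqrtModular ν k := Real.rpow_pos_of_pos (modularFn_pos ν k) _

lemma sqrtModular_mul (k l : D) : sqrtModular ν (k * l) = sqrtModular ν k * sqrtModular ν l := by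
  rw [sqrtModular, modularFn_mul, Real.mul_rpow (modularFn_pos ν k).le (modularFn_pos ν l).le]; rfl

lemma sqrtModular_one : sqrtModular ν (1 : D) = 1 := by
  rw [sqrtModular, modularFn_one, Real.one_rpow]

lemma sqrtModular_inv (k : D) : sqrtModular ν k⁻¹ = (sqrtModular ν k)⁻¹ := by
  rw [sqrtModular, modularFn_inv, Real.inv_rpow (modularFn_pos ν k).le]; rfl

lemma sqrtModular_mul_self (k : D) : sqrtModular ν k * sqrtModular ν k = modularFn ν k := by
  rw [sqrtModular, ← Real.rpow_add (modularFn_pos ν k)]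
  norm_num

lemma continuous_sqrtModular [T2Space D] [ν.Regular] : Continuous (sqrtModular ν : D → ℝ) :=
  (continuous_modularFn ν).rpow_const fun k => Or.inl (modularFn_pos ν k).ne'

lemma rpow_neg_half_modularFn (k : D) :
    modularFn ν k ^ (-(1 / 2) : ℝ) = (sqrtModular ν k)⁻¹ :=
  Real.rpow_neg (modularFn_pos ν k).le _

end SqrtModular

section Family

variable {G : Type v} [Group G] [TopologicalSpace G] [IsTopologicalGroup G]
  [MeasurableSpace G] [BorelSpace G] {μ : Measure G} [IsFiniteMeasureOnCompacts μ]
  {A : Type u} [NonUnitalCStarAlgebra A] {α : CStarAction G A}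
  {X : Type w} [TopologicalSpace X] [MulAction G X] [ContinuousSMul G X]

lemma continuous_tconv_family {Z : Type*} [TopologicalSpace Z] {F H : Z → G × X → A}
    (hF : Continuous fun p : Z × G × X => F p.1 p.2)
    (hH : Continuous fun p : Z × G × X => H p.1 p.2) {C : Set G} (hC : IsCompact C)
    (h : ∀ z r s, r ∉ C → F z (r, s) = 0) :
    Continuous fun p : Z × G × X => tconv μ α (F p.1) (H p.1) p.2 := by
  refine continuous_integral_of_compact_support' μ
    (F := fun (p : Z × G × X) t => F p.1 (t, p.2.2) * α.act t (H p.1 (t⁻¹ * p.2.1, t⁻¹ • p.2.2)))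
    ?_ hC fun z t ht => by rw [h _ _ _ ht, zero_mul]
  exact (hF.comp (show Continuous fun z : (Z × G × X) × G => (z.1.1, (z.2, z.1.2.2)) by
    fun_prop)).mul (α.continuous_act_comp continuous_snd (hH.comp (show Continuous
      fun z : (Z × G × X) × G => (z.1.1, (z.2⁻¹ * z.1.2.1, z.2⁻¹ • z.1.2.2)) by fun_prop)))

end Family

/-! ### Orbit maps, pull-backs and integration over orbits -/

section OrbitMaps

variable {G : Type v} [Group G] [TopologicalSpace G] [IsTopologicalGroup G] [LocallyCompactSpace G]
  [T2Space G] [MeasurableSpace G] [BorelSpace G] {μ : Measure G} [μ.IsHaarMeasure] [μ.Regular]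
  {A : Type u} [NonUnitalCStarAlgebra A] {α : CStarAction G A}
  {X : Type w} [Group X] [TopologicalSpace X] [IsTopologicalGroup X] [LocallyCompactSpace X]
  [T2Space X] [MulAction G X] [ContinuousSMul G X] [IsScalarTower G X X]
  {D : Type*} [Group D] [TopologicalSpace D] [IsTopologicalGroup D] [LocallyCompactSpace D]
  [T2Space D] [MeasurableSpace D] [BorelSpace D] {ν : Measure D} [ν.IsHaarMeasure] [ν.Regular]
  {i : D →* X} (hi : IsClosedEmbedding i)

include hi in
-- Such a k has i(k) = s⁻¹(s i(k)) in V⁻¹W, and preimages of compact sets under a closed embedding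
-- are compact. This is properness of the action of `D` on `X`.
lemma exists_compact_of_mul_mem {V W : Set X} (hV : IsCompact V) (hW : IsCompact W) :
    ∃ S : Set D, IsCompact S ∧ ∀ s ∈ V, ∀ k, s * i k ∈ W → k ∈ S := by
  refine ⟨i ⁻¹' ((fun p : X × X => p.1⁻¹ * p.2) '' V ×ˢ W),
    hi.isCompact_preimage ((hV.prod hW).image (by fun_prop)), fun s hs k hk => ?_⟩
  exact ⟨(s, s * i k), ⟨hs, hk⟩, by simp⟩

variable (ν i) in
/-- Integration of a function on `G × X` over the orbits of `D`. -/
def orbitIntegral (f : G × X → A) (p : G × X) : A := ∫ k, f (p.1, p.2 * i k) ∂ν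

include hi in
lemma orbitIntegral_vanish {f : G × X → A} (hf : IsCompactlySupported f) {V : Set X}
    (hV : IsCompact V) :
    ∃ S : Set D, IsCompact S ∧ ∀ r, ∀ s ∈ V, ∀ k ∉ S, f (r, s * i k) = 0 := by
  obtain ⟨S, hS, h0⟩ := hf.exists_compact
  obtain ⟨T, hT, h1⟩ := exists_compact_of_mul_mem hi hV (hS.image continuous_snd)
  exact ⟨T, hT, fun r s hs k hk => h0 _ fun h => hk (h1 s hs k ⟨_, h, rfl⟩)⟩

include hi in
lemma integrable_orbitIntegral {f : G × X → A} (hf : IsCompactlySupported f) (r : G) (s : X) :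
    Integrable (fun k => f (r, s * i k)) ν := by
  obtain ⟨S, hS, h0⟩ := orbitIntegral_vanish hi hf (isCompact_singleton (x := s))
  exact integrable_of_continuous_of_vanish ν (hf.continuous.comp
    (continuous_const.prodMk (continuous_const.mul hi.continuous))) hS (h0 r s rfl)

include hi in
lemma IsCompactlySupported.orbitIntegral {f : G × X → A} (hf : IsCompactlySupported f) :
    IsFiberCompact (orbitIntegral ν i f) := by
  refine ⟨?_, ?_⟩
  · refine continuous_integral_of_locally_compact_support ν
      (F := fun (p : G × X) k => f (p.1, p.2 * i k)) ?_ fun p => ?_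
    · have := hi.continuous
      exact hf.continuous.comp (by fun_prop)
    · obtain ⟨V, hV, hpV⟩ := exists_compact_mem_nhds p.2
      obtain ⟨S, hS, h0⟩ := orbitIntegral_vanish hi hf hV
      exact ⟨Prod.snd ⁻¹' V, continuous_snd.continuousAt.preimage_mem_nhds hpV, S, hS,
        fun z hz k hk => h0 _ _ hz _ hk⟩
  · obtain ⟨C, hC, h0⟩ := hf.isFiberCompact.exists_compact
    exact ⟨C, hC, fun r s hr => integral_eq_zero_of_ae (Eventually.of_forall fun k => h0 _ _ hr)⟩

variable {Y : Type*} [TopologicalSpace Y] [LocallyCompactSpace Y] [T2Space Y] [MulAction G Y]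
  [ContinuousSMul G Y]

variable (G) in
/-- `q` is the equivariant quotient map by the right translation action of `D` along `i`. -/
structure IsOrbitMap (i : D →* X) (q : X → Y) : Prop where
  isClosedEmbedding : IsClosedEmbedding i
  isOpenQuotientMap : IsOpenQuotientMap q
  map_smul : ∀ (t : G) x, q (t • x) = t • q x
  map_mul : ∀ x k, q (x * i k) = q x
  exists_eq_mul : ∀ x y, q x = q y → ∃ k, y = x * i k

/-- The pull-back of a function on `G × Y` to `G × X`. -/
def pullback (q : X → Y) (b : G × Y → A) (p : G × X) : A := b (p.1, q p.2)

lemma orbitIntegral_mul (f : G × X → A) (r : G) (s : X) (k : D) :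
    orbitIntegral ν i f (r, s * i k) = orbitIntegral ν i f (r, s) := by
  refine Eq.trans ?_ (integral_mul_left_eq_self (fun m => f (r, s * i m)) k)
  simp only [orbitIntegral, map_mul, mul_assoc]

variable {q : X → Y} (hq : IsOrbitMap G i q)

namespace IsOrbitMap

include hq

lemma isOpenQuotientMap_prodMap : IsOpenQuotientMap (Prod.map (id : G → G) q) :=
  IsOpenQuotientMap.id.prodMap hq.isOpenQuotientMap

lemma isFiberCompact_pullback {b : G × Y → A} (hb : IsFiberCompact b) :
    IsFiberCompact (pullback q b) := by
  obtain ⟨C, hC, h0⟩ := hb.exists_compact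
  exact ⟨hb.continuous.comp hq.isOpenQuotientMap_prodMap.continuous, C, hC,
    fun r s hr => h0 r _ hr⟩

lemma tconv_pullback (b c : G × Y → A) :
    tconv μ α (pullback q b) (pullback q c) = pullback q (tconv μ α b c) := by
  ext ⟨r, s⟩
  simp only [tconv, pullback, hq.map_smul]

lemma tstar_pullback (b : G × Y → A) :
    tstar μ α (pullback q b) = pullback q (tstar μ α b) := by
  ext ⟨r, s⟩
  simp only [tstar, pullback, hq.map_smul]

lemma pullback_injective {b c : G × Y → A} (h : pullback q b = pullback q c) : b = c := by
  ext ⟨r, y⟩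
  obtain ⟨s, rfl⟩ := hq.isOpenQuotientMap.surjective y
  exact congrFun h (r, s)

variable (ν) in
-- Left invariance of `ν` makes the orbit integral constant on orbits, so it factors through q.
-- Continuity descends because id × q is a quotient map, and the support lies in the image of a
-- compact set.
lemma exists_descent {f : G × X → A} (hf : IsCompactlySupported f) :
    ∃ b : C_c(G × Y, A), pullback q b = orbitIntegral ν i f := by
  have hs := hq.isOpenQuotientMap.surjective
  let b : G × Y → A := fun p => orbitIntegral ν i f (p.1, Function.surjInv hs p.2)
  have hb : pullback q b = orbitIntegral ν i f := by
    ext ⟨r, s⟩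
    obtain ⟨k, hk⟩ := hq.exists_eq_mul s (Function.surjInv hs (q s)) (Function.surjInv_eq hs _).symm
    change orbitIntegral ν i f (r, Function.surjInv hs (q s)) = _
    rw [hk, orbitIntegral_mul]
  have hbc : Continuous b := by
    rw [hq.isOpenQuotientMap_prodMap.isQuotientMap.continuous_iff]
    change Continuous (pullback q b)
    rw [hb]
    exact (hf.orbitIntegral hq.isClosedEmbedding).continuous
  obtain ⟨S, hS, h0⟩ := hf.exists_compact
  refine ⟨mkCc b hbc ⟨Prod.map id q '' S, hS.image hq.isOpenQuotientMap_prodMap.continuous, ?_⟩, hb⟩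
  rintro ⟨r, y⟩ hp
  obtain ⟨s, rfl⟩ := hs y
  change pullback q b (r, s) = 0
  rw [hb]
  refine integral_eq_zero_of_ae (Eventually.of_forall fun k => h0 _ fun h => hp ⟨_, h, ?_⟩)
  simp [hq.map_mul]

variable (ν) in
/-- The function on `G × Y` obtained by integrating over the orbits of `D`. -/
def descend {f : G × X → A} (hf : IsCompactlySupported f) : C_c(G × Y, A) :=
  (hq.exists_descent ν hf).choose

lemma pullback_descend {f : G × X → A} (hf : IsCompactlySupported f) :
    pullback q (hq.descend ν hf) = orbitIntegral ν i f :=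
  (hq.exists_descent ν hf).choose_spec

lemma descend_apply {f : G × X → A} (hf : IsCompactlySupported f) (r : G) (s : X) :
    hq.descend ν hf (r, q s) = ∫ k, f (r, s * i k) ∂ν :=
  congrFun (hq.pullback_descend hf) (r, s)

lemma eq_of_pullback_eq {b c : C_c(G × Y, A)} (h : pullback q b = pullback q c) : b = c :=
  DFunLike.coe_injective (hq.pullback_injective h)

/-- A pull-back is constant along orbits and can be taken out of the integral over `D`; this gives
⟨x, y·b⟩R = ⟨x,y⟩R b. -/
lemma orbitIntegral_tconv_pullback {f : G × X → A} (hf : IsCompactlySupported f) {b : G × Y → A}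
    (hb : IsFiberCompact b) :
    orbitIntegral ν i (tconv μ α f (pullback q b)) =
      tconv μ α (orbitIntegral ν i f) (pullback q b) := by
  ext ⟨r, s⟩
  obtain ⟨C, hC, hC0⟩ := hf.isFiberCompact.exists_compact
  obtain ⟨S, hS, h0⟩ := orbitIntegral_vanish hq.isClosedEmbedding hf (isCompact_singleton (x := s))
  rw [orbitIntegral, tconv]
  have e : ∀ k, tconv μ α f (pullback q b) (r, s * i k) = ∫ t, f (t, s * i k) *
      α.act t (pullback q b (t⁻¹ * r, t⁻¹ • s)) ∂μ := fun k => by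
    simp only [tconv, pullback, hq.map_mul, hq.map_smul]
  rw [integral_congr_ae (Eventually.of_forall e),
    integral_swap_of_vanish (S := S) (S' := C) ν μ ?_ hS hC]
  · refine integral_congr_ae (Eventually.of_forall fun t => ?_)
    exact integral_mul_const_of_integrable (integrable_orbitIntegral hq.isClosedEmbedding hf t s)
  · intro k t hk
    rw [h0 _ _ rfl _ hk, zero_mul]
  · intro k t ht
    rw [hC0 _ _ ht, zero_mul]
  · have := hq.isClosedEmbedding.continuous
    exact (hf.continuous.comp (show Continuous fun p : D × G => (p.2, s * i p.1) by fun_prop)).mul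
      (α.continuous_act_comp continuous_snd ((hq.isFiberCompact_pullback hb).continuous.comp
        (show Continuous fun p : D × G => (p.2⁻¹ * r, p.2⁻¹ • s) by fun_prop)))

/-- The involution acts through `G` on the left and commutes with right translation by `D`. -/
lemma orbitIntegral_tstar {f : G × X → A} (hf : IsCompactlySupported f) :
    orbitIntegral ν i (tstar μ α f) = tstar μ α (orbitIntegral ν i f) := by
  ext ⟨r, s⟩
  rw [tstar_apply, orbitIntegral, orbitIntegral, ← integral_star_comm, ← starHomCLM_apply,
    ← ContinuousLinearMap.integral_comp_comm, ← integral_smul]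
  · refine integral_congr_ae (Eventually.of_forall fun k => ?_)
    simp only [tstar_apply, starHomCLM_apply, smul_mul_assoc]
  · exact integrable_star (integrable_orbitIntegral hq.isClosedEmbedding hf _ _)

end IsOrbitMap

end OrbitMaps

section ConvolutionAlgebra

variable {G : Type v} [Group G] [TopologicalSpace G] [IsTopologicalGroup G] [LocallyCompactSpace G]
  [T2Space G] [MeasurableSpace G] [BorelSpace G] {μ : Measure G} [μ.IsHaarMeasure] [μ.Regular]
  {A : Type u} [NonUnitalCStarAlgebra A] {α : CStarAction G A}
  {X : Type w} [TopologicalSpace X] [T2Space X] [MulAction G X] [ContinuousSMul G X]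

variable (μ α) in
/-- The involution on `C_c(G × X, A)`. -/
def starCc (x : C_c(G × X, A)) : C_c(G × X, A) :=
  ((isCompactlySupported_coe x).tstar (μ := μ) (α := α)).toCc

lemma coe_starCc (x : C_c(G × X, A)) : ⇑(starCc μ α x) = tstar μ α x := rfl

lemma starCc_starCc (x : C_c(G × X, A)) : starCc μ α (starCc μ α x) = x :=
  DFunLike.coe_injective (tstar_tstar x)

lemma inclₗ_starCc (x : C_c(G × X, A)) : inclₗ μ α X (starCc μ α x) = star (inclₗ μ α X x) :=
  (inclₗ_star fun _ => rfl).symm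

variable (μ α) in
/-- Convolution on `C_c(G × X, A)`. -/
def convCc (x y : C_c(G × X, A)) : C_c(G × X, A) :=
  ((isCompactlySupported_coe x).tconv_left (μ := μ) (α := α)
    (isCompactlySupported_coe y).isFiberCompact).toCc

lemma coe_convCc (x y : C_c(G × X, A)) : ⇑(convCc μ α x y) = tconv μ α x y := rfl

lemma inclₗ_convCc (x y : C_c(G × X, A)) :
    inclₗ μ α X (convCc μ α x y) = inclₗ μ α X x * inclₗ μ α X y :=
  (inclₗ_mul fun _ => rfl).symm

end ConvolutionAlgebra

/-! ### The left action and the left inner product -/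

section BimoduleOperations

variable {G : Type v} [Group G] [TopologicalSpace G] [IsTopologicalGroup G] [LocallyCompactSpace G]
  [T2Space G] [MeasurableSpace G] [BorelSpace G] {μ : Measure G} [μ.IsHaarMeasure] [μ.Regular]
  {A : Type u} [NonUnitalCStarAlgebra A] {α : CStarAction G A}
  {X : Type w} [Group X] [TopologicalSpace X] [IsTopologicalGroup X] [LocallyCompactSpace X]
  [T2Space X] [MulAction G X] [ContinuousSMul G X] [IsScalarTower G X X]
  {D : Type*} [Group D] [TopologicalSpace D] [IsTopologicalGroup D] [LocallyCompactSpace D]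
  [T2Space D] [MeasurableSpace D] [BorelSpace D] {ν : Measure D} [ν.IsHaarMeasure] [ν.Regular]
  {i : D →* X} (hi : IsClosedEmbedding i)

variable (μ α i) in
/-- The convolution of `f` with the right translates of `g`. -/
def tconvRtrans (f g : G × X → A) (p : D × G × X) : A := tconv μ α f (rtrans (i p.1) g) p.2

include hi in
lemma continuous_tconvRtrans {f g : G × X → A} (hf : IsFiberCompact f) (hg : Continuous g) :
    Continuous (tconvRtrans μ α i f g) := by
  obtain ⟨C, hC, h0⟩ := hf.exists_compact
  have := hi.continuous
  exact continuous_tconv_family (F := fun _ : D => f) (H := fun k => rtrans (i k) g)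
    (hf.continuous.comp continuous_snd)
    (hg.comp (show Continuous fun p : D × G × X => (p.2.1, p.2.2 * i p.1) by fun_prop)) hC
    fun _ => h0

include hi in
-- A nonzero integrand puts both s and s i(k) into fixed compact sets, so properness confines k. The
-- resulting compact set depends only on the supports of f and g, as boundedness of the pairing
-- requires.
lemma tconvRtrans_vanish {S₀ S : Set (G × X)} (hS₀ : IsCompact S₀)
    (hS : IsCompact S) : ∃ S' : Set (D × G × X), IsCompact S' ∧ ∀ f g : G × X → A,
      (∀ p ∉ S₀, f p = 0) → (∀ p ∉ S, g p = 0) → ∀ p ∉ S', tconvRtrans μ α i f g p = 0 := by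
  obtain ⟨T, hT, h1⟩ := exists_compact_of_mul_mem hi (hS₀.image continuous_snd)
    (((hS₀.image continuous_fst).prod (hS.image continuous_snd)).image
      (show Continuous fun p : G × X => p.1 • p.2 by fun_prop))
  refine ⟨T ×ˢ ((fun q : (G × X) × G => (q.1.1 * q.2, q.1.2)) '' (S₀ ×ˢ (Prod.fst '' S))),
    hT.prod ((hS₀.prod (hS.image continuous_fst)).image (by fun_prop)), ?_⟩
  rintro f g h0 hg ⟨k, r, s⟩ hp
  rw [Set.mem_prod, not_and_or] at hp
  rcases hp with hk | hrs
  · refine integral_eq_zero_of_ae (Eventually.of_forall fun t => ?_)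
    by_cases h2 : (t, s) ∈ S₀
    · by_cases h3 : (t⁻¹ * r, t⁻¹ • s * i k) ∈ S
      · refine (hk (h1 s ⟨(t, s), h2, rfl⟩ k ?_)).elim
        exact ⟨(t, t⁻¹ • s * i k), ⟨⟨(t, s), h2, rfl⟩, ⟨_, h3, rfl⟩⟩, by simp [← smul_mul_assoc]⟩
      · simp [rtrans, hg _ h3]
    · simp [h0 _ h2]
  · exact tconv_apply_eq_zero_of_left (C := Prod.fst '' S) (g := rtrans (i k) g) h0
      (fun a b ha => hg _ fun h => ha ⟨_, h, rfl⟩) hrs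

include hi in
lemma IsCompactlySupported.tconvRtrans {f g : G × X → A} (hf : IsCompactlySupported f)
    (hg : IsCompactlySupported g) : IsCompactlySupported (tconvRtrans μ α i f g) := by
  obtain ⟨S, hS, h0⟩ := hg.exists_compact
  obtain ⟨S₀, hS₀, h0'⟩ := hf.exists_compact
  obtain ⟨S', hS', h1⟩ := tconvRtrans_vanish (μ := μ) (α := α) hi hS₀ hS
  exact ⟨continuous_tconvRtrans hi hf.isFiberCompact hg.continuous, S', hS', h1 f g h0' h0⟩

variable (ν) in
include hi in
lemma isCompactlySupported_sqrtModular_smul {f g : G × X → A} (hf : IsCompactlySupported f)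
    (hg : IsCompactlySupported g) : IsCompactlySupported
      fun p => (sqrtModular ν p.1)⁻¹ • tconvRtrans μ α i f g p := by
  have h := hf.tconvRtrans (μ := μ) (α := α) hi hg
  obtain ⟨S, hS, h0⟩ := h.exists_compact
  refine ⟨?_, S, hS, fun p hp => by rw [h0 p hp, smul_zero]⟩
  exact (((continuous_sqrtModular ν).comp continuous_fst).inv₀
    fun p => (sqrtModular_pos ν p.1).ne').smul h.continuous

variable (μ α ν) in
/-- The function `(k, r, s) ↦ Δ(k)^(-1/2) (x * β_k(y))(r, s)`. -/
def twistedConv (x y : C_c(G × X, A)) : C_c(D × G × X, A) :=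
  (isCompactlySupported_sqrtModular_smul (μ := μ) (α := α) ν hi (isCompactlySupported_coe x)
    (isCompactlySupported_coe y)).toCc

lemma twistedConv_apply (x y : C_c(G × X, A)) (k : D) (r : G) (s : X) :
    twistedConv μ α ν hi x y (k, r, s) =
      (sqrtModular ν k)⁻¹ • tconv μ α x (rtrans (i k) y) (r, s) := rfl

/-- Right translation on `C_c(G × X, A)`. -/
def rtransCc (d : X) (x : C_c(G × X, A)) : C_c(G × X, A) :=
  ((isCompactlySupported_coe x).rtrans d).toCc

lemma inclₗ_rtransCc (k : D) (x : C_c(G × X, A)) :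
    inclₗ μ α X (rtransCc (i k) x) = (rightDualAction μ α hi).act k (inclₗ μ α X x) :=
  (rightDualAction_inclₗ hi k fun _ => rfl).symm

lemma inclₗ_sliceCc_twistedConv (x y : C_c(G × X, A)) (k : D) :
    inclₗ μ α X (sliceCc (twistedConv μ α ν hi x y) k) = (sqrtModular ν k)⁻¹ •
      (inclₗ μ α X x * (rightDualAction μ α hi).act k (inclₗ μ α X y)) := by
  rw [← inclₗ_rtransCc, ← inclₗ_convCc, ← LinearMap.map_smul_of_tower]
  rfl

variable (μ α ν) in
/-- The integrand of the left action. -/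
def lactFamily (i : D →* X) (c : C_c(D × G × X, A)) (x : C_c(G × X, A)) (k : D) : C_c(G × X, A) :=
  sqrtModular ν k • convCc μ α (sliceCc c k) (rtransCc (i k) x)

lemma lactFamily_apply (c : C_c(D × G × X, A)) (x : C_c(G × X, A)) (k : D) (p : G × X) :
    lactFamily μ α ν i c x k p =
      sqrtModular ν k • tconv μ α (sliceCc c k) (rtrans (i k) x) p := rfl

include hi in
lemma continuous_lactFamily (c : C_c(D × G × X, A)) (x : C_c(G × X, A)) :
    Continuous fun p : D × G × X => lactFamily μ α ν i c x p.1 p.2 := by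
  refine ((continuous_sqrtModular ν).comp continuous_fst).smul ?_
  have := hi.continuous
  obtain ⟨S, m, hS, -, h0⟩ := exists_boundedOn c
  refine continuous_tconv_family (F := fun k => ⇑(sliceCc c k)) (H := fun k => rtrans (i k) x)
    c.continuous (x.continuous.comp (show Continuous fun p : D × G × X =>
      (p.2.1, p.2.2 * i p.1) by fun_prop)) (hS.image (continuous_fst.comp continuous_snd)) ?_
  exact fun k r s hr => h0.1 _ fun h => hr ⟨_, h, rfl⟩

lemma exists_lactFamily_vanish (i : D →* X) (c : C_c(D × G × X, A)) (x : C_c(G × X, A)) :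
    ∃ (T : Set D) (S : Set (G × X)), IsCompact T ∧ IsCompact S ∧
      (∀ k ∉ T, lactFamily μ α ν i c x k = 0) ∧ ∀ k, ∀ p ∉ S, lactFamily μ α ν i c x k p = 0 := by
  obtain ⟨S, m, hS, -, h0⟩ := exists_boundedOn c
  obtain ⟨S', m', hS', -, h0'⟩ := exists_boundedOn x
  refine ⟨Prod.fst '' S, _, hS.image continuous_fst,
    ((hS.image continuous_snd).prod (hS'.image continuous_fst)).image
      (f := fun q : (G × X) × G => (q.1.1 * q.2, q.1.2)) (by fun_prop), fun k hk => ?_, ?_⟩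
  · ext p
    rw [lactFamily_apply, tconv, integral_eq_zero_of_ae (Eventually.of_forall fun t => ?_), smul_zero]
    · rfl
    · have : sliceCc c k (t, p.2) = 0 := h0.1 _ fun h => hk ⟨_, h, rfl⟩
      simp [this]
  · rintro k ⟨r, s⟩ hp
    rw [lactFamily_apply, tconv_apply_eq_zero_of_left (S := Prod.snd '' S) (C := Prod.fst '' S')
      (f := sliceCc c k) (g := rtrans (i k) x) (fun p hp => h0.1 (k, p) fun h => hp ⟨_, h, rfl⟩)
      (fun r s hr => h0'.1 _ fun h => hr ⟨_, h, rfl⟩) hp, smul_zero]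

lemma isCompactlySupported_integral_family {F : D → C_c(G × X, A)} {T : Set D} {S : Set (G × X)}
    (hF : Continuous fun p : D × G × X => F p.1 p.2) (hT : IsCompact T) (hS : IsCompact S)
    (h1 : ∀ k ∉ T, F k = 0) (h2 : ∀ k, ∀ p ∉ S, F k p = 0) :
    IsCompactlySupported fun p => ∫ k, F k p ∂ν := by
  have h3 : ∀ p, ∀ k ∉ T, F k p = 0 := fun p k hk => by
    rw [h1 k hk, CompactlySupportedContinuousMap.coe_zero, Pi.zero_apply]
  have h4 : Continuous fun p : (G × X) × D => F p.2 p.1 := hF.comp continuous_swap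
  have h5 : ∀ p ∉ S, ∫ k, F k p ∂ν = 0 := fun p hp =>
    integral_eq_zero_of_ae (Eventually.of_forall fun k => h2 k p hp)
  exact ⟨continuous_integral_of_compact_support' ν h4 hT h3, S, hS, h5⟩

include hi in
lemma isCompactlySupported_integral_lactFamily (c : C_c(D × G × X, A)) (x : C_c(G × X, A)) :
    IsCompactlySupported fun p => ∫ k, lactFamily μ α ν i c x k p ∂ν := by
  obtain ⟨T, S, hT, hS, h1, h2⟩ := exists_lactFamily_vanish (μ := μ) (α := α) (ν := ν) i c x
  exact isCompactlySupported_integral_family (continuous_lactFamily hi c x) hT hS h1 h2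

variable (μ α ν) in
/-- The left action of `C_c(D × G × X, A)` on `C_c(G × X, A)`. -/
def lactCc (c : C_c(D × G × X, A)) (x : C_c(G × X, A)) : C_c(G × X, A) :=
  (isCompactlySupported_integral_lactFamily (μ := μ) (α := α) (ν := ν) hi c x).toCc

lemma lactCc_apply (c : C_c(D × G × X, A)) (x : C_c(G × X, A)) (p : G × X) :
    lactCc μ α ν hi c x p = ∫ k, sqrtModular ν k •
      tconv μ α (sliceCc c k) (rtrans (i k) x) p ∂ν := rfl

/-- Inductively continuous maps commute with the integral defining the left action. -/
lemma InductivelyContinuous.map_lactCc {E : Type*} [NormedAddCommGroup E] [NormedSpace ℂ E]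
    [CompleteSpace E] {J : C_c(G × X, A) →ₗ[ℂ] E} (hJ : InductivelyContinuous J)
    (c : C_c(D × G × X, A)) (x : C_c(G × X, A)) :
    J (lactCc μ α ν hi c x) = ∫ k, sqrtModular ν k •
      J (convCc μ α (sliceCc c k) (rtransCc (i k) x)) ∂ν := by
  obtain ⟨T, S, hT, hS, h1, h2⟩ := exists_lactFamily_vanish (μ := μ) (α := α) (ν := ν) i c x
  rw [hJ.map_integral ν (continuous_lactFamily hi c x) hT h1 hS h2 (lactCc μ α ν hi c x)
    fun p => rfl]
  simp only [lactFamily, LinearMap.map_smul_of_tower]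

lemma inclₗ_lactCc (c : C_c(D × G × X, A)) (x : C_c(G × X, A)) :
    inclₗ μ α X (lactCc μ α ν hi c x) = ∫ k, sqrtModular ν k • (inclₗ μ α X (sliceCc c k) *
      (rightDualAction μ α hi).act k (inclₗ μ α X x)) ∂ν := by
  rw [inductivelyContinuous_inclₗ.map_lactCc hi]
  simp only [inclₗ_convCc, inclₗ_rtransCc hi]

variable (μ α ν) in
/-- The left inner product on `C_c(G × X, A)`. -/
def linnerCc (x y : C_c(G × X, A)) : C_c(D × G × X, A) := twistedConv μ α ν hi x (starCc μ α y)

lemma inclₗ_sliceCc_linnerCc (x y : C_c(G × X, A)) (k : D) :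
    inclₗ μ α X (sliceCc (linnerCc μ α ν hi x y) k) = (sqrtModular ν k)⁻¹ •
      (inclₗ μ α X x * (rightDualAction μ α hi).act k (star (inclₗ μ α X y))) := by
  rw [linnerCc, inclₗ_sliceCc_twistedConv, inclₗ_starCc]

lemma linnerCc_add_left (x y z : C_c(G × X, A)) :
    linnerCc μ α ν hi (x + y) z = linnerCc μ α ν hi x z + linnerCc μ α ν hi y z := by
  ext ⟨k, r, s⟩
  rw [CompactlySupportedContinuousMap.add_apply, linnerCc, linnerCc, linnerCc, twistedConv_apply,
    twistedConv_apply, twistedConv_apply, ← smul_add]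
  congr 1
  exact congrFun (tconv_add_left (isCompactlySupported_coe x).isFiberCompact
    (isCompactlySupported_coe y).isFiberCompact
    ((isCompactlySupported_coe (starCc μ α z)).rtrans (i k)).continuous) (r, s)

lemma linnerCc_smul_left (c : ℂ) (x y : C_c(G × X, A)) :
    linnerCc μ α ν hi (c • x) y = c • linnerCc μ α ν hi x y := by
  ext ⟨k, r, s⟩
  rw [CompactlySupportedContinuousMap.smul_apply, linnerCc, linnerCc, twistedConv_apply,
    twistedConv_apply, smul_comm]
  congr 1
  exact congrFun (tconv_smul_left c (x : G × X → A) _) (r, s)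

/-- At k⁻¹ the weight is Δ(k)^{1/2}, and the factor Δ(k)⁻¹ of the involution turns it back into
Δ(k)^{-1/2}: the exponent is chosen to make the inner product Hermitian. -/
lemma star_inclItₗ_linnerCc (x y : C_c(G × X, A)) :
    star (inclItₗ μ α hi ν (linnerCc μ α ν hi x y)) = inclItₗ μ α hi ν (linnerCc μ α ν hi y x) := by
  refine inclItₗ_star hi fun k => ?_
  have e : ∀ z, star ((rightDualAction μ α hi).act k⁻¹ (star z)) =
    (rightDualAction μ α hi).act k⁻¹ z := fun z => by rw [← map_star, star_star]
  rw [inclₗ_sliceCc_linnerCc, inclₗ_sliceCc_linnerCc, sqrtModular_inv, inv_inv, star_smul,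
    star_trivial (sqrtModular ν k), starHom_real_smul, star_mul, e, map_mul, ← CStarAction.act_mul,
    mul_inv_cancel, CStarAction.act_one, smul_smul, ← sqrtModular_mul_self, mul_inv, mul_assoc,
    inv_mul_cancel₀ (sqrtModular_pos ν k).ne', mul_one]

include hi in
lemma integrable_inclₗ_lactFamily (c : C_c(D × G × X, A)) (x : C_c(G × X, A)) :
    Integrable (fun k => inclₗ μ α X (lactFamily μ α ν i c x k)) ν := by
  obtain ⟨T, S, hT, hS, h1, h2⟩ := exists_lactFamily_vanish (μ := μ) (α := α) (ν := ν) i c x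
  exact integrable_of_continuous_of_vanish ν (inductivelyContinuous_inclₗ.continuous_family
    (continuous_lactFamily hi c x) hT h1 hS h2) hT fun k hk => by rw [h1 k hk, map_zero]

lemma inclₗ_lactFamily (c : C_c(D × G × X, A)) (x : C_c(G × X, A)) (k : D) :
    inclₗ μ α X (lactFamily μ α ν i c x k) = sqrtModular ν k • (inclₗ μ α X (sliceCc c k) *
      (rightDualAction μ α hi).act k (inclₗ μ α X x)) := by
  rw [lactFamily, LinearMap.map_smul_of_tower, inclₗ_convCc, inclₗ_rtransCc hi]

/-- Since Δ(m⁻¹k)^{-1/2} = Δ(m)^{1/2}Δ(k)^{-1/2}, the weight Δ(m)^{1/2} in the action is the one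
that makes this inner product L-linear; the rest is multiplicativity of β_m. -/
lemma inclItₗ_linnerCc_lactCc (c : C_c(D × G × X, A)) (x y : C_c(G × X, A)) :
    inclItₗ μ α hi ν (linnerCc μ α ν hi (lactCc μ α ν hi c x) y) =
      inclItₗ μ α hi ν c * inclItₗ μ α hi ν (linnerCc μ α ν hi x y) := by
  refine (inclItₗ_mul hi fun k => ?_).symm
  have h := integrable_inclₗ_lactFamily (μ := μ) (α := α) (ν := ν) hi c x
  simp only [inclₗ_lactFamily hi] at h
  rw [inclₗ_sliceCc_linnerCc, inclₗ_lactCc, ← integral_mul_const_of_integrable h, ← integral_smul]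
  refine integral_congr_ae (Eventually.of_forall fun m => ?_)
  simp only []
  rw [inclₗ_sliceCc_linnerCc, starHom_real_smul, map_mul, ← CStarAction.act_mul,
    mul_inv_cancel_left, sqrtModular_mul, sqrtModular_inv, mul_inv, inv_inv, mul_smul_comm,
    smul_mul_assoc, smul_smul, mul_comm (sqrtModular ν m), mul_assoc]

end BimoduleOperations

/-! ### The right action and the right inner product -/

section RightOperations

variable {G : Type v} [Group G] [TopologicalSpace G] [IsTopologicalGroup G] [LocallyCompactSpace G]
  [T2Space G] [MeasurableSpace G] [BorelSpace G] {μ : Measure G} [μ.IsHaarMeasure] [μ.Regular]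
  {A : Type u} [NonUnitalCStarAlgebra A] {α : CStarAction G A}
  {X : Type w} [Group X] [TopologicalSpace X] [IsTopologicalGroup X] [LocallyCompactSpace X]
  [T2Space X] [MulAction G X] [ContinuousSMul G X] [IsScalarTower G X X]
  {D : Type*} [Group D] [TopologicalSpace D] [IsTopologicalGroup D] [LocallyCompactSpace D]
  [T2Space D] [MeasurableSpace D] [BorelSpace D] {ν : Measure D} [ν.IsHaarMeasure] [ν.Regular]
  {i : D →* X}
  {Y : Type w} [TopologicalSpace Y] [LocallyCompactSpace Y] [T2Space Y] [MulAction G Y]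
  [ContinuousSMul G Y] {q : X → Y}

lemma tconv_real_smul_left (c : ℝ) (f g : G × X → A) :
    tconv μ α (c • f) g = c • tconv μ α f g := by
  ext ⟨r, s⟩
  rw [Pi.smul_apply, tconv_apply, tconv_apply, ← integral_smul]
  simp [smul_mul_assoc]

/-- Fubini for the outer integral and the convolution integral. While t stays in the compact
projection of the support of x, the point t⁻¹s stays in a compact subset of `X`, so supports of the
family need only be controlled over compact sets. -/
lemma integral_tconv_family {Z : Type*} [TopologicalSpace Z] [R1Space Z] [MeasurableSpace Z]
    [OpensMeasurableSpace Z] (κ : Measure Z) [IsFiniteMeasureOnCompacts κ] {x : G × X → A}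
    (hx : IsFiberCompact x) {H : Z → G × X → A} (hH : Continuous fun p : Z × G × X => H p.1 p.2)
    (h0 : ∀ V : Set X, IsCompact V → ∃ S, IsCompact S ∧ ∀ z ∉ S, ∀ r, ∀ s ∈ V, H z (r, s) = 0)
    (p : G × X) :
    ∫ z, tconv μ α x (H z) p ∂κ = tconv μ α x (fun p => ∫ z, H z p ∂κ) p := by
  obtain ⟨r, s⟩ := p
  obtain ⟨C, hC, hC0⟩ := hx.exists_compact
  obtain ⟨S, hS, h0⟩ := h0 ((fun t : G => t⁻¹ • s) '' C) (hC.image (by fun_prop))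
  simp only [tconv_apply]
  rw [integral_swap_of_vanish (S := S) (S' := C) κ μ ?_ hS hC]
  · refine integral_congr_ae (Eventually.of_forall fun t => ?_)
    by_cases ht : t ∈ C
    · have hI : Integrable (fun z => H z (t⁻¹ * r, t⁻¹ • s)) κ :=
        integrable_of_continuous_of_vanish κ (hH.comp (continuous_id.prodMk continuous_const)) hS
          fun z hz => h0 z hz _ _ ⟨t, ht, rfl⟩
      simp only
      rw [← starHomCLM_apply, ← ContinuousLinearMap.integral_comp_comm _ hI,
        ← integral_const_mul_of_integrable (ContinuousLinearMap.integrable_comp _ hI)]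
      rfl
    · simp only [hC0 t s ht, zero_mul, integral_zero]
  · intro z t hz
    by_cases ht : t ∈ C
    · rw [h0 z hz _ _ ⟨t, ht, rfl⟩, map_zero, mul_zero]
    · rw [hC0 _ _ ht, zero_mul]
  · intro z t ht
    rw [hC0 _ _ ht, zero_mul]
  · exact (hx.continuous.comp (show Continuous fun p : Z × G => (p.2, s) by fun_prop)).mul
      (α.continuous_act_comp continuous_snd (hH.comp
        (show Continuous fun p : Z × G => (p.1, p.2⁻¹ * r, p.2⁻¹ • s) by fun_prop)))

lemma integral_tconv_rtrans (hi : IsClosedEmbedding i) {x f : G × X → A} (hx : IsFiberCompact x)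
    (hf : IsCompactlySupported f) (p : G × X) :
    ∫ k, tconv μ α x (rtrans (i k) f) p ∂ν = tconv μ α x (orbitIntegral ν i f) p := by
  have := hi.continuous
  refine integral_tconv_family ν hx (hf.continuous.comp
    (show Continuous fun p : D × G × X => (p.2.1, p.2.2 * i p.1) by fun_prop)) (fun V hV => ?_) p
  obtain ⟨S, hS, h⟩ := orbitIntegral_vanish hi hf hV
  exact ⟨S, hS, fun k hk r s hs => h r s hs k hk⟩

namespace IsOrbitMap

variable (hq : IsOrbitMap G i q)

variable (μ α) in
/-- The right action of `C_c(G × Y, A)` on `C_c(G × X, A)`. -/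
def ractCc (x : C_c(G × X, A)) (b : C_c(G × Y, A)) : C_c(G × X, A) :=
  ((isCompactlySupported_coe x).tconv_left (μ := μ) (α := α)
    (hq.isFiberCompact_pullback (isCompactlySupported_coe b).isFiberCompact)).toCc

lemma coe_ractCc (x : C_c(G × X, A)) (b : C_c(G × Y, A)) :
    ⇑(hq.ractCc μ α x b) = tconv μ α x (pullback q b) := rfl

lemma isCompactlySupported_tstar_tconv (x y : C_c(G × X, A)) :
    IsCompactlySupported (tconv μ α (tstar μ α x) y) :=
  ((isCompactlySupported_coe x).tstar).tconv_left (isCompactlySupported_coe y).isFiberCompact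

variable (μ α ν) in
/-- The right inner product on `C_c(G × X, A)`. -/
def rinnerCc (x y : C_c(G × X, A)) : C_c(G × Y, A) :=
  hq.descend ν (isCompactlySupported_tstar_tconv (μ := μ) (α := α) x y)

lemma pullback_rinnerCc (x y : C_c(G × X, A)) :
    pullback q (hq.rinnerCc μ α ν x y) = orbitIntegral ν i (tconv μ α (tstar μ α x) y) :=
  hq.pullback_descend _

lemma rinnerCc_apply (x y : C_c(G × X, A)) (r : G) (s : X) :
    hq.rinnerCc μ α ν x y (r, q s) = ∫ k, tconv μ α (tstar μ α x) y (r, s * i k) ∂ν :=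
  hq.descend_apply _ r s

lemma rinnerCc_add_right (x y z : C_c(G × X, A)) :
    hq.rinnerCc μ α ν x (y + z) = hq.rinnerCc μ α ν x y + hq.rinnerCc μ α ν x z := by
  refine hq.eq_of_pullback_eq (funext fun p => ?_)
  change hq.rinnerCc μ α ν x (y + z) (p.1, q p.2) =
    hq.rinnerCc μ α ν x y (p.1, q p.2) + hq.rinnerCc μ α ν x z (p.1, q p.2)
  rw [rinnerCc_apply, rinnerCc_apply, rinnerCc_apply, ← integral_add
    (integrable_orbitIntegral hq.isClosedEmbedding (isCompactlySupported_tstar_tconv x y) _ _)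
    (integrable_orbitIntegral hq.isClosedEmbedding (isCompactlySupported_tstar_tconv x z) _ _)]
  refine integral_congr_ae (Eventually.of_forall fun k => ?_)
  exact congrFun (tconv_add_right (isCompactlySupported_coe x).tstar.isFiberCompact
    y.continuous z.continuous) _

lemma rinnerCc_smul_right (c : ℂ) (x y : C_c(G × X, A)) :
    hq.rinnerCc μ α ν x (c • y) = c • hq.rinnerCc μ α ν x y := by
  refine hq.eq_of_pullback_eq (funext fun p => ?_)
  change hq.rinnerCc μ α ν x (c • y) (p.1, q p.2) = c • hq.rinnerCc μ α ν x y (p.1, q p.2)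
  rw [rinnerCc_apply, rinnerCc_apply, ← integral_smul]
  refine integral_congr_ae (Eventually.of_forall fun k => ?_)
  exact congrFun (tconv_smul_right c _ _) _

/-- Pull-back is injective and commutes with the involution, so the claim becomes (x^* * y)^* = y^*
* x integrated over orbits. -/
lemma tstar_rinnerCc (x y : C_c(G × X, A)) :
    tstar μ α (hq.rinnerCc μ α ν x y) = hq.rinnerCc μ α ν y x := by
  refine hq.pullback_injective ?_
  rw [← hq.tstar_pullback, hq.pullback_rinnerCc, hq.pullback_rinnerCc, ← hq.orbitIntegral_tstar
    (isCompactlySupported_tstar_tconv x y), tstar_tconv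
    (isCompactlySupported_coe x).tstar.isFiberCompact (isCompactlySupported_coe y).isFiberCompact,
    tstar_tstar]

lemma star_inclₗ_rinnerCc (x y : C_c(G × X, A)) :
    star (inclₗ μ α Y (hq.rinnerCc μ α ν x y)) = inclₗ μ α Y (hq.rinnerCc μ α ν y x) :=
  inclₗ_star fun p => (congrFun (hq.tstar_rinnerCc x y) p).symm

lemma rinnerCc_ractCc (x y : C_c(G × X, A)) (b : C_c(G × Y, A)) :
    ⇑(hq.rinnerCc μ α ν x (hq.ractCc μ α y b)) = tconv μ α (hq.rinnerCc μ α ν x y) b := by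
  refine hq.pullback_injective ?_
  rw [← hq.tconv_pullback, hq.pullback_rinnerCc, hq.pullback_rinnerCc, coe_ractCc,
    ← hq.orbitIntegral_tconv_pullback (isCompactlySupported_tstar_tconv x y)
      (isCompactlySupported_coe b).isFiberCompact, tconv_assoc
      (isCompactlySupported_coe x).tstar.isFiberCompact (isCompactlySupported_coe y).isFiberCompact
      (hq.isFiberCompact_pullback (isCompactlySupported_coe b).isFiberCompact)]

lemma inclₗ_rinnerCc_ractCc (x y : C_c(G × X, A)) (b : C_c(G × Y, A)) :
    inclₗ μ α Y (hq.rinnerCc μ α ν x (hq.ractCc μ α y b)) =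
      inclₗ μ α Y (hq.rinnerCc μ α ν x y) * inclₗ μ α Y b :=
  (inclₗ_mul fun p => congrFun (hq.rinnerCc_ractCc x y b) p).symm

/-- The factors Δ(k)^{1/2} and Δ(k)^{-1/2} cancel, leaving ∫ x * β_k(y^*) * β_k(z) dk = x * ∫
β_k(y^* * z) dk, and the last integral is the pull-back of ⟨y,z⟩R. -/
lemma lactCc_linnerCc (x y z : C_c(G × X, A)) :
    lactCc μ α ν hq.isClosedEmbedding (linnerCc μ α ν hq.isClosedEmbedding x y) z =
      hq.ractCc μ α x (hq.rinnerCc μ α ν y z) := by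
  refine DFunLike.ext _ _ fun p => ?_
  have hx := (isCompactlySupported_coe x).isFiberCompact
  have hy := (isCompactlySupported_coe y).tstar (μ := μ) (α := α)
  have hz := isCompactlySupported_coe z
  rw [coe_ractCc, lactCc_apply, hq.pullback_rinnerCc, ← integral_tconv_rtrans hq.isClosedEmbedding
    hx (isCompactlySupported_tstar_tconv y z)]
  refine integral_congr_ae (Eventually.of_forall fun k => ?_)
  have e : ⇑(sliceCc (linnerCc μ α ν hq.isClosedEmbedding x y) k) =
    (sqrtModular ν k)⁻¹ • tconv μ α x (rtrans (i k) (tstar μ α y)) := rfl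
  simp only [e]
  rw [tconv_real_smul_left, Pi.smul_apply, smul_smul, mul_inv_cancel₀ (sqrtModular_pos ν k).ne',
    one_smul, tconv_assoc hx (hy.isFiberCompact.rtrans _) (hz.isFiberCompact.rtrans _), tconv_rtrans]

end IsOrbitMap

end RightOperations

/-! ### Approximate units from convolution squares -/

section
open scoped Pointwise

/-- A C*-algebra has self-adjoint contractive approximate units that are uniform on compact sets. -/
lemma exists_approximate_unit {A : Type*} [NonUnitalCStarAlgebra A] {C : Set A} (hC : IsCompact C)
    {ε : ℝ} (hε : 0 < ε) :
    ∃ e : A, star e = e ∧ ‖e‖ ≤ 1 ∧ ∀ a ∈ C, ‖a * e - a‖ ≤ ε ∧ ‖e * a - a‖ ≤ ε := by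
  let _ : PartialOrder A := CStarAlgebra.spectralOrder A
  have _ : StarOrderedRing A := CStarAlgebra.spectralOrderedRing A
  have hl := CStarAlgebra.increasingApproximateUnit A
  have := hl.neBot
  -- A finite ε/3-net of C reduces uniformity on C to finitely many elements; contractivity of e
  -- controls the rest.
  obtain ⟨t, -, ht, hcov⟩ := hC.finite_cover_balls (e := ε / 3) (by positivity)
  have h1 : ∀ᶠ e in CStarAlgebra.approximateUnit A, ∀ b ∈ t,
      ‖b * e - b‖ < ε / 3 ∧ ‖e * b - b‖ < ε / 3 := by
    refine (eventually_all_finite ht).2 fun b _ => ?_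
    filter_upwards [(tendsto_iff_norm_sub_tendsto_zero.1 (hl.tendsto_mul_left b)).eventually
      (gt_mem_nhds (show (0 : ℝ) < ε / 3 by positivity)),
      (tendsto_iff_norm_sub_tendsto_zero.1 (hl.tendsto_mul_right b)).eventually
      (gt_mem_nhds (show (0 : ℝ) < ε / 3 by positivity))] with e h h' using ⟨h, h'⟩
  obtain ⟨e, ⟨he, hen⟩, hes⟩ := ((h1.and hl.eventually_norm).and hl.eventually_star_eq).exists
  refine ⟨e, hes, hen, fun a ha => ?_⟩
  obtain ⟨b, hb, hab⟩ := Set.mem_iUnion₂.1 (hcov ha)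
  rw [Metric.mem_ball, dist_eq_norm] at hab
  obtain ⟨h2, h3⟩ := he b hb
  constructor
  · calc ‖a * e - a‖ = ‖(a - b) * e + (b * e - b) - (a - b)‖ := by rw [sub_mul]; congr 1; abel
      _ ≤ ‖(a - b) * e‖ + ‖b * e - b‖ + ‖a - b‖ :=
        (norm_sub_le _ _).trans (add_le_add_left (norm_add_le _ _) _)
      _ ≤ ‖a - b‖ * 1 + ‖b * e - b‖ + ‖a - b‖ := by
        gcongr
        exact (norm_mul_le _ _).trans (by gcongr)
      _ ≤ ε := by linarith
  · calc ‖e * a - a‖ = ‖e * (a - b) + (e * b - b) - (a - b)‖ := by rw [mul_sub]; congr 1; abel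
      _ ≤ ‖e * (a - b)‖ + ‖e * b - b‖ + ‖a - b‖ :=
        (norm_sub_le _ _).trans (add_le_add_left (norm_add_le _ _) _)
      _ ≤ 1 * ‖a - b‖ + ‖e * b - b‖ + ‖a - b‖ := by
        gcongr
        exact (norm_mul_le _ _).trans (by gcongr)
      _ ≤ ε := by linarith

section ApproximateUnits

variable {G : Type v} [Group G] [TopologicalSpace G] [IsTopologicalGroup G] [LocallyCompactSpace G]
  [T2Space G] [MeasurableSpace G] [BorelSpace G] {μ : Measure G} [μ.IsHaarMeasure] [μ.Regular]
  {A : Type u} [NonUnitalCStarAlgebra A] {α : CStarAction G A}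
  {X : Type w} [TopologicalSpace X] [T2Space X] [MulAction G X] [ContinuousSMul G X]

variable (X) in
/-- The function `(r, s) ↦ φ(r) a`. -/
def constFun (φ : C_c(G, ℝ)) (a : A) (p : G × X) : A := φ p.1 • a

lemma isFiberCompact_constFun (φ : C_c(G, ℝ)) (a : A) : IsFiberCompact (constFun X φ a) :=
  ⟨(φ.continuous.comp continuous_fst).smul continuous_const, tsupport φ, φ.hasCompactSupport,
    fun r s hr => by rw [constFun, image_eq_zero_of_notMem_tsupport hr, zero_smul]⟩

variable (μ α X) in
/-- The convolution square `κ^* * κ` of `κ(r, s) = φ(r) a`. -/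
def squareFun (φ : C_c(G, ℝ)) (a : A) : G × X → A :=
  tconv μ α (tstar μ α (constFun X φ a)) (constFun X φ a)

lemma isFiberCompact_squareFun (φ : C_c(G, ℝ)) (a : A) : IsFiberCompact (squareFun μ α X φ a) :=
  (isFiberCompact_constFun φ a).tstar.tconv (isFiberCompact_constFun φ a)

/-- Inversion of Haar measure. The result does not involve s, so κ^* * κ is the same function over
`X` and over any quotient of it. -/
lemma squareFun_apply (φ : C_c(G, ℝ)) (a : A) (g : G) (s : X) :
    squareFun μ α X φ a (g, s) = ∫ u, (φ u * φ (u * g)) • α.act u⁻¹ (star a * a) ∂μ := by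
  rw [squareFun, tconv_apply]
  have hφ := φ.continuous
  have hc : Continuous fun u => φ u * φ (u * g) := by fun_prop
  refine Eq.trans (integral_congr_ae (Eventually.of_forall fun u => ?_)) (integral_inv_modularFn μ
    (f := fun u => (φ u * φ (u * g)) • α.act u⁻¹ (star a * a)) (hc.smul
      ((α.continuous_act _).comp continuous_inv)) φ.hasCompactSupport fun u hu => by
        rw [image_eq_zero_of_notMem_tsupport hu, zero_mul, zero_smul])
  simp only [tstar_apply, constFun, inv_inv, star_smul, star_trivial, starHom_real_smul,
    map_mul, smul_smul, smul_mul_assoc, mul_smul_comm]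
  congr 1
  ring

variable (μ α) in
/-- Right convolution with `κ^* * κ`, where `κ(r, s) = φ(r) a`. -/
def convSquare (φ : C_c(G, ℝ)) (a : A) (z : C_c(G × X, A)) : C_c(G × X, A) :=
  ((isCompactlySupported_coe z).tconv_left (μ := μ) (α := α) (isFiberCompact_squareFun (μ := μ) (α := α) φ a)).toCc

lemma coe_convSquare (φ : C_c(G, ℝ)) (a : A) (z : C_c(G × X, A)) :
    ⇑(convSquare μ α φ a z) = tconv μ α z (squareFun μ α X φ a) := rfl

lemma eventually_norm_translate_sub_le (z : C_c(G × X, A)) {ε : ℝ} (hε : 0 < ε) :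
    ∀ᶠ t in 𝓝 (1 : G), ∀ r s, ‖z (r * t, s) - z (r, s)‖ ≤ ε := by
  have hc : Continuous fun q : G × (G × X) => ‖z (q.2.1 * q.1, q.2.2) - z q.2‖ :=
    ((z.continuous.comp (by fun_prop)).sub (z.continuous.comp (by fun_prop))).norm
  have h1 : ∀ᶠ t in 𝓝 (1 : G), ∀ p ∈ tsupport z, ‖z (p.1 * t, p.2) - z p‖ < ε := by
    refine z.hasCompactSupport.isCompact.eventually_forall_of_forall_eventually fun p _ => ?_
    refine (hc.tendsto (1, p)).eventually (gt_mem_nhds ?_)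
    simpa using hε
  have h2 : ∀ᶠ t in 𝓝 (1 : G), ∀ p ∈ tsupport z, ‖z (p.1 * t⁻¹, p.2) - z p‖ < ε :=
    (continuous_inv.tendsto' (1 : G) 1 inv_one).eventually h1
  filter_upwards [h1, h2] with t ht ht' r s
  by_cases h : (r, s) ∈ tsupport z
  · exact (ht _ h).le
  by_cases h' : (r * t, s) ∈ tsupport z
  · have := ht' _ h'
    simp only [mul_inv_cancel_right] at this
    rw [norm_sub_rev]
    exact this.le
  · rw [image_eq_zero_of_notMem_tsupport h, image_eq_zero_of_notMem_tsupport h', sub_self, norm_zero]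
    exact hε.le

/-- Written out, z * κ^* * κ at (r, s) is the average of z(rt, s)α_{rtu⁻¹}(a^*a) with weights
φ(u)φ(ut⁻¹) of total mass one, so a bound on the support of the weights bounds the average. -/
lemma norm_convSquare_sub_le (z : C_c(G × X, A)) (φ : C_c(G, ℝ)) (hφ : ∀ g, 0 ≤ φ g)
    (h1 : ∫ t, ∫ u, φ u * φ (u * t⁻¹) ∂μ ∂μ = 1) (a : A) {ε : ℝ} (r : G) (s : X)
    (h : ∀ t u, φ u ≠ 0 → φ (u * t⁻¹) ≠ 0 →
      ‖z (r * t, s) * α.act (r * t * u⁻¹) (star a * a) - z (r, s)‖ ≤ ε) :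
    ‖convSquare μ α φ a z (r, s) - z (r, s)‖ ≤ ε := by
  set S := tsupport φ
  have hS : IsCompact S := φ.hasCompactSupport
  have h0 : ∀ g ∉ S, φ g = 0 := fun g hg => image_eq_zero_of_notMem_tsupport hg
  have hT : IsCompact ((fun p : G × G => p.1⁻¹ * p.2) '' S ×ˢ S) := (hS.prod hS).image (by fun_prop)
  set T := (fun p : G × G => p.1⁻¹ * p.2) '' S ×ˢ S
  have h0' : ∀ t ∉ T, ∀ u, φ u * φ (u * t⁻¹) = 0 := fun t ht u => by
    by_contra hne
    refine ht ⟨(u * t⁻¹, u), ⟨by_contra fun h' => hne ?_, by_contra fun h' => hne ?_⟩, by simp⟩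
    · rw [h0 _ h', mul_zero]
    · rw [h0 _ h', zero_mul]
  let ω : G → ℝ := fun t => ∫ u, φ u * φ (u * t⁻¹) ∂μ
  have hφc := φ.continuous
  have hw : Continuous fun p : G × G => φ p.2 * φ (p.2 * p.1⁻¹) := by fun_prop
  have hω : Continuous ω := continuous_integral_of_compact_support' μ hw hS fun t u hu => by
    rw [h0 u hu, zero_mul]
  have hωi : Integrable ω μ := integrable_of_continuous_of_vanish μ hω hT fun t ht =>
    integral_eq_zero_of_ae (Eventually.of_forall fun u => h0' t ht u)
  let F : G → A := fun t => z (r * t, s) * α.act (r * t) (squareFun μ α X φ a (t⁻¹, t⁻¹ • r⁻¹ • s))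
  have hF : convSquare μ α φ a z (r, s) = ∫ t, F t ∂μ := by
    rw [coe_convSquare, tconv_apply, ← integral_mul_left_eq_self (μ := μ) _ r]
    refine integral_congr_ae (Eventually.of_forall fun t => ?_)
    simp only [F, mul_inv_rev, inv_mul_cancel_right, mul_smul]
  have hFi : Integrable F μ := by
    have := (integrable_tconv_integrand (μ := μ) (α := α) (isCompactlySupported_coe z).isFiberCompact
      (isFiberCompact_squareFun (μ := μ) (α := α) φ a).continuous r s).comp_mul_left r
    simpa only [mul_inv_rev, inv_mul_cancel_right, mul_smul] using this
  have e : ∀ t, F t - ω t • z (r, s) = ∫ u, (φ u * φ (u * t⁻¹)) •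
      (z (r * t, s) * α.act (r * t * u⁻¹) (star a * a) - z (r, s)) ∂μ := fun t => by
    have hi1 : Integrable (fun u => φ u * φ (u * t⁻¹)) μ :=
      integrable_of_continuous_of_vanish μ (by fun_prop) hS fun u hu => by rw [h0 u hu, zero_mul]
    have hi2 : Integrable (fun u => (φ u * φ (u * t⁻¹)) • α.act u⁻¹ (star a * a)) μ :=
      integrable_of_continuous_of_vanish μ ((hw.comp (continuous_const.prodMk continuous_id)).smul
        ((α.continuous_act _).comp continuous_inv)) hS fun u hu => by rw [h0 u hu, zero_mul, zero_smul]
    simp only [smul_sub]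
    rw [integral_sub _ (hi1.smul_const _), integral_smul_const]
    · congr 1
      simp only [F]
      rw [squareFun_apply, ← starHomCLM_apply, ← ContinuousLinearMap.integral_comp_comm _ hi2,
        ← integral_const_mul_of_integrable (ContinuousLinearMap.integrable_comp _ hi2)]
      refine integral_congr_ae (Eventually.of_forall fun u => ?_)
      simp only [starHomCLM_apply, starHom_real_smul, mul_smul_comm, α.act_mul]
    · have := (ContinuousLinearMap.mul ℂ A (z (r * t, s))).integrable_comp
        (ContinuousLinearMap.integrable_comp (starHomCLM (α.act (r * t))) hi2)
      simp only [ContinuousLinearMap.mul_apply'] at this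
      simpa only [starHomCLM_apply, starHom_real_smul, mul_smul_comm, ← α.act_mul] using this
  have e2 : convSquare μ α φ a z (r, s) - z (r, s) = ∫ t, (F t - ω t • z (r, s)) ∂μ := by
    rw [integral_sub hFi (hωi.smul_const _), integral_smul_const, h1, one_smul, hF]
  have hωε : ∀ t, ‖F t - ω t • z (r, s)‖ ≤ ω t * ε := fun t => by
    rw [e, ← integral_mul_const]
    refine norm_integral_le_of_norm_le (Integrable.mul_const (integrable_of_continuous_of_vanish μ
      (by fun_prop) hS fun u hu => by rw [h0 u hu, zero_mul]) _) (Eventually.of_forall fun u => ?_)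
    rw [norm_smul, Real.norm_of_nonneg (mul_nonneg (hφ _) (hφ _))]
    by_cases hu : φ u = 0
    · simp [hu]
    by_cases hu' : φ (u * t⁻¹) = 0
    · simp [hu']
    · exact mul_le_mul_of_nonneg_left (h t u hu hu') (mul_nonneg (hφ _) (hφ _))
  calc _ ≤ ∫ t, ω t * ε ∂μ := by
        rw [e2]
        exact norm_integral_le_of_norm_le (hωi.mul_const _) (Eventually.of_forall hωε)
    _ = ε := by rw [integral_mul_const, h1, one_mul]

variable (μ) in
-- A bump f is rescaled by c^{-1/2}, where c is the total mass of ω(t) = ∫ f(u)f(ut⁻¹) du. The mass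
-- is positive because ω is continuous and nonnegative with ω(1) = ∫ f² ≠ 0.
lemma exists_normalized_bump {U : Set G} (hU : U ∈ 𝓝 (1 : G)) :
    ∃ φ : C_c(G, ℝ), (∀ g, 0 ≤ φ g) ∧ (∀ g ∉ U, φ g = 0) ∧
      ∫ t, ∫ u, φ u * φ (u * t⁻¹) ∂μ ∂μ = 1 := by
  obtain ⟨f, S, hf, hS, hSU, hnn, h0, h1⟩ := exists_bump μ hU
  have hT : IsCompact ((fun p : G × G => p.1⁻¹ * p.2) '' S ×ˢ S) := (hS.prod hS).image (by fun_prop)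
  let ω : G → ℝ := fun t => ∫ u, f u * f (u * t⁻¹) ∂μ
  have hω : Continuous ω := continuous_integral_of_compact_support' μ
    (F := fun t u => f u * f (u * t⁻¹)) (by fun_prop) hS fun t u hu => by rw [h0 u hu, zero_mul]
  have hω0 : ∀ t, 0 ≤ ω t := fun t => integral_nonneg fun u => mul_nonneg (hnn _) (hnn _)
  obtain ⟨g, hg⟩ : ∃ g, f g ≠ 0 := by
    by_contra! h
    simp [h] at h1
  have hω1 : ω 1 ≠ 0 := by
    refine (Continuous.integral_pos_of_hasCompactSupport_nonneg_nonzero (f := fun u => f u * f (u * 1⁻¹))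
      (by fun_prop) (HasCompactSupport.intro hS fun u hu => by rw [h0 u hu, zero_mul])
      (fun u => mul_nonneg (hnn _) (hnn _)) (x := g) ?_).ne'
    simpa using hg
  have hc : 0 < ∫ t, ω t ∂μ := by
    refine hω.integral_pos_of_hasCompactSupport_nonneg_nonzero (HasCompactSupport.intro hT
      fun t ht => integral_eq_zero_of_ae (Eventually.of_forall fun u => ?_)) hω0 hω1
    change f u * f (u * t⁻¹) = 0
    by_contra hne
    refine ht ⟨(u * t⁻¹, u), ⟨by_contra fun h' => hne ?_, by_contra fun h' => hne ?_⟩, by simp⟩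
    · rw [h0 _ h', mul_zero]
    · rw [h0 _ h', zero_mul]
  set c := ∫ t, ω t ∂μ
  refine ⟨mkCc (fun g => (√c)⁻¹ * f g) (by fun_prop) ⟨S, hS, fun g hg => by rw [h0 g hg, mul_zero]⟩,
    fun g => mul_nonneg (by positivity) (hnn g), fun g hg => ?_, ?_⟩
  · rw [mkCc_apply, h0 g fun h => hg (hSU h), mul_zero]
  · have e : ∀ t u, (√c)⁻¹ * f u * ((√c)⁻¹ * f (u * t⁻¹)) = c⁻¹ * (f u * f (u * t⁻¹)) :=
      fun t u => by
        have : (√c)⁻¹ * (√c)⁻¹ = c⁻¹ := by rw [← mul_inv, Real.mul_self_sqrt hc.le]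
        rw [← this]; ring
    simp only [mkCc_apply, e, integral_const_mul]
    exact inv_mul_cancel₀ hc.ne'

/-- Three errors are added: moving r to rt costs ε/4 by uniform continuity; moving e² by the action
costs ε/4; and be² differs from b by ε/2, where e is an approximate unit for the compact set of
values b = α_{r⁻¹}(z(r, s)). -/
lemma exists_norm_convSquare_sub_le (z : C_c(G × X, A)) {C : Set G} (hC : C ∈ 𝓝 (1 : G)) {ε : ℝ}
    (hε : 0 < ε) : ∃ (φ : C_c(G, ℝ)) (a : A), (∀ g ∉ C, φ g = 0) ∧
      ∀ p, ‖convSquare μ α φ a z p - z p‖ ≤ ε := by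
  obtain ⟨S, m, hS, hm, hz⟩ := exists_boundedOn z
  have hB : IsCompact ((fun p : G × X => α.act p.1⁻¹ (z p)) '' S) :=
    hS.image (α.continuous_act_comp (continuous_inv.comp continuous_fst) z.continuous)
  obtain ⟨e, hes, hen, he⟩ := exists_approximate_unit hB (ε := ε / 4) (by positivity)
  have h1 := eventually_norm_translate_sub_le z (ε := ε / 4) (by positivity)
  have h2 : ∀ᶠ g in 𝓝 (1 : G), m * ‖α.act g (e * e) - e * e‖ < ε / 4 := by
    have hc : Continuous fun g => m * ‖α.act g (e * e) - e * e‖ :=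
      continuous_const.mul (((α.continuous_act _).sub continuous_const).norm)
    refine (hc.tendsto 1).eventually (gt_mem_nhds ?_)
    rw [α.act_one, sub_self, norm_zero, mul_zero]
    positivity
  have hV : ∀ᶠ q in 𝓝 ((1 : G), (1 : G)), (∀ r s, ‖z (r * (q.1⁻¹ * q.2), s) - z (r, s)‖ ≤ ε / 4) := by
    have hc : Continuous fun q : G × G => q.1⁻¹ * q.2 := by fun_prop
    exact (hc.tendsto' (1, 1) 1 (by simp)).eventually h1
  have hV' : ∀ᶠ q in 𝓝 (1 : G), m * ‖α.act q⁻¹ (e * e) - e * e‖ < ε / 4 :=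
    (continuous_inv.tendsto' (1 : G) 1 inv_one).eventually h2
  rw [nhds_prod_eq] at hV
  -- Both t = (ut⁻¹)⁻¹u and tu⁻¹ = (ut⁻¹)⁻¹ are near the identity when u and ut⁻¹ are in the support
  -- of φ, so it is the support of φ that has to be shrunk.
  obtain ⟨V, hV1, hV2⟩ := (eventually_prod_self_iff
    (r := fun a b => ∀ r s, ‖z (r * (a⁻¹ * b), s) - z (r, s)‖ ≤ ε / 4)).1 hV
  obtain ⟨φ, hφ, hφ0, hφ1⟩ := exists_normalized_bump μ (inter_mem (inter_mem hC hV1) hV')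
  refine ⟨φ, e, fun g hg => hφ0 g fun h => hg h.1.1, fun ⟨r, s⟩ =>
    norm_convSquare_sub_le z φ hφ hφ1 e r s fun t u hu hu' => ?_⟩
  have hu1 := (by_contra fun h => hu (hφ0 u h) : u ∈ _)
  have hu2 := (by_contra fun h => hu' (hφ0 _ h) : u * t⁻¹ ∈ _)
  have ht : ‖z (r * t, s) - z (r, s)‖ ≤ ε / 4 := by
    have := hV2 _ hu2.1.2 _ hu1.1.2 r s
    simpa using this
  have hg : m * ‖α.act (t * u⁻¹) (e * e) - e * e‖ ≤ ε / 4 := by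
    have := (Set.mem_ofPred.1 hu2.2).le
    rwa [mul_inv_rev, inv_inv] at this
  set b := α.act r⁻¹ (z (r, s)) with hb
  have hbz : α.act r b = z (r, s) := by rw [hb, α.act_act_inv]
  have hbm : ‖b‖ ≤ m := (NonUnitalStarAlgHom.norm_apply_le _ _).trans (hz.2 _)
  have hbe : ‖b * e - b‖ ≤ ε / 4 := by
    by_cases hp : (r, s) ∈ S
    · exact (he b ⟨_, hp, rfl⟩).1
    · rw [hb, hz.1 _ hp, map_zero, zero_mul, sub_self, norm_zero]; positivity
  have hee : ‖e * e‖ ≤ 1 := (norm_mul_le _ _).trans (mul_le_one₀ hen (norm_nonneg _) hen)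
  have hbee : ‖b * (e * e) - b‖ ≤ ε / 2 := by
    have e1 : b * (e * e) - b = (b * e - b) * e + (b * e - b) := by rw [sub_mul, mul_assoc]; abel
    rw [e1]
    refine (norm_add_le _ _).trans ?_
    have := (norm_mul_le (b * e - b) e).trans (mul_le_mul hbe hen (norm_nonneg _) (by positivity))
    linarith
  rw [hes]
  generalize e * e = w at *
  have e1 : z (r * t, s) * α.act (r * t * u⁻¹) w - z (r, s) =
      (z (r * t, s) - z (r, s)) * α.act (r * t * u⁻¹) w +
      α.act r (b * (α.act (t * u⁻¹) w - w) + (b * w - b)) := by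
    have e2 : b * (α.act (t * u⁻¹) w - w) + (b * w - b) = b * α.act (t * u⁻¹) w - b := by
      rw [mul_sub]; abel
    rw [e2, map_sub, map_mul, hbz, ← α.act_mul, ← mul_assoc r, sub_mul]
    abel
  have h3 := (norm_mul_le (z (r * t, s) - z (r, s)) (α.act (r * t * u⁻¹) w)).trans
    (mul_le_mul ht ((NonUnitalStarAlgHom.norm_apply_le _ _).trans hee) (norm_nonneg _)
      (by positivity))
  have h4 := (norm_mul_le b (α.act (t * u⁻¹) w - w)).trans
    (mul_le_mul_of_nonneg_right hbm (norm_nonneg _))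
  rw [e1]
  refine (norm_add_le _ _).trans ?_
  have h5 := (NonUnitalStarAlgHom.norm_apply_le (α.act r) _).trans
    (norm_add_le (b * (α.act (t * u⁻¹) w - w)) (b * w - b))
  linarith

/-- A closed set that contains `J (z * κ^* * κ)` for all `κ` contains `J z`. -/
lemma InductivelyContinuous.mem_of_convSquare_mem {E : Type*} [SeminormedAddCommGroup E] [Module ℂ E]
    {J : C_c(G × X, A) →ₗ[ℂ] E} (hJ : InductivelyContinuous J) {F : Set E} (hF : IsClosed F)
    (z : C_c(G × X, A)) (h : ∀ φ a, J (convSquare μ α φ a z) ∈ F) : J z ∈ F := by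
  rw [← hF.closure_eq, Metric.mem_closure_iff]
  intro ε hε
  obtain ⟨C, hCc, hC⟩ := exists_compact_mem_nhds (1 : G)
  obtain ⟨S, m, hS, -, hz⟩ := exists_boundedOn z
  set C' := (fun p : G × G => p.1 * p.2) '' (C⁻¹ ×ˢ C)
  have hC' : IsCompact C' := (hCc.inv.prod hCc).image (by fun_prop)
  set S' := (fun q : (G × X) × G => (q.1.1 * q.2, q.1.2)) '' (S ×ˢ C')
  -- One compact set carries z and all z * κ^* * κ with φ vanishing off C, so the constant K is
  -- fixed before φ and a are chosen.
  obtain ⟨K, hK, hJK⟩ := hJ (S ∪ S') (hS.union ((hS.prod hC').image (by fun_prop)))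
  obtain ⟨φ, a, hφ, hle⟩ := exists_norm_convSquare_sub_le (μ := μ) (α := α) z hC
    (ε := ε / (K + 1)) (by positivity)
  refine ⟨_, h φ a, ?_⟩
  have h0 : ∀ r (s : X), r ∉ C → constFun X φ a (r, s) = 0 := fun r s hr => by
    rw [constFun, hφ r hr, zero_smul]
  rw [dist_comm, dist_eq_norm, ← map_sub]
  refine (hJK (ε / (K + 1)) _ ⟨fun p hp => ?_, hle⟩).trans_lt ?_
  · rw [Set.mem_union, not_or] at hp
    rw [CompactlySupportedContinuousMap.sub_apply, hz.1 p hp.1, sub_zero, coe_convSquare]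
    refine tconv_apply_eq_zero_of_left hz.1 (C := C') (fun r s hr => ?_) hp.2
    refine tconv_apply_eq_zero (C := C⁻¹) (C' := C) (fun r s hr => ?_) h0 hr
    rw [tstar_apply, h0 _ _ (by simpa using hr)]
    simp
  · rw [mul_div_assoc', div_lt_iff₀ (by positivity)]
    nlinarith

end ApproximateUnits

end

/-! ### Bounded operators and pairings on C_c -/

section BoundedPairings

variable {P P' Q : Type*} [TopologicalSpace P] [TopologicalSpace P'] [TopologicalSpace Q]
  {A : Type*} [NonUnitalCStarAlgebra A]

/-- Maps between spaces of compactly supported functions that are bounded on functions with support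
in a fixed compact set. -/
def IsBoundedOperator (T : C_c(P, A) → C_c(Q, A)) : Prop :=
  ∀ S, IsCompact S → ∃ S' C, IsCompact S' ∧ (0 : ℝ) ≤ C ∧ ∀ m x, BoundedOn S m x →
    BoundedOn S' (C * m) (T x)

/-- The analogue of `IsBoundedOperator` for functions of two variables. -/
def IsBoundedPairing (b : C_c(P, A) → C_c(P', A) → C_c(Q, A)) : Prop :=
  ∀ S S', IsCompact S → IsCompact S' → ∃ S'' C, IsCompact S'' ∧ (0 : ℝ) ≤ C ∧ ∀ m m' x y,
    BoundedOn S m x → BoundedOn S' m' y → BoundedOn S'' (C * (m * m')) (b x y)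

lemma InductivelyContinuous.comp_isBoundedOperator {E : Type*} [SeminormedAddCommGroup E]
    [Module ℂ E] {J : C_c(Q, A) →ₗ[ℂ] E} (hJ : InductivelyContinuous J)
    {T : C_c(P, A) → C_c(Q, A)} (hT : IsBoundedOperator T) {J' : C_c(P, A) →ₗ[ℂ] E}
    (h : ∀ x, J' x = J (T x)) : InductivelyContinuous J' := by
  intro S hS
  obtain ⟨S', C, hS', hC, hT'⟩ := hT S hS
  obtain ⟨C', hC', h'⟩ := hJ S' hS'
  exact ⟨C' * C, mul_nonneg hC' hC, fun m x hx => by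
    rw [h, mul_assoc]; exact h' _ _ (hT' m x hx)⟩

namespace IsBoundedPairing

variable {b : C_c(P, A) → C_c(P', A) → C_c(Q, A)} (hb : IsBoundedPairing b)

include hb

lemma left (y : C_c(P', A)) : IsBoundedOperator fun x => b x y := by
  intro S hS
  obtain ⟨S₀, m₀, hS₀, hm₀, hy⟩ := exists_boundedOn y
  obtain ⟨S', C, hS', hC, h⟩ := hb S S₀ hS hS₀
  exact ⟨S', C * m₀, hS', mul_nonneg hC hm₀, fun m x hx => by
    rw [mul_assoc, mul_comm m₀]; exact h _ _ _ _ hx hy⟩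

lemma comp_left {P'' : Type*} [TopologicalSpace P''] {T : C_c(P'', A) → C_c(P, A)}
    (hT : IsBoundedOperator T) : IsBoundedPairing fun x y => b (T x) y := by
  intro S S' hS hS'
  obtain ⟨S₁, C₁, hS₁, hC₁, h₁⟩ := hT S hS
  obtain ⟨S₂, C₂, hS₂, hC₂, h₂⟩ := hb S₁ S' hS₁ hS'
  exact ⟨S₂, C₂ * C₁, hS₂, mul_nonneg hC₂ hC₁, fun m m' x y hx hy => by
    rw [mul_assoc, ← mul_assoc C₁]; exact h₂ _ _ _ _ (h₁ _ _ hx) hy⟩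

lemma comp_right {P'' : Type*} [TopologicalSpace P''] {T : C_c(P'', A) → C_c(P', A)}
    (hT : IsBoundedOperator T) : IsBoundedPairing fun x y => b x (T y) := by
  intro S S' hS hS'
  obtain ⟨S₁, C₁, hS₁, hC₁, h₁⟩ := hT S' hS'
  obtain ⟨S₂, C₂, hS₂, hC₂, h₂⟩ := hb S S₁ hS hS₁
  exact ⟨S₂, C₂ * C₁, hS₂, mul_nonneg hC₂ hC₁, fun m m' x y hx hy => by
    rw [mul_assoc, mul_left_comm C₁]; exact h₂ _ _ _ _ hx (h₁ _ _ hy)⟩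

end IsBoundedPairing

/-- This quadratic estimate is the boundedness that a covariant form has to satisfy. -/
lemma IsBoundedPairing.exists_norm_le {b : C_c(P, A) → C_c(P, A) → C_c(Q, A)}
    (hb : IsBoundedPairing b) {E : Type*} [SeminormedAddCommGroup E] [Module ℂ E]
    {J : C_c(Q, A) →ₗ[ℂ] E} (hJ : InductivelyContinuous J) {S : Set P} (hS : IsCompact S) :
    ∃ C : ℝ, 0 ≤ C ∧ ∀ m x, BoundedOn S m x → ‖J (b x x)‖ ≤ C * m ^ 2 := by
  obtain ⟨S', C, hS', hC, h⟩ := hb S S hS hS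
  obtain ⟨C', hC', h'⟩ := hJ S' hS'
  exact ⟨C' * C, mul_nonneg hC' hC, fun m x hx => by
    rw [mul_assoc, sq]; exact h' _ _ (h _ _ _ _ hx hx)⟩

end BoundedPairings

section BoundednessOfConvolution

variable {G : Type v} [Group G] [TopologicalSpace G] [IsTopologicalGroup G] [LocallyCompactSpace G]
  [T2Space G] [MeasurableSpace G] [BorelSpace G] {μ : Measure G} [μ.IsHaarMeasure] [μ.Regular]
  {A : Type u} [NonUnitalCStarAlgebra A] {α : CStarAction G A}
  {X : Type w} [TopologicalSpace X] [T2Space X] [MulAction G X] [ContinuousSMul G X]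

lemma BoundedOn.nonneg {P : Type*} [TopologicalSpace P] {S : Set P} {m : ℝ} {f : C_c(P, A)}
    (h : BoundedOn S m f) (p : P) : 0 ≤ m := (norm_nonneg _).trans (h.2 p)

lemma boundedOn_of_mem {P : Type*} [TopologicalSpace P] {S : Set P} {m : ℝ} {f : C_c(P, A)}
    (hm : P → 0 ≤ m) (h0 : ∀ p ∉ S, f p = 0) (h1 : ∀ p ∈ S, ‖f p‖ ≤ m) : BoundedOn S m f := by
  refine ⟨h0, fun p => ?_⟩
  by_cases hp : p ∈ S
  · exact h1 p hp
  · rw [h0 p hp, norm_zero]; exact hm p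

lemma isBoundedOperator_starCc : IsBoundedOperator (starCc μ α : C_c(G × X, A) → C_c(G × X, A)) := by
  intro S hS
  have hS' : IsCompact ((fun q : G × X => (q.1⁻¹, q.1⁻¹ • q.2)) '' S) := hS.image (by fun_prop)
  obtain ⟨C, hC⟩ := hS'.exists_bound_of_continuousOn (f := fun p : G × X => (modularFn μ p.1)⁻¹)
    (((continuous_modularFn μ).comp continuous_fst).inv₀
      fun p => (modularFn_pos μ p.1).ne').continuousOn
  refine ⟨_, max C 0, hS', le_max_right _ _, fun m x hx => boundedOn_of_mem
    (fun p => mul_nonneg (le_max_right _ _) (hx.nonneg p)) (fun p hp => tstar_eq_zero hx.1 hp)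
    fun p hp => ?_⟩
  rw [coe_starCc, tstar, norm_smul]
  refine mul_le_mul ((hC p hp).trans (le_max_left _ _)) ?_ (norm_nonneg _) (le_max_right _ _)
  exact (NonUnitalStarAlgHom.norm_apply_le _ _).trans ((norm_star _).trans_le (hx.2 _))

lemma isBoundedPairing_convCc :
    IsBoundedPairing (convCc μ α : C_c(G × X, A) → C_c(G × X, A) → C_c(G × X, A)) := by
  intro S S' hS hS'
  have hC : IsCompact (Prod.fst '' S) := hS.image continuous_fst
  refine ⟨_, μ.real (Prod.fst '' S), (hS.prod (hS'.image continuous_fst)).image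
    (f := fun q : (G × X) × G => (q.1.1 * q.2, q.1.2)) (by fun_prop), measureReal_nonneg,
    fun m m' x y hx hy => ⟨fun p hp => ?_, fun p => ?_⟩⟩
  · exact tconv_apply_eq_zero_of_left (C := Prod.fst '' S') hx.1
      (fun r s hr => hy.1 _ fun h => hr ⟨_, h, rfl⟩) hp
  · rw [coe_convCc, mul_comm]
    exact norm_tconv_le hC (fun r s hr => hx.1 _ fun h => hr ⟨_, h, rfl⟩) hx.2 hy.2 p

lemma isBoundedPairing_tstar_tconv :
    IsBoundedPairing (fun x y : C_c(G × X, A) => convCc μ α (starCc μ α x) y) :=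
  isBoundedPairing_convCc.comp_left isBoundedOperator_starCc

end BoundednessOfConvolution

section BoundednessOfOperations

variable {G : Type v} [Group G] [TopologicalSpace G] [IsTopologicalGroup G] [LocallyCompactSpace G]
  [T2Space G] [MeasurableSpace G] [BorelSpace G] {μ : Measure G} [μ.IsHaarMeasure] [μ.Regular]
  {A : Type u} [NonUnitalCStarAlgebra A] {α : CStarAction G A}
  {X : Type w} [Group X] [TopologicalSpace X] [IsTopologicalGroup X] [LocallyCompactSpace X]
  [T2Space X] [MulAction G X] [ContinuousSMul G X] [IsScalarTower G X X]
  {D : Type*} [Group D] [TopologicalSpace D] [IsTopologicalGroup D] [LocallyCompactSpace D]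
  [T2Space D] [MeasurableSpace D] [BorelSpace D] {ν : Measure D} [ν.IsHaarMeasure] [ν.Regular]
  {i : D →* X}
  {Y : Type w} [TopologicalSpace Y] [LocallyCompactSpace Y] [T2Space Y] [MulAction G Y]
  [ContinuousSMul G Y] {q : X → Y}

lemma isBoundedPairing_twistedConv (hi : IsClosedEmbedding i) :
    IsBoundedPairing (twistedConv μ α ν hi : C_c(G × X, A) → C_c(G × X, A) → _) := by
  intro S S' hS hS'
  obtain ⟨S'', hS'', h0⟩ := tconvRtrans_vanish (A := A) (μ := μ) (α := α) hi hS hS'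
  obtain ⟨C, hC⟩ := hS''.exists_bound_of_continuousOn (f := fun p => (sqrtModular ν p.1)⁻¹)
    (((continuous_sqrtModular ν).comp continuous_fst).inv₀
      fun p => (sqrtModular_pos ν p.1).ne').continuousOn
  have hC' : IsCompact (Prod.fst '' S) := hS.image continuous_fst
  refine ⟨S'', max C 0 * μ.real (Prod.fst '' S), hS'', mul_nonneg (le_max_right _ _)
    measureReal_nonneg, fun m m' x y hx hy => boundedOn_of_mem (fun p => ?_) (fun p hp => ?_)
    fun p hp => ?_⟩
  · exact mul_nonneg (mul_nonneg (le_max_right _ _) measureReal_nonneg)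
      (mul_nonneg (hx.nonneg p.2) (hy.nonneg p.2))
  · change (sqrtModular ν p.1)⁻¹ • tconvRtrans μ α i x y p = 0
    rw [h0 _ _ hx.1 hy.1 p hp, smul_zero]
  · change ‖(sqrtModular ν p.1)⁻¹ • tconvRtrans μ α i x y p‖ ≤ _
    rw [norm_smul, mul_assoc, mul_comm (μ.real _)]
    refine mul_le_mul ((hC p hp).trans (le_max_left _ _)) ?_ (norm_nonneg _) (le_max_right _ _)
    exact norm_tconv_le hC' (fun r s hr => hx.1 _ fun h => hr ⟨_, h, rfl⟩) hx.2
      (fun p => hy.2 _) _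

lemma isBoundedPairing_linnerCc (hi : IsClosedEmbedding i) :
    IsBoundedPairing (linnerCc μ α ν hi : C_c(G × X, A) → C_c(G × X, A) → _) :=
  (isBoundedPairing_twistedConv hi).comp_right isBoundedOperator_starCc

namespace IsOrbitMap

variable (hq : IsOrbitMap G i q)

variable (ν) in
/-- Integration over the orbits of `D`. -/
def descendCc (f : C_c(G × X, A)) : C_c(G × Y, A) := hq.descend ν (isCompactlySupported_coe f)

lemma rinnerCc_eq (x y : C_c(G × X, A)) :
    hq.rinnerCc μ α ν x y = hq.descendCc ν (convCc μ α (starCc μ α x) y) := rfl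

lemma isBoundedOperator_descendCc : IsBoundedOperator (hq.descendCc ν : C_c(G × X, A) → _) := by
  intro S hS
  have hV : IsCompact (Prod.snd '' S) := hS.image continuous_snd
  obtain ⟨T, hT, hT1⟩ := exists_compact_of_mul_mem hq.isClosedEmbedding hV hV
  have h0 : ∀ (f : C_c(G × X, A)), (∀ p ∉ S, f p = 0) → ∀ p ∉ Prod.map id q '' S,
      hq.descendCc ν f p = 0 := by
    rintro f hf ⟨r, y⟩ hp
    obtain ⟨s, rfl⟩ := hq.isOpenQuotientMap.surjective y
    rw [descendCc, hq.descend_apply]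
    refine integral_eq_zero_of_ae (Eventually.of_forall fun k => hf _ fun h => hp ⟨_, h, ?_⟩)
    simp [hq.map_mul]
  refine ⟨_, ν.real T, hS.image hq.isOpenQuotientMap_prodMap.continuous, measureReal_nonneg,
    fun m f hf => boundedOn_of_mem (fun p => ?_) (h0 f hf.1) ?_⟩
  · obtain ⟨s, -⟩ := hq.isOpenQuotientMap.surjective p.2
    exact mul_nonneg measureReal_nonneg (hf.nonneg (p.1, s))
  · rintro _ ⟨⟨r, s⟩, hp, rfl⟩
    change ‖hq.descendCc ν f (r, q s)‖ ≤ _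
    rw [descendCc, hq.descend_apply, mul_comm]
    exact norm_integral_le_of_vanish ν hT (fun k hk => hf.1 _ fun h =>
      hk (hT1 s ⟨_, hp, rfl⟩ k ⟨_, h, rfl⟩)) fun k => hf.2 _

lemma isBoundedPairing_rinnerCc :
    IsBoundedPairing (hq.rinnerCc μ α ν : C_c(G × X, A) → C_c(G × X, A) → _) := by
  intro S S' hS hS'
  obtain ⟨S₁, C₁, hS₁, hC₁, h₁⟩ := isBoundedPairing_tstar_tconv (μ := μ) (α := α) S S' hS hS'
  obtain ⟨S₂, C₂, hS₂, hC₂, h₂⟩ := hq.isBoundedOperator_descendCc (ν := ν) (A := A) S₁ hS₁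
  exact ⟨S₂, C₂ * C₁, hS₂, mul_nonneg hC₂ hC₁, fun m m' x y hx hy => by
    rw [mul_assoc]; exact h₂ _ _ (h₁ _ _ _ _ hx hy)⟩

end IsOrbitMap

end BoundednessOfOperations

/-! ### Continuity of families with locally controlled supports -/

section ContinuousFamilies

variable {T P : Type*} [TopologicalSpace T] [TopologicalSpace P] [LocallyCompactSpace T] [T2Space T]
  [T2Space P]
  {A : Type*} [NonUnitalCStarAlgebra A] {E : Type*} [NormedAddCommGroup E] [NormedSpace ℂ E]
  [CompleteSpace E]

/-- Inductively continuous maps preserve continuity of families with locally uniformly compact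
supports. -/
lemma InductivelyContinuous.continuous_family_of_locally {J : C_c(P, A) →ₗ[ℂ] E}
    (hJ : InductivelyContinuous J) {f : T → C_c(P, A)}
    (hf : Continuous fun p : T × P => f p.1 p.2)
    (h : ∀ K : Set T, IsCompact K → ∃ S, IsCompact S ∧ ∀ t ∈ K, ∀ p ∉ S, f t p = 0) :
    Continuous fun t => J (f t) := by
  rw [continuous_iff_continuousAt]
  intro t₀
  obtain ⟨K, hK, hKt⟩ := exists_compact_mem_nhds t₀
  obtain ⟨χ, hχ1, -, hχc, -⟩ := exists_continuous_one_zero_of_isCompact hK isClosed_empty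
    (Set.disjoint_empty _)
  obtain ⟨S, hS, h0⟩ := h _ hχc.isCompact
  have h0' : ∀ t ∉ tsupport χ, χ t • f t = 0 := fun t ht => by
    rw [image_eq_zero_of_notMem_tsupport ht, zero_smul]
  have hc : Continuous fun t => J (χ t • f t) := by
    refine hJ.continuous_family (S₀ := tsupport χ) (S := S)
      ((χ.continuous.comp continuous_fst).smul hf) hχc h0' hS fun t p hp => ?_
    by_cases ht : t ∈ tsupport χ
    · change χ t • f t p = 0
      rw [h0 t ht p hp, smul_zero]
    · rw [h0' t ht]; rfl
  refine hc.continuousAt.congr ?_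
  filter_upwards [hKt] with t ht
  rw [hχ1 ht, Pi.one_apply, one_smul]

end ContinuousFamilies

/-! ### Representations of crossed products from covariant forms -/

section CovariantForms

variable {G : Type v} [Group G] [TopologicalSpace G] [IsTopologicalGroup G] [LocallyCompactSpace G]
  [T2Space G] [MeasurableSpace G] [BorelSpace G] {μ : Measure G} [μ.IsHaarMeasure] [μ.Regular]
  {A : Type u} [NonUnitalCStarAlgebra A] {α : CStarAction G A}
  {X : Type w} [TopologicalSpace X] [T2Space X] [MulAction G X] [ContinuousSMul G X]
  {M : Type w} [TopologicalSpace M] [LocallyCompactSpace M] [T2Space M] [MulAction G M]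
  [ContinuousSMul G M]

/-- Pointwise multiplication of `C_c(G × X, A)` by functions on `M`, pulled back along `X → M`. -/
def mulCc {m : X → M} (hm : Continuous m) (f : C₀(M, A)) (x : C_c(G × X, A)) : C_c(G × X, A) :=
  mkCc (tmul (f ∘ m) x) (((f.continuous.comp hm).comp continuous_snd).mul x.continuous)
    ⟨tsupport x, x.hasCompactSupport, fun p hp => by
      rw [tmul, image_eq_zero_of_notMem_tsupport hp, mul_zero]⟩

lemma mulCc_apply {m : X → M} (hm : Continuous m) (f : C₀(M, A)) (x : C_c(G × X, A)) (p : G × X) :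
    mulCc hm f x p = f (m p.2) * x p := rfl

variable (α) in
/-- Translation on `C_c(G × X, A)`. -/
def transCc (t : G) (x : C_c(G × X, A)) : C_c(G × X, A) :=
  mkCc (ttrans α t x) (α.continuous_act_comp continuous_const (x.continuous.comp (by fun_prop)))
    ⟨(fun p : G × X => (t * p.1, t • p.2)) '' tsupport x,
      x.hasCompactSupport.isCompact.image (by fun_prop), fun p hp => by
      rw [ttrans, image_eq_zero_of_notMem_tsupport fun h => hp ⟨_, h, by simp⟩, map_zero]⟩

lemma transCc_apply (t : G) (x : C_c(G × X, A)) (p : G × X) :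
    transCc α t x p = α.act t (x (t⁻¹ * p.1, t⁻¹ • p.2)) := rfl

lemma isFiberCompact_pullback {m : X → M} (hm : Continuous m) (f : C_c(G × M, A)) :
    IsFiberCompact (pullback m f) := by
  obtain ⟨C, hC, h0⟩ := (isCompactlySupported_coe f).isFiberCompact.exists_compact
  exact ⟨f.continuous.comp (by fun_prop), C, hC, fun r s hr => h0 r _ hr⟩

variable (μ α) in
/-- Left convolution by functions on `G × M`, pulled back along `X → M`. -/
def pullConv {m : X → M} (hm : Continuous m) (f : C_c(G × M, A)) (x : C_c(G × X, A)) :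
    C_c(G × X, A) :=
  (IsCompactlySupported.tconv_right (μ := μ) (α := α) (isFiberCompact_pullback hm f)
    (isCompactlySupported_coe x)).toCc

lemma transCc_vanish {S : Set (G × X)} {x : C_c(G × X, A)} (hx : ∀ p ∉ S, x p = 0) {K : Set G}
    {t : G} (ht : t ∈ K) {p : G × X}
    (hp : p ∉ (fun q : G × (G × X) => (q.1 * q.2.1, q.1 • q.2.2)) '' (K ×ˢ S)) :
    transCc α t x p = 0 := by
  rw [transCc_apply, hx _ fun h => hp ⟨(t, _), ⟨ht, h⟩, by simp⟩, map_zero]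

variable (α) in
/-- A positive semi-definite form on `C_c(G × X, A)` for which the pointwise multiplications and the
translations form a covariant representation. -/
structure IsCovariantForm {m : X → M} (hm : Continuous m)
    (h : C_c(G × X, A) → C_c(G × X, A) → ℂ) : Prop where
  add_right : ∀ x y z, h x (y + z) = h x y + h x z
  smul_right : ∀ (c : ℂ) x y, h x (c • y) = c * h x y
  conj_symm : ∀ x y, starRingEnd ℂ (h x y) = h y x
  nonneg : ∀ x, 0 ≤ (h x x).re
  mulCc_left : ∀ f x y, h (mulCc hm f x) y = h x (mulCc hm (star f) y)
  transCc_transCc : ∀ t x y, h (transCc α t x) (transCc α t y) = h x y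
  bounded : ∀ S, IsCompact S → ∃ C : ℝ, 0 ≤ C ∧ ∀ k x, BoundedOn S k x → (h x x).re ≤ C * k ^ 2

namespace IsCovariantForm

variable {m : X → M} {hm : Continuous m} {h : C_c(G × X, A) → C_c(G × X, A) → ℂ}
  (hh : IsCovariantForm α hm h)

/-- The pre-inner product given by a covariant form. -/
@[reducible] def core : PreInnerProductSpace.Core ℂ C_c(G × X, A) where
  inner := h
  conj_inner_symm x y := hh.conj_symm y x
  re_inner_nonneg := hh.nonneg
  add_left x y z := by
    rw [← hh.conj_symm, hh.add_right, map_add, hh.conj_symm, hh.conj_symm]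
  smul_left x y c := by
    rw [← hh.conj_symm, hh.smul_right, map_mul, hh.conj_symm]

/-- Take f = χ ⊗ e with χ equal to one on the projection of the support of x to `M` and e an
approximate unit for the compact set of values of x. This is non-degeneracy of the GNS
representation. -/
lemma exists_mulCc_sub_le (hm : Continuous m) (x : C_c(G × X, A)) {ε : ℝ} (hε : 0 < ε) :
    ∃ f : C₀(M, A), ∀ p, ‖mulCc hm f x p - x p‖ ≤ ε := by
  obtain ⟨e, -, -, he⟩ := exists_approximate_unit
    (x.hasCompactSupport.isCompact.image x.continuous) hε
  obtain ⟨χ, hχ1, -, hχc, -⟩ := exists_continuous_one_zero_of_isCompact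
    (x.hasCompactSupport.isCompact.image (hm.comp continuous_snd)) isClosed_empty
    (Set.disjoint_empty _)
  refine ⟨⟨⟨fun y => χ y • e, by fun_prop⟩, ?_⟩, fun p => ?_⟩
  · exact (HasCompactSupport.intro hχc fun y hy => by
      change χ y • e = 0
      rw [image_eq_zero_of_notMem_tsupport hy, zero_smul]).is_zero_at_infty
  · rw [mulCc_apply]
    by_cases hp : p ∈ tsupport x
    · change ‖(χ (m p.2) • e) * x p - x p‖ ≤ ε
      have hχp : χ (m p.2) = 1 := hχ1 ⟨p, hp, rfl⟩
      rw [hχp, one_smul]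
      exact (he _ ⟨p, hp, rfl⟩).2
    · rw [image_eq_zero_of_notMem_tsupport hp, mul_zero, sub_zero, norm_zero]
      exact hε.le

variable (μ) in
include hh in
/-- The covariant representation associated to a covariant form. -/
theorem exists_covRep (hmG : ∀ (t : G) x, m (t • x) = t • m x) :
    ∃ (R : CovRep (translationAction α M)) (j : C_c(G × X, A) →ₗ[ℂ] R.E), DenseRange j ∧
      InductivelyContinuous j ∧ (∀ x y, inner ℂ (j x) (j y) = h x y) ∧
      ∀ (f : C_c(G × M, A)) x, R.integratedForm μ (curryCc f) (j x) = j (pullConv μ α hm f x) := by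
  -- The form may be degenerate; a seminorm suffices because completion passes to the separated
  -- quotient.
  let _ : SeminormedAddCommGroup C_c(G × X, A) :=
    InnerProductSpace.Core.toSeminormedAddCommGroup (c := hh.core)
  let _ : InnerProductSpace ℂ C_c(G × X, A) := InnerProductSpace.ofCore hh.core
  have hn : ∀ S, IsCompact S → ∃ C : ℝ, 0 ≤ C ∧ ∀ k (x : C_c(G × X, A)), BoundedOn S k x →
      ‖x‖ ≤ C * k := fun S hS => by
    rcases isEmpty_or_nonempty X with hX | ⟨⟨s⟩⟩
    · refine ⟨0, le_rfl, fun k x _ => ?_⟩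
      rw [show x = 0 by ext p; exact (hX.false p.2).elim, norm_zero, zero_mul]
    obtain ⟨C, hC, hb⟩ := hh.bounded S hS
    refine ⟨√C, Real.sqrt_nonneg _, fun k x hx => ?_⟩
    have hk : 0 ≤ k := hx.nonneg (1, s)
    change √(h x x).re ≤ _
    rw [← Real.sqrt_sq hk, ← Real.sqrt_mul hC]
    exact Real.sqrt_le_sqrt (hb k x hx)
  let J : C_c(G × X, A) →ₗᵢ[ℂ] UniformSpace.Completion C_c(G × X, A) :=
    UniformSpace.Completion.toComplₗᵢ
  have hJ : InductivelyContinuous J.toLinearMap := fun S hS => by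
    obtain ⟨C, hC, hb⟩ := hn S hS
    exact ⟨C, hC, fun k x hx => (J.norm_map x).trans_le (hb k x hx)⟩
  let π : C₀(M, A) →ₗ[ℂ] C_c(G × X, A) →ₗ[ℂ] C_c(G × X, A) := LinearMap.mk₂ ℂ
    (fun f x => mulCc hm f x) (fun f g x => by ext p; exact add_mul _ _ _)
    (fun c f x => by ext p; exact smul_mul_assoc _ _ _) (fun f x y => by ext p; exact mul_add _ _ _)
    (fun c f x => by ext p; exact mul_smul_comm _ _ _)
  let U : G → C_c(G × X, A) →ₗ[ℂ] C_c(G × X, A) := fun t =>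
    { toFun := transCc α t
      map_add' := fun x y => by ext p; exact map_add (α.act t) _ _
      map_smul' := fun c x => by ext p; exact map_smul (α.act t) _ _ }
  have hUc : ∀ x : C_c(G × X, A), Continuous fun q : G × (G × X) => transCc α q.1 x q.2 := fun x =>
    α.continuous_act_comp continuous_fst (x.continuous.comp
      (show Continuous fun q : G × (G × X) => (q.1⁻¹ * q.2.1, q.1⁻¹ • q.2.2) by fun_prop))
  have hUmul : ∀ s t x, U (s * t) x = U s (U t x) := fun s t x => by
    ext p
    change transCc α (s * t) x p = transCc α s (transCc α t x) p
    simp only [transCc_apply, α.act_mul, mul_inv_rev, mul_smul, mul_assoc]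
  have hnd : ∀ x : C_c(G × X, A), x ∈ closure (Submodule.span ℂ {x | ∃ b y, x = π b y} :
      Set C_c(G × X, A)) := fun x => by
    obtain ⟨S, k, hS, hk, hx⟩ := exists_boundedOn x
    obtain ⟨C, hC, hb⟩ := hn S hS
    rw [Metric.mem_closure_iff]
    intro ε hε
    obtain ⟨f, hf⟩ := exists_mulCc_sub_le hm x (ε := ε / (C + 1)) (by positivity)
    refine ⟨π f x, Submodule.subset_span ⟨f, x, rfl⟩, ?_⟩
    rw [dist_comm, dist_eq_norm]
    refine (hb (ε / (C + 1)) _ ⟨fun p hp => ?_, hf⟩).trans_lt ?_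
    · change mulCc hm f x p - x p = 0
      rw [mulCc_apply, hx.1 p hp, mul_zero, sub_zero]
    · rw [mul_div_assoc', div_lt_iff₀ (by positivity)]
      nlinarith
  have hUct : ∀ x, Continuous fun t => U t x := fun x => by
    refine J.isometry.isUniformInducing.isInducing.continuous_iff.2 ?_
    obtain ⟨S, k, hS, hk, hx⟩ := exists_boundedOn x
    refine hJ.continuous_family_of_locally (f := fun t => transCc α t x) (hUc x) fun K hK => ?_
    exact ⟨_, (hK.prod hS).image (f := fun q : G × (G × X) => (q.1 * q.2.1, q.1 • q.2.2))
      (by fun_prop), fun t ht p hp => transCc_vanish hx.1 ht hp⟩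
  obtain ⟨R, j, hj, hjπ, hjU⟩ := _root_.exists_covRep (γ := translationAction α M) π
    (fun f g x => by ext p; exact mul_assoc _ _ _) hh.mulCc_left hnd U
    (fun x => by
      ext p
      change transCc α 1 x p = x p
      rw [transCc_apply, α.act_one, inv_one, one_mul, one_smul])
    hUmul (fun t x => congrArg (fun z : ℂ => √z.re) (hh.transCc_transCc t x x)) hUct
    (fun t f x => by
      ext p
      change α.act t (f (t⁻¹ • m p.2)) * transCc α t x p = transCc α t (mulCc hm f x) p
      rw [transCc_apply, transCc_apply, mulCc_apply, map_mul, hmG])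
  have hjI : InductivelyContinuous j.toLinearMap := fun S hS => by
    obtain ⟨C, hC, hb⟩ := hn S hS
    exact ⟨C, hC, fun k x hx => (j.norm_map x).trans_le (hb k x hx)⟩
  refine ⟨R, j.toLinearMap, hj, hjI, fun x y => j.inner_map_map x y, fun f x => ?_⟩
  obtain ⟨S₀, k₀, hS₀, -, hf⟩ := exists_boundedOn f
  obtain ⟨S, k, hS, -, hx⟩ := exists_boundedOn x
  have hT : IsCompact (Prod.fst '' S₀) := hS₀.image continuous_fst
  have hf0 : ∀ t ∉ Prod.fst '' S₀, curryCc f t = 0 := fun t ht =>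
    ZeroAtInftyContinuousMap.ext fun y => hf.1 _ fun h => ht ⟨_, h, rfl⟩
  have hF0 : ∀ t ∉ Prod.fst '' S₀, mulCc hm (curryCc f t) (transCc α t x) = 0 := fun t ht => by
    ext p
    rw [mulCc_apply, hf0 t ht]
    exact zero_mul _
  -- Left convolution by f is the integral over t of translation by t followed by multiplication by
  -- f(t, ·), and inductive continuity of `j` lets it pass through that integral.
  rw [R.integratedForm_apply μ, hjI.map_integral μ
    (f := fun t => mulCc hm (curryCc f t) (transCc α t x)) ?_ hT hF0
    ((hT.prod hS).image (f := fun q : G × (G × X) => (q.1 * q.2.1, q.1 • q.2.2)) (by fun_prop)) ?_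
    (pullConv μ α hm f x) fun p => rfl]
  · refine integral_congr_ae (Eventually.of_forall fun t => ?_)
    exact (congrArg _ (hjU t x)).trans (hjπ _ _)
  · exact (f.continuous.comp (show Continuous fun q : G × (G × X) => (q.1, m q.2.2) by
      fun_prop)).mul (hUc x)
  · intro t p hp
    by_cases ht : t ∈ Prod.fst '' S₀
    · rw [mulCc_apply, transCc_vanish hx.1 ht hp, mul_zero]
    · rw [hF0 t ht]; rfl

end IsCovariantForm

end CovariantForms

/-! ### Cones, correlation functions and cut-offs -/

section
open scoped Pointwise

section Cones

/-- A closed convex cone contains the integrals of its compactly supported functions. -/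
lemma integral_mem_of_cone {T : Type*} [TopologicalSpace T] [R1Space T] [MeasurableSpace T]
    [OpensMeasurableSpace T] (κ : Measure T) [IsFiniteMeasureOnCompacts κ] {E : Type*}
    [NormedAddCommGroup E] [NormedSpace ℝ E] [CompleteSpace E] {F : Set E} (hF : IsClosed F)
    (h0 : (0 : E) ∈ F) (hadd : ∀ x ∈ F, ∀ y ∈ F, x + y ∈ F)
    (hsmul : ∀ c : ℝ, 0 ≤ c → ∀ x ∈ F, c • x ∈ F) {f : T → E} (hf : Continuous f) {S : Set T}
    (hS : IsCompact S) (hfS : ∀ t ∉ S, f t = 0) (h : ∀ t, f t ∈ F) : ∫ t, f t ∂κ ∈ F := by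
  have hconv : Convex ℝ F := fun x hx y hy a b ha hb _ =>
    hadd _ (hsmul a ha x hx) _ (hsmul b hb y hy)
  rw [← setIntegral_eq_integral_of_forall_compl_eq_zero hfS,
    ← measure_smul_setAverage f hS.measure_lt_top.ne]
  by_cases hκ : κ S = 0
  · rwa [measureReal_def, hκ, ENNReal.toReal_zero, zero_smul]
  · exact hsmul _ measureReal_nonneg _ (hconv.set_average_mem hF hκ hS.measure_lt_top.ne
      (Eventually.of_forall h) (integrable_of_continuous_of_vanish κ hf hS hfS).integrableOn)

lemma exists_star_mul_self_add {C : Type*} [NonUnitalCStarAlgebra C] {a b : C}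
    (ha : ∃ x, a = star x * x) (hb : ∃ x, b = star x * x) : ∃ x, a + b = star x * x := by
  let _ : PartialOrder C := CStarAlgebra.spectralOrder C
  have _ : StarOrderedRing C := CStarAlgebra.spectralOrderedRing C
  rw [← CStarAlgebra.nonneg_iff_eq_star_mul_self] at *
  exact add_nonneg ha hb

lemma exists_star_mul_self_smul {C : Type*} [NonUnitalCStarAlgebra C] {a : C} {c : ℝ} (hc : 0 ≤ c)
    (ha : ∃ x, a = star x * x) : ∃ x, c • a = star x * x := by
  obtain ⟨x, rfl⟩ := ha
  refine ⟨√c • x, ?_⟩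
  rw [star_smul, star_trivial (√c), smul_mul_smul_comm, Real.mul_self_sqrt hc]

end Cones

section Functions

variable {X : Type*} [Group X] [TopologicalSpace X] [IsTopologicalGroup X] [LocallyCompactSpace X]
  [T2Space X] {D : Type*} [Group D] [TopologicalSpace D] [IsTopologicalGroup D]
  [LocallyCompactSpace D] [T2Space D] {i : D →* X} (hi : IsClosedEmbedding i)

/-- A locally compact Hausdorff space need not be normal, so the Tietze theorem is applied in the
one-point compactification, to which the closed embedding extends. A cut-off equal to one on the
image of the support of χ restores compact support. -/
lemma Topology.IsClosedEmbedding.exists_extension_compactlySupported {D X : Type*} [TopologicalSpace D]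
    [TopologicalSpace X] [LocallyCompactSpace D] [T2Space D] [LocallyCompactSpace X] [T2Space X]
    {i : D → X} (hi : IsClosedEmbedding i) (χ : C_c(D, ℝ)) :
    ∃ w : C_c(X, ℝ), ∀ k, w (i k) = χ k := by
  have hm : IsClosedEmbedding (OnePoint.map i) :=
    (OnePoint.continuous_map hi.continuous (by
      simpa only [coclosedCompact_eq_cocompact] using hi.tendsto_cocompact)).isClosedEmbedding
      (Option.map_injective hi.injective)
  have ht : Tendsto χ (coclosedCompact D) (𝓝 0) := by
    rw [coclosedCompact_eq_cocompact]
    exact χ.hasCompactSupport.is_zero_at_infty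
  obtain ⟨F, hF⟩ := ContinuousMap.exists_extension' hm
    (OnePoint.continuousMapMk (χ : C(D, ℝ)) 0 ht)
  obtain ⟨g, hg1, -, hg, -⟩ := exists_continuous_one_zero_of_isCompact
    (χ.hasCompactSupport.isCompact.image hi.continuous) isClosed_empty (by simp)
  refine ⟨mkCc (fun x => g x * F (x : OnePoint X))
    (g.continuous.mul (F.continuous.comp OnePoint.continuous_coe))
    ⟨tsupport g, hg, fun x hx => by rw [image_eq_zero_of_notMem_tsupport hx, zero_mul]⟩,
    fun k => ?_⟩
  have h1 : F (i k : OnePoint X) = χ k := congr_fun hF (k : OnePoint D)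
  rw [mkCc_apply, h1]
  by_cases hk : k ∈ tsupport χ
  · rw [hg1 ⟨k, hk, rfl⟩, Pi.one_apply, one_mul]
  · rw [image_eq_zero_of_notMem_tsupport hk, mul_zero]

variable [MeasurableSpace X] [BorelSpace X] (κ : Measure X) [κ.IsHaarMeasure]

/-- The correlation function `k ↦ ∫ w'(p) w(k⁻¹ p) dp`. -/
def correlation (w' w : C_c(X, ℝ)) : C_c(D, ℝ) :=
  mkCc (fun k => ∫ p, w' p * w ((i k)⁻¹ * p) ∂κ)
    (continuous_integral_of_compact_support' κ (F := fun k p => w' p * w ((i k)⁻¹ * p))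
      ((w'.continuous.comp continuous_snd).mul (w.continuous.comp
        (((hi.continuous.comp continuous_fst).inv).mul continuous_snd)))
      w'.hasCompactSupport fun k p hp => by rw [image_eq_zero_of_notMem_tsupport hp, zero_mul])
    ⟨i ⁻¹' (tsupport w' * (tsupport w)⁻¹), hi.isCompact_preimage
      (w'.hasCompactSupport.isCompact.mul w.hasCompactSupport.isCompact.inv), fun k hk => by
      refine integral_eq_zero_of_ae (Eventually.of_forall fun p => ?_)
      by_contra hne
      refine hk (Set.mem_mul.2 ⟨p, ?_, p⁻¹ * i k, ?_, by group⟩)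
      · exact by_contra fun h => hne (by simp [image_eq_zero_of_notMem_tsupport h])
      · rw [Set.mem_inv, mul_inv_rev, inv_inv]
        exact by_contra fun h => hne (by simp [image_eq_zero_of_notMem_tsupport h])⟩

lemma correlation_apply (w' w : C_c(X, ℝ)) (k : D) :
    correlation hi κ w' w k = ∫ p, w' p * w ((i k)⁻¹ * p) ∂κ := rfl

lemma correlation_apply' (w' w : C_c(X, ℝ)) (k : D) :
    correlation hi κ w' w k = ∫ p, w' (i k * p) * w p ∂κ := by
  rw [correlation_apply, ← integral_mul_left_eq_self _ (i k)]
  simp only [inv_mul_cancel_left]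

/-- Every compactly supported function is approximated by correlation functions. -/
lemma exists_correlation_sub_le (χ : C_c(D, ℝ)) : ∃ (w' : C_c(X, ℝ)) (S : Set D), IsCompact S ∧
    ∀ ε > 0, ∃ w : C_c(X, ℝ), (∀ k ∉ S, correlation hi κ w' w k = 0 ∧ χ k = 0) ∧
      ∀ k, |correlation hi κ w' w k - χ k| ≤ ε := by
  -- With w' extending χ and w a bump at 1, the integral ∫ w'(i(k)p)w(p) dp is close to w'(i(k)) =
  -- χ(k). Both w' and the compact set are fixed before ε, so that constants depending on them are
  -- too.
  obtain ⟨w', hw'⟩ := hi.exists_extension_compactlySupported χ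
  obtain ⟨V, hV, hV1⟩ := exists_compact_mem_nhds (1 : X)
  have hc : IsCompact (tsupport w' * V⁻¹ ∪ tsupport w') :=
    (w'.hasCompactSupport.isCompact.mul hV.inv).union w'.hasCompactSupport
  refine ⟨w', i ⁻¹' (tsupport w' * V⁻¹ ∪ tsupport w'), hi.isCompact_preimage hc, fun ε hε => ?_⟩
  have e1 : ∀ᶠ p in 𝓝 (1 : X), ∀ x ∈ tsupport w' * V⁻¹ ∪ tsupport w',
      |w' (x * p) - w' x| ≤ ε := by
    refine hc.eventually_forall_of_forall_eventually fun x _ => ?_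
    have h : Continuous fun z : X × X => |w' (z.2 * z.1) - w' z.2| := by fun_prop
    have h' : |w' (x * 1) - w' x| < ε := by simpa using hε
    exact ((h.tendsto (1, x)).eventually (gt_mem_nhds h')).mono fun _ h => h.le
  obtain ⟨f, S, hf, hS, hSU, hnn, h0, h1⟩ := exists_bump κ (inter_mem e1 hV1)
  let w : C_c(X, ℝ) := mkCc f hf ⟨S, hS, h0⟩
  have hz : ∀ k, i k ∉ tsupport w' * V⁻¹ ∪ tsupport w' →
      correlation hi κ w' w k = 0 ∧ χ k = 0 := fun k hk => by
    refine ⟨?_, ?_⟩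
    · rw [correlation_apply']
      refine integral_eq_zero_of_ae (Eventually.of_forall fun p => ?_)
      change w' (i k * p) * f p = 0
      by_contra hne
      refine hk (Or.inl (Set.mem_mul.2 ⟨i k * p, ?_, p⁻¹, ?_, by group⟩))
      · exact by_contra fun h => hne (by simp [image_eq_zero_of_notMem_tsupport h])
      · refine Set.inv_mem_inv.2 (by_contra fun h => hne ?_)
        rw [h0 p fun h' => h (hSU h').2, mul_zero]
    · rw [← hw']
      exact image_eq_zero_of_notMem_tsupport fun h => hk (Or.inr h)
  refine ⟨w, hz, fun k => ?_⟩
  by_cases hk : i k ∈ tsupport w' * V⁻¹ ∪ tsupport w'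
  · have hint : Integrable (fun p => w' (i k * p) * w p) κ :=
      integrable_of_continuous_of_vanish κ (by fun_prop) hS fun p hp => by
        change _ * f p = 0
        rw [h0 p hp, mul_zero]
    have hint' : Integrable (fun p => f p) κ := integrable_of_continuous_of_vanish κ hf hS h0
    have e : correlation hi κ w' w k - χ k = ∫ p, (w' (i k * p) - w' (i k)) * f p ∂κ := by
      have e0 : χ k = w' (i k) * ∫ p, f p ∂κ := by rw [h1, mul_one, hw']
      rw [correlation_apply', e0, ← integral_const_mul,
        ← integral_sub hint (hint'.const_mul _)]
      refine integral_congr_ae (Eventually.of_forall fun p => ?_)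
      change w' (i k * p) * f p - w' (i k) * f p = _
      ring
    rw [e, ← Real.norm_eq_abs]
    calc _ ≤ ∫ p, ε * f p ∂κ := by
          refine norm_integral_le_of_norm_le (hint'.const_mul _) (Eventually.of_forall fun p => ?_)
          by_cases hp : p ∈ S
          · rw [norm_mul, Real.norm_of_nonneg (hnn p)]
            exact mul_le_mul_of_nonneg_right ((hSU hp).1 _ hk) (hnn p)
          · simp [h0 p hp]
      _ = ε := by rw [integral_const_mul, h1, mul_one]
  · rw [(hz k hk).1, (hz k hk).2, sub_zero, abs_zero]
    exact hε.le

/-- Autocorrelation functions can be concentrated near the identity. -/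
lemma exists_autocorrelation_bump [MeasurableSpace D] [BorelSpace D] (ν : Measure D)
    [ν.IsHaarMeasure] {U : Set D} (hU : U ∈ 𝓝 (1 : D)) : ∃ w : C_c(X, ℝ),
      (∀ k, 0 ≤ correlation hi κ w w k) ∧ (∀ k ∉ U, correlation hi κ w w k = 0) ∧
        ∫ k, correlation hi κ w w k ∂ν = 1 := by
  rw [hi.isInducing.nhds_eq_comap, map_one, mem_comap] at hU
  obtain ⟨V, hV, hVU⟩ := hU
  have hd : Tendsto (fun z : X × X => z.1 * z.2⁻¹) (𝓝 1 ×ˢ 𝓝 1) (𝓝 1) := by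
    have : Continuous fun z : X × X => z.1 * z.2⁻¹ := by fun_prop
    simpa [nhds_prod_eq] using this.tendsto (1, 1)
  -- If p and i(k)⁻¹p both lie in V', then i(k) = p(i(k)⁻¹p)⁻¹ lies in V; so a bump supported in V'
  -- has its autocorrelation supported where required.
  obtain ⟨V', hV', hV'V⟩ := mem_prod_same_iff.1 (hd hV)
  obtain ⟨f, S, hf, hS, hSU, hnn, h0, h1⟩ := exists_bump κ hV'
  let w : C_c(X, ℝ) := mkCc f hf ⟨S, hS, h0⟩
  have hω0 : ∀ k, 0 ≤ correlation hi κ w w k := fun k =>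
    integral_nonneg fun p => mul_nonneg (hnn _) (hnn _)
  obtain ⟨g, hg⟩ : ∃ g, f g ≠ 0 := by
    by_contra! h
    simp [h] at h1
  have hω1 : correlation hi κ w w 1 ≠ 0 := by
    rw [correlation_apply]
    refine (Continuous.integral_pos_of_hasCompactSupport_nonneg_nonzero
      (f := fun p => w p * w ((i 1)⁻¹ * p)) (by fun_prop)
      (HasCompactSupport.intro hS fun u hu => ?_)
      (fun u => mul_nonneg (hnn _) (hnn _)) (x := g) ?_).ne'
    · change f u * _ = 0
      rw [h0 u hu, zero_mul]
    · simpa [w] using hg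
  have hc : 0 < ∫ k, correlation hi κ w w k ∂ν :=
    (correlation hi κ w w).continuous.integral_pos_of_hasCompactSupport_nonneg_nonzero
      (correlation hi κ w w).hasCompactSupport hω0 hω1
  set c := ∫ k, correlation hi κ w w k ∂ν
  have hv : ∃ v : C_c(X, ℝ), ∀ k, correlation hi κ v v k = c⁻¹ * correlation hi κ w w k := by
    refine ⟨mkCc (fun g => (√c)⁻¹ * f g) (by fun_prop)
      ⟨S, hS, fun g hg => by rw [h0 g hg, mul_zero]⟩, fun k => ?_⟩
    rw [correlation_apply, correlation_apply, ← integral_const_mul]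
    refine integral_congr_ae (Eventually.of_forall fun p => ?_)
    change (√c)⁻¹ * f p * ((√c)⁻¹ * f ((i k)⁻¹ * p)) = c⁻¹ * (f p * f ((i k)⁻¹ * p))
    have : (√c)⁻¹ * (√c)⁻¹ = c⁻¹ := by rw [← mul_inv, Real.mul_self_sqrt hc.le]
    rw [← this]; ring
  obtain ⟨v, hv⟩ := hv
  refine ⟨v, fun k => ?_, fun k hk => ?_, ?_⟩
  · rw [hv]
    exact mul_nonneg (by positivity) (hω0 k)
  · rw [hv]
    have : correlation hi κ w w k = 0 := by
      rw [correlation_apply]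
      refine integral_eq_zero_of_ae (Eventually.of_forall fun p => ?_)
      change f p * f ((i k)⁻¹ * p) = 0
      by_contra hne
      refine hk (hVU ?_)
      have hp : p ∈ V' := by_contra fun h => hne (by rw [h0 p fun h' => h (hSU h'), zero_mul])
      have hp' : (i k)⁻¹ * p ∈ V' :=
        by_contra fun h => hne (by rw [h0 _ fun h' => h (hSU h'), mul_zero])
      simpa using hV'V (Set.mk_mem_prod hp hp')
    rw [this, mul_zero]
  · simp only [hv, integral_const_mul]
    exact inv_mul_cancel₀ hc.ne'

end Functions

section Cutoff

/-- Openness of q makes the image of a compact neighbourhood a neighbourhood, and finitely many of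
these cover W. -/
lemma IsOpenQuotientMap.exists_compact_subset_image {X Y : Type*} [TopologicalSpace X]
    [TopologicalSpace Y] [LocallyCompactSpace X] {q : X → Y} (hq : IsOpenQuotientMap q) {W : Set Y}
    (hW : IsCompact W) : ∃ S : Set X, IsCompact S ∧ W ⊆ q '' S := by
  refine hW.induction_on (p := fun W => ∃ S : Set X, IsCompact S ∧ W ⊆ q '' S)
    ⟨∅, isCompact_empty, Set.empty_subset _⟩ (fun s t hst ⟨S, hS, h⟩ => ⟨S, hS, hst.trans h⟩)
    (fun s t ⟨S, hS, h⟩ ⟨S', hS', h'⟩ => ⟨S ∪ S', hS.union hS', by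
      rw [Set.image_union]; exact Set.union_subset_union h h'⟩) fun y _ => ?_
  obtain ⟨x, rfl⟩ := hq.surjective y
  obtain ⟨V, hV, hVx⟩ := exists_compact_mem_nhds x
  exact ⟨q '' V, mem_nhdsWithin_of_mem_nhds (hq.isOpenMap.image_mem_nhds hVx), V, hV, le_rfl⟩

variable {G : Type v} [Group G]
  {X : Type w} [Group X] [TopologicalSpace X] [IsTopologicalGroup X] [LocallyCompactSpace X]
  [T2Space X] [MulAction G X] [IsScalarTower G X X]
  {D : Type*} [Group D] [TopologicalSpace D] [IsTopologicalGroup D] [LocallyCompactSpace D]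
  [T2Space D] [MeasurableSpace D] [BorelSpace D] (ν : Measure D) [ν.IsHaarMeasure]
  {i : D →* X}
  {Y : Type*} [TopologicalSpace Y] [MulAction G Y] {q : X → Y}

/-- A function whose square has integral one over the orbits of `D` in a given compact set. -/
lemma IsOrbitMap.exists_cutoff (hq : IsOrbitMap G i q) {W : Set Y} (hW : IsCompact W) :
    ∃ g : C_c(X, ℝ), ∀ s, q s ∈ W → ∫ k, g (s * i k) * g (s * i k) ∂ν = 1 := by
  have hi := hq.isClosedEmbedding
  obtain ⟨S, hS, hWS⟩ := hq.isOpenQuotientMap.exists_compact_subset_image hW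
  obtain ⟨g, hg1, -, hg, hg01⟩ := exists_continuous_one_zero_of_isCompact hS isClosed_empty
    (by simp)
  let P : X → ℝ := fun s => ∫ k, g (s * i k) * g (s * i k) ∂ν
  have hF : Continuous fun z : X × D => g (z.1 * i z.2) * g (z.1 * i z.2) := by
    have : Continuous fun z : X × D => g (z.1 * i z.2) :=
      g.continuous.comp (continuous_fst.mul (hi.continuous.comp continuous_snd))
    exact this.mul this
  have hPc : Continuous P := by
    refine continuous_integral_of_locally_compact_support ν
      (F := fun s k => g (s * i k) * g (s * i k)) hF fun s => ?_
    obtain ⟨V, hV, hVs⟩ := exists_compact_mem_nhds s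
    obtain ⟨T, hT, h⟩ := exists_compact_of_mul_mem hi hV hg
    refine ⟨V, hVs, T, hT, fun z hz k hk => ?_⟩
    rw [image_eq_zero_of_notMem_tsupport fun h' => hk (h z hz k h'), zero_mul]
  have hPinv : ∀ s m, P (s * i m) = P s := fun s m => by
    have := integral_mul_left_eq_self (μ := ν) (fun k => g (s * i k) * g (s * i k)) m
    refine Eq.trans (integral_congr_ae (Eventually.of_forall fun k => ?_)) this
    rw [i.map_mul, ← mul_assoc]
  have hPpos : ∀ s ∈ S, 0 < P s := fun s hs => by
    obtain ⟨T, hT, h⟩ := exists_compact_of_mul_mem hi (isCompact_singleton (x := s)) hg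
    refine Continuous.integral_pos_of_hasCompactSupport_nonneg_nonzero (x := 1)
      (hF.comp (continuous_const.prodMk continuous_id)) (HasCompactSupport.intro hT fun k hk => ?_)
      (fun k => mul_self_nonneg _) ?_
    · rw [image_eq_zero_of_notMem_tsupport fun h' => hk (h s rfl k h'), zero_mul]
    · simp [hg1 hs]
  -- P has a positive lower bound c on S, and being constant on orbits it has this bound over all of
  -- W. Dividing by √(max(P, c)) is thus continuous everywhere and agrees with dividing by √P over
  -- W.
  obtain ⟨c, hc, hcP⟩ := hS.exists_forall_le' hPc.continuousOn hPpos
  refine ⟨mkCc (fun s => g s * (√(max (P s) c))⁻¹) (g.continuous.mul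
    ((hPc.max continuous_const).sqrt.inv₀ fun s => (Real.sqrt_pos.2 (lt_max_of_lt_right hc)).ne'))
    ⟨tsupport g, hg, fun s hs => by rw [image_eq_zero_of_notMem_tsupport hs, zero_mul]⟩,
    fun s hs => ?_⟩
  obtain ⟨x, hx, hxs⟩ := hWS hs
  obtain ⟨m, rfl⟩ := hq.exists_eq_mul x s hxs
  have hle : c ≤ P x := hcP x hx
  have hP0 : 0 < P x := hc.trans_le hle
  have e : ∀ k, (√(max (P (x * i m * i k)) c))⁻¹ * (√(max (P (x * i m * i k)) c))⁻¹ = (P x)⁻¹ := by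
    intro k
    rw [hPinv, hPinv, max_eq_left hle, ← mul_inv, Real.mul_self_sqrt hP0.le]
  have e' : ∀ k, g (x * i m * i k) * (√(max (P (x * i m * i k)) c))⁻¹ *
      (g (x * i m * i k) * (√(max (P (x * i m * i k)) c))⁻¹) =
      (g (x * i m * i k) * g (x * i m * i k)) * (P x)⁻¹ := fun k => by
    rw [← e k]; ring
  simp only [mkCc_apply, e']
  rw [integral_mul_const]
  change P (x * i m) * _ = 1
  rw [hPinv, mul_inv_cancel₀ hP0.ne']

end Cutoff

end

/-! ### Convolution squares with weights -/

section WeightedSquares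

variable {G : Type v} [Group G] [TopologicalSpace G] [IsTopologicalGroup G] [LocallyCompactSpace G]
  [T2Space G] [MeasurableSpace G] [BorelSpace G] {μ : Measure G} [μ.IsHaarMeasure] [μ.Regular]
  {A : Type u} [NonUnitalCStarAlgebra A] {α : CStarAction G A}
  {X : Type w} [TopologicalSpace X] [T2Space X] [MulAction G X] [ContinuousSMul G X]

/-- The function `(r, s) ↦ g(s) φ(r) a`. -/
def weightFun (g : X → ℝ) (φ : C_c(G, ℝ)) (a : A) (p : G × X) : A := g p.2 • constFun X φ a p

variable (μ α) in
/-- The integrand of the convolution square of `(r, s) ↦ φ(r) a`. -/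
def squareIntegrand (φ : C_c(G, ℝ)) (a : A) (r : G) (s : X) (t : G) : A :=
  tstar μ α (constFun X φ a) (t, s) * α.act t (constFun X φ a (t⁻¹ * r, t⁻¹ • s))

lemma continuous_squareIntegrand (φ : C_c(G, ℝ)) (a : A) (r : G) (s : X) :
    Continuous (squareIntegrand μ α φ a r s) :=
  ((isFiberCompact_constFun φ a).tstar.continuous.comp (by fun_prop)).mul
    (α.continuous_act_comp continuous_id ((isFiberCompact_constFun φ a).continuous.comp
      (by fun_prop)))

lemma squareIntegrand_eq_zero {φ : C_c(G, ℝ)} {t : G} (ht : t⁻¹ ∉ tsupport φ) (a : A) (r : G)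
    (s : X) : squareIntegrand μ α φ a r s t = 0 := by
  rw [squareIntegrand, tstar_apply, constFun, image_eq_zero_of_notMem_tsupport ht, zero_smul,
    star_zero, map_zero, smul_zero, zero_mul]

lemma tstar_weightFun (g : X → ℝ) (φ : C_c(G, ℝ)) (a : A) (t : G) (s : X) :
    tstar μ α (weightFun g φ a) (t, s) = g (t⁻¹ • s) • tstar μ α (constFun X φ a) (t, s) := by
  rw [tstar_apply, tstar_apply, weightFun, star_smul, star_trivial (g _), starHom_real_smul,
    smul_comm]

/-- The involution and the convolution both evaluate their weights at t⁻¹s, so the weights combine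
into one scalar factor at a common point. Averages over weights can therefore be computed inside the
integral. -/
lemma tconv_tstar_weightFun (g g' : X → ℝ) (φ : C_c(G, ℝ)) (a : A) (r : G) (s : X) :
    tconv μ α (tstar μ α (weightFun g φ a)) (weightFun g' φ a) (r, s) =
      ∫ t, (g (t⁻¹ • s) * g' (t⁻¹ • s)) • squareIntegrand μ α φ a r s t ∂μ := by
  rw [tconv_apply]
  refine integral_congr_ae (Eventually.of_forall fun t => ?_)
  simp only [tstar_weightFun]
  rw [weightFun, starHom_real_smul, smul_mul_smul_comm, squareIntegrand]

/-- Integrating weights with total weight `c` yields a multiple of the convolution square. -/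
lemma integral_weighted_squareIntegrand {Z : Type*} [TopologicalSpace Z] [R1Space Z]
    [MeasurableSpace Z]
    [OpensMeasurableSpace Z] (κ : Measure Z) [IsFiniteMeasureOnCompacts κ] {H : Z → X → ℝ}
    (hH : Continuous fun p : Z × X => H p.1 p.2)
    (h0 : ∀ V : Set X, IsCompact V → ∃ S, IsCompact S ∧ ∀ z ∉ S, ∀ y ∈ V, H z y = 0)
    (φ : C_c(G, ℝ)) (a : A) (r : G) (s : X) {c : ℝ}
    (h : ∀ t ∈ tsupport φ, ∫ z, H z (t • s) ∂κ = c) :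
    ∫ z, ∫ t, H z (t⁻¹ • s) • squareIntegrand μ α φ a r s t ∂μ ∂κ =
      c • squareFun μ α X φ a (r, s) := by
  have hC : IsCompact ((tsupport φ)⁻¹) := φ.hasCompactSupport.isCompact.inv
  obtain ⟨S, hS, hS0⟩ := h0 ((fun t : G => t⁻¹ • s) '' (tsupport φ)⁻¹) (hC.image (by fun_prop))
  have hz : ∀ (z : Z) (t : G), t ∉ (tsupport φ)⁻¹ →
      H z (t⁻¹ • s) • squareIntegrand μ α φ a r s t = 0 := fun z t ht => by
    rw [squareIntegrand_eq_zero (fun h => ht (Set.mem_inv.2 h)), smul_zero]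
  have hz' : ∀ (z : Z) (t : G), z ∉ S → t ∈ (tsupport φ)⁻¹ → H z (t⁻¹ • s) = 0 :=
    fun z t hzS ht => hS0 z hzS _ ⟨t, ht, rfl⟩
  rw [integral_swap_of_vanish κ μ ?_ hS hC ?_ hz, squareFun, tconv_apply, ← integral_smul]
  · refine integral_congr_ae (Eventually.of_forall fun t => ?_)
    by_cases ht : t ∈ (tsupport φ)⁻¹
    · change ∫ z, H z (t⁻¹ • s) • squareIntegrand μ α φ a r s t ∂κ =
        c • squareIntegrand μ α φ a r s t
      rw [integral_smul_const, h _ (Set.mem_inv.1 ht)]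
    · change ∫ z, H z (t⁻¹ • s) • squareIntegrand μ α φ a r s t ∂κ =
        c • squareIntegrand μ α φ a r s t
      simp only [squareIntegrand_eq_zero (fun h => ht (Set.mem_inv.2 h)), smul_zero,
        integral_zero]
  · exact (hH.comp (by fun_prop : Continuous fun p : Z × G => (p.1, p.2⁻¹ • s))).smul
      ((continuous_squareIntegrand φ a r s).comp continuous_snd)
  · intro z t hzS
    by_cases ht : t ∈ (tsupport φ)⁻¹
    · rw [hz' z t hzS ht, zero_smul]
    · exact hz z t ht

end WeightedSquares

/-! ### Positivity on the left and fullness on the right -/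

section RightFullness

variable {G : Type v} [Group G] [TopologicalSpace G] [IsTopologicalGroup G] [LocallyCompactSpace G]
  [T2Space G] [MeasurableSpace G] [BorelSpace G] {μ : Measure G} [μ.IsHaarMeasure] [μ.Regular]
  {A : Type u} [NonUnitalCStarAlgebra A] {α : CStarAction G A}
  {X : Type w} [Group X] [TopologicalSpace X] [IsTopologicalGroup X] [LocallyCompactSpace X]
  [T2Space X] [MulAction G X] [ContinuousSMul G X] [IsScalarTower G X X]
  {D : Type*} [Group D] [TopologicalSpace D] [IsTopologicalGroup D] [LocallyCompactSpace D]
  [T2Space D] [MeasurableSpace D] [BorelSpace D] {ν : Measure D} [ν.IsHaarMeasure] [ν.Regular]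
  {i : D →* X}
  {Y : Type w} [TopologicalSpace Y] [LocallyCompactSpace Y] [T2Space Y] [MulAction G Y]
  [ContinuousSMul G Y] {q : X → Y}

lemma squareFun_pullback (q : X → Y) (φ : C_c(G, ℝ)) (a : A) :
    pullback q (squareFun μ α Y φ a) = squareFun μ α X φ a := by
  ext ⟨r, s⟩
  rw [pullback, squareFun_apply, squareFun_apply]

/-- The function `(r, s) ↦ g(s) φ(r) a`, for `g` of compact support. -/
def weightCc (g : C_c(X, ℝ)) (φ : C_c(G, ℝ)) (a : A) : C_c(G × X, A) :=
  mkCc (weightFun g φ a)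
    ((g.continuous.comp continuous_snd).smul (isFiberCompact_constFun φ a).continuous)
    ⟨tsupport φ ×ˢ tsupport g, φ.hasCompactSupport.isCompact.prod g.hasCompactSupport, fun p hp => by
      rw [weightFun, constFun, smul_smul]
      have : g p.2 * φ p.1 = 0 := by
        by_contra hne
        refine hp ⟨by_contra fun h => hne ?_, by_contra fun h => hne ?_⟩
        · rw [image_eq_zero_of_notMem_tsupport h, mul_zero]
        · rw [image_eq_zero_of_notMem_tsupport h, zero_mul]
      rw [this, zero_smul]⟩

namespace IsOrbitMap

variable (hq : IsOrbitMap G i q)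

variable (μ α ν) in
/-- Right inner products agree on compact sets with convolution squares. -/
lemma exists_rinnerCc_eq_squareFun (φ : C_c(G, ℝ)) (a : A) {W : Set Y} (hW : IsCompact W) :
    ∃ u : C_c(G × X, A), ∀ r, ∀ y ∈ W,
      hq.rinnerCc μ α ν u u (r, y) = squareFun μ α Y φ a (r, y) := by
  -- The weights are evaluated at ts with t in the support of φ and q(s) in W, so the cut-off has to
  -- be normalised over the translates of W by that support.
  obtain ⟨g, hg⟩ := hq.exists_cutoff ν
    ((φ.hasCompactSupport.isCompact.prod hW).image (f := fun p : G × Y => p.1 • p.2) (by fun_prop))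
  refine ⟨weightCc g φ a, fun r y hy => ?_⟩
  obtain ⟨s, rfl⟩ := hq.isOpenQuotientMap.surjective y
  have hi := hq.isClosedEmbedding.continuous
  rw [rinnerCc_apply]
  change _ = pullback q (squareFun μ α Y φ a) (r, s)
  rw [squareFun_pullback, ← one_smul ℝ (squareFun μ α X φ a (r, s)),
    ← integral_weighted_squareIntegrand ν (H := fun k y => g (y * i k) * g (y * i k)) ?_ ?_ φ a r s
      (c := 1) fun t ht => hg _ ?_]
  · refine integral_congr_ae (Eventually.of_forall fun k => ?_)
    refine (tconv_tstar_weightFun _ _ φ a r (s * i k)).trans ?_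
    refine integral_congr_ae (Eventually.of_forall fun t => ?_)
    have e : t⁻¹ • (s * i k) = t⁻¹ • s * i k := (smul_mul_assoc _ _ _).symm
    simp only [squareIntegrand, tstar_apply, constFun, e]
  · have : Continuous fun p : D × X => g (p.2 * i p.1) := g.continuous.comp
      (continuous_snd.mul (hi.comp continuous_fst))
    exact this.mul this
  · intro V hV
    obtain ⟨S, hS, h⟩ := exists_compact_of_mul_mem hq.isClosedEmbedding hV g.hasCompactSupport
    refine ⟨S, hS, fun k hk y hy => ?_⟩
    rw [image_eq_zero_of_notMem_tsupport fun h' => hk (h y hy k h'), zero_mul]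
  · rw [hq.map_smul]
    exact ⟨(t, q s), ⟨ht, hy⟩, rfl⟩

/-- The convolution sees κ^* * κ only over the points q(t⁻¹s) with (t, s) in the support of z. These
form a compact set, on which a right inner product can replace it. -/
lemma exists_convSquare_eq_ractCc (φ : C_c(G, ℝ)) (a : A) (z : C_c(G × X, A)) :
    ∃ u, convSquare μ α φ a z = hq.ractCc μ α z (hq.rinnerCc μ α ν u u) := by
  have hc := hq.isOpenQuotientMap.continuous
  obtain ⟨u, hu⟩ := hq.exists_rinnerCc_eq_squareFun μ α ν φ a
    (z.hasCompactSupport.isCompact.image (f := fun p : G × X => q (p.1⁻¹ • p.2))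
      (hc.comp (by fun_prop)))
  refine ⟨u, DFunLike.coe_injective ?_⟩
  rw [coe_convSquare, coe_ractCc, ← squareFun_pullback q]
  ext ⟨r, s⟩
  rw [tconv_apply, tconv_apply]
  refine integral_congr_ae (Eventually.of_forall fun t => ?_)
  by_cases ht : (t, s) ∈ tsupport z
  · simp only [pullback]
    rw [hu _ _ ⟨_, ht, rfl⟩]
  · simp only [image_eq_zero_of_notMem_tsupport ht, zero_mul]

lemma exists_convSquare_eq_convCc (φ : C_c(G, ℝ)) (a : A) (b : C_c(G × Y, A)) :
    ∃ u, convSquare μ α φ a b = convCc μ α b (hq.rinnerCc μ α ν u u) := by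
  obtain ⟨u, hu⟩ := hq.exists_rinnerCc_eq_squareFun μ α ν φ a
    (b.hasCompactSupport.isCompact.image (f := fun p : G × Y => p.1⁻¹ • p.2) (by fun_prop))
  refine ⟨u, DFunLike.coe_injective ?_⟩
  rw [coe_convSquare, coe_convCc]
  ext ⟨r, s⟩
  rw [tconv_apply, tconv_apply]
  refine integral_congr_ae (Eventually.of_forall fun t => ?_)
  by_cases ht : (t, s) ∈ tsupport b
  · simp only
    rw [hu _ _ ⟨_, ht, rfl⟩]
  · simp only [image_eq_zero_of_notMem_tsupport ht, zero_mul]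

/-- The left inner product is positive. -/
theorem exists_inclItₗ_linnerCc_self (x : C_c(G × X, A)) : ∃ l,
    inclItₗ μ α hq.isClosedEmbedding ν (linnerCc μ α ν hq.isClosedEmbedding x x) = star l * l := by
  have hi := hq.isClosedEmbedding
  let J : C_c(G × X, A) →ₗ[ℂ] CrossedProduct ν (rightDualAction μ α hi) :=
    { toFun := fun z => inclItₗ μ α hi ν (linnerCc μ α ν hi z x)
      map_add' := fun z z' => by rw [linnerCc_add_left, _root_.map_add]
      map_smul' := fun c z => by rw [linnerCc_smul_left, _root_.map_smul, RingHom.id_apply] }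
  have hJ : InductivelyContinuous J := (inductivelyContinuous_inclItₗ hi).comp_isBoundedOperator
    ((isBoundedPairing_linnerCc hi).left x) fun _ => rfl
  refine hJ.mem_of_convSquare_mem (μ := μ) (α := α) isClosed_star_mul_self x fun φ a => ?_
  obtain ⟨u, hu⟩ := hq.exists_convSquare_eq_ractCc (μ := μ) (α := α) (ν := ν) φ a x
  -- L⟨x·⟨u,u⟩R, x⟩ = L⟨L⟨x,u⟩·u, x⟩ = L⟨x,u⟩L⟨u,x⟩, and the first factor is the adjoint of the
  -- second.
  refine ⟨inclItₗ μ α hi ν (linnerCc μ α ν hi u x), ?_⟩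
  rw [hu, ← lactCc_linnerCc]
  change inclItₗ μ α hi ν (linnerCc μ α ν hi (lactCc μ α ν hi _ u) x) = _
  rw [inclItₗ_linnerCc_lactCc, star_inclItₗ_linnerCc]

/-- The right inner product is full. -/
theorem dense_span_inclₗ_rinnerCc : Dense (Submodule.span ℂ {r | ∃ x y : C_c(G × X, A),
    r = inclₗ μ α Y (hq.rinnerCc μ α ν x y)} :
      Set (CrossedProduct μ (translationAction α Y))) := by
  refine fun r => closure_minimal (fun z hz => ?_) isClosed_closure
    (denseRange_inclₗ (μ := μ) (α := α) (X := Y) r)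
  obtain ⟨b, rfl⟩ := hz
  refine (inductivelyContinuous_inclₗ (μ := μ) (α := α)).mem_of_convSquare_mem (μ := μ) (α := α)
    isClosed_closure b fun φ a => ?_
  obtain ⟨u, hu⟩ := hq.exists_convSquare_eq_convCc (μ := μ) (α := α) (ν := ν) φ a b
  -- The witnesses come from b⟨u,u⟩R = (⟨u,u⟩R b^*)^* = ⟨u·b^*, u⟩R.
  refine subset_closure (Submodule.subset_span ⟨hq.ractCc μ α u (starCc μ α b), u, ?_⟩)
  rw [hu, inclₗ_convCc, ← star_inclₗ_rinnerCc hq u (hq.ractCc μ α u (starCc μ α b)),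
    inclₗ_rinnerCc_ractCc, star_mul, inclₗ_starCc, star_star, star_inclₗ_rinnerCc]

end IsOrbitMap

end RightFullness

/-! ### Tents and their averages -/

section
open scoped Pointwise

section Tents

variable {G : Type v} [Group G] [TopologicalSpace G] [IsTopologicalGroup G] [LocallyCompactSpace G]
  [T2Space G] [MeasurableSpace G] [BorelSpace G] {μ : Measure G} [μ.IsHaarMeasure] [μ.Regular]
  {A : Type u} [NonUnitalCStarAlgebra A] {α : CStarAction G A}
  {X : Type w} [Group X] [TopologicalSpace X] [IsTopologicalGroup X] [LocallyCompactSpace X]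
  [T2Space X] [MulAction G X] [ContinuousSMul G X] [IsScalarTower G X X]
  {D : Type*} [Group D] [TopologicalSpace D] [IsTopologicalGroup D] [LocallyCompactSpace D]
  [T2Space D] [MeasurableSpace D] [BorelSpace D] {ν : Measure D} [ν.IsHaarMeasure] [ν.Regular]
  {i : D →* X} (hi : IsClosedEmbedding i)

/-- The function `s ↦ w(s⁻¹ p)`. -/
def reflectCc (w : C_c(X, ℝ)) (p : X) : C_c(X, ℝ) :=
  mkCc (fun s => w (s⁻¹ * p)) (by fun_prop) ⟨{p} * (tsupport w)⁻¹,
    isCompact_singleton.mul w.hasCompactSupport.isCompact.inv, fun s hs =>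
      image_eq_zero_of_notMem_tsupport fun h => hs (Set.mem_mul.2
        ⟨p, rfl, p⁻¹ * s, by simpa using h, by group⟩)⟩

/-- The function `(r, s) ↦ w(s⁻¹ p) φ(r) a`. -/
def tentCc (w : C_c(X, ℝ)) (φ : C_c(G, ℝ)) (a : A) (p : X) : C_c(G × X, A) :=
  weightCc (reflectCc w p) φ a

lemma tentCc_apply (w : C_c(X, ℝ)) (φ : C_c(G, ℝ)) (a : A) (p : X) (z : G × X) :
    tentCc w φ a p z = w (z.2⁻¹ * p) • constFun X φ a z := rfl

lemma tstar_tentCc (w : C_c(X, ℝ)) (φ : C_c(G, ℝ)) (a : A) (p : X) (z : G × X) :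
    tstar μ α (tentCc w φ a p) z =
      w ((z.1⁻¹ • z.2)⁻¹ * p) • tstar μ α (constFun X φ a) z :=
  tstar_weightFun _ φ a z.1 z.2

lemma tstar_tentCc_eq_zero {φ : C_c(G, ℝ)} (w : C_c(X, ℝ)) (a : A) (p : X) {r : G} (s : X)
    (hr : r ∉ (tsupport φ)⁻¹) : tstar μ α (tentCc w φ a p) (r, s) = 0 := by
  rw [tstar_tentCc, tstar_apply, constFun,
    image_eq_zero_of_notMem_tsupport (fun h => hr (Set.mem_inv.2 h))]
  simp

lemma continuous_tstar_tentCc (w : C_c(X, ℝ)) (φ : C_c(G, ℝ)) (a : A) :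
    Continuous fun z : X × G × X => tstar μ α (tentCc w φ a z.1) z.2 := by
  simp only [tstar_tentCc]
  have : Continuous fun z : X × G × X => w ((z.2.1⁻¹ • z.2.2)⁻¹ * z.1) := by fun_prop
  exact this.smul ((isFiberCompact_constFun φ a).tstar.continuous.comp continuous_snd)

include hi in
lemma continuous_twistedConv_family {Z : Type*} [TopologicalSpace Z] {x y : Z → C_c(G × X, A)}
    (hx : Continuous fun p : Z × G × X => x p.1 p.2)
    (hy : Continuous fun p : Z × G × X => y p.1 p.2) {S : Set (G × X)} (hS : IsCompact S)
    (h : ∀ z, ∀ p ∉ S, x z p = 0) :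
    Continuous fun p : Z × D × G × X => twistedConv μ α ν hi (x p.1) (y p.1) p.2 := by
  have hic := hi.continuous
  have h1 : Continuous fun p : Z × D × G × X => (sqrtModular ν p.2.1)⁻¹ :=
    ((continuous_sqrtModular ν).comp (by fun_prop)).inv₀ fun p => (sqrtModular_pos ν p.2.1).ne'
  have h2 : Continuous fun p : (Z × D) × G × X =>
      tconv μ α (x p.1.1) (rtrans (i p.1.2) (y p.1.1)) p.2 :=
    continuous_tconv_family (F := fun p : Z × D => x p.1) (H := fun p => rtrans (i p.2) (y p.1))
      (hx.comp (by fun_prop : Continuous fun p : (Z × D) × G × X => (p.1.1, p.2)))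
      (hy.comp (by fun_prop : Continuous fun p : (Z × D) × G × X =>
        (p.1.1, p.2.1, p.2.2 * i p.1.2)))
      (hS.image continuous_fst) fun z r s hr => h _ _ fun h => hr ⟨_, h, rfl⟩
  exact h1.smul (h2.comp
    (by fun_prop : Continuous fun p : Z × D × G × X => ((p.1, p.2.1), p.2.2)))

lemma continuous_convCc_family {Z : Type*} [TopologicalSpace Z] (f : C_c(G × X, A))
    {y : Z → C_c(G × X, A)} (hy : Continuous fun p : Z × G × X => y p.1 p.2) :
    Continuous fun p : Z × G × X => convCc μ α f (y p.1) p.2 :=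
  continuous_tconv_family (F := fun _ => f) (H := fun z => y z)
    (f.continuous.comp continuous_snd) hy (f.hasCompactSupport.isCompact.image continuous_fst)
    fun _ _ _ hr => image_eq_zero_of_notMem_tsupport fun h => hr ⟨_, h, rfl⟩

lemma continuous_tentCc (w : C_c(X, ℝ)) (φ : C_c(G, ℝ)) (a : A) :
    Continuous fun z : X × G × X => tentCc w φ a z.1 z.2 := by
  simp only [tentCc_apply]
  have : Continuous fun z : X × G × X => w (z.2.2⁻¹ * z.1) := by fun_prop
  exact this.smul ((isFiberCompact_constFun φ a).continuous.comp continuous_snd)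

lemma convCc_starCc_tentCc_eq_zero (f : C_c(G × X, A)) (w : C_c(X, ℝ)) (φ : C_c(G, ℝ)) (a : A)
    (p : X) {z : G × X} (hz : z ∉ (fun q : (G × X) × G => (q.1.1 * q.2, q.1.2)) ''
      (tsupport f ×ˢ (tsupport φ)⁻¹)) : convCc μ α f (starCc μ α (tentCc w φ a p)) z = 0 :=
  tconv_apply_eq_zero_of_left (fun _ hz => image_eq_zero_of_notMem_tsupport hz)
    (fun _ s hr => tstar_tentCc_eq_zero w a p s hr) hz

include hi in
lemma continuous_twistedConv_tentCc (f : C_c(G × X, A)) (w' w : C_c(X, ℝ)) (φ : C_c(G, ℝ)) (a : A) :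
    Continuous fun z : X × D × G × X => twistedConv μ α ν hi
      (convCc μ α f (starCc μ α (tentCc w' φ a z.1))) (tentCc w φ a z.1) z.2 := by
  have hS₁ : IsCompact ((fun q : (G × X) × G => (q.1.1 * q.2, q.1.2)) ''
      (tsupport f ×ˢ (tsupport φ)⁻¹)) :=
    (f.hasCompactSupport.isCompact.prod φ.hasCompactSupport.isCompact.inv).image (by fun_prop)
  exact continuous_twistedConv_family hi
    (continuous_convCc_family f (y := fun p => starCc μ α (tentCc w' φ a p))
      (continuous_tstar_tentCc w' φ a)) (continuous_tentCc w φ a) hS₁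
    fun p z hz => convCc_starCc_tentCc_eq_zero f w' φ a p hz

variable [MeasurableSpace X] [BorelSpace X] (κ : Measure X) [κ.IsHaarMeasure]

/-- At y = t⁻¹s the weight is w'(y⁻¹p)w((y i(k))⁻¹p). Its integral over p is the correlation at k,
independent of y by left invariance of `κ`, so it comes out as a scalar factor. -/
lemma integral_tconv_tentCc (w' w : C_c(X, ℝ)) (φ : C_c(G, ℝ)) (a : A) (k : D) (z : G × X) :
    ∫ p, tconv μ α (tstar μ α (tentCc w' φ a p)) (rtrans (i k) (tentCc w φ a p)) z ∂κ =
      correlation hi κ w' w k • squareFun μ α X φ a z := by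
  obtain ⟨r, s⟩ := z
  rw [← integral_weighted_squareIntegrand κ
    (H := fun p y => w' (y⁻¹ * p) * w ((y * i k)⁻¹ * p)) (by fun_prop) (fun V hV => ?_) φ a r s
    (c := correlation hi κ w' w k) fun t _ => ?_]
  · refine integral_congr_ae (Eventually.of_forall fun p => ?_)
    exact tconv_tstar_weightFun (fun y => w' (y⁻¹ * p)) (fun y => w ((y * i k)⁻¹ * p)) φ a r s
  · refine ⟨V * tsupport w', hV.mul w'.hasCompactSupport, fun p hp y hy => ?_⟩
    rw [image_eq_zero_of_notMem_tsupport fun h => hp (Set.mem_mul.2 ⟨y, hy, _, h, by group⟩),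
      zero_mul]
  · refine Eq.trans (integral_congr_ae (Eventually.of_forall fun p => ?_))
      (integral_mul_left_eq_self (μ := κ) (fun p => w' p * w ((i k)⁻¹ * p)) (t • s)⁻¹)
    simp only [mul_inv_rev, mul_assoc]

include hi in
lemma integral_tconv_tconv_tentCc (f : C_c(G × X, A)) (w' w : C_c(X, ℝ)) (φ : C_c(G, ℝ)) (a : A)
    (k : D) (z : G × X) :
    ∫ p, tconv μ α (convCc μ α f (starCc μ α (tentCc w' φ a p)))
      (rtrans (i k) (tentCc w φ a p)) z ∂κ =
      correlation hi κ w' w k • convSquare μ α φ a f z := by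
  have hc : Continuous fun z : X × G × X => tconv μ α (tstar μ α (tentCc w' φ a z.1))
      (rtrans (i k) (tentCc w φ a z.1)) z.2 :=
    continuous_tconv_family (F := fun p => tstar μ α (tentCc w' φ a p))
      (H := fun p => rtrans (i k) (tentCc w φ a p)) (continuous_tstar_tentCc w' φ a)
      ((continuous_tentCc w φ a).comp
        (by fun_prop : Continuous fun z : X × G × X => (z.1, z.2.1, z.2.2 * i k)))
      φ.hasCompactSupport.isCompact.inv fun p r s hr => tstar_tentCc_eq_zero w' a p s hr
  have e : ∀ p, tconv μ α (convCc μ α f (starCc μ α (tentCc w' φ a p)))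
      (rtrans (i k) (tentCc w φ a p)) z = tconv μ α f (tconv μ α (tstar μ α (tentCc w' φ a p))
        (rtrans (i k) (tentCc w φ a p))) z := fun p =>
    congrFun (tconv_assoc (isCompactlySupported_coe f).isFiberCompact
      (isCompactlySupported_coe (tentCc w' φ a p)).tstar.isFiberCompact
      ((isCompactlySupported_coe (tentCc w φ a p)).rtrans (i k)).isFiberCompact) z
  simp only [e]
  rw [integral_tconv_family κ (isCompactlySupported_coe f).isFiberCompact hc]
  · simp only [integral_tconv_tentCc hi κ]
    obtain ⟨r, s⟩ := z
    rw [coe_convSquare, tconv_apply, tconv_apply, ← integral_smul]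
    refine integral_congr_ae (Eventually.of_forall fun t => ?_)
    simp only [starHom_real_smul, mul_smul_comm]
  · intro V hV
    have hC : IsCompact ((fun q : G × X => q.1⁻¹ • q.2) '' ((tsupport φ)⁻¹ ×ˢ V)) :=
      (φ.hasCompactSupport.isCompact.inv.prod hV).image (by fun_prop)
    refine ⟨_, hC.mul w'.hasCompactSupport.isCompact, fun p hp r s hs => ?_⟩
    rw [tconv_apply]
    refine integral_eq_zero_of_ae (Eventually.of_forall fun t => ?_)
    have : tstar μ α (tentCc w' φ a p) (t, s) = 0 := by
      by_cases ht : t ∈ (tsupport φ)⁻¹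
      · rw [tstar_tentCc, image_eq_zero_of_notMem_tsupport (fun h => hp (Set.mem_mul.2
          ⟨t⁻¹ • s, ⟨(t, s), ⟨ht, hs⟩, rfl⟩, _, h, by group⟩)), zero_smul]
      · exact tstar_tentCc_eq_zero w' a p s ht
    simp only [this, zero_mul, Pi.zero_apply]

lemma isBoundedOperator_tensorCc {P Q : Type*} [TopologicalSpace P] [TopologicalSpace Q]
    [R1Space P] [R1Space Q] (χ : C_c(P, ℝ)) :
    IsBoundedOperator (tensorCc χ : C_c(Q, A) → C_c(P × Q, A)) := by
  intro S hS
  obtain ⟨S', C, hS', hC, hb⟩ := exists_boundedOn χ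
  refine ⟨S' ×ˢ S, C, hS'.prod hS, hC, fun m x hx => ⟨fun p hp => ?_, fun p => ?_⟩⟩
  · rw [Set.mem_prod, not_and_or] at hp
    change χ p.1 • x p.2 = 0
    rcases hp with h | h
    · rw [hb.1 _ h, zero_smul]
    · rw [hx.1 _ h, smul_zero]
  · change ‖χ p.1 • x p.2‖ ≤ _
    rw [norm_smul]
    exact mul_le_mul (hb.2 _) (hx.2 _) (norm_nonneg _) hC

/-- Integrals over the tents of left inner products of tents are tensors of correlation
functions. -/
theorem InductivelyContinuous.mem_of_tentCc_mem {E : Type*} [NormedAddCommGroup E] [NormedSpace ℂ E]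
    [CompleteSpace E] {J : C_c(D × G × X, A) →ₗ[ℂ] E} (hJ : InductivelyContinuous J) {F : Set E}
    (hF : IsClosed F) (h0 : (0 : E) ∈ F) (hadd : ∀ x ∈ F, ∀ y ∈ F, x + y ∈ F)
    (hsmul : ∀ c : ℝ, 0 ≤ c → ∀ x ∈ F, c • x ∈ F) (w' w : C_c(X, ℝ)) (f : C_c(G × X, A))
    (h : ∀ φ a p, J (twistedConv μ α ν hi (convCc μ α f (starCc μ α (tentCc w' φ a p)))
      (tentCc w φ a p)) ∈ F) (χ : C_c(D, ℝ))
    (hχ : ∀ k, χ k = (sqrtModular ν k)⁻¹ * correlation hi κ w' w k) : J (tensorCc χ f) ∈ F := by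
  let J' : C_c(G × X, A) →ₗ[ℂ] E :=
    { toFun := fun f => J (tensorCc χ f)
      map_add' := fun f g => by
        rw [← map_add]
        congr 1
        ext p
        exact smul_add _ _ _
      map_smul' := fun c f => by
        rw [RingHom.id_apply, ← map_smul]
        congr 1
        ext p
        exact smul_comm _ _ _ }
  have hJ' : InductivelyContinuous J' :=
    hJ.comp_isBoundedOperator (isBoundedOperator_tensorCc χ) fun _ => rfl
  -- F is closed, so f may be replaced by f * κ^* * κ; for such functions the tensor is exactly an
  -- average over tents.
  refine hJ'.mem_of_convSquare_mem (μ := μ) (α := α) hF f fun φ a => ?_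
  change J (tensorCc χ (convSquare μ α φ a f)) ∈ F
  set T' := tentCc w' φ a
  set T := tentCc w φ a
  have hC : IsCompact (tsupport φ)⁻¹ := φ.hasCompactSupport.isCompact.inv
  set S₁ := (fun q : (G × X) × G => (q.1.1 * q.2, q.1.2)) '' (tsupport f ×ˢ (tsupport φ)⁻¹)
  have hS₁ : IsCompact S₁ := (f.hasCompactSupport.isCompact.prod hC).image (by fun_prop)
  have h1 : ∀ p, ∀ z ∉ S₁, convCc μ α f (starCc μ α (T' p)) z = 0 := fun p z hz =>
    convCc_starCc_tentCc_eq_zero f w' φ a p hz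
  -- At (r, s) the tent in f * T'_p^* contributes the weight w'((r⁻¹s)⁻¹p) whatever the convolution
  -- variable, so p is confined to the points r⁻¹s times the support of w'.
  set S₀ := (fun q : G × X => q.1⁻¹ • q.2) '' S₁ * tsupport w'
  have hS₀ : IsCompact S₀ := (hS₁.image (by fun_prop)).mul w'.hasCompactSupport.isCompact
  have h2 : ∀ p ∉ S₀, convCc μ α f (starCc μ α (T' p)) = 0 := fun p hp => by
    ext ⟨r, s⟩
    by_cases hz : (r, s) ∈ S₁
    · rw [coe_convCc, tconv_apply]
      refine integral_eq_zero_of_ae (Eventually.of_forall fun t => ?_)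
      have : starCc μ α (T' p) (t⁻¹ * r, t⁻¹ • s) = 0 := by
        have e : w' (((t⁻¹ * r)⁻¹ • t⁻¹ • s)⁻¹ * p) = 0 := by
          refine image_eq_zero_of_notMem_tsupport fun h =>
            hp (Set.mem_mul.2 ⟨r⁻¹ • s, ⟨(r, s), hz, rfl⟩, _, h, ?_⟩)
          rw [smul_smul]
          simp
        rw [coe_starCc, tstar_tentCc, e, zero_smul]
      simp only [this, map_zero, mul_zero, Pi.zero_apply]
    · exact h1 p _ hz
  have h3 : ∀ p ∈ S₀, ∀ z ∉ tsupport φ ×ˢ (S₀ * (tsupport w)⁻¹), T p z = 0 := fun p hp z hz => by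
    rw [Set.mem_prod, not_and_or] at hz
    rw [tentCc_apply]
    rcases hz with h | h
    · rw [constFun, image_eq_zero_of_notMem_tsupport h, zero_smul, smul_zero]
    · rw [image_eq_zero_of_notMem_tsupport fun h' => h (Set.mem_mul.2
        ⟨p, hp, _, Set.inv_mem_inv.2 h', by group⟩), zero_smul]
  obtain ⟨S, hS, hvan⟩ := tconvRtrans_vanish (A := A) (μ := μ) (α := α) hi hS₁
    (φ.hasCompactSupport.isCompact.prod (hS₀.mul w.hasCompactSupport.isCompact.inv))
  have h4 : ∀ p ∉ S₀, twistedConv μ α ν hi (convCc μ α f (starCc μ α (T' p))) (T p) = 0 :=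
    fun p hp => by
      ext ⟨k, r, s⟩
      rw [twistedConv_apply, h2 p hp, tconv_apply]
      simp
  have h5 : ∀ p, ∀ z ∉ S, twistedConv μ α ν hi (convCc μ α f (starCc μ α (T' p))) (T p) z = 0 :=
    fun p z hz => by
      by_cases hp : p ∈ S₀
      · change (sqrtModular ν z.1)⁻¹ • tconvRtrans μ α i _ _ z = 0
        rw [hvan _ _ (h1 p) (h3 p hp) z hz, smul_zero]
      · rw [h4 p hp, CompactlySupportedContinuousMap.zero_apply]
  have h6 := continuous_twistedConv_tentCc (μ := μ) (α := α) (ν := ν) hi f w' w φ a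
  rw [hJ.map_integral κ (f := fun p => twistedConv μ α ν hi (convCc μ α f (starCc μ α (T' p))) (T p))
    h6 hS₀ h4 hS h5 (tensorCc χ (convSquare μ α φ a f)) fun z => ?_]
  · exact integral_mem_of_cone κ hF h0 hadd hsmul (hJ.continuous_family h6 hS₀ h4 hS h5) hS₀
      (fun p hp => by rw [h4 p hp, map_zero]) fun p => h φ a p
  · obtain ⟨k, r, s⟩ := z
    change χ k • convSquare μ α φ a f (r, s) = _
    simp only [twistedConv_apply]
    rw [integral_smul, integral_tconv_tconv_tentCc hi κ, smul_smul, hχ]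

end Tents

end

/-! ### Fullness of the left inner product -/

section LeftFullness

variable {G : Type v} [Group G] [TopologicalSpace G] [IsTopologicalGroup G] [LocallyCompactSpace G]
  [T2Space G] [MeasurableSpace G] [BorelSpace G] {μ : Measure G} [μ.IsHaarMeasure] [μ.Regular]
  {A : Type u} [NonUnitalCStarAlgebra A] {α : CStarAction G A}
  {X : Type w} [Group X] [TopologicalSpace X] [IsTopologicalGroup X] [LocallyCompactSpace X]
  [T2Space X] [MulAction G X] [ContinuousSMul G X] [IsScalarTower G X X]
  {D : Type*} [Group D] [TopologicalSpace D] [IsTopologicalGroup D] [LocallyCompactSpace D]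
  [T2Space D] [MeasurableSpace D] [BorelSpace D] {ν : Measure D} [ν.IsHaarMeasure] [ν.Regular]
  {i : D →* X} (hi : IsClosedEmbedding i)

variable (ν) in
/-- The function `Δ^(-1/2) χ`. -/
def sqrtModularInvMul (χ : C_c(D, ℝ)) : C_c(D, ℝ) :=
  mkCc (fun k => (sqrtModular ν k)⁻¹ * χ k)
    (((continuous_sqrtModular ν).inv₀ fun k => (sqrtModular_pos ν k).ne').mul χ.continuous)
    ⟨tsupport χ, χ.hasCompactSupport, fun k hk => by
      rw [image_eq_zero_of_notMem_tsupport hk, mul_zero]⟩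

variable (ν) in
/-- The function `Δ^(1/2) χ`. -/
def sqrtModularMul (χ : C_c(D, ℝ)) : C_c(D, ℝ) :=
  mkCc (fun k => sqrtModular ν k * χ k) ((continuous_sqrtModular ν).mul χ.continuous)
    ⟨tsupport χ, χ.hasCompactSupport, fun k hk => by
      rw [image_eq_zero_of_notMem_tsupport hk, mul_zero]⟩

variable (μ α ν) in
/-- The left inner product is full. -/
theorem dense_span_inclItₗ_linnerCc : Dense (Submodule.span ℂ {l | ∃ x y : C_c(G × X, A),
    l = inclItₗ μ α hi ν (linnerCc μ α ν hi x y)} :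
      Set (CrossedProduct ν (rightDualAction μ α hi))) := by
  let _ : MeasurableSpace X := borel X
  have _ : BorelSpace X := ⟨rfl⟩
  let κ : Measure X := Measure.haar
  set V := Submodule.span ℂ {l | ∃ x y : C_c(G × X, A),
    l = inclItₗ μ α hi ν (linnerCc μ α ν hi x y)}
  have hV : (V.topologicalClosure : Set (CrossedProduct ν (rightDualAction μ α hi))) = closure (V : Set _) :=
    Submodule.topologicalClosure_coe V
  suffices h : ∀ (χ : C_c(D, ℝ)) (f : C_c(G × X, A)),
      inclItₗ μ α hi ν (tensorCc χ f) ∈ V.topologicalClosure by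
    refine fun l => closure_minimal ?_ isClosed_closure
      (dense_span_inclItₗ_tensorCc (μ := μ) (α := α) (ν := ν) hi l)
    rw [← hV]
    refine Submodule.span_le.2 ?_
    rintro _ ⟨χ, f, rfl⟩
    exact h χ f
  intro χ f
  -- Averages over tents carry a factor Δ^{-1/2}, so it is Δ^{1/2}χ that is approximated by
  -- correlations.
  obtain ⟨w', S, hS, hw⟩ := exists_correlation_sub_le hi κ (sqrtModularMul ν χ)
  -- The closed span is in particular a closed convex cone, and each function being averaged is the
  -- left inner product of f * T'_p^* with T_p^*.
  have hmem : ∀ w, inclItₗ μ α hi ν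
      (tensorCc (sqrtModularInvMul ν (correlation hi κ w' w)) f) ∈ V.topologicalClosure := fun w =>
    (inductivelyContinuous_inclItₗ hi).mem_of_tentCc_mem hi κ (μ := μ) (α := α) isClosed_closure
      (zero_mem V.topologicalClosure) (fun x hx y hy => V.topologicalClosure.add_mem hx hy)
      (fun c _ x hx => V.topologicalClosure.smul_of_tower_mem c hx) w' w f
      (fun φ a p => subset_closure (Submodule.subset_span ⟨_, starCc μ α (tentCc w φ a p), by
        rw [linnerCc, starCc_starCc]⟩)) _ fun k => rfl
  rw [← SetLike.mem_coe, ← V.isClosed_topologicalClosure.closure_eq, Metric.mem_closure_iff]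
  intro ε hε
  obtain ⟨C, hC⟩ := hS.exists_bound_of_continuousOn (f := fun k => (sqrtModular ν k)⁻¹)
    ((continuous_sqrtModular ν).inv₀ fun k => (sqrtModular_pos ν k).ne').continuousOn
  obtain ⟨Sf, m, hSf, hm, hf⟩ := exists_boundedOn f
  obtain ⟨C', hC'0, hC'⟩ := inductivelyContinuous_inclItₗ (μ := μ) (α := α) (ν := ν) hi _
    (hS.prod hSf)
  set M := max C 0
  have hM : 0 ≤ M := le_max_right _ _
  -- M, m and C' depend only on S and f and are already fixed; this tolerance makes the final bound
  -- C' M m times it smaller than ε.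
  obtain ⟨w, hw0, hw1⟩ := hw (ε / ((C' + 1) * (M * m + 1))) (by positivity)
  refine ⟨_, hmem w, ?_⟩
  have e : ∀ p, (tensorCc (sqrtModularInvMul ν (correlation hi κ w' w)) f - tensorCc χ f) p =
      ((sqrtModular ν p.1)⁻¹ * (correlation hi κ w' w p.1 - sqrtModularMul ν χ p.1)) • f p.2 :=
    fun p => by
      change ((sqrtModular ν p.1)⁻¹ * correlation hi κ w' w p.1) • f p.2 - χ p.1 • f p.2 =
        ((sqrtModular ν p.1)⁻¹ * (correlation hi κ w' w p.1 - sqrtModular ν p.1 * χ p.1)) • f p.2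
      rw [← sub_smul, mul_sub, inv_mul_cancel_left₀ (sqrtModular_pos ν p.1).ne']
  rw [dist_comm, dist_eq_norm, ← map_sub]
  have hδ : 0 ≤ ε / ((C' + 1) * (M * m + 1)) := by positivity
  refine (hC' (M * (ε / ((C' + 1) * (M * m + 1))) * m) _ ⟨fun p hp => ?_, fun p => ?_⟩).trans_lt ?_
  · rw [e]
    rw [Set.mem_prod, not_and_or] at hp
    rcases hp with h | h
    · rw [(hw0 _ h).1, (hw0 _ h).2, sub_zero, mul_zero, zero_smul]
    · rw [hf.1 _ h, smul_zero]
  · rw [e, norm_smul, norm_mul]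
    by_cases hp : p.1 ∈ S
    · exact mul_le_mul (mul_le_mul ((hC _ hp).trans (le_max_left _ _)) (hw1 _) (norm_nonneg _) hM)
        (hf.2 _) (norm_nonneg _) (by positivity)
    · rw [(hw0 _ hp).1, (hw0 _ hp).2, sub_zero, norm_zero, mul_zero, zero_mul]
      positivity
  · have : C' * (M * (ε / ((C' + 1) * (M * m + 1))) * m) =
        ε * (C' * (M * m)) / ((C' + 1) * (M * m + 1)) := by ring
    rw [this, div_lt_iff₀ (by positivity)]
    have : 0 ≤ M * m := by positivity
    nlinarith

end LeftFullness

/-! ### Positivity of the right inner product -/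

section RightPositivity

variable {G : Type v} [Group G] [TopologicalSpace G] [IsTopologicalGroup G] [LocallyCompactSpace G]
  [T2Space G] [MeasurableSpace G] [BorelSpace G] {μ : Measure G} [μ.IsHaarMeasure] [μ.Regular]
  {A : Type u} [NonUnitalCStarAlgebra A] {α : CStarAction G A}
  {X : Type w} [Group X] [TopologicalSpace X] [IsTopologicalGroup X] [LocallyCompactSpace X]
  [T2Space X] [MulAction G X] [ContinuousSMul G X] [IsScalarTower G X X]
  {D : Type*} [Group D] [TopologicalSpace D] [IsTopologicalGroup D] [LocallyCompactSpace D]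
  [T2Space D] [MeasurableSpace D] [BorelSpace D] {ν : Measure D} [ν.IsHaarMeasure] [ν.Regular]
  {i : D →* X} (hi : IsClosedEmbedding i)
  {Y : Type w} [TopologicalSpace Y] [LocallyCompactSpace Y] [T2Space Y] [MulAction G Y]
  [ContinuousSMul G Y] {q : X → Y}

lemma integrable_family {F : D → C_c(G × X, A)} {T : Set D}
    (hF : Continuous fun p : D × G × X => F p.1 p.2) (hT : IsCompact T) (h : ∀ k ∉ T, F k = 0)
    (p : G × X) : Integrable (fun k => F k p) ν :=
  integrable_of_continuous_of_vanish ν (hF.comp (continuous_id.prodMk continuous_const)) hT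
    fun k hk => by
      change F k p = 0
      rw [h k hk, CompactlySupportedContinuousMap.zero_apply]

include hi in
lemma integrable_lactFamily (c : C_c(D × G × X, A)) (x : C_c(G × X, A)) (p : G × X) :
    Integrable (fun k => lactFamily μ α ν i c x k p) ν := by
  obtain ⟨T, S, hT, -, h1, -⟩ := exists_lactFamily_vanish (μ := μ) (α := α) (ν := ν) i c x
  exact integrable_family (continuous_lactFamily hi c x) hT h1 p

include hi in
lemma continuous_rtransCc_family (x : C_c(G × X, A)) :
    Continuous fun p : D × G × X => rtransCc (i p.1) x p.2 := by
  have := hi.continuous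
  exact x.continuous.comp (by fun_prop : Continuous fun p : D × G × X => (p.2.1, p.2.2 * i p.1))

lemma lactCc_add_left (c d : C_c(D × G × X, A)) (x : C_c(G × X, A)) :
    lactCc μ α ν hi (c + d) x = lactCc μ α ν hi c x + lactCc μ α ν hi d x := by
  ext p
  refine Eq.trans (integral_congr_ae (Eventually.of_forall fun k => ?_)) (integral_add
    (integrable_lactFamily hi c x p) (integrable_lactFamily hi d x p))
  simp only [lactFamily_apply]
  rw [← smul_add]
  congr 1
  exact congrFun (tconv_add_left (isCompactlySupported_coe (sliceCc c k)).isFiberCompact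
    (isCompactlySupported_coe (sliceCc d k)).isFiberCompact
    ((isCompactlySupported_coe x).rtrans (i k)).continuous) p

lemma lactCc_smul_left (a : ℂ) (c : C_c(D × G × X, A)) (x : C_c(G × X, A)) :
    lactCc μ α ν hi (a • c) x = a • lactCc μ α ν hi c x := by
  ext p
  refine Eq.trans (integral_congr_ae (Eventually.of_forall fun k => ?_)) (integral_smul a
    fun k => lactFamily μ α ν i c x k p)
  simp only [lactFamily_apply]
  rw [smul_comm]
  congr 1
  exact congrFun (tconv_smul_left a _ _) p

/-- For fixed x this makes c ↦ c·x compatible with inductive continuity, so that statements about c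
can be tested on averages of tents. -/
lemma isBoundedOperator_lactCc (x : C_c(G × X, A)) :
    IsBoundedOperator fun c => lactCc μ α ν hi c x := by
  intro S hS
  obtain ⟨Sx, mx, hSx, hmx, hx⟩ := exists_boundedOn x
  have hT : IsCompact (Prod.fst '' S) := hS.image continuous_fst
  have hS' : IsCompact (Prod.snd '' S) := hS.image continuous_snd
  have hC : IsCompact (Prod.fst '' (Prod.snd '' S)) := hS'.image continuous_fst
  obtain ⟨C, hC'⟩ := hT.exists_bound_of_continuousOn (f := fun k => sqrtModular ν k)
    (continuous_sqrtModular ν).continuousOn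
  set M := max C 0
  have hM : 0 ≤ M := le_max_right _ _
  have h0 : ∀ c : C_c(D × G × X, A), (∀ p ∉ S, c p = 0) → ∀ k, ∀ p ∉ Prod.snd '' S,
      sliceCc c k p = 0 := fun c hc k p hp => hc _ fun h => hp ⟨_, h, rfl⟩
  refine ⟨_, M * mx * μ.real (Prod.fst '' (Prod.snd '' S)) * ν.real (Prod.fst '' S),
    (hS'.prod (hSx.image continuous_fst)).image
      (f := fun q : (G × X) × G => (q.1.1 * q.2, q.1.2)) (by fun_prop),
    mul_nonneg (mul_nonneg (mul_nonneg hM hmx) measureReal_nonneg) measureReal_nonneg,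
    fun m c hc => boundedOn_of_mem (fun p => ?_) (fun p hp => ?_) fun p hp => ?_⟩
  · exact mul_nonneg (mul_nonneg (mul_nonneg (mul_nonneg hM hmx) measureReal_nonneg)
      measureReal_nonneg) (hc.nonneg (1, p))
  · rw [lactCc_apply]
    refine integral_eq_zero_of_ae (Eventually.of_forall fun k => ?_)
    simp only
    rw [tconv_apply_eq_zero_of_left (C := Prod.fst '' Sx) (g := rtrans (i k) x) (h0 c hc.1 k)
      (fun r s hr => hx.1 _ fun h => hr ⟨_, h, rfl⟩) hp, smul_zero, Pi.zero_apply]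
  · rw [lactCc_apply]
    have hm : 0 ≤ m := hc.nonneg (1, p)
    refine (norm_integral_le_of_vanish ν hT (m := M * (m * mx * μ.real (Prod.fst '' (Prod.snd '' S))))
      (fun k hk => ?_) fun k => ?_).trans_eq (by ring)
    · rw [tconv_apply]
      have : ∀ t, sliceCc c k (t, p.2) = 0 := fun t => hc.1 (k, t, p.2) fun h => hk ⟨_, h, rfl⟩
      simp [this]
    · by_cases hk : k ∈ Prod.fst '' S
      · rw [norm_smul]
        refine mul_le_mul ((hC' k hk).trans (le_max_left _ _)) ?_ (norm_nonneg _) hM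
        exact norm_tconv_le hC (fun r s hr => h0 c hc.1 k _ fun h => hr ⟨_, h, rfl⟩)
          (fun p => hc.2 _) (fun p => hx.2 _) p
      · have : ∀ t, sliceCc c k (t, p.2) = 0 := fun t => hc.1 (k, t, p.2) fun h => hk ⟨_, h, rfl⟩
        rw [tconv]
        simp only [this, zero_mul, integral_zero, smul_zero, norm_zero]
        have := @measureReal_nonneg _ _ μ (Prod.fst '' (Prod.snd '' S))
        positivity

namespace IsOrbitMap

variable (hq : IsOrbitMap G i q)

variable (ν) in
/-- Integration over the orbits of `D`, as a linear map. -/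
def descendₗ : C_c(G × X, A) →ₗ[ℂ] C_c(G × Y, A) where
  toFun := hq.descendCc ν
  map_add' f g := by
    refine hq.eq_of_pullback_eq (funext fun p => ?_)
    change hq.descendCc ν (f + g) (p.1, q p.2) = hq.descendCc ν f (p.1, q p.2) +
      hq.descendCc ν g (p.1, q p.2)
    rw [descendCc, descendCc, descendCc, descend_apply, descend_apply, descend_apply, ← integral_add
      (integrable_orbitIntegral hq.isClosedEmbedding (isCompactlySupported_coe f) _ _)
      (integrable_orbitIntegral hq.isClosedEmbedding (isCompactlySupported_coe g) _ _)]
    rfl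
  map_smul' c f := by
    refine hq.eq_of_pullback_eq (funext fun p => ?_)
    change hq.descendCc ν (c • f) (p.1, q p.2) = c • hq.descendCc ν f (p.1, q p.2)
    rw [descendCc, descendCc, descend_apply, descend_apply, ← integral_smul]
    rfl

/-- Functions pulled back from `Y` leave the orbit integral. Applied to x^* * v and ⟨v,x⟩R it
produces the product ⟨x,v⟩R⟨v,x⟩R. -/
lemma descendCc_ractCc (x : C_c(G × X, A)) (b : C_c(G × Y, A)) :
    hq.descendCc ν (hq.ractCc μ α x b) = convCc μ α (hq.descendCc ν x) b := by
  refine hq.eq_of_pullback_eq ?_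
  rw [coe_convCc, ← tconv_pullback hq]
  refine (hq.pullback_descend _).trans ?_
  rw [coe_ractCc, hq.orbitIntegral_tconv_pullback (isCompactlySupported_coe x)
    (isCompactlySupported_coe b).isFiberCompact]
  congr 1
  exact (hq.pullback_descend _).symm

/-- The right inner product is positive. -/
theorem exists_inclₗ_rinnerCc_self (x : C_c(G × X, A)) : ∃ r,
    inclₗ μ α Y (hq.rinnerCc μ α ν x x) = star r * r := by
  have hi := hq.isClosedEmbedding
  let _ : MeasurableSpace X := borel X
  have _ : BorelSpace X := ⟨rfl⟩
  let κ : Measure X := Measure.haar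
  set F := {a : CrossedProduct μ (translationAction α Y) | ∃ b, a = star b * b} with hF
  have hFc : IsClosed F := isClosed_star_mul_self
  let J : C_c(G × X, A) →ₗ[ℂ] CrossedProduct μ (translationAction α Y) :=
    inclₗ μ α Y ∘ₗ hq.descendₗ ν
  have hJ : InductivelyContinuous J :=
    (inductivelyContinuous_inclₗ (μ := μ) (α := α)).comp_isBoundedOperator
      (hq.isBoundedOperator_descendCc (ν := ν)) fun _ => rfl
  let J' : C_c(D × G × X, A) →ₗ[ℂ] CrossedProduct μ (translationAction α Y) :=
    { toFun := fun c => J (lactCc μ α ν hi c x)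
      map_add' := fun c d => by rw [lactCc_add_left, _root_.map_add]
      map_smul' := fun a c => by rw [lactCc_smul_left, _root_.map_smul, RingHom.id_apply] }
  have hJ' : InductivelyContinuous J' :=
    hJ.comp_isBoundedOperator (isBoundedOperator_lactCc hi x) fun _ => rfl
  -- Θ(k) is x^* * β_k(x) integrated over orbits; it depends continuously on k and equals ⟨x,x⟩R at
  -- the identity.
  let Θ : D → CrossedProduct μ (translationAction α Y) := fun k =>
    J (convCc μ α (starCc μ α x) (rtransCc (i k) x))
  have hΘ : Continuous Θ := by
    refine hJ.continuous_family_of_locally (continuous_convCc_family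
      (y := fun k => rtransCc (i k) x) _
      (continuous_rtransCc_family hi x)) fun K _ =>
        ⟨_, ((starCc μ α x).hasCompactSupport.isCompact.prod
          (x.hasCompactSupport.isCompact.image continuous_fst)).image
          (f := fun q : (G × X) × G => (q.1.1 * q.2, q.1.2)) (by fun_prop), fun k _ p hp =>
            tconv_apply_eq_zero_of_left (C := Prod.fst '' tsupport x) (g := rtrans (i k) x)
              (fun p hp => image_eq_zero_of_notMem_tsupport hp)
              (fun r s hr => image_eq_zero_of_notMem_tsupport (f := x) (x := (r, s * i k))
                fun h => hr ⟨_, h, rfl⟩) hp⟩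
  -- Smearing Θ by an autocorrelation gives a positive element, because it is a limit of averages
  -- over tents and each tent contributes a square.
  have hmem : ∀ w : C_c(X, ℝ), ∫ k, correlation hi κ w w k • Θ k ∂ν ∈ F := fun w => by
    have h := hJ'.mem_of_tentCc_mem hi κ (μ := μ) (α := α) (F := F) hFc ⟨0, by simp⟩
      (fun _ ha _ hb => exists_star_mul_self_add ha hb)
      (fun c hc _ ha => exists_star_mul_self_smul hc ha) w w (starCc μ α x) (fun φ a p => ?_)
      (sqrtModularInvMul ν (correlation hi κ w w)) fun k => rfl
    · convert h using 1
      refine Eq.trans ?_ (hJ.map_lactCc hi (tensorCc (sqrtModularInvMul ν (correlation hi κ w w))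
        (starCc μ α x)) x).symm
      refine integral_congr_ae (Eventually.of_forall fun k => ?_)
      change _ = sqrtModular ν k • J (convCc μ α (((sqrtModular ν k)⁻¹ * correlation hi κ w w k) •
        starCc μ α x) (rtransCc (i k) x))
      have e : convCc μ α (((sqrtModular ν k)⁻¹ * correlation hi κ w w k) •
        starCc μ α x) (rtransCc (i k) x) = ((sqrtModular ν k)⁻¹ * correlation hi κ w w k) •
          convCc μ α (starCc μ α x) (rtransCc (i k) x) :=
        DFunLike.coe_injective (tconv_real_smul_left _ _ _)
      rw [e, LinearMap.map_smul_of_tower, smul_smul, mul_inv_cancel_left₀ (sqrtModular_pos ν k).ne']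
    · set v := starCc μ α (tentCc w φ a p) with hv
      -- For v = T_p^* one has L⟨x^* * v, v⟩·x = (x^* * v)·⟨v,x⟩R, and integration over orbits gives
      -- ⟨x,v⟩R⟨v,x⟩R.
      refine ⟨inclₗ μ α Y (hq.rinnerCc μ α ν v x), ?_⟩
      change inclₗ μ α Y (hq.descendCc ν (lactCc μ α ν hi (twistedConv μ α ν hi
        (convCc μ α (starCc μ α x) v) (tentCc w φ a p)) x)) = _
      have e : tentCc w φ a p = starCc μ α v := by rw [hv, starCc_starCc]
      rw [e]
      change inclₗ μ α Y (hq.descendCc ν (lactCc μ α ν hi (linnerCc μ α ν hi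
        (convCc μ α (starCc μ α x) v) v) x)) = _
      rw [hq.lactCc_linnerCc, hq.descendCc_ractCc, ← hq.rinnerCc_eq, inclₗ_convCc, star_inclₗ_rinnerCc]
  have h1 : Θ 1 = inclₗ μ α Y (hq.rinnerCc μ α ν x x) := by
    have e : rtransCc (i (1 : D)) x = x := DFunLike.coe_injective (by
      change rtrans (i 1) x = x
      rw [i.map_one, rtrans_one])
    change inclₗ μ α Y (hq.descendCc ν (convCc μ α (starCc μ α x) (rtransCc (i 1) x))) = _
    rw [e, rinnerCc_eq]
  change inclₗ μ α Y (hq.rinnerCc μ α ν x x) ∈ F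
  rw [← h1, ← hFc.closure_eq, Metric.mem_closure_iff]
  intro ε hε
  -- Autocorrelations of mass one supported near the identity recover Θ(1) as a limit of positive
  -- elements.
  obtain ⟨w, hw0, hwU, hw1⟩ := exists_autocorrelation_bump hi κ ν
    (hΘ.continuousAt.preimage_mem_nhds (Metric.ball_mem_nhds (Θ 1) (half_pos hε)))
  refine ⟨_, hmem w, ?_⟩
  have hi1 : Integrable (correlation hi κ w w) ν :=
    (correlation hi κ w w).continuous.integrable_of_hasCompactSupport
      (correlation hi κ w w).hasCompactSupport
  have hi2 : Integrable (fun k => correlation hi κ w w k • Θ k) ν :=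
    integrable_of_continuous_of_vanish ν ((correlation hi κ w w).continuous.smul hΘ)
      (correlation hi κ w w).hasCompactSupport fun k hk => by
        rw [image_eq_zero_of_notMem_tsupport hk, zero_smul]
  have e : ∫ k, correlation hi κ w w k • Θ k ∂ν - Θ 1 =
      ∫ k, correlation hi κ w w k • (Θ k - Θ 1) ∂ν := by
    simp only [smul_sub]
    rw [integral_sub hi2 (hi1.smul_const _), integral_smul_const, hw1, one_smul]
  rw [dist_comm, dist_eq_norm, e]
  refine lt_of_le_of_lt ?_ (half_lt_self hε)
  calc _ ≤ ∫ k, correlation hi κ w w k * (ε / 2) ∂ν := by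
        refine norm_integral_le_of_norm_le (hi1.mul_const _) (Eventually.of_forall fun k => ?_)
        rw [norm_smul, Real.norm_of_nonneg (hw0 k)]
        by_cases hk : k ∈ Θ ⁻¹' Metric.ball (Θ 1) (ε / 2)
        · rw [← dist_eq_norm]
          exact mul_le_mul_of_nonneg_left (Metric.mem_ball.1 hk).le (hw0 k)
        · rw [hwU k hk, zero_mul, zero_mul]
    _ = ε / 2 := by rw [integral_mul_const, hw1, one_mul]

end IsOrbitMap

end RightPositivity

/-- Norms of positive elements are determined by positive functionals. -/
lemma norm_le_of_forall_isPositiveFunctional {C : Type*} [NonUnitalCStarAlgebra C] {r s : C} {c : ℝ}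
    (hc : 0 ≤ c) (hr : ∃ a, r = star a * a)
    (h : ∀ φ : C →L[ℂ] ℂ, IsPositiveFunctional φ → (φ r).re ≤ c * (φ s).re) : ‖r‖ ≤ c * ‖s‖ := by
  obtain ⟨a, rfl⟩ := hr
  obtain ⟨φ, hφ, ha⟩ := exists_positive_functional a
  have h1 := h φ hφ
  rw [ha, Complex.ofReal_re] at h1
  rw [CStarRing.norm_star_mul_self, ← sq]
  exact h1.trans (mul_le_mul_of_nonneg_left ((Complex.re_le_norm _).trans (hφ.norm_le s)) hc)

/-! ### Non-degeneracy of integrated forms -/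

section Nondegeneracy

variable {H : Type v} {B : Type u} [Group H] [TopologicalSpace H] [IsTopologicalGroup H]
  [LocallyCompactSpace H] [T2Space H] [NonUnitalCStarAlgebra B] [MeasurableSpace H] [BorelSpace H]
  {μ : Measure H} [μ.IsHaarMeasure] {γ : CStarAction H B}

/-- The integrated form of a covariant representation is non-degenerate. -/
lemma CovRep.mem_closure_span_eval (R : CovRep γ) (x : R.E) :
    x ∈ closure (Submodule.span ℂ {x : R.E | ∃ b y, x = CrossedProduct.eval μ R b y} : Set R.E) := by
  set V := Submodule.span ℂ {x : R.E | ∃ b y, x = CrossedProduct.eval μ R b y}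
  rw [← Submodule.topologicalClosure_coe]
  refine closure_minimal ?_ V.isClosed_topologicalClosure (R.nondegenerate x)
  refine Submodule.span_le.2 ?_
  rintro _ ⟨b, h, rfl⟩
  rw [Submodule.topologicalClosure_coe, Metric.mem_closure_iff]
  intro ε hε
  have hc : Continuous fun s => R.π b ((R.U s : R.E →L[ℂ] R.E) h) :=
    (R.π b).continuous.comp (R.continuous_U h)
  obtain ⟨φ, S, hφ, hS, hSU, hφ0, hφS, hφ1⟩ := exists_bump μ
    (hc.continuousAt.preimage_mem_nhds (Metric.ball_mem_nhds _ (half_pos hε)))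
  -- With φ of mass one near the identity, the integrated form of φ ⊗ b maps h close to π(b)h.
  let f : C_c(H, B) := tensorConst (mkCc φ hφ ⟨S, hS, hφS⟩) b
  refine ⟨_, Submodule.subset_span ⟨CrossedProduct.ofCc μ γ f, h, rfl⟩, ?_⟩
  have hi1 : Integrable φ μ := integrable_of_continuous_of_vanish μ hφ hS hφS
  have hi2 : Integrable (fun s => φ s • R.π b ((R.U s : R.E →L[ℂ] R.E) h)) μ :=
    integrable_of_continuous_of_vanish μ (hφ.smul hc) hS fun s hs => by rw [hφS s hs, zero_smul]
  have e : CrossedProduct.eval μ R (CrossedProduct.ofCc μ γ f) h =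
      ∫ s, φ s • R.π b ((R.U s : R.E →L[ℂ] R.E) h) ∂μ := by
    rw [CrossedProduct.eval_ofCc, R.integratedForm_apply μ]
    refine integral_congr_ae (Eventually.of_forall fun s => ?_)
    change R.π (φ s • b) ((R.U s : R.E →L[ℂ] R.E) h) = _
    rw [starHom_real_smul]
    rfl
  have e' : ∫ s, φ s • R.π b ((R.U s : R.E →L[ℂ] R.E) h) ∂μ - R.π b h =
      ∫ s, φ s • (R.π b ((R.U s : R.E →L[ℂ] R.E) h) - R.π b h) ∂μ := by
    simp only [smul_sub]
    rw [integral_sub hi2 (hi1.smul_const _), integral_smul_const, hφ1, one_smul]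
  rw [dist_comm, dist_eq_norm, e, e']
  refine lt_of_le_of_lt ?_ (half_lt_self hε)
  calc _ ≤ ∫ s, φ s * (ε / 2) ∂μ := by
        refine norm_integral_le_of_norm_le (hi1.mul_const _) (Eventually.of_forall fun s => ?_)
        rw [norm_smul, Real.norm_of_nonneg (hφ0 s)]
        by_cases hs : s ∈ S
        · have := hSU hs
          rw [Set.mem_preimage, R.U_one_apply, Metric.mem_ball, dist_eq_norm] at this
          exact mul_le_mul_of_nonneg_left this.le (hφ0 s)
        · rw [hφS s hs, zero_mul, zero_mul]
    _ = ε / 2 := by rw [integral_mul_const, hφ1, one_mul]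

end Nondegeneracy

/-! ### Boundedness of the left action -/

section LeftBound

variable {G : Type v} [Group G] [TopologicalSpace G] [IsTopologicalGroup G] [LocallyCompactSpace G]
  [T2Space G] [MeasurableSpace G] [BorelSpace G] {μ : Measure G} [μ.IsHaarMeasure] [μ.Regular]
  {A : Type u} [NonUnitalCStarAlgebra A] {α : CStarAction G A}
  {X : Type w} [Group X] [TopologicalSpace X] [IsTopologicalGroup X] [LocallyCompactSpace X]
  [T2Space X] [MulAction G X] [ContinuousSMul G X] [IsScalarTower G X X]
  {D : Type*} [Group D] [TopologicalSpace D] [IsTopologicalGroup D] [LocallyCompactSpace D]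
  [T2Space D] [MeasurableSpace D] [BorelSpace D] {ν : Measure D} [ν.IsHaarMeasure] [ν.Regular]
  {i : D →* X} (hi : IsClosedEmbedding i)
  {Y : Type w} [TopologicalSpace Y] [LocallyCompactSpace Y] [T2Space Y] [MulAction G Y]
  [ContinuousSMul G Y] {q : X → Y}

include hi in
lemma exists_rtransCc_vanish (x : C_c(G × X, A)) {K : Set D} (hK : IsCompact K) :
    ∃ S, IsCompact S ∧ ∀ k ∈ K, ∀ p ∉ S, rtransCc (i k) x p = 0 := by
  have := hi.continuous
  refine ⟨(fun p : D × G × X => (p.2.1, p.2.2 * (i p.1)⁻¹)) '' (K ×ˢ tsupport x),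
    (hK.prod x.hasCompactSupport).image (by fun_prop), fun k hk p hp => ?_⟩
  exact image_eq_zero_of_notMem_tsupport (f := x) fun h =>
    hp ⟨(k, p.1, p.2 * i k), ⟨hk, h⟩, by simp⟩

namespace IsOrbitMap

variable (hq : IsOrbitMap G i q)

/-- Translating by k shifts the orbit variable on the right, which costs Δ(k)⁻¹. Consequently
Δ(k)^{1/2}β_k preserves the inner product, in agreement with the weight in the left action. -/
lemma rinnerCc_rtransCc (x y : C_c(G × X, A)) (k : D) :
    hq.rinnerCc μ α ν (rtransCc (i k) x) (rtransCc (i k) y) =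
      (modularFn ν k)⁻¹ • hq.rinnerCc μ α ν x y := by
  refine hq.eq_of_pullback_eq (funext fun p => ?_)
  change hq.rinnerCc μ α ν (rtransCc (i k) x) (rtransCc (i k) y) (p.1, q p.2) =
    (modularFn ν k)⁻¹ • hq.rinnerCc μ α ν x y (p.1, q p.2)
  rw [rinnerCc_apply, rinnerCc_apply, ← integral_mul_right_modularFn]
  refine integral_congr_ae (Eventually.of_forall fun l => ?_)
  change tconv μ α (tstar μ α (rtrans (i k) x)) (rtrans (i k) y) (p.1, p.2 * i l) = _
  rw [tstar_rtrans, tconv_rtrans]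
  simp only [i.map_mul, ← mul_assoc]
  rfl

lemma rinnerCc_mulCc (f : C₀(X, A)) (x y : C_c(G × X, A)) :
    hq.rinnerCc μ α ν (mulCc continuous_id f x) y =
      hq.rinnerCc μ α ν x (mulCc continuous_id (star f) y) := by
  rw [rinnerCc_eq, rinnerCc_eq]
  exact congrArg _ (DFunLike.coe_injective (tconv_tstar_tmul f x y))

lemma rinnerCc_transCc (t : G) (x y : C_c(G × X, A)) :
    hq.rinnerCc μ α ν (transCc α t x) (transCc α t y) = hq.rinnerCc μ α ν x y := by
  rw [rinnerCc_eq, rinnerCc_eq]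
  exact congrArg _ (DFunLike.coe_injective (tconv_tstar_ttrans x y t))

/-- The acting algebra is C₀(X, A), not C₀(Y, A): functions on `X` multiply on the left of the
convolution and are adjointable for ⟨x,y⟩R, so the GNS space represents the inner crossed product of
L. -/
lemma isCovariantForm_rinnerCc {φ : CrossedProduct μ (translationAction α Y) →L[ℂ] ℂ}
    (hφ : IsPositiveFunctional φ) : IsCovariantForm α (continuous_id (X := X))
      fun x y => φ (inclₗ μ α Y (hq.rinnerCc μ α ν x y)) where
  add_right x y z := by rw [rinnerCc_add_right, _root_.map_add, _root_.map_add]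
  smul_right c x y := by rw [rinnerCc_smul_right, _root_.map_smul, _root_.map_smul, smul_eq_mul]
  conj_symm x y := by rw [← hφ.map_star, star_inclₗ_rinnerCc]
  nonneg x := by
    obtain ⟨r, hr⟩ := hq.exists_inclₗ_rinnerCc_self (μ := μ) (α := α) (ν := ν) x
    rw [hr]
    exact (Complex.nonneg_iff.1 (hφ.nonneg r)).1
  mulCc_left f x y := by rw [rinnerCc_mulCc]
  transCc_transCc t x y := by rw [rinnerCc_transCc]
  bounded S hS := by
    obtain ⟨C, hC, h⟩ := (hq.isBoundedPairing_rinnerCc (μ := μ) (α := α) (ν := ν)).exists_norm_le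
      (inductivelyContinuous_inclₗ (μ := μ) (α := α)) hS
    exact ⟨C, hC, fun k x hx => ((Complex.re_le_norm _).trans (hφ.norm_le _)).trans (h k x hx)⟩

end IsOrbitMap

end LeftBound

section LeftActionBound

variable {G : Type v} [Group G] [TopologicalSpace G] [IsTopologicalGroup G] [LocallyCompactSpace G]
  [T2Space G] [MeasurableSpace G] [BorelSpace G] {μ : Measure G} [μ.IsHaarMeasure] [μ.Regular]
  {A : Type u} [NonUnitalCStarAlgebra A] {α : CStarAction G A}
  {X : Type w} [Group X] [TopologicalSpace X] [IsTopologicalGroup X] [LocallyCompactSpace X]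
  [T2Space X] [MulAction G X] [ContinuousSMul G X] [IsScalarTower G X X]
  {D : Type*} [Group D] [TopologicalSpace D] [IsTopologicalGroup D] [LocallyCompactSpace D]
  [T2Space D] [MeasurableSpace D] [BorelSpace D] {ν : Measure D} [ν.IsHaarMeasure] [ν.Regular]
  {i : D →* X} (hi : IsClosedEmbedding i)
  {Y : Type w} [TopologicalSpace Y] [LocallyCompactSpace Y] [T2Space Y] [MulAction G Y]
  [ContinuousSMul G Y] {q : X → Y}

lemma tconv_real_smul_right (c : ℝ) (f g : G × X → A) :
    tconv μ α f (c • g) = c • tconv μ α f g := by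
  have h := tconv_smul_right (μ := μ) (α := α) (c : ℂ) f g
  simpa only [Complex.coe_smul] using h

variable (ν) in
/-- The map `x ↦ Δ(k)^(1/2) β_k(x)`. -/
def modularRtrans (i : D →* X) (k : D) : C_c(G × X, A) →ₗ[ℂ] C_c(G × X, A) where
  toFun x := sqrtModular ν k • rtransCc (i k) x
  map_add' x y := smul_add (sqrtModular ν k) (rtransCc (i k) x) (rtransCc (i k) y)
  map_smul' c x := smul_comm (sqrtModular ν k) c (rtransCc (i k) x)

lemma modularRtrans_apply (k : D) (x : C_c(G × X, A)) :
    modularRtrans ν i k x = sqrtModular ν k • rtransCc (i k) x := rfl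

lemma modularRtrans_one (x : C_c(G × X, A)) : modularRtrans ν i 1 x = x := by
  rw [modularRtrans_apply, sqrtModular_one, one_smul, i.map_one]
  exact DFunLike.coe_injective (rtrans_one _)

lemma modularRtrans_mul (k l : D) (x : C_c(G × X, A)) :
    modularRtrans ν i (k * l) x = modularRtrans ν i k (modularRtrans ν i l x) := by
  rw [modularRtrans_apply, modularRtrans_apply, modularRtrans_apply, sqrtModular_mul, mul_smul,
    i.map_mul]
  refine congrArg _ (DFunLike.coe_injective ?_)
  change sqrtModular ν l • rtrans (i k * i l) x = rtrans (i k) (sqrtModular ν l • rtrans (i l) x)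
  rw [rtrans_mul]
  rfl

/-- Right translation respects convolution; on the GNS space this is the covariance relation between
C₀(X, A) ⋊ G and `D`. -/
lemma convCc_modularRtrans (k : D) (f x : C_c(G × X, A)) :
    convCc μ α (rtransCc (i k) f) (modularRtrans ν i k x) = modularRtrans ν i k (convCc μ α f x) := by
  refine DFunLike.coe_injective ?_
  change tconv μ α (rtrans (i k) f) ((sqrtModular ν k : ℝ) • rtrans (i k) x) =
    sqrtModular ν k • rtrans (i k) (tconv μ α f x)
  rw [← tconv_rtrans, tconv_real_smul_right]

include hi in
lemma continuous_modularRtrans_family (x : C_c(G × X, A)) :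
    Continuous fun p : D × G × X => modularRtrans ν i p.1 x p.2 :=
  ((continuous_sqrtModular ν).comp continuous_fst).smul (continuous_rtransCc_family hi x)

namespace IsOrbitMap

variable (hq : IsOrbitMap G i q)

lemma rinnerCc_real_smul_right (c : ℝ) (x y : C_c(G × X, A)) :
    hq.rinnerCc μ α ν x (c • y) = c • hq.rinnerCc μ α ν x y := by
  have h := hq.rinnerCc_smul_right (μ := μ) (α := α) (ν := ν) (c : ℂ) x y
  simpa only [Complex.coe_smul] using h

lemma inclₗ_rinnerCc_modularRtrans (k : D) (x : C_c(G × X, A)) :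
    inclₗ μ α Y (hq.rinnerCc μ α ν (modularRtrans ν i k x) (modularRtrans ν i k x)) =
      inclₗ μ α Y (hq.rinnerCc μ α ν x x) := by
  rw [modularRtrans_apply, rinnerCc_real_smul_right, LinearMap.map_smul_of_tower,
    ← star_inclₗ_rinnerCc, rinnerCc_real_smul_right, LinearMap.map_smul_of_tower,
    rinnerCc_rtransCc, LinearMap.map_smul_of_tower, star_smul, star_smul, star_inclₗ_rinnerCc,
    star_trivial, star_trivial, smul_smul, smul_smul, sqrtModular_mul_self,
    mul_inv_cancel₀ (modularFn_pos ν k).ne', one_smul]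

/-- The left action is bounded. -/
theorem norm_inclₗ_rinnerCc_lactCc_le (c : C_c(D × G × X, A)) (x : C_c(G × X, A)) :
    ‖inclₗ μ α Y (hq.rinnerCc μ α ν (lactCc μ α ν hq.isClosedEmbedding c x)
      (lactCc μ α ν hq.isClosedEmbedding c x))‖ ≤
      ‖inclItₗ μ α hq.isClosedEmbedding ν c‖ ^ 2 * ‖inclₗ μ α Y (hq.rinnerCc μ α ν x x)‖ := by
  have hi := hq.isClosedEmbedding
  refine norm_le_of_forall_isPositiveFunctional (sq_nonneg _)
    (hq.exists_inclₗ_rinnerCc_self _) fun φ hφ => ?_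
  obtain ⟨R, j, hj, hjI, hjh, hjR⟩ := (hq.isCovariantForm_rinnerCc (ν := ν) hφ).exists_covRep μ
    fun _ _ => rfl
  have hnorm : ∀ z, ‖j z‖ ^ 2 = (φ (inclₗ μ α Y (hq.rinnerCc μ α ν z z))).re := fun z => by
    rw [← hjh, ← inner_self_eq_norm_sq (𝕜 := ℂ)]
    rfl
  let π := CrossedProduct.eval μ R
  have hπ : ∀ f z, π (inclₗ μ α X f) (j z) = j (convCc μ α f z) := hjR
  have hUn : ∀ k z, ‖j (modularRtrans ν i k z)‖ = ‖j z‖ := fun k z => by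
    rw [← sq_eq_sq₀ (norm_nonneg _) (norm_nonneg _), hnorm, hnorm, inclₗ_rinnerCc_modularRtrans]
  have hUc : ∀ z, Continuous fun k => j (modularRtrans ν i k z) := fun z =>
    hjI.continuous_family_of_locally (continuous_modularRtrans_family hi z) fun K hK => by
      obtain ⟨S, hS, h0⟩ := exists_rtransCc_vanish hi z hK
      refine ⟨S, hS, fun k hk p hp => ?_⟩
      change sqrtModular ν k • rtransCc (i k) z p = 0
      rw [h0 k hk p hp, smul_zero]
  -- The operators Δ(k)^{1/2}β_k are isometric for the form and strongly continuous, so `D` acts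
  -- unitarily on the GNS space.
  obtain ⟨W, hW, hWc⟩ := exists_unitary_extension j hj (modularRtrans ν i) modularRtrans_one
    modularRtrans_mul hUn hUc
  have hcov : ∀ k b y, π ((rightDualAction μ α hi).act k b) ((W k : R.E →L[ℂ] R.E) y) =
      (W k : R.E →L[ℂ] R.E) (π b y) := fun k b y => by
    have hπc : Continuous π := continuous_nonUnitalStarAlgHom π
    have hact := continuous_nonUnitalStarAlgHom ((rightDualAction μ α hi).act k)
    refine (denseRange_inclₗ (μ := μ) (α := α) (X := X)).induction_on b
      (isClosed_eq (by fun_prop) (by fun_prop)) fun f => ?_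
    refine hj.induction_on y (isClosed_eq (by fun_prop) (by fun_prop)) fun z => ?_
    rw [← inclₗ_rtransCc, hW, hπ, hπ, hW, convCc_modularRtrans]
  -- The inner crossed product lives one universe above the GNS space, which is too small to be a
  -- carrier in the definition of the iterated crossed product; the lifted estimate bridges this.
  have key := norm_integral_le_norm_ofCc.{max (u + 1) (v + 1) (w + 1), _, max u v w} ν π
    (fun y => R.mem_closure_span_eval y) W hWc hcov
    (curryCrossed μ (translationAction α X) c) (j x)
  -- The integrated form of the pair (π, W) applied to j(x) is j(c·x), so its norm bound is the
  -- required one.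
  have e : ∫ k, π (curryCrossed μ (translationAction α X) c k) ((W k : R.E →L[ℂ] R.E) (j x)) ∂ν =
      j (lactCc μ α ν hi c x) := by
    rw [hjI.map_lactCc hi]
    refine integral_congr_ae (Eventually.of_forall fun k => ?_)
    simp only
    rw [curryCrossed_eq, hW, hπ, ← LinearMap.map_smul_of_tower]
    exact congrArg _ (DFunLike.coe_injective (tconv_real_smul_right _ _ _))
  rw [e] at key
  rw [← hnorm, ← hnorm, ← mul_pow]
  exact pow_le_pow_left₀ (norm_nonneg _) key 2

end IsOrbitMap

end LeftActionBound

/-! ### Pointwise forms and injectivity of C_c in the crossed product -/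

section PointwiseForms

variable {G : Type v} [Group G] [TopologicalSpace G] [IsTopologicalGroup G] [LocallyCompactSpace G]
  [T2Space G] [MeasurableSpace G] [BorelSpace G] {μ : Measure G} [μ.IsHaarMeasure] [μ.Regular]
  {A : Type u} [NonUnitalCStarAlgebra A] {α : CStarAction G A}
  {X : Type w} [TopologicalSpace X] [T2Space X] [MulAction G X] [ContinuousSMul G X]

lemma starCc_add (x y : C_c(G × X, A)) : starCc μ α (x + y) = starCc μ α x + starCc μ α y :=
  DFunLike.coe_injective (tstar_add _ _)

lemma starCc_smul (c : ℂ) (x : C_c(G × X, A)) :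
    starCc μ α (c • x) = starRingEnd ℂ c • starCc μ α x :=
  DFunLike.coe_injective (tstar_smul _ _)

/-- At the identity of `G` the convolution x^* * x is an integral of squares in `A`, so positive
functionals see an integral of nonnegative numbers. -/
lemma functional_convCc_starCc_self (φ : A →L[ℂ] ℂ) (x : C_c(G × X, A)) (s : X) :
    (φ (convCc μ α (starCc μ α x) x (1, s))).re = ∫ t, (modularFn μ t)⁻¹ *
      (φ (star (α.act t (x (t⁻¹, t⁻¹ • s))) * α.act t (x (t⁻¹, t⁻¹ • s)))).re ∂μ := by
  have hi := integrable_tconv_integrand (μ := μ) (α := α)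
    ((isCompactlySupported_coe x).tstar (μ := μ) (α := α)).isFiberCompact x.continuous 1 s
  rw [coe_convCc, tconv_apply]
  refine ((Complex.reCLM.comp (φ.restrictScalars ℝ)).integral_comp_comm hi).symm.trans ?_
  refine integral_congr_ae (Eventually.of_forall fun t => ?_)
  simp only [tstar_apply, mul_one, smul_mul_assoc, map_star, ContinuousLinearMap.comp_apply,
    ContinuousLinearMap.coe_restrictScalars', Complex.reCLM_apply, map_smul,
    smul_eq_mul]
  rfl

lemma IsPositiveFunctional.re_convCc_starCc_self_nonneg {φ : A →L[ℂ] ℂ}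
    (hφ : IsPositiveFunctional φ) (x : C_c(G × X, A)) (s : X) :
    0 ≤ (φ (convCc μ α (starCc μ α x) x (1, s))).re := by
  rw [functional_convCc_starCc_self]
  exact integral_nonneg fun t => mul_nonneg (inv_nonneg.2 (modularFn_pos μ t).le)
    (Complex.nonneg_iff.1 (hφ.nonneg _)).1

/-- A continuous nonnegative integrand with integral zero vanishes. Over the point r⁻¹s and at t =
r⁻¹, for a functional attaining the norm, the integrand is a positive multiple of ‖x(r, s)‖². -/
lemma eq_zero_of_functional_convCc_starCc_self {x : C_c(G × X, A)}
    (h : ∀ φ : A →L[ℂ] ℂ, IsPositiveFunctional φ → ∀ s,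
      (φ (convCc μ α (starCc μ α x) x (1, s))).re = 0) : x = 0 := by
  ext ⟨r, s⟩
  obtain ⟨φ, hφ, ha⟩ := exists_positive_functional (α.act r⁻¹ (x (r, s)))
  have h1 := h φ hφ (r⁻¹ • s)
  rw [functional_convCc_starCc_self] at h1
  have hg : Continuous fun t : G => α.act t (x (t⁻¹, t⁻¹ • r⁻¹ • s)) :=
    α.continuous_act_comp continuous_id (x.continuous.comp (by fun_prop))
  have hc : Continuous fun t => (modularFn μ t)⁻¹ * (φ (star (α.act t (x (t⁻¹, t⁻¹ • r⁻¹ • s))) *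
      α.act t (x (t⁻¹, t⁻¹ • r⁻¹ • s)))).re :=
    ((continuous_modularFn μ).inv₀ fun t => (modularFn_pos μ t).ne').mul
      (Complex.continuous_re.comp (φ.continuous.comp (hg.star.mul hg)))
  have hS : HasCompactSupport fun t => (modularFn μ t)⁻¹ * (φ (star (α.act t (x (t⁻¹, t⁻¹ • r⁻¹ • s)))
      * α.act t (x (t⁻¹, t⁻¹ • r⁻¹ • s)))).re := by
    refine HasCompactSupport.intro ((x.hasCompactSupport.isCompact.image continuous_fst).image
      continuous_inv) fun t ht => ?_
    rw [image_eq_zero_of_notMem_tsupport (f := x) (x := (t⁻¹, t⁻¹ • r⁻¹ • s))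
      fun h => ht ⟨t⁻¹, ⟨_, h, rfl⟩, inv_inv t⟩, map_zero, mul_zero, map_zero, Complex.zero_re, mul_zero]
  by_contra hne
  refine (hc.integral_pos_of_hasCompactSupport_nonneg_nonzero hS (fun t => mul_nonneg
    (inv_nonneg.2 (modularFn_pos μ t).le) (Complex.nonneg_iff.1 (hφ.nonneg _)).1)
    (x := r⁻¹) ?_).ne' h1
  rw [inv_inv, smul_inv_smul, ha, Complex.ofReal_re, CStarAction.norm_act]
  exact mul_ne_zero (inv_ne_zero (modularFn_pos μ _).ne') (pow_ne_zero _ (norm_ne_zero_iff.2 hne))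

/-- These forms, over all functionals on `A` and all points s, supply enough representations of the
crossed product to separate compactly supported functions. -/
lemma isCovariantForm_convCc [LocallyCompactSpace X] {φ : A →L[ℂ] ℂ} (hφ : IsPositiveFunctional φ)
    (s : X) : IsCovariantForm α (continuous_id (X := X))
      fun x y => φ (convCc μ α (starCc μ α x) y (1, s)) where
  add_right x y z := by
    rw [← map_add, coe_convCc]
    exact congrArg φ (congrFun (tconv_add_right
      (isCompactlySupported_coe (starCc μ α x)).isFiberCompact y.continuous z.continuous) _)
  smul_right c x y := by
    rw [← smul_eq_mul, ← map_smul, coe_convCc]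
    exact congrArg φ (congrFun (tconv_smul_right c _ _) _)
  conj_symm x y := by
    rw [← hφ.map_star]
    refine congrArg φ ?_
    have e : starCc μ α (convCc μ α (starCc μ α x) y) = convCc μ α (starCc μ α y) x :=
      DFunLike.coe_injective ((tstar_tconv (isCompactlySupported_coe x).tstar.isFiberCompact
        (isCompactlySupported_coe y).isFiberCompact).trans (by rw [tstar_tstar]; rfl))
    rw [← e]
    simp only [coe_starCc, tstar_apply, modularFn_one, inv_one, one_smul, α.act_one]
  nonneg x := hφ.re_convCc_starCc_self_nonneg x s
  mulCc_left f x y := congrArg φ (congrFun (tconv_tstar_tmul f x y) _)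
  transCc_transCc t x y := congrArg φ (congrFun (tconv_tstar_ttrans x y t) _)
  bounded S hS := by
    obtain ⟨S', C, -, hC, h⟩ := isBoundedPairing_tstar_tconv (μ := μ) (α := α) S S hS hS
    refine ⟨C, hC, fun k x hx => ?_⟩
    rw [sq]
    exact ((Complex.re_le_norm _).trans (hφ.norm_le _)).trans ((h k k x x hx hx).2 _)

/-- The embedding of `C_c(G × X, A)` into the crossed product is injective. -/
theorem inclₗ_injective [LocallyCompactSpace X] : Function.Injective (inclₗ μ α X) := by
  refine (injective_iff_map_eq_zero _).2 fun b hb => ?_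
  -- If b is zero in the crossed product, every GNS representation kills the vector of b * x, hence
  -- (b * x)^* * (b * x) vanishes at each (1, s) under every functional.
  have h0 : ∀ x, convCc μ α b x = 0 := fun x =>
    eq_zero_of_functional_convCc_starCc_self (μ := μ) (α := α) fun φ hφ s => by
      obtain ⟨R, j, -, -, hjh, hjR⟩ := (isCovariantForm_convCc (μ := μ) (α := α) hφ s).exists_covRep μ
        fun _ _ => rfl
      have e : j (convCc μ α b x) = 0 := by
        refine (hjR b x).symm.trans ?_
        change CrossedProduct.eval μ R (inclₗ μ α X b) (j x) = 0
        rw [hb, map_zero]; rfl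
      rw [← hjh, e, inner_zero_left, Complex.zero_re]
  -- The same criterion applied to b^* involves b * b^*, which is zero by the previous step.
  have h1 : starCc μ α b = 0 :=
    eq_zero_of_functional_convCc_starCc_self (μ := μ) (α := α) fun φ hφ s => by
      rw [starCc_starCc, h0, CompactlySupportedContinuousMap.zero_apply, map_zero, Complex.zero_re]
  rw [← starCc_starCc (μ := μ) (α := α) b, h1]
  simpa using starCc_smul (μ := μ) (α := α) 0 (0 : C_c(G × X, A))

end PointwiseForms

/-! ### Definiteness and boundedness of the right action -/

section RightBound

variable {G : Type v} [Group G] [TopologicalSpace G] [IsTopologicalGroup G] [LocallyCompactSpace G]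
  [T2Space G] [MeasurableSpace G] [BorelSpace G] {μ : Measure G} [μ.IsHaarMeasure] [μ.Regular]
  {A : Type u} [NonUnitalCStarAlgebra A] {α : CStarAction G A}
  {X : Type w} [Group X] [TopologicalSpace X] [IsTopologicalGroup X] [LocallyCompactSpace X]
  [T2Space X] [MulAction G X] [ContinuousSMul G X] [IsScalarTower G X X]
  {D : Type*} [Group D] [TopologicalSpace D] [IsTopologicalGroup D] [LocallyCompactSpace D]
  [T2Space D] [MeasurableSpace D] [BorelSpace D] {ν : Measure D} [ν.IsHaarMeasure] [ν.Regular]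
  {i : D →* X}
  {Y : Type w} [TopologicalSpace Y] [LocallyCompactSpace Y] [T2Space Y] [MulAction G Y]
  [ContinuousSMul G Y] {q : X → Y}

/-- With stars inserted the inner product is Δ(k)^{-1/2} x^* * β_k(y). Translation by `G` commutes
with β_k and cancels as in x^* * y. -/
lemma linnerCc_starCc_transCc (hi : IsClosedEmbedding i) (t : G) (x y : C_c(G × X, A)) :
    linnerCc μ α ν hi (starCc μ α (transCc α t x)) (starCc μ α (transCc α t y)) =
      linnerCc μ α ν hi (starCc μ α x) (starCc μ α y) := by
  rw [linnerCc, linnerCc, starCc_starCc, starCc_starCc]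
  ext ⟨k, r, s⟩
  rw [twistedConv_apply, twistedConv_apply]
  congr 1
  refine Eq.trans ?_ (congrFun (tconv_tstar_ttrans x (rtrans (i k) y) t) (r, s))
  have e : rtrans (i k) (transCc α t y) = ttrans α t (rtrans (i k) y) := by
    ext p
    change α.act t (y (t⁻¹ * p.1, t⁻¹ • (p.2 * i k))) = α.act t (y (t⁻¹ * p.1, t⁻¹ • p.2 * i k))
    rw [smul_mul_assoc]
  rw [e]
  rfl

namespace IsOrbitMap

variable (hq : IsOrbitMap G i q)

/-- The right inner product is definite. -/
theorem eq_zero_of_inclₗ_rinnerCc_self {x : C_c(G × X, A)}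
    (h : inclₗ μ α Y (hq.rinnerCc μ α ν x x) = 0) : x = 0 := by
  -- Injectivity turns the vanishing in the crossed product into vanishing of the function. Its
  -- value at (1, q(s)) is the integral over an orbit of a nonnegative continuous function, which
  -- must vanish at s itself.
  have h0 : hq.rinnerCc μ α ν x x = 0 := inclₗ_injective (by rw [h, map_zero])
  refine eq_zero_of_functional_convCc_starCc_self (μ := μ) (α := α) fun φ hφ s => ?_
  let F : D → ℝ := fun k => (φ (convCc μ α (starCc μ α x) x (1, s * i k))).re
  have hi := hq.isClosedEmbedding.continuous
  have hF : Continuous F := Complex.continuous_re.comp (φ.continuous.comp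
    ((convCc μ α (starCc μ α x) x).continuous.comp (by fun_prop)))
  obtain ⟨T, hT, hT0⟩ := orbitIntegral_vanish hq.isClosedEmbedding
    (isCompactlySupported_coe (convCc μ α (starCc μ α x) x)) (isCompact_singleton (x := s))
  have hFS : HasCompactSupport F := HasCompactSupport.intro hT fun k hk => by
    change (φ (convCc μ α (starCc μ α x) x (1, s * i k))).re = 0
    rw [hT0 1 s rfl k hk, map_zero, Complex.zero_re]
  have hint : ∫ k, F k ∂ν = 0 := by
    refine ((Complex.reCLM.comp (φ.restrictScalars ℝ)).integral_comp_comm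
      (integrable_orbitIntegral hq.isClosedEmbedding
        (isCompactlySupported_coe (convCc μ α (starCc μ α x) x)) 1 s)).trans ?_
    have h1 := hq.rinnerCc_apply (μ := μ) (α := α) (ν := ν) x x 1 s
    rw [h0, CompactlySupportedContinuousMap.zero_apply] at h1
    refine (congrArg _ h1.symm).trans (map_zero _)
  by_contra hne
  refine (hF.integral_pos_of_hasCompactSupport_nonneg_nonzero hFS (μ := ν)
    (fun k => hφ.re_convCc_starCc_self_nonneg x _) (x := 1) ?_).ne' hint
  change (φ (convCc μ α (starCc μ α x) x (1, s * i 1))).re ≠ 0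
  rwa [i.map_one, mul_one]

/-- Functions on `Y` are constant along orbits and so commute with β_k, which functions on `X` need
not do. Hence the GNS space of the left inner product represents C₀(Y, A) ⋊ G. -/
lemma linnerCc_starCc_mulCc (f : C₀(Y, A)) (x y : C_c(G × X, A)) :
    linnerCc μ α ν hq.isClosedEmbedding
      (starCc μ α (mulCc hq.isOpenQuotientMap.continuous f x)) (starCc μ α y) =
    linnerCc μ α ν hq.isClosedEmbedding (starCc μ α x)
      (starCc μ α (mulCc hq.isOpenQuotientMap.continuous (star f) y)) := by
  rw [linnerCc, linnerCc, starCc_starCc, starCc_starCc]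
  ext ⟨k, r, s⟩
  rw [twistedConv_apply, twistedConv_apply]
  congr 1
  refine (congrFun (tconv_tstar_tmul (f ∘ q) x (rtrans (i k) y)) (r, s)).trans ?_
  congr 1
  ext p
  change star (f (q p.2)) * y (p.1, p.2 * i k) = star (f (q (p.2 * i k))) * y (p.1, p.2 * i k)
  rw [hq.map_mul]

lemma isCovariantForm_linnerCc
    {φ : CrossedProduct ν (rightDualAction μ α hq.isClosedEmbedding) →L[ℂ] ℂ}
    (hφ : IsPositiveFunctional φ) : IsCovariantForm α hq.isOpenQuotientMap.continuous
      fun x y => φ (inclItₗ μ α hq.isClosedEmbedding ν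
        (linnerCc μ α ν hq.isClosedEmbedding (starCc μ α x) (starCc μ α y))) where
  add_right x y z := by
    rw [starCc_add, ← star_inclItₗ_linnerCc, linnerCc_add_left, _root_.map_add, star_add,
      star_inclItₗ_linnerCc, star_inclItₗ_linnerCc, _root_.map_add]
  smul_right c x y := by
    rw [starCc_smul, ← star_inclItₗ_linnerCc, linnerCc_smul_left, _root_.map_smul, star_smul,
      star_inclItₗ_linnerCc, _root_.map_smul, smul_eq_mul]
    congr 1
    exact star_star c
  conj_symm x y := by rw [← hφ.map_star, star_inclItₗ_linnerCc]
  nonneg x := by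
    obtain ⟨r, hr⟩ := hq.exists_inclItₗ_linnerCc_self (μ := μ) (α := α) (ν := ν) (starCc μ α x)
    rw [hr]
    exact (Complex.nonneg_iff.1 (hφ.nonneg r)).1
  mulCc_left f x y := by rw [hq.linnerCc_starCc_mulCc]
  transCc_transCc t x y := by rw [linnerCc_starCc_transCc]
  bounded S hS := by
    obtain ⟨C, hC, h⟩ := (((isBoundedPairing_linnerCc (μ := μ) (α := α) (ν := ν)
      hq.isClosedEmbedding).comp_left (isBoundedOperator_starCc (μ := μ) (α := α))).comp_right
        (isBoundedOperator_starCc (μ := μ) (α := α))).exists_norm_le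
      (inductivelyContinuous_inclItₗ (μ := μ) (α := α) (ν := ν) hq.isClosedEmbedding) hS
    exact ⟨C, hC, fun k x hx => ((Complex.re_le_norm _).trans (hφ.norm_le _)).trans (h k x hx)⟩

/-- The involution exchanges the right action of b with left convolution by the pull-back of b^*, an
operator of a representation of R and therefore bounded by ‖b‖. -/
lemma starCc_ractCc (x : C_c(G × X, A)) (b : C_c(G × Y, A)) :
    starCc μ α (hq.ractCc μ α x b) =
      pullConv μ α hq.isOpenQuotientMap.continuous (starCc μ α b) (starCc μ α x) := by
  refine DFunLike.coe_injective ?_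
  rw [coe_starCc, coe_ractCc, tstar_tconv (isCompactlySupported_coe x).isFiberCompact
    (hq.isFiberCompact_pullback (isCompactlySupported_coe b).isFiberCompact), hq.tstar_pullback]
  rfl

/-- The right action is bounded. -/
theorem norm_inclItₗ_linnerCc_ractCc_le (x : C_c(G × X, A)) (b : C_c(G × Y, A)) :
    ‖inclItₗ μ α hq.isClosedEmbedding ν (linnerCc μ α ν hq.isClosedEmbedding (hq.ractCc μ α x b)
      (hq.ractCc μ α x b))‖ ≤ ‖inclₗ μ α Y b‖ ^ 2 *
      ‖inclItₗ μ α hq.isClosedEmbedding ν (linnerCc μ α ν hq.isClosedEmbedding x x)‖ := by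
  refine norm_le_of_forall_isPositiveFunctional (sq_nonneg _)
    (hq.exists_inclItₗ_linnerCc_self _) fun φ hφ => ?_
  obtain ⟨R, j, -, -, hjh, hjR⟩ := (hq.isCovariantForm_linnerCc hφ).exists_covRep μ hq.map_smul
  have hnorm : ∀ z, ‖j (starCc μ α z)‖ ^ 2 = (φ (inclItₗ μ α hq.isClosedEmbedding ν
      (linnerCc μ α ν hq.isClosedEmbedding z z))).re := fun z => by
    rw [← inner_self_eq_norm_sq (𝕜 := ℂ), hjh, starCc_starCc]
    rfl
  have e : j (starCc μ α (hq.ractCc μ α x b)) =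
      CrossedProduct.eval μ R (star (inclₗ μ α Y b)) (j (starCc μ α x)) := by
    rw [starCc_ractCc, ← inclₗ_starCc]
    exact (hjR _ _).symm
  rw [← hnorm, ← hnorm, ← mul_pow, e]
  refine pow_le_pow_left₀ (norm_nonneg _) ((ContinuousLinearMap.le_opNorm _ _).trans ?_) 2
  gcongr
  rw [← norm_star (inclₗ μ α Y b)]
  exact NonUnitalStarAlgHom.norm_apply_le _ _

end IsOrbitMap

end RightBound

/-! ### The pre-imprimitivity bimodule C_c(G × X, A) -/

section Bimodule

variable {G : Type v} [Group G] [TopologicalSpace G] [IsTopologicalGroup G] [LocallyCompactSpace G]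
  [T2Space G] [MeasurableSpace G] [BorelSpace G] {μ : Measure G} [μ.IsHaarMeasure] [μ.Regular]
  {A : Type u} [NonUnitalCStarAlgebra A] {α : CStarAction G A}
  {X : Type w} [Group X] [TopologicalSpace X] [IsTopologicalGroup X] [LocallyCompactSpace X]
  [T2Space X] [MulAction G X] [ContinuousSMul G X] [IsScalarTower G X X]
  {D : Type*} [Group D] [TopologicalSpace D] [IsTopologicalGroup D] [LocallyCompactSpace D]
  [T2Space D] [MeasurableSpace D] [BorelSpace D] {ν : Measure D} [ν.IsHaarMeasure] [ν.Regular]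
  {i : D →* X}
  {Y : Type w} [TopologicalSpace Y] [LocallyCompactSpace Y] [T2Space Y] [MulAction G Y]
  [ContinuousSMul G Y] {q : X → Y}

variable (μ α ν) in
/-- The pre-imprimitivity bimodule structure on `C_c(G × X, A)`. -/
def IsOrbitMap.preImprimitivity (hq : IsOrbitMap G i q) :
    PreImprimitivity (CrossedProduct ν (rightDualAction μ α hq.isClosedEmbedding))
      (CrossedProduct μ (translationAction α Y)) C_c(G × X, A) C_c(D × G × X, A) C_c(G × Y, A) where
  jL := inclItₗ μ α hq.isClosedEmbedding ν
  jR := inclₗ μ α Y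
  denseL := denseRange_inclItₗ hq.isClosedEmbedding
  denseR := denseRange_inclₗ
  lact := lactCc μ α ν hq.isClosedEmbedding
  ract := hq.ractCc μ α
  linner₀ := linnerCc μ α ν hq.isClosedEmbedding
  rinner₀ := hq.rinnerCc μ α ν
  linner_add_left x y z := by rw [linnerCc_add_left, _root_.map_add]
  linner_smul_left c x y := by rw [linnerCc_smul_left, _root_.map_smul]
  star_linner := star_inclItₗ_linnerCc hq.isClosedEmbedding
  linner_lact := inclItₗ_linnerCc_lactCc hq.isClosedEmbedding
  linner_self := hq.exists_inclItₗ_linnerCc_self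
  linner_full := dense_span_inclItₗ_linnerCc μ α ν hq.isClosedEmbedding
  rinner_add_right x y z := by rw [hq.rinnerCc_add_right, _root_.map_add]
  rinner_smul_right c x y := by rw [hq.rinnerCc_smul_right, _root_.map_smul]
  star_rinner := hq.star_inclₗ_rinnerCc
  rinner_ract := hq.inclₗ_rinnerCc_ractCc
  rinner_self := hq.exists_inclₗ_rinnerCc_self
  rinner_full := hq.dense_span_inclₗ_rinnerCc
  definite _ := hq.eq_zero_of_inclₗ_rinnerCc_self
  lact_linner := hq.lactCc_linnerCc
  lact_bound := hq.norm_inclₗ_rinnerCc_lactCc_le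
  ract_bound := hq.norm_inclItₗ_linnerCc_ractCc_le

end Bimodule

/-! ### The quotients G/N, K/N and G/K -/

section QuotientGroups

variable {G : Type v} [Group G] [TopologicalSpace G] [IsTopologicalGroup G]

/-- Left translation by `G` commutes with right multiplication; the general argument uses this to
make convolution and involution commute with β_k. -/
instance isScalarTower_quotient (N : Subgroup G) [N.Normal] : IsScalarTower G (G ⧸ N) (G ⧸ N) :=
  ⟨fun t x y => by
    induction x using QuotientGroup.induction_on with
    | H x =>
      induction y using QuotientGroup.induction_on with
      | H y => exact congrArg QuotientGroup.mk (mul_assoc t x y)⟩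

/-- Closedness of an image in G/N is tested in `G`. Because N ≤ K, the preimage there is the image
of a closed subset of `K`, and `K` is closed. -/
lemma isClosedEmbedding_quotientIncl {K N : Subgroup G} [N.Normal] (hK : IsClosed (K : Set G))
    (hNK : N ≤ K) : IsClosedEmbedding (quotientIncl N K) := by
  refine IsClosedEmbedding.of_continuous_injective_isClosedMap (continuous_quotientIncl N K) ?_ ?_
  · refine (injective_iff_map_eq_one _).2 fun k hk => ?_
    induction k using QuotientGroup.induction_on with
    | H k =>
      rw [quotientIncl_mk, QuotientGroup.eq_one_iff] at hk
      exact (QuotientGroup.eq_one_iff k).2 hk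
  · intro C hC
    have h1 : IsClosed (((↑) : K → G) '' ((↑) ⁻¹' C : Set K)) :=
      hK.isClosedEmbedding_subtypeVal.isClosedMap _
        (hC.preimage QuotientGroup.continuous_mk)
    refine (QuotientGroup.isQuotientMap_mk (N := N)).isClosed_preimage.1 ?_
    convert h1 using 1
    ext g
    constructor
    · rintro ⟨c, hc, hcg⟩
      induction c using QuotientGroup.induction_on with
      | H k =>
        rw [quotientIncl_mk] at hcg
        have h2 := QuotientGroup.eq.1 hcg
        have hg : g ∈ K := by simpa using K.mul_mem k.2 (hNK h2)
        refine ⟨⟨g, hg⟩, ?_, rfl⟩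
        have h3 : ((⟨g, hg⟩ : K) : K ⧸ N.subgroupOf K) = (k : K ⧸ N.subgroupOf K) :=
          (QuotientGroup.eq.2 (show (k : K)⁻¹ * ⟨g, hg⟩ ∈ N.subgroupOf K from h2)).symm
        rw [Set.mem_preimage, h3]
        exact hc
    · rintro ⟨k, hk, rfl⟩
      exact ⟨_, hk, rfl⟩

lemma isOrbitMap_quotientMapOfLE {K N : Subgroup G} [N.Normal] (hK : IsClosed (K : Set G))
    (hNK : N ≤ K) : IsOrbitMap G (quotientIncl N K) (Subgroup.quotientMapOfLE hNK) where
  isClosedEmbedding := isClosedEmbedding_quotientIncl hK hNK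
  isOpenQuotientMap := by
    refine (QuotientGroup.isOpenQuotientMap_mk (N := N)).of_comp_iff.1 ?_
    exact QuotientGroup.isOpenQuotientMap_mk (N := K)
  map_smul t x := by
    induction x using QuotientGroup.induction_on with
    | H x => rfl
  map_mul x k := by
    induction x using QuotientGroup.induction_on with
    | H x =>
      induction k using QuotientGroup.induction_on with
      | H k =>
        refine QuotientGroup.eq.2 ?_
        simp
  exists_eq_mul x y h := by
    induction x using QuotientGroup.induction_on with
    | H x =>
      induction y using QuotientGroup.induction_on with
      | H y =>
        have h1 : x⁻¹ * y ∈ K := QuotientGroup.eq.1 h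
        refine ⟨((⟨x⁻¹ * y, h1⟩ : K) : K ⧸ N.subgroupOf K), ?_⟩
        rw [quotientIncl_mk]
        exact congrArg QuotientGroup.mk (mul_inv_cancel_left x y).symm

end QuotientGroups

end

theorem proposition3p3
    {A : Type u} [NonUnitalCStarAlgebra A]
    {G : Type v} [Group G] [TopologicalSpace G] [IsTopologicalGroup G] [LocallyCompactSpace G]
    [T2Space G] [MeasurableSpace G] [BorelSpace G]
    (μ : Measure G) [μ.IsHaarMeasure] [μ.Regular]
    (α : CStarAction G A)
    (K N : Subgroup G) [N.Normal] (hK : IsClosed (K : Set G)) (hN : IsClosed (N : Set G))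
    (hNK : N ≤ K)
    [MeasurableSpace (K ⧸ N.subgroupOf K)] [BorelSpace (K ⧸ N.subgroupOf K)]
    (ν : Measure (K ⧸ N.subgroupOf K)) [ν.IsHaarMeasure] [ν.Regular] :
    ∃ (Z : ImprimitivityBimodule.{max u v}
          (CrossedProduct ν (dualActionRestrict μ α N K))
          (TransformationCrossedProduct μ α K))
      (ι : C_c(G × G ⧸ N, A) →ₗ[ℂ] Z.carrier),
      Function.Injective ι ∧ DenseRange ι ∧
      -- the left action of `L`
      (∀ (c : C_c((K ⧸ N.subgroupOf K) × G × G ⧸ N, A)) (x : C_c(G × G ⧸ N, A)),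
        ∃ y : C_c(G × G ⧸ N, A),
          (∀ r s : G, y (r, s) =
            ∫ k, ∫ t, (modularFn ν k ^ (1 / 2 : ℝ)) •
              (c (k, t, s) * α.act t (x (t⁻¹ * r, ((t⁻¹ * s : G) : G ⧸ N) * quotientIncl N K k)))
              ∂μ ∂ν) ∧
          Z.lact (inclIterated μ (ltAction α N) ν (dualActionRestrict μ α N K) c) (ι x) = ι y) ∧
      -- the right action of `R`
      (∀ (x : C_c(G × G ⧸ N, A)) (b : C_c(G × G ⧸ K, A)),
        ∃ y : C_c(G × G ⧸ N, A),
          (∀ r s : G, y (r, s) =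
            ∫ t, x (t, s) * α.act t (b (t⁻¹ * r, ((t⁻¹ * s : G) : G ⧸ K))) ∂μ) ∧
          Z.ract (ι x) (inclCrossed μ (ltAction α K) b) = ι y) ∧
      -- the `L`-valued inner product
      (∀ x y : C_c(G × G ⧸ N, A),
        ∃ c : C_c((K ⧸ N.subgroupOf K) × G × G ⧸ N, A),
          (∀ (k : K ⧸ N.subgroupOf K) (r s : G), c (k, r, s) =
            (modularFn ν k ^ (-(1 / 2) : ℝ)) • ∫ t, modularFn μ (r⁻¹ * t) •
              (x (t, s) *
                α.act r (star (y (r⁻¹ * t, ((r⁻¹ * s : G) : G ⧸ N) * quotientIncl N K k)))) ∂μ) ∧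
          Z.linner (ι x) (ι y) =
            inclIterated μ (ltAction α N) ν (dualActionRestrict μ α N K) c) ∧
      -- the `R`-valued inner product
      (∀ x y : C_c(G × G ⧸ N, A),
        ∃ b : C_c(G × G ⧸ K, A),
          (∀ r s : G, b (r, s) =
            ∫ k, ∫ t, (modularFn μ t)⁻¹ •
              α.act t (star (x (t⁻¹, ((t⁻¹ * s : G) : G ⧸ N) * quotientIncl N K k)) *
                y (t⁻¹ * r, ((t⁻¹ * s : G) : G ⧸ N) * quotientIncl N K k)) ∂μ ∂ν) ∧
          Z.rinner (ι x) (ι y) = inclCrossed μ (ltAction α K) b) := by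
  -- Closedness of N and of K supplies the Hausdorff and locally compact structure on K/N that the
  -- general argument asks of D.
  have _ : IsClosed (N.subgroupOf K : Set K) := hN.preimage continuous_subtype_val
  have _ : T2Space (K ⧸ N.subgroupOf K) := QuotientGroup.instT2Space
  have _ : LocallyCompactSpace K := hK.isClosedEmbedding_subtypeVal.locallyCompactSpace
  have hq := isOrbitMap_quotientMapOfLE hK hNK
  obtain ⟨Z, ι, h_inj, h_dense, h_lact, h_ract, h_linner, h_rinner⟩ :=
    (hq.preImprimitivity μ α ν).exists_imprimitivityBimodule
  refine ⟨Z, ι, h_inj, h_dense, fun c x => ⟨_, fun r s => ?_, h_lact c x⟩,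
    fun x b => ⟨_, fun r s => rfl, h_ract x b⟩, fun x y => ⟨_, fun k r s => ?_, h_linner x y⟩,
    fun x y => ⟨_, fun r s => ?_, h_rinner x y⟩⟩
  · refine (lactCc_apply hq.isClosedEmbedding c x (r, (s : G ⧸ N))).trans ?_
    refine integral_congr_ae (Eventually.of_forall fun k => ?_)
    exact (integral_smul _ _).symm
  · refine (twistedConv_apply hq.isClosedEmbedding x (starCc μ α y) k r (s : G ⧸ N)).trans ?_
    rw [rpow_neg_half_modularFn]
    refine congrArg _ (integral_congr_ae (Eventually.of_forall fun t => ?_))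
    -- Unfolding y^* at (t⁻¹r, t⁻¹s i(k)) uses α_t α_{t⁻¹r} = α_r and Δ_G(t⁻¹r)⁻¹ = Δ_G(r⁻¹t).
    have h1 : (t⁻¹ * r)⁻¹ = r⁻¹ * t := by rw [mul_inv_rev, inv_inv]
    have h2 : (r⁻¹ * t) • (t⁻¹ • (s : G ⧸ N) * quotientIncl N K k) =
        ((r⁻¹ * s : G) : G ⧸ N) * quotientIncl N K k := by
      rw [← smul_mul_assoc, smul_smul, mul_assoc, mul_inv_cancel, mul_one]
      rfl
    change x (t, s) * α.act t (tstar μ α y (t⁻¹ * r, t⁻¹ • (s : G ⧸ N) * quotientIncl N K k)) = _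
    rw [tstar_apply, h1, h2, starHom_real_smul, mul_smul_comm, ← modularFn_inv, h1, ← α.act_mul,
      mul_inv_cancel_left]
  · refine (hq.rinnerCc_apply x y r (s : G ⧸ N)).trans ?_
    refine integral_congr_ae (Eventually.of_forall fun k => integral_congr_ae
      (Eventually.of_forall fun t => ?_))
    have h1 : t⁻¹ • ((s : G ⧸ N) * quotientIncl N K k) =
        ((t⁻¹ * s : G) : G ⧸ N) * quotientIncl N K k := (smul_mul_assoc _ _ _).symm
    change tstar μ α x (t, (s : G ⧸ N) * quotientIncl N K k) *
      α.act t (y (t⁻¹ * r, t⁻¹ • ((s : G ⧸ N) * quotientIncl N K k))) = _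
    rw [tstar_apply, h1, smul_mul_assoc, ← map_mul]
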